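/- **Model.** A randomized word RAM with word length $w$ runs a finite program (independent of $w$ and of the input) that uses finitely many $w$-bit registers and finitely many memory banks of $2^w$ cells of $w$ bits each. Constants, addition, subtraction and multiplication modulo $2^w$, left and right shifts, bitwise Boolean operations, comparison, memory accesses, tests for zero, the output of a word, and drawing a uniformly random element of $\{0,\dots,v-1\}$ for a given $v\le 2^w$ take one time unit each. A program *solves* a problem on a class of inputs if, on each of these inputs, it halts with probability $1$ and its output is always correct. **Problems.** *3XOR*: given a list of the $n$ elements of a set $X\subseteq\{0,1\}^w$, decide whether there are $a,b,c\in X$ with $a\oplus b=c$. *Offline SetIntersection*: given a finite set $C$ (coded as $\{0,\dots,|C|-1\}$), finite indexed families $A$, $B$ of subsets of $C$ (each set given by a list of its elements) and $q$ pairs $(S,S')\in A\times B$, list, for each of the $q$ pairs, all elements of $S\cap S'$ (each once, in any order). The *output size* is $\sum|S\cap S'|$ over the $q$ pairs. **Parameters.** Let $0\le\gamma<1$ and $\delta>0$ be real numbers such that for $\alpha\in\{\gamma,\delta\}$ a word RAM can compute from $n$, in expected time $n^{2-\Omega(1)}$, an exponent $r$ with $2^r=\Theta(n^\alpha)$ (for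 example, any rational $\gamma,\delta$). For each $n$ let $W(n)$ be a set of admissible word lengths such that all $w\in W(n)$ satisfy $n<2^w$ and, for all large $n$, $\kappa\log_2 n\le w\le 2^{O(n\log n)}$, where $\kappa>\max\{1+\gamma,\,1+\delta-\gamma,\,(3+\delta-\gamma)/2\}$ is a constant (so that the numbers describing the SetIntersection instances below fit into a word). Let $f(n)=n^{o(1)}$ be positive for all large $n$. **Hypothesis.** 3XOR requires expected time $\Omega(n^2/f(n))$ on a word RAM with admissible word length: for every program that solves 3XOR for all $n$, all $w\in W(n)$ and all $X\subseteq\{0,1\}^w$ with $|X|=n$, there is $c>0$ such that for all large $n$ there are $w\in W(n)$ and an $X\subseteq\{0,1\}^w$ with $|X|=n$, listed in some order, on which the expected running time is at least $c\,n^2/f(n)$. **Theorem.** Let $\gamma,\delta$ be as above. There is a constant $K_0>0$, depending only on $\gamma$ and $\delta$, such that for every $K\ge K_0$, every $W$ and every $f$ as above the following holds under the hypothesis. For $n\in\mathbb N$ and $w\in W(n)$ consider the instances of offline SetIntersection for which $|C|,|A|,|B|,q$ and the total sizes $\sum_{S\in A}|S|$, $\sum_{S\in B}|S|$ are less than $2^w$,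 and for which $$\tfrac1K n^{1+\delta-\gamma}\le|C|\le K n^{1+\delta-\gamma},\qquad |A|=|B|,\qquad \tfrac1K\sqrt{n^{1+\delta+\gamma}}\le|A|\le K\sqrt{n^{1+\delta+\gamma}},$$ $$|S|\le K n^{1-\gamma}\ \text{ for all } S\in A\cup B,\qquad \tfrac1K n^{1+\gamma}\le q\le K n^{1+\gamma}.$$ Every program that solves offline SetIntersection on all these instances (for all $n$ and all $w\in W(n)$) requires expected time $\Omega(n^2/f(n))$ on random instances of this kind with expected output size $O(n^{2-\delta})$: there is $c>0$ such that for all large $n$ there are $w\in W(n)$ and a probability distribution on these instances for which the expected output size is at most $K n^{2-\delta}$ and the expected running time (over the instance and the random choices of the program) is at least $c\,n^2/f(n)$. -/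

import Mathlib

open Filter Topology
open scoped ENNReal

/-! ### The randomized word RAM

Words are bit strings of length `w`.  A program is a finite object that does not depend on `w`.
It uses finitely many registers and finitely many memory banks, each bank having one cell for each
of the `2 ^ w` addresses.  Every elementary instruction, every test and every sequencing step takes
one unit of time. -/

namespace WordRAM

/-- The operations on pairs of words.  `lt` is the comparison of unsigned integers, with value
`1` or `0`. -/
inductive BinOp where
  | add | sub | mul | and | or | xor | shiftLeft | shiftRight | lt

/-- Arithmetic is modulo `2 ^ w`; a shift by at least `w` positions gives the zero word. -/
def BinOp.eval {w : ℕ} : BinOp → BitVec w → BitVec w → BitVec w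
  | .add, x, y => x + y
  | .sub, x, y => x - y
  | .mul, x, y => x * y
  | .and, x, y => x &&& y
  | .or, x, y => x ||| y
  | .xor, x, y => x ^^^ y
  | .shiftLeft, x, y => x <<< y.toNat
  | .shiftRight, x, y => x >>> y.toNat
  | .lt, x, y => if x.toNat < y.toNat then BitVec.ofNat w 1 else BitVec.ofNat w 0

/-- Programs.  Registers and memory banks are named by natural numbers. -/
inductive Program where
  /-- do nothing -/
  | skip
  /-- `reg d := c`, for a constant `c` -/
  | const (d c : ℕ)
  /-- `reg d := NOT (reg a)` -/
  | not (d a : ℕ)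
  /-- `reg d := reg a ∘ reg b` -/
  | op (o : BinOp) (d a b : ℕ)
  /-- `reg d := bank k [reg a]` -/
  | load (d k a : ℕ)
  /-- `bank k [reg a] := reg b` -/
  | store (k a b : ℕ)
  /-- `reg d :=` a uniformly random element of `{0, …, v - 1}`, where `v = reg a` -/
  | rand (d a : ℕ)
  /-- append `reg a` to the output -/
  | emit (a : ℕ)
  /-- first `p`, then `q` -/
  | seq (p q : Program)
  /-- `p` if `reg a ≠ 0`, otherwise `q` -/
  | ite (a : ℕ) (p q : Program)
  /-- repeat `p` as long as `reg a ≠ 0` -/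
  | while (a : ℕ) (p : Program)

/-- Contents of the registers, of the memory banks, and of the output stream. -/
structure State (w : ℕ) where
  reg : ℕ → BitVec w
  mem : ℕ → BitVec w → BitVec w
  out : List (BitVec w)

namespace State

variable {w : ℕ}

def setReg (s : State w) (d : ℕ) (x : BitVec w) : State w :=
  { s with reg := Function.update s.reg d x }

def setMem (s : State w) (k : ℕ) (a x : BitVec w) : State w :=
  { s with mem := Function.update s.mem k (Function.update (s.mem k) a x) }

def emit (s : State w) (x : BitVec w) : State w :=
  { s with out := s.out ++ [x] }

end State

/-- A uniformly random element of `{0, …, v - 1}`.  The word `0` stands for `v = 2 ^ w`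
(note that `v - 1` is computed modulo `2 ^ w`). -/
noncomputable def randWord {w : ℕ} (v : BitVec w) : PMF (BitVec w) :=
  (PMF.uniformOfFintype (Fin ((v - 1).toNat + 1))).map fun i => BitVec.ofNat w i

/-- The program pieces that remain to be executed, and the current state. -/
abbrev Config (w : ℕ) : Type := List Program × State w

/-- The machine has halted when nothing remains to be executed. -/
def Halted {w : ℕ} (c : Config w) : Prop := c.1 = []

/-- One step of the computation (a halted machine stays as it is). -/
noncomputable def step {w : ℕ} : Config w → PMF (Config w)
  | ([], s) => PMF.pure ([], s)
  | (.skip :: k, s) => PMF.pure (k, s)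
  | (.const d c :: k, s) => PMF.pure (k, s.setReg d (BitVec.ofNat w c))
  | (.not d a :: k, s) => PMF.pure (k, s.setReg d (~~~ (s.reg a)))
  | (.op o d a b :: k, s) => PMF.pure (k, s.setReg d (o.eval (s.reg a) (s.reg b)))
  | (.load d m a :: k, s) => PMF.pure (k, s.setReg d (s.mem m (s.reg a)))
  | (.store m a b :: k, s) => PMF.pure (k, s.setMem m (s.reg a) (s.reg b))
  | (.rand d a :: k, s) => (randWord (s.reg a)).map fun x => (k, s.setReg d x)
  | (.emit a :: k, s) => PMF.pure (k, s.emit (s.reg a))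
  | (.seq p q :: k, s) => PMF.pure (p :: q :: k, s)
  | (.ite a p q :: k, s) => PMF.pure ((if s.reg a ≠ 0 then p else q) :: k, s)
  | (.while a p :: k, s) => PMF.pure (if s.reg a ≠ 0 then p :: .while a p :: k else k, s)

/-- The law of the configuration after `t` steps of `P`, started in the state `s`. -/
noncomputable def run {w : ℕ} (P : Program) (s : State w) : ℕ → PMF (Config w)
  | 0 => PMF.pure ([P], s)
  | t + 1 => (run P s t).bind step

/-- The probability that `P`, started in `s`, makes more than `t` steps. -/
noncomputable def probRunning {w : ℕ} (P : Program) (s : State w) (t : ℕ) : ℝ≥0∞ :=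
  (run P s t).toOuterMeasure {c | ¬ Halted c}

/-- The expected number of steps, `∑ₜ Pr[more than t steps]`. -/
noncomputable def expectedTime {w : ℕ} (P : Program) (s : State w) : ℝ≥0∞ :=
  ∑' t, probRunning P s t

/-- Started in `s`, the program halts with probability one, and whenever it halts, its output
is as desired. -/
def HaltsWith {w : ℕ} (P : Program) (s : State w) (good : List (BitVec w) → Prop) : Prop :=
  (⨅ t, probRunning P s t) = 0 ∧
    ∀ t, ∀ c ∈ (run P s t).support, Halted c → good c.2.out

/-- The memory contents of an array of numbers, stored from address `0` on and followed by
zeros. -/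
def arrayOf (w : ℕ) (l : List ℕ) : BitVec w → BitVec w :=
  fun i => BitVec.ofNat w (l.getD i.toNat 0)

/-- The initial state with the numbers `regs` in the first registers, the arrays `banks` in
the first memory banks, and zeros everywhere else. -/
def initState (w : ℕ) (regs : List ℕ) (banks : List (List ℕ)) : State w where
  reg i := BitVec.ofNat w (regs.getD i 0)
  mem k := arrayOf w (banks.getD k [])
  out := []

/-- On input `n` a word RAM can find, in expected time `n ^ (2 - Ω(1))`, a power of two
that agrees with `n ^ α` up to a constant factor (the exponent `r` of `2 ^ r` is the output).
For instance every rational `α ≥ 0` has this property. -/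
def PowerConstructible (α : ℝ) : Prop :=
  ∃ (P : Program) (K ε : ℝ), 0 < K ∧ 0 < ε ∧ ∀ᶠ n : ℕ in atTop, ∀ w : ℕ, n < 2 ^ w →
    HaltsWith P (initState w [n] [])
      (fun out => ∃ r : ℕ, (n : ℝ) ^ α / K ≤ (2 : ℝ) ^ r ∧ (2 : ℝ) ^ r ≤ K * (n : ℝ) ^ α ∧
        out = [BitVec.ofNat w r]) ∧
    expectedTime P (initState w [n] []) ≤ ENNReal.ofReal (K * (n : ℝ) ^ (2 - ε))

end WordRAM

open WordRAM

/-! ### The problem 3XOR -/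

/-- The input of 3XOR: a listing of the set `X` in the first memory bank, and `n = |X|` in the
first register. -/
def threeXORInput {w : ℕ} (X : List (BitVec w)) : State w :=
  initState w [X.length] [X.map BitVec.toNat]

def HasXORTriple {w : ℕ} (X : List (BitVec w)) : Prop :=
  ∃ a ∈ X, ∃ b ∈ X, ∃ c ∈ X, a ^^^ b = c

open Classical in
/-- `P` decides 3XOR for sets of `n` words of length `w`, for all `n` and all `w ∈ W n`
(output `1` for yes, `0` for no). -/
def SolvesThreeXOR (W : ℕ → Set ℕ) (P : Program) : Prop :=
  ∀ n : ℕ, ∀ w ∈ W n, ∀ X : List (BitVec w), X.Nodup → X.length = n →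
    HaltsWith P (threeXORInput X)
      (fun out => out = [BitVec.ofNat w (if HasXORTriple X then 1 else 0)])

/-- 3XOR requires expected time `Ω(g(n))` on word RAMs with word lengths `w ∈ W n`: so does,
in the worst case over the inputs with `n` words, every program that solves it. -/
def ThreeXORRequires (W : ℕ → Set ℕ) (g : ℕ → ℝ) : Prop :=
  ∀ P : Program, SolvesThreeXOR W P →
    ∃ c : ℝ, 0 < c ∧ ∀ᶠ n : ℕ in atTop, ∃ w ∈ W n, ∃ X : List (BitVec w),
      X.Nodup ∧ X.length = n ∧ ENNReal.ofReal (c * g n) ≤ expectedTime P (threeXORInput X)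

/-! ### The problem offline SetIntersection -/

/-- The ground set is `C = {0, …, c - 1}`; `A` and `B` are indexed families of sets, each set
given by a listing of its elements; a query is a pair of an index into `A` and an index
into `B`. -/
structure SetIntersectionInstance where
  c : ℕ
  A : List (List ℕ)
  B : List (List ℕ)
  Q : List (ℕ × ℕ)

namespace SetIntersectionInstance

/-- The lists in the two families list subsets of `C` without repetition, and the queries
refer to members of the families. -/
def Valid (I : SetIntersectionInstance) : Prop :=
  (∀ S ∈ I.A ++ I.B, S.Nodup ∧ ∀ x ∈ S, x < I.c) ∧
    ∀ p ∈ I.Q, p.1 < I.A.length ∧ p.2 < I.B.length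

/-- The first set of the `i`-th query. -/
def left (I : SetIntersectionInstance) (i : ℕ) : List ℕ :=
  I.A.getD (I.Q.getD i (0, 0)).1 []

/-- The second set of the `i`-th query. -/
def right (I : SetIntersectionInstance) (i : ℕ) : List ℕ :=
  I.B.getD (I.Q.getD i (0, 0)).2 []

/-- All pairs `(i, x)` where `x` lies in both sets of the `i`-th query. -/
def answers (I : SetIntersectionInstance) : Finset (ℕ × ℕ) :=
  (Finset.range I.Q.length ×ˢ Finset.range I.c).filter
    fun p => p.2 ∈ I.left p.1 ∧ p.2 ∈ I.right p.1

/-- The total number of elements of the intersections that are asked for. -/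
def outputSize (I : SetIntersectionInstance) : ℕ := I.answers.card

/-- All numbers that occur in the input of the word RAM fit into a word. -/
def Fits (I : SetIntersectionInstance) (w : ℕ) : Prop :=
  I.c < 2 ^ w ∧ I.A.length < 2 ^ w ∧ I.B.length < 2 ^ w ∧ I.Q.length < 2 ^ w ∧
    I.A.flatten.length < 2 ^ w ∧ I.B.flatten.length < 2 ^ w

/-- The positions at which the members of a family start (and the last one ends) when all of
them are written one after the other. -/
def offsets (F : List (List ℕ)) : List ℕ :=
  (List.range (F.length + 1)).map fun j => (F.take j).flatten.length

/-- The input of the word RAM: `|C|`, `|A|`, `|B|` and the number `q` of queries in registers,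
and six arrays for the two families and the two components of the queries. -/
def input (I : SetIntersectionInstance) (w : ℕ) : State w :=
  initState w [I.c, I.A.length, I.B.length, I.Q.length]
    [offsets I.A, I.A.flatten, offsets I.B, I.B.flatten, I.Q.map Prod.fst, I.Q.map Prod.snd]

/-- The output lists the answers `(i, x)`, in any order, each of them once. -/
def CorrectOutput (I : SetIntersectionInstance) (w : ℕ) (out : List (BitVec w)) : Prop :=
  ∃ L : List (ℕ × ℕ), L.Nodup ∧ L.toFinset = I.answers ∧
    out = L.flatMap fun p => [BitVec.ofNat w p.1, BitVec.ofNat w p.2]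

/-- The sizes: `|C| = Θ(n ^ (1 + δ - γ))`, `|A| = |B| = Θ(√(n ^ (1 + δ + γ)))`,
`|S| = O(n ^ (1 - γ))` for all `S` in `A` and `B`, and `q = Θ(n ^ (1 + γ))`, where `K` is the
constant in all `O`'s and `Θ`'s. -/
def HasSizes (I : SetIntersectionInstance) (γ δ K : ℝ) (n : ℕ) : Prop :=
  ((n : ℝ) ^ (1 + δ - γ) / K ≤ I.c ∧ (I.c : ℝ) ≤ K * (n : ℝ) ^ (1 + δ - γ)) ∧
  I.A.length = I.B.length ∧
  (√((n : ℝ) ^ (1 + δ + γ)) / K ≤ I.A.length ∧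
    (I.A.length : ℝ) ≤ K * √((n : ℝ) ^ (1 + δ + γ))) ∧
  (∀ S ∈ I.A ++ I.B, (S.length : ℝ) ≤ K * (n : ℝ) ^ (1 - γ)) ∧
  ((n : ℝ) ^ (1 + γ) / K ≤ I.Q.length ∧ (I.Q.length : ℝ) ≤ K * (n : ℝ) ^ (1 + γ))

/-- The inputs with parameter `n` on a word RAM with word length `w`. -/
def Allowed (I : SetIntersectionInstance) (γ δ K : ℝ) (n w : ℕ) : Prop :=
  I.Valid ∧ I.Fits w ∧ I.HasSizes γ δ K n

end SetIntersectionInstance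

open SetIntersectionInstance

/-- `P` solves offline SetIntersection on all instances of the given sizes. -/
def SolvesSetIntersection (W : ℕ → Set ℕ) (γ δ K : ℝ) (P : Program) : Prop :=
  ∀ n : ℕ, ∀ w ∈ W n, ∀ I : SetIntersectionInstance, I.Allowed γ δ K n w →
    HaltsWith P (I.input w) (I.CorrectOutput w)

/-- Every program that solves offline SetIntersection on instances of the given sizes requires
expected time `Ω(g(n))` on (random) instances of these sizes whose expected output size is at
most `K * n ^ (2 - δ)`. -/
def SetIntersectionRequires (W : ℕ → Set ℕ) (γ δ K : ℝ) (g : ℕ → ℝ) : Prop :=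
  ∀ P : Program, SolvesSetIntersection W γ δ K P →
    ∃ c : ℝ, 0 < c ∧ ∀ᶠ n : ℕ in atTop, ∃ w ∈ W n, ∃ D : PMF SetIntersectionInstance,
      (∀ I ∈ D.support, I.Allowed γ δ K n w) ∧
      ∑' I, D I * (I.outputSize : ℝ≥0∞) ≤ ENNReal.ofReal (K * (n : ℝ) ^ (2 - δ)) ∧
      ENNReal.ofReal (c * g n) ≤ ∑' I, D I * expectedTime P (I.input w)

/-! ### Standing assumptions -/

/-- The word lengths in `W n` are those that are considered for the parameter `n`.  A word can
hold `n`; for large `n` it can also hold the numbers that describe the instances of offline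
SetIntersection (that is, `|C|`, `q` and the total size of the sets, up to a factor
`n ^ Ω(1)`); and `w = 2 ^ O(n log n)`. -/
def AdmissibleWordLengths (γ δ : ℝ) (W : ℕ → Set ℕ) : Prop :=
  (∀ n : ℕ, ∀ w ∈ W n, n < 2 ^ w) ∧
  (∃ κ : ℝ, 1 + δ - γ < κ ∧ 1 + γ < κ ∧ (3 + δ - γ) / 2 < κ ∧
    ∀ᶠ n : ℕ in atTop, ∀ w ∈ W n, κ * Real.logb 2 n ≤ w) ∧
  (∃ M : ℝ, ∀ᶠ n : ℕ in atTop, ∀ w ∈ W n, (w : ℝ) ≤ (2 : ℝ) ^ (M * n * Real.logb 2 n))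

/-- `f(n) = n ^ o(1)`. -/
def IsSubpolynomial (f : ℕ → ℝ) : Prop :=
  ∃ e : ℕ → ℝ, Tendsto e atTop (𝓝 0) ∧ ∀ᶠ n : ℕ in atTop, f n = (n : ℝ) ^ e n

/-!
# From 3XOR to offline SetIntersection

Let `X` be a list of `n` words.  The lower bound for offline SetIntersection comes from a randomized
reduction if `δ < 1 + γ`, and from the length of the input if `δ ≥ 1 + γ`.

**The reduction.**  Let `2 ^ r ≈ n ^ γ` and `2 ^ d ≈ n ^ δ`, and choose `s` with
`2 ^ (r + 2 * s) ≈ n ^ (1 + δ)`.  Two random linear maps over the field with two elements, `h₁` with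
`r` bits and `h₂` with `2 * s` bits, are drawn, and the elements of `X` are put into `2 ^ r` buckets
according to `h₁`; a bucket has room for a constant multiple of `n / 2 ^ r` elements.  An element is
bad if its bucket is full or has another element with the same value of `h₂`.  Collisions under a
random linear map are rare, so that few elements are bad (`expect_badCount`); they are compared
directly with all elements.  If `a ⊕ b = k` for elements `a` and `b` in the buckets and `a` has
bucket `u`, then `b` has bucket `u ⊕ h₁ k` by linearity, and `h₂ a ⊕ h₂ b = h₂ k`.  Hence, for every
element `k` and every bucket `u`, one asks for the intersection of the sets

* `{h₂ a ⊕ (upper half of h₂ k)}`, where `a` runs through the bucket `u`,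
* `{h₂ b ⊕ (lower half of h₂ k)}`, where `b` runs through the bucket `u ⊕ h₁ k`.

Each set depends on the bucket and on `s` bits only, so that each family consists of `2 ^ (r + s)`
sets, although there are `n * 2 ^ r` queries.  This is `hashInstance`; the sets are filled up to
equal size with elements that occur in no set of the other family.  Every reported element is
traced back to `a`, and `a ⊕ k ∈ X` is tested, so that the answer is always correct, as the model
requires.

The expected number of false answers is at most `n ^ 3 / 2 ^ (r + 2 * s) = O(n ^ (2 - δ))`, but
there is a true answer for every pair of elements whose sum belongs to `X`.  Therefore `2 ^ d`
random pairs of elements are tested beforehand, and the instance is used only if none of them has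
its sum in `X`.  With `t` pairs whose sum is in `X` this happens with probability at most about
`(1 - t / n ^ 2) ^ 2 ^ d`, and `t` times this probability is at most `n ^ 2 / 2 ^ d`.  So the law
`instanceLaw`, in which an instance without answers takes the place of the unused instances, has
expected output size `O(n ^ (2 - δ))` (`instanceLaw_outputSize`).  The rest of the reduction takes
expected time `n ^ (2 - Ω(1))` (`eventually_overhead_le`), and its expected time is at most a
constant multiple of the time of the given program under `instanceLaw`, plus this overhead
(`stage_time_le`).  If the program were fast on `instanceLaw`, the reduction would contradict the
hypothesis on 3XOR (`setIntersectionRequires_of_small`).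

**The length of the input.**  If `δ ≥ 1 + γ`, then sets of `Θ(n ^ (1 - γ))` elements have at least
about `n ^ ((3 + δ - γ) / 2) ≥ n ^ 2` elements altogether.  There are instances without answers on
which a change of a single cell can create an answer, and since the output must be correct with
certainty, the program has to read all these cells (`le_expectedTime_of_sensitive`).  On the other
hand, exhaustive search solves 3XOR in time `O(n ^ 2)`, so that the bound in the hypothesis, and
hence the bound to be proved, is `O(n ^ 2)` (`setIntersectionRequires_of_large`).

**Programs.**  The programs are verified with triples `Triple p s T Post`: from the state `s` the
program `p` halts almost surely within expected time `T`, in a state that satisfies `Post`.  `Spec`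
is the version for programs that make random choices, where the time of the continuation is averaged
over the law of an outcome; `Triple.embed` is the rule for a given program that is run as a
subroutine with renamed registers and memory banks, and whose outputs are handled by another
program.  The word length may be much larger than `n`, and a word RAM has no instruction for the
parity of a word; a linear form is evaluated by `parityCode` in time proportional to `blockExp w`,
which is `O(log n)`.
-/

/-! ### Expectations over discrete distributions -/

/-- The expectation of `F` under the discrete distribution `μ`. -/
noncomputable def PMF.expect {α : Type*} (μ : PMF α) (F : α → ℝ≥0∞) : ℝ≥0∞ := ∑' a, μ a * F a

namespace PMF

variable {α β : Type*}

theorem expect_pure (a : α) (F : α → ℝ≥0∞) : (PMF.pure a).expect F = F a := by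
  classical
  unfold expect
  rw [tsum_eq_single a]
  · simp [PMF.pure_apply]
  · intro b hb; simp [PMF.pure_apply, hb]

theorem expect_bind (μ : PMF α) (ν : α → PMF β) (F : β → ℝ≥0∞) :
    (μ.bind ν).expect F = μ.expect fun a => (ν a).expect F := by
  unfold expect
  simp only [PMF.bind_apply, ← ENNReal.tsum_mul_left, ← ENNReal.tsum_mul_right]
  rw [ENNReal.tsum_comm]
  simp only [mul_assoc]

theorem expect_map (μ : PMF α) (f : α → β) (F : β → ℝ≥0∞) :
    (μ.map f).expect F = μ.expect fun a => F (f a) := by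
  rw [← PMF.bind_pure_comp, expect_bind]
  simp [expect_pure]

theorem expect_mono (μ : PMF α) {F F' : α → ℝ≥0∞} (h : ∀ a ∈ μ.support, F a ≤ F' a) :
    μ.expect F ≤ μ.expect F' := by
  refine ENNReal.tsum_le_tsum fun a => ?_
  by_cases ha : μ a = 0
  · simp [ha]
  · exact mul_le_mul_right (h a ((PMF.mem_support_iff _ _).2 ha)) _

theorem expect_const (μ : PMF α) (x : ℝ≥0∞) : μ.expect (fun _ => x) = x := by
  unfold expect
  rw [ENNReal.tsum_mul_right, μ.tsum_coe, one_mul]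

theorem expect_add (μ : PMF α) (F F' : α → ℝ≥0∞) :
    μ.expect (fun a => F a + F' a) = μ.expect F + μ.expect F' := by
  unfold expect
  simp only [mul_add]
  exact ENNReal.tsum_add

theorem expect_const_mul (μ : PMF α) (x : ℝ≥0∞) (F : α → ℝ≥0∞) :
    μ.expect (fun a => x * F a) = x * μ.expect F := by
  unfold expect
  rw [← ENNReal.tsum_mul_left]
  exact tsum_congr fun a => by ring

theorem expect_sum (μ : PMF α) {ι : Type*} (s : Finset ι) (F : ι → α → ℝ≥0∞) :
    μ.expect (fun a => ∑ i ∈ s, F i a) = ∑ i ∈ s, μ.expect (F i) := by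
  classical
  induction s using Finset.induction_on with
  | empty => simp [expect]
  | insert i s hi ih => simp only [Finset.sum_insert hi, expect_add, ih]

theorem le_expect (μ : PMF α) {F : α → ℝ≥0∞} {x : ℝ≥0∞} (h : ∀ a ∈ μ.support, x ≤ F a) :
    x ≤ μ.expect F := by
  rw [← expect_const μ x]; exact expect_mono μ h

theorem expect_le (μ : PMF α) {F : α → ℝ≥0∞} {x : ℝ≥0∞} (h : ∀ a ∈ μ.support, F a ≤ x) :
    μ.expect F ≤ x := by
  rw [← expect_const μ x]; exact expect_mono μ h

theorem expect_iSup (μ : PMF α) {F : ℕ → α → ℝ≥0∞} (h : Monotone F) :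
    μ.expect (fun a => ⨆ t, F t a) = ⨆ t, μ.expect (F t) := by
  unfold expect
  simp only [ENNReal.mul_iSup]
  simp only [ENNReal.tsum_eq_iSup_sum]
  rw [iSup_comm]
  refine iSup_congr fun s => ?_
  refine ENNReal.finsetSum_iSup_of_monotone fun a i j hij => ?_
  exact mul_le_mul_right (h hij a) _

theorem expect_indicator (μ : PMF α) (S : Set α) [DecidablePred (· ∈ S)] :
    μ.expect (fun a => if a ∈ S then 1 else 0) = μ.toOuterMeasure S := by
  unfold expect
  rw [PMF.toOuterMeasure_apply]
  refine tsum_congr fun a => ?_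
  by_cases h : a ∈ S <;> simp [h]

end PMF

/-! ### Expected running times and success probabilities of configurations -/

namespace WordRAM

variable {w : ℕ}

/-- The expected number of steps among the first `t` ones, started in a configuration. -/
noncomputable def timeUpTo : ℕ → Config w → ℝ≥0∞
  | 0, _ => 0
  | _ + 1, ([], _) => 0
  | t + 1, (p :: k, s) => 1 + (step (p :: k, s)).expect (timeUpTo t)

open Classical in
/-- The probability to halt with a good output within `t` steps. -/
noncomputable def winUpTo (good : List (BitVec w) → Prop) : ℕ → Config w → ℝ≥0∞
  | _, ([], s) => if good s.out then 1 else 0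
  | 0, (_ :: _, _) => 0
  | t + 1, (p :: k, s) => (step (p :: k, s)).expect (winUpTo good t)

/-- The probability to halt eventually, with a good output. -/
noncomputable def winProb (good : List (BitVec w) → Prop) (c : Config w) : ℝ≥0∞ :=
  ⨆ t, winUpTo good t c

/-- The law of the configuration after `t` steps, started in the configuration `c`. -/
noncomputable def runFrom (c : Config w) : ℕ → PMF (Config w)
  | 0 => PMF.pure c
  | t + 1 => (runFrom c t).bind step

theorem run_eq_runFrom (P : Program) (s : State w) (t : ℕ) : run P s t = runFrom ([P], s) t := by
  induction t with
  | zero => rfl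
  | succ t ih => simp [run, runFrom, ih]

theorem runFrom_succ (c : Config w) (t : ℕ) :
    runFrom c (t + 1) = (step c).bind fun c' => runFrom c' t := by
  induction t with
  | zero => simp [runFrom]
  | succ t ih =>
    rw [runFrom, ih, PMF.bind_bind]
    rfl

theorem runFrom_halted (s : State w) (t : ℕ) : runFrom ([], s) t = PMF.pure ([], s) := by
  induction t with
  | zero => rfl
  | succ t ih => rw [runFrom, ih, PMF.pure_bind, step]

theorem timeUpTo_halted (t : ℕ) (s : State w) : timeUpTo t ([], s) = 0 := by
  cases t <;> rfl

theorem timeUpTo_mono : ∀ (t : ℕ) (c : Config w), timeUpTo t c ≤ timeUpTo (t + 1) c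
  | 0, c => by simp [timeUpTo]
  | t + 1, ([], s) => by simp [timeUpTo]
  | t + 1, (p :: k, s) => by
    rw [timeUpTo, timeUpTo]
    gcongr
    exact PMF.expect_mono _ fun c _ => timeUpTo_mono t c

theorem timeUpTo_monotone : Monotone (timeUpTo : ℕ → Config w → ℝ≥0∞) :=
  monotone_nat_of_le_succ fun t c => timeUpTo_mono t c

theorem winUpTo_mono (good : List (BitVec w) → Prop) :
    ∀ (t : ℕ) (c : Config w), winUpTo good t c ≤ winUpTo good (t + 1) c
  | 0, (p :: k, s) => by simp [winUpTo]
  | 0, ([], s) => by simp [winUpTo]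
  | t + 1, ([], s) => by simp [winUpTo]
  | t + 1, (p :: k, s) => by
    rw [winUpTo, winUpTo]
    exact PMF.expect_mono _ fun c _ => winUpTo_mono good t c

theorem winUpTo_monotone (good : List (BitVec w) → Prop) :
    Monotone (winUpTo good : ℕ → Config w → ℝ≥0∞) :=
  monotone_nat_of_le_succ fun t c => winUpTo_mono good t c

open Classical in
theorem winProb_halted (good : List (BitVec w) → Prop) (s : State w) :
    winProb good ([], s) = if good s.out then 1 else 0 := by
  unfold winProb
  have : ∀ t, winUpTo good t (([], s) : Config w) = if good s.out then 1 else 0 := by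
    intro t; cases t <;> simp [winUpTo]
  simp [this]

theorem winProb_cons (good : List (BitVec w) → Prop) (p : Program) (k : List Program)
    (s : State w) :
    winProb good (p :: k, s) = (step (p :: k, s)).expect (winProb good) := by
  unfold winProb
  rw [PMF.expect_iSup _ (winUpTo_monotone good)]
  apply le_antisymm
  · refine iSup_le fun t => ?_
    cases t with
    | zero => simp [winUpTo]
    | succ t => rw [winUpTo]; exact le_iSup (fun t => (step (p :: k, s)).expect (winUpTo good t)) t
  · refine iSup_le fun t => ?_
    refine le_trans ?_ (le_iSup _ (t + 1))
    rw [winUpTo]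

open Classical in
theorem sum_running_eq_timeUpTo (t : ℕ) (c : Config w) :
    ∑ i ∈ Finset.range t, (runFrom c i).toOuterMeasure {c | ¬ Halted c} = timeUpTo t c := by
  induction t generalizing c with
  | zero => simp [timeUpTo]
  | succ t ih =>
    obtain ⟨k, s⟩ := c
    cases k with
    | nil => simp [runFrom_halted, timeUpTo, PMF.toOuterMeasure_pure_apply, Halted]
    | cons p k =>
      rw [Finset.sum_range_succ', timeUpTo, add_comm]
      congr 1
      · simp [runFrom, PMF.toOuterMeasure_pure_apply, Halted]
      · simp only [← PMF.expect_indicator, runFrom_succ, PMF.expect_bind]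
        rw [← PMF.expect_sum]
        congr 1
        funext c'
        rw [← ih c']
        simp only [PMF.expect_indicator]

theorem expectedTime_eq (P : Program) (s : State w) :
    expectedTime P s = ⨆ t, timeUpTo t ([P], s) := by
  unfold expectedTime probRunning
  rw [ENNReal.tsum_eq_iSup_nat]
  simp only [run_eq_runFrom, sum_running_eq_timeUpTo]

open Classical in
theorem winUpTo_eq (good : List (BitVec w) → Prop) (t : ℕ) (c : Config w) :
    winUpTo good t c = (runFrom c t).toOuterMeasure {c | Halted c ∧ good c.2.out} := by
  induction t generalizing c with
  | zero =>
    obtain ⟨k, s⟩ := c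
    cases k <;> simp [winUpTo, runFrom, PMF.toOuterMeasure_pure_apply, Halted]
  | succ t ih =>
    obtain ⟨k, s⟩ := c
    cases k with
    | nil => simp [winUpTo, runFrom_halted, PMF.toOuterMeasure_pure_apply, Halted]
    | cons p k =>
      rw [winUpTo, runFrom_succ, ← PMF.expect_indicator, PMF.expect_bind]
      congr 1
      funext c'
      rw [ih, PMF.expect_indicator]

open Classical in
/-- The probabilities to have halted and to be still running add up to one. -/
theorem expect_halted_add_running (μ : PMF (Config w)) :
    μ.toOuterMeasure {c | Halted c} + μ.toOuterMeasure {c | ¬ Halted c} = 1 := by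
  rw [← PMF.expect_indicator, ← PMF.expect_indicator, ← PMF.expect_add]
  conv_rhs => rw [← PMF.expect_const μ 1]
  congr 1
  funext c
  by_cases h : Halted c <;> simp [h]

open Classical in
/-- A program that halts with a good output with probability one satisfies `HaltsWith`: at every
time, the probability to have halted with a good output and the probability of any event that
excludes this add up to at most one. -/
theorem haltsWith_of_winProb {P : Program} {s : State w} {good : List (BitVec w) → Prop}
    (h : 1 ≤ winProb good ([P], s)) : HaltsWith P s good := by
  have key : ∀ (t : ℕ) (q : Config w → Prop), (∀ c, q c → ¬ (Halted c ∧ good c.2.out)) →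
      winUpTo good t ([P], s) + (run P s t).toOuterMeasure {c | q c} ≤ 1 := by
    intro t q hq
    rw [winUpTo_eq, run_eq_runFrom, ← PMF.expect_indicator, ← PMF.expect_indicator,
      ← PMF.expect_add]
    refine PMF.expect_le _ fun c _ => ?_
    by_cases h1 : q c
    · have := hq c h1
      simp only [Set.mem_ofPred_eq, this, h1, if_true, if_false]; simp
    · simp only [Set.mem_ofPred_eq, h1, if_false, add_zero]; split_ifs <;> simp
  constructor
  -- A positive limit of the probabilities to be running would bound `winProb` away from one.
  · by_contra hne
    set x := ⨅ t, probRunning P s t with hx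
    have h2 : winProb good ([P], s) + x ≤ 1 := by
      unfold winProb
      rw [ENNReal.iSup_add]
      refine iSup_le fun t => le_trans ?_ (key t (fun c => ¬ Halted c) (fun c hc h' => hc h'.1))
      gcongr
      exact iInf_le _ t
    have h3 : 1 + x ≤ 1 := le_trans (by gcongr) h2
    have h4 : (1 : ℝ≥0∞) < 1 + x := ENNReal.lt_add_right (by simp) hne
    exact absurd h3 (not_le.2 h4)
  · intro t c hc hcH
    by_contra hbad
    -- A halted configuration persists, so a bad one keeps its probability for ever.
    have hstay : ∀ t', t ≤ t' → (run P s t) c ≤ (run P s t') c := by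
      intro t' htt'
      induction t', htt' using Nat.le_induction with
      | base => exact le_rfl
      | succ t' _ ih =>
        refine ih.trans ?_
        rw [run, PMF.bind_apply]
        refine le_trans ?_ (ENNReal.le_tsum c)
        obtain ⟨k, s'⟩ := c
        obtain rfl : k = [] := hcH
        simp [step, PMF.pure_apply]
    have h2 : winProb good ([P], s) + (run P s t) c ≤ 1 := by
      unfold winProb
      rw [ENNReal.iSup_add]
      refine iSup_le fun t' => ?_
      have h1 := key (max t t') (fun c' => c' = c) (by rintro _ rfl ⟨_, hg⟩; exact hbad hg)
      refine le_trans ?_ h1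
      refine add_le_add (winUpTo_monotone good (le_max_right _ _) _) ?_
      refine (hstay _ (le_max_left t t')).trans ?_
      rw [Set.ofPred_eq_eq_singleton, PMF.toOuterMeasure_apply_singleton]
    have h3 : 1 + (run P s t) c ≤ 1 := le_trans (by gcongr) h2
    have h4 : (1 : ℝ≥0∞) < 1 + (run P s t) c :=
      ENNReal.lt_add_right (by simp) ((PMF.mem_support_iff _ _).1 hc)
    exact absurd h3 (not_le.2 h4)

end WordRAM

/-! ### Hoare triples with running times -/

namespace WordRAM

variable {w : ℕ}

/-- The registers that a program may overwrite. -/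
def Program.writesReg : Program → ℕ → Bool
  | .skip, _ => false
  | .const d _, r => d == r
  | .not d _, r => d == r
  | .op _ d _ _, r => d == r
  | .load d _ _, r => d == r
  | .store _ _ _, _ => false
  | .rand d _, r => d == r
  | .emit _, _ => false
  | .seq p q, r => p.writesReg r || q.writesReg r
  | .ite _ p q, r => p.writesReg r || q.writesReg r
  | .while _ p, r => p.writesReg r

/-- The memory banks that a program may modify. -/
def Program.writesMem : Program → ℕ → Bool
  | .store m _ _, b => m == b
  | .seq p q, b => p.writesMem b || q.writesMem b
  | .ite _ p q, b => p.writesMem b || q.writesMem b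
  | .while _ p, b => p.writesMem b
  | _, _ => false

/-- Whether a program contains an output instruction. -/
def Program.emits : Program → Bool
  | .emit _ => true
  | .seq p q => p.emits || q.emits
  | .ite _ p q => p.emits || q.emits
  | .while _ p => p.emits
  | _ => false

/-- The state `s'` differs from `s` only in places where `p` may write. Every rule below hands this
relation to the continuation, so that postconditions need to mention only what a program changes. -/
structure Frame (p : Program) (s s' : State w) : Prop where
  reg : ∀ r, p.writesReg r = false → s'.reg r = s.reg r
  mem : ∀ b, p.writesMem b = false → s'.mem b = s.mem b
  out : p.emits = false → s'.out = s.out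

theorem Frame.rfl {p : Program} {s : State w} : Frame p s s :=
  ⟨fun _ _ => Eq.refl _, fun _ _ => Eq.refl _, fun _ => Eq.refl _⟩

theorem Frame.trans {p : Program} {s s' s'' : State w} (h : Frame p s s') (h' : Frame p s' s'') :
    Frame p s s'' :=
  ⟨fun r hr => (h'.reg r hr).trans (h.reg r hr), fun b hb => (h'.mem b hb).trans (h.mem b hb),
    fun ho => (h'.out ho).trans (h.out ho)⟩

theorem Frame.mono {p q : Program} {s s' : State w} (h : Frame p s s')
    (hr : ∀ r, q.writesReg r = false → p.writesReg r = false)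
    (hm : ∀ b, q.writesMem b = false → p.writesMem b = false)
    (ho : q.emits = false → p.emits = false) : Frame q s s' :=
  ⟨fun r h1 => h.reg r (hr r h1), fun b h1 => h.mem b (hm b h1), fun h1 => h.out (ho h1)⟩

theorem Frame.seq_left {p q : Program} {s s' : State w} (h : Frame p s s') :
    Frame (.seq p q) s s' :=
  h.mono (fun _ h1 => (Bool.or_eq_false_iff.1 h1).1) (fun _ h1 => (Bool.or_eq_false_iff.1 h1).1)
    fun h1 => (Bool.or_eq_false_iff.1 h1).1

theorem Frame.seq_right {p q : Program} {s s' : State w} (h : Frame q s s') :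
    Frame (.seq p q) s s' :=
  h.mono (fun _ h1 => (Bool.or_eq_false_iff.1 h1).2) (fun _ h1 => (Bool.or_eq_false_iff.1 h1).2)
    fun h1 => (Bool.or_eq_false_iff.1 h1).2

theorem Frame.ite_left {a : ℕ} {p q : Program} {s s' : State w} (h : Frame p s s') :
    Frame (.ite a p q) s s' :=
  h.mono (fun _ h1 => (Bool.or_eq_false_iff.1 h1).1) (fun _ h1 => (Bool.or_eq_false_iff.1 h1).1)
    fun h1 => (Bool.or_eq_false_iff.1 h1).1

theorem Frame.ite_right {a : ℕ} {p q : Program} {s s' : State w} (h : Frame q s s') :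
    Frame (.ite a p q) s s' :=
  h.mono (fun _ h1 => (Bool.or_eq_false_iff.1 h1).2) (fun _ h1 => (Bool.or_eq_false_iff.1 h1).2)
    fun h1 => (Bool.or_eq_false_iff.1 h1).2

theorem Frame.while {a : ℕ} {p : Program} {s s' : State w} (h : Frame p s s') :
    Frame (.while a p) s s' :=
  h.mono (fun _ h1 => h1) (fun _ h1 => h1) fun h1 => h1

/-- Started in `s`, the program `p` halts almost surely, in expected time at most `T`, in a state
that satisfies `Post a` where `a` is drawn from `μ`.  More precisely, whatever is executed
afterwards, an adversary may choose the final state among those that satisfy `Post a`. -/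
structure Spec {α : Type*} (p : Program) (s : State w) (T : ℝ≥0∞) (μ : PMF α)
    (Post : α → State w → Prop) : Prop where
  time : ∀ (k : List Program) (t : ℕ) (B : α → ℝ≥0∞),
    (∀ a s', Post a s' → Frame p s s' → timeUpTo t (k, s') ≤ B a) →
      timeUpTo (t + 1) (p :: k, s) ≤ T + μ.expect B
  win : ∀ (good : List (BitVec w) → Prop) (k : List Program) (x : ℝ≥0∞),
    (∀ a s', Post a s' → Frame p s s' → x ≤ winProb good (k, s')) → x ≤ winProb good (p :: k, s)

/-- Started in `s`, the program `p` halts almost surely, in expected time at most `T`, in a state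
that satisfies `Post`. -/
structure Triple (p : Program) (s : State w) (T : ℝ≥0∞) (Post : State w → Prop) : Prop where
  time : ∀ (k : List Program) (t : ℕ) (B : ℝ≥0∞),
    (∀ s', Post s' → Frame p s s' → timeUpTo t (k, s') ≤ B) →
      timeUpTo (t + 1) (p :: k, s) ≤ T + B
  win : ∀ (good : List (BitVec w) → Prop) (k : List Program) (x : ℝ≥0∞),
    (∀ s', Post s' → Frame p s s' → x ≤ winProb good (k, s')) → x ≤ winProb good (p :: k, s)

theorem Triple.mono {p : Program} {s : State w} {T T' : ℝ≥0∞} {Post Post' : State w → Prop}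
    (h : Triple p s T Post) (hT : T ≤ T') (hP : ∀ s', Post s' → Frame p s s' → Post' s') :
    Triple p s T' Post' :=
  ⟨fun k t B hB => (h.time k t B fun s' h1 h2 => hB s' (hP s' h1 h2) h2).trans (by gcongr),
    fun good k x hx => h.win good k x fun s' h1 h2 => hx s' (hP s' h1 h2) h2⟩

theorem Spec.mono {α : Type*} {p : Program} {s : State w} {T T' : ℝ≥0∞} {μ : PMF α}
    {Post Post' : α → State w → Prop}
    (h : Spec p s T μ Post) (hT : T ≤ T') (hP : ∀ a s', Post a s' → Frame p s s' → Post' a s') :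
    Spec p s T' μ Post' :=
  ⟨fun k t B hB => (h.time k t B fun a s' h1 h2 => hB a s' (hP a s' h1 h2) h2).trans (by gcongr),
    fun good k x hx => h.win good k x fun a s' h1 h2 => hx a s' (hP a s' h1 h2) h2⟩

theorem timeUpTo_cons_pure {p : Program} {k : List Program} {s : State w} {c : Config w}
    (h : step (p :: k, s) = PMF.pure c) (t : ℕ) :
    timeUpTo (t + 1) (p :: k, s) = 1 + timeUpTo t c := by
  rw [timeUpTo, h, PMF.expect_pure]

theorem winProb_cons_pure {p : Program} {k : List Program} {s : State w} {c : Config w}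
    (h : step (p :: k, s) = PMF.pure c) (good : List (BitVec w) → Prop) :
    winProb good (p :: k, s) = winProb good c := by
  rw [winProb_cons, h, PMF.expect_pure]

/-- The rule for programs that consist of a single deterministic step. -/
theorem Triple.of_step {p : Program} {s s' : State w}
    (h : ∀ k, step (p :: k, s) = PMF.pure (k, s')) (hF : Frame p s s') :
    Triple p s 1 (fun x => x = s') :=
  ⟨fun k t B hB => by rw [timeUpTo_cons_pure (h k)]; gcongr; exact hB s' (Eq.refl _) hF,
    fun good k x hx => by rw [winProb_cons_pure (h k)]; exact hx s' (Eq.refl _) hF⟩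

/-- Sequential composition: the random outcome of the first program is followed by that of the
second one. -/
theorem Spec.seq {α β : Type*} {p q : Program} {s : State w} {T : ℝ≥0∞} {T' : α → ℝ≥0∞}
    {μ : PMF α} {ν : α → PMF β} {Post : α → State w → Prop} {Post' : β → State w → Prop}
    (h : Spec p s T μ Post)
    (h' : ∀ a s', Post a s' → Frame p s s' → Spec q s' (T' a) (ν a) Post') :
    Spec (.seq p q) s (1 + T + μ.expect T') (μ.bind ν) Post' := by
  constructor
  · intro k t B hB
    rw [timeUpTo_cons_pure (show step (Program.seq p q :: k, s) = PMF.pure (p :: q :: k, s) from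
      Eq.refl _), add_assoc 1, add_assoc 1]
    gcongr
    cases t with
    | zero => simp [timeUpTo]
    | succ t =>
      refine (h.time (q :: k) t (fun a => T' a + (ν a).expect B) ?_).trans ?_
      · intro a s' h1 h2
        refine (timeUpTo_monotone (Nat.le_succ t) _).trans ?_
        refine (h' a s' h1 h2).time k t B fun b s'' h3 h4 => ?_
        exact (timeUpTo_monotone (Nat.le_succ t) _).trans
          (hB b s'' h3 (h2.seq_left.trans h4.seq_right))
      · rw [PMF.expect_add, PMF.expect_bind, add_assoc]
  · intro good k x hx
    rw [winProb_cons_pure (show step (Program.seq p q :: k, s) = PMF.pure (p :: q :: k, s) from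
      Eq.refl _)]
    exact h.win good _ x fun a s' h1 h2 => (h' a s' h1 h2).win good k x fun b s'' h3 h4 =>
      hx b s'' h3 (h2.seq_left.trans h4.seq_right)

/-- A deterministic outcome is a random one, drawn from a Dirac measure. -/
theorem Triple.toSpec {p : Program} {s : State w} {T : ℝ≥0∞} {Post : State w → Prop}
    (h : Triple p s T Post) {α : Type*} (a : α) :
    Spec p s T (PMF.pure a) (fun b s' => b = a ∧ Post s') :=
  ⟨fun k t B hB => by
      rw [PMF.expect_pure]; exact h.time k t _ fun s' h1 h2 => hB a s' ⟨Eq.refl _, h1⟩ h2,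
    fun good k x hx => h.win good k x fun s' h1 h2 => hx a s' ⟨Eq.refl _, h1⟩ h2⟩

/-- Forgetting the law of the outcome. -/
theorem Spec.toTriple {α : Type*} {p : Program} {s : State w} {T : ℝ≥0∞} {μ : PMF α}
    {Post : α → State w → Prop} (h : Spec p s T μ Post) :
    Triple p s T (fun s' => ∃ a, Post a s') :=
  ⟨fun k t B hB => by
      refine (h.time k t (fun _ => B) fun a s' h1 h2 => hB s' ⟨a, h1⟩ h2).trans ?_
      rw [PMF.expect_const],
    fun good k x hx => h.win good k x fun a s' h1 h2 => hx s' ⟨a, h1⟩ h2⟩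

theorem Triple.seq {p q : Program} {s : State w} {T T' : ℝ≥0∞}
    {Post Post' : State w → Prop} (h : Triple p s T Post)
    (h' : ∀ s', Post s' → Frame p s s' → Triple q s' T' Post') :
    Triple (.seq p q) s (1 + T + T') Post' := by
  have := (Spec.seq (T' := fun _ => T') (h.toSpec ()) (by
    rintro a s' ⟨_, h1⟩ h2
    exact (h' s' h1 h2).toSpec ())).toTriple
  rw [PMF.expect_const] at this
  refine this.mono le_rfl ?_
  rintro s' ⟨_, h1⟩ _
  exact h1.2

theorem Triple.seq_spec {α : Type*} {p q : Program} {s : State w} {T T' : ℝ≥0∞}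
    {μ : PMF α} {Post : State w → Prop} {Post' : α → State w → Prop} (h : Triple p s T Post)
    (h' : ∀ s', Post s' → Frame p s s' → Spec q s' T' μ Post') :
    Spec (.seq p q) s (1 + T + T') μ Post' := by
  have := Spec.seq (T' := fun _ => T') (ν := fun _ => μ) (Post' := Post')
    (h.toSpec ()) fun a s' h1 h2 => h' s' h1.2 h2
  rwa [PMF.expect_const, PMF.pure_bind] at this

theorem Spec.seq_triple {α : Type*} {p q : Program} {s : State w} {T : ℝ≥0∞} {T' : α → ℝ≥0∞}
    {μ : PMF α} {Post Post' : α → State w → Prop} (h : Spec p s T μ Post)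
    (h' : ∀ a s', Post a s' → Frame p s s' → Triple q s' (T' a) (Post' a)) :
    Spec (.seq p q) s (1 + T + μ.expect T') μ Post' := by
  have := Spec.seq (ν := fun a => PMF.pure a) (Post' := Post')
    h fun a s' h1 h2 => ((h' a s' h1 h2).toSpec a).mono le_rfl fun b s'' h3 _ => h3.1 ▸ h3.2
  rwa [PMF.bind_pure] at this

theorem Triple.ite {a : ℕ} {p q : Program} {s : State w} {T : ℝ≥0∞} {Post : State w → Prop}
    (hp : s.reg a ≠ 0 → Triple p s T Post) (hq : s.reg a = 0 → Triple q s T Post) :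
    Triple (.ite a p q) s (1 + T) Post := by
  by_cases ha : s.reg a = 0
  · have hs : ∀ k, step (Program.ite a p q :: k, s) = PMF.pure (q :: k, s) := by
      intro k; simp [step, ha]
    constructor
    · intro k t B hB
      rw [timeUpTo_cons_pure (hs k), add_assoc]
      gcongr
      refine (timeUpTo_monotone (Nat.le_succ t) _).trans ?_
      exact (hq ha).time k t B fun s' h1 h2 => hB s' h1 h2.ite_right
    · intro good k x hx
      rw [winProb_cons_pure (hs k)]
      exact (hq ha).win good k x fun s' h1 h2 => hx s' h1 h2.ite_right
  · have hs : ∀ k, step (Program.ite a p q :: k, s) = PMF.pure (p :: k, s) := by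
      intro k; rw [step, if_pos ha]
    constructor
    · intro k t B hB
      rw [timeUpTo_cons_pure (hs k), add_assoc]
      gcongr
      refine (timeUpTo_monotone (Nat.le_succ t) _).trans ?_
      exact (hp ha).time k t B fun s' h1 h2 => hB s' h1 h2.ite_left
    · intro good k x hx
      rw [winProb_cons_pure (hs k)]
      exact (hp ha).win good k x fun s' h1 h2 => hx s' h1 h2.ite_left

/-- The rule for loops.  `Inv j` is the invariant when `j` iterations remain to be made. -/
theorem Triple.while {a : ℕ} {p : Program} (N : ℕ) (s₀ : State w) (Inv : ℕ → State w → Prop)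
    (T : ℕ → ℝ≥0∞) (h0 : Inv N s₀)
    (hstep : ∀ j < N, ∀ s, Inv (j + 1) s → Frame (.while a p) s₀ s →
      s.reg a ≠ 0 ∧ Triple p s (T j) (Inv j))
    (hend : ∀ s, Inv 0 s → Frame (.while a p) s₀ s → s.reg a = 0) :
    Triple (.while a p) s₀ (1 + ∑ j ∈ Finset.range N, (1 + T j)) (Inv 0) := by
  constructor
  -- A truncation `t + 1` that suffices for the first iteration suffices for the later ones,
  -- since `timeUpTo` is monotone; it therefore stays fixed in the induction.
  · intro k t B hB
    suffices H : ∀ n ≤ N, ∀ s, Inv n s → Frame (.while a p) s₀ s →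
        timeUpTo (t + 1) (Program.while a p :: k, s) ≤
          1 + ∑ j ∈ Finset.range n, (1 + T j) + B from H N le_rfl s₀ h0 Frame.rfl
    intro n
    induction n with
    | zero =>
      intro _ s hs hF
      rw [timeUpTo_cons_pure (show _ = PMF.pure (k, s) by simp [step, hend s hs hF])]
      simp only [Finset.range_zero, Finset.sum_empty, add_zero]
      gcongr
      exact hB s hs hF
    | succ n ih =>
      intro hn s hs hF
      obtain ⟨h1, h2⟩ := hstep n hn s hs hF
      rw [timeUpTo_cons_pure (show _ = PMF.pure (p :: .while a p :: k, s) by rw [step, if_pos h1])]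
      have h3 : timeUpTo t (p :: .while a p :: k, s) ≤
          T n + (1 + ∑ j ∈ Finset.range n, (1 + T j) + B) := by
        refine (timeUpTo_monotone (show t ≤ t + 1 + 1 by omega) _).trans ?_
        exact h2.time _ _ _ fun s' h4 h5 => ih (by omega) s' h4 (hF.trans h5.while)
      calc 1 + timeUpTo t (p :: .while a p :: k, s)
          ≤ 1 + (T n + (1 + ∑ j ∈ Finset.range n, (1 + T j) + B)) := by gcongr
        _ = _ := by rw [Finset.sum_range_succ]; ring
  · intro good k x hx
    suffices H : ∀ n ≤ N, ∀ s, Inv n s → Frame (.while a p) s₀ s →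
        x ≤ winProb good (Program.while a p :: k, s) from H N le_rfl s₀ h0 Frame.rfl
    intro n
    induction n with
    | zero =>
      intro _ s hs hF
      rw [winProb_cons_pure (show _ = PMF.pure (k, s) by simp [step, hend s hs hF])]
      exact hx s hs hF
    | succ n ih =>
      intro hn s hs hF
      obtain ⟨h1, h2⟩ := hstep n hn s hs hF
      rw [winProb_cons_pure (show _ = PMF.pure (p :: .while a p :: k, s) by rw [step, if_pos h1])]
      exact h2.win _ _ _ fun s' h4 h5 => ih (by omega) s' h4 (hF.trans h5.while)

/-! ### Straight-line programs -/

/-- The effect of a program without loops, random choices and output (the values at other programs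
are immaterial). -/
@[simp] def Program.exec : Program → State w → State w
  | .const d c, s => s.setReg d (BitVec.ofNat w c)
  | .not d a, s => s.setReg d (~~~ (s.reg a))
  | .op o d a b, s => s.setReg d (o.eval (s.reg a) (s.reg b))
  | .load d m a, s => s.setReg d (s.mem m (s.reg a))
  | .store m a b, s => s.setMem m (s.reg a) (s.reg b)
  | .seq p q, s => q.exec (p.exec s)
  | .ite a p q, s => if s.reg a ≠ 0 then p.exec s else q.exec s
  | _, s => s

/-- Programs without loops, random choices and output. -/
def Program.straight : Program → Bool
  | .rand _ _ => false
  | .emit _ => false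
  | .while _ _ => false
  | .seq p q => p.straight && q.straight
  | .ite _ p q => p.straight && q.straight
  | _ => true

/-- A bound for the running time of a program without loops. -/
def Program.cost : Program → ℕ
  | .seq p q => 1 + p.cost + q.cost
  | .ite _ p q => 1 + max p.cost q.cost
  | _ => 1

@[simp] theorem setReg_reg (s : State w) (d r : ℕ) (x : BitVec w) :
    (s.setReg d x).reg r = if r = d then x else s.reg r := by
  simp [State.setReg, Function.update_apply]

@[simp] theorem setReg_mem (s : State w) (d : ℕ) (x : BitVec w) : (s.setReg d x).mem = s.mem := rfl

@[simp] theorem setMem_reg (s : State w) (b : ℕ) (a x : BitVec w) :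
    (s.setMem b a x).reg = s.reg := rfl

@[simp] theorem setMem_mem (s : State w) (b b' : ℕ) (a x : BitVec w) :
    (s.setMem b a x).mem b' = if b' = b then Function.update (s.mem b) a x else s.mem b' := by
  by_cases h : b' = b
  · subst h; simp [State.setMem]
  · simp [State.setMem, h]

theorem frame_setReg {p : Program} {s : State w} {d : ℕ} {x : BitVec w}
    (h : ∀ r, p.writesReg r = false → d ≠ r) : Frame p s (s.setReg d x) :=
  ⟨fun r hr => by rw [setReg_reg, if_neg (h r hr).symm], fun _ _ => rfl, fun _ => rfl⟩

theorem frame_setMem {p : Program} {s : State w} {b : ℕ} {a x : BitVec w}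
    (h : ∀ r, p.writesMem r = false → b ≠ r) : Frame p s (s.setMem b a x) :=
  ⟨fun _ _ => rfl, fun r hr => by rw [setMem_mem, if_neg (h r hr).symm], fun _ => rfl⟩

/-- A straight-line program brings about the state that `Program.exec` computes, within the time
`Program.cost`. -/
theorem Triple.exec : ∀ (p : Program) (s : State w), p.straight = true →
    Triple p s p.cost (fun s' => s' = p.exec s)
  | .skip, s, _ =>
    (Triple.of_step (fun k => Eq.refl _) Frame.rfl).mono (by simp [Program.cost]) fun _ h _ => h
  | .const d c, s, _ =>
    (Triple.of_step (fun k => Eq.refl _) (frame_setReg (by simp [Program.writesReg]))).mono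
      (by simp [Program.cost]) fun _ h _ => h
  | .not d a, s, _ =>
    (Triple.of_step (fun k => Eq.refl _) (frame_setReg (by simp [Program.writesReg]))).mono
      (by simp [Program.cost]) fun _ h _ => h
  | .op o d a b, s, _ =>
    (Triple.of_step (fun k => Eq.refl _) (frame_setReg (by simp [Program.writesReg]))).mono
      (by simp [Program.cost]) fun _ h _ => h
  | .load d m a, s, _ =>
    (Triple.of_step (fun k => Eq.refl _) (frame_setReg (by simp [Program.writesReg]))).mono
      (by simp [Program.cost]) fun _ h _ => h
  | .store m a b, s, _ =>
    (Triple.of_step (fun k => Eq.refl _) (frame_setMem (by simp [Program.writesMem]))).mono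
      (by simp [Program.cost]) fun _ h _ => h
  | .seq p q, s, h => by
    simp only [Program.straight, Bool.and_eq_true] at h
    have := Triple.seq (T' := q.cost) (Post' := fun s' => s' = q.exec (p.exec s))
      (Triple.exec p s h.1) (by rintro _ rfl _; exact Triple.exec q _ h.2)
    simpa [Program.cost, Program.exec] using this
  | .ite a p q, s, h => by
    simp only [Program.straight, Bool.and_eq_true] at h
    have := Triple.ite (a := a) (p := p) (q := q) (s := s) (T := (max p.cost q.cost : ℕ))
      (Post := fun s' => s' = (Program.ite a p q).exec s)
      (fun ha => (Triple.exec p s h.1).mono (by exact_mod_cast le_max_left _ _)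
        (by rintro _ rfl _; rw [Program.exec, if_pos ha]))
      (fun ha => (Triple.exec q s h.2).mono (by exact_mod_cast le_max_right _ _)
        (by rintro _ rfl _; simp [Program.exec, ha]))
    simpa [Program.cost] using this

theorem Triple.straight {p : Program} {s : State w} (T : ℕ) {Post : State w → Prop}
    (h : p.straight = true) (hT : p.cost ≤ T) (hP : Post (p.exec s)) : Triple p s T Post :=
  (Triple.exec p s h).mono (by exact_mod_cast hT) (by rintro _ rfl _; exact hP)

theorem exec_frame {p : Program} (s : State w) : Frame p s (p.exec s) := by
  induction p generalizing s with
  | skip => exact Frame.rfl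
  | const d c => exact frame_setReg (by simp [Program.writesReg])
  | not d a => exact frame_setReg (by simp [Program.writesReg])
  | op o d a b => exact frame_setReg (by simp [Program.writesReg])
  | load d m a => exact frame_setReg (by simp [Program.writesReg])
  | store m a b => exact frame_setMem (by simp [Program.writesMem])
  | rand d a => exact Frame.rfl
  | emit a => exact Frame.rfl
  | seq p q hp hq => exact (hp s).seq_left.trans (hq _).seq_right
  | ite a p q hp hq =>
    by_cases ha : s.reg a = 0
    · rw [Program.exec, if_neg (not_not.2 ha)]; exact (hq s).ite_right
    · rw [Program.exec, if_pos ha]; exact (hp s).ite_left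
  | _ => exact Frame.rfl

/-- A list of programs, executed one after the other. -/
@[simp] def block : List Program → Program
  | [] => .skip
  | [p] => p
  | p :: q :: ps => .seq p (block (q :: ps))

/-- Repeat `body` with register `c` running downwards from its initial value minus one to zero.
The register `e` has to hold the number one. -/
def forDown (c e : ℕ) (body : Program) : Program := .while c (.seq (.op .sub c c e) body)

theorem ofNat_sub_one (j : ℕ) : BitVec.ofNat w (j + 1) - BitVec.ofNat w 1 = BitVec.ofNat w j := by
  rw [BitVec.ofNat_add, BitVec.add_sub_cancel]

theorem ofNat_ne_zero {j : ℕ} (h0 : j ≠ 0) (h : j < 2 ^ w) : BitVec.ofNat w j ≠ 0#w := by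
  intro h1
  have := congrArg BitVec.toNat h1
  simp [Nat.mod_eq_of_lt h] at this
  exact h0 this

/-- The rule for counting loops.  The invariant must not depend on the counter. -/
theorem Triple.forDown {c e : ℕ} {body : Program} (N : ℕ) (s₀ : State w)
    (Inv : ℕ → State w → Prop) (T : ℕ → ℝ≥0∞) (hN : N < 2 ^ w)
    (hc : body.writesReg c = false) (he : body.writesReg e = false) (hce : c ≠ e)
    (hrc : s₀.reg c = BitVec.ofNat w N) (hre : s₀.reg e = BitVec.ofNat w 1)
    (h0 : Inv N s₀) (hInv : ∀ j s x, Inv j s → Inv j (s.setReg c x))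
    (hstep : ∀ j < N, ∀ s, s.reg c = BitVec.ofNat w j → Inv (j + 1) s →
      Frame (WordRAM.forDown c e body) s₀ s → Triple body s (T j) (Inv j)) :
    Triple (WordRAM.forDown c e body) s₀ (1 + ∑ j ∈ Finset.range N, (3 + T j)) (Inv 0) := by
  have := Triple.while (a := c) (p := .seq (.op .sub c c e) body) N s₀
    (fun j s => s.reg c = BitVec.ofNat w j ∧ Inv j s) (fun j => 1 + 1 + T j) ⟨hrc, h0⟩ ?_ ?_
  · refine this.mono ?_ fun s h _ => h.2
    simp only [← add_assoc]
    norm_num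
  · rintro j hj s ⟨hs, hI⟩ hF
    refine ⟨by rw [hs]; exact ofNat_ne_zero (by omega) (by omega), ?_⟩
    refine Triple.seq (Post := fun s' => s' = s.setReg c (BitVec.ofNat w j)) ?_ ?_
    · have h1 := Triple.exec (.op .sub c c e) s rfl
      refine h1.mono (by simp [Program.cost]) ?_
      rintro _ rfl _
      have : s.reg e = BitVec.ofNat w 1 := by
        rw [← hre]; exact hF.reg e (by simp [Program.writesReg, he, hce])
      rw [Program.exec, hs, this, BinOp.eval, ofNat_sub_one]
    · rintro _ rfl hF'
      refine (hstep j hj _ (by simp [setReg_reg]) (hInv _ _ _ hI)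
        (hF.trans hF'.seq_left.while)).mono le_rfl ?_
      intro s' hs' hF''
      exact ⟨by rw [hF''.reg c hc, setReg_reg, if_pos rfl], hs'⟩
  · rintro s ⟨hs, _⟩ _
    rw [hs]; simp

end WordRAM

/-! ### Running a program as a subroutine -/

namespace WordRAM

variable {w : ℕ}

/-- The program `P` with its registers and memory banks renamed by `f` and `g`, and with every
output instruction replaced by the program `h`, which gets the register to be written. -/
def Program.embed (f g : ℕ → ℕ) (h : ℕ → Program) : Program → Program
  | .skip => .skip
  | .const d c => .const (f d) c
  | .not d a => .not (f d) (f a)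
  | .op o d a b => .op o (f d) (f a) (f b)
  | .load d m a => .load (f d) (g m) (f a)
  | .store m a b => .store (g m) (f a) (f b)
  | .rand d a => .rand (f d) (f a)
  | .emit a => h (f a)
  | .seq p q => .seq (p.embed f g h) (q.embed f g h)
  | .ite a p q => .ite (f a) (p.embed f g h) (q.embed f g h)
  | .while a p => .while (f a) (p.embed f g h)

/-- The state `S` contains a copy of `s`, with the names of registers and banks changed. The outputs
are not compared: those of the subroutine are consumed by the handler. -/
structure Embeds (f g : ℕ → ℕ) (s S : State w) : Prop where
  reg : ∀ r, S.reg (f r) = s.reg r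
  mem : ∀ b, S.mem (g b) = s.mem b

/-- The property `J out S` of the surrounding state does not depend on the part of the memory
that is used by the subroutine. -/
def Insensitive (f g : ℕ → ℕ) (J : List (BitVec w) → State w → Prop) : Prop :=
  ∀ out S S', (∀ r, (∀ i, f i ≠ r) → S'.reg r = S.reg r) →
    (∀ b, (∀ i, g i ≠ b) → S'.mem b = S.mem b) → S'.out = S.out → J out S → J out S'

/-- The program `h` handles an output word: it maintains the property `J` of the outputs so far and
the surrounding state, and it does not touch the registers and banks of the subroutine. A step of
the subroutine that is an output costs at most `T` steps when it is handled. -/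
structure Handles (f g : ℕ → ℕ) (h : ℕ → Program) (J : List (BitVec w) → State w → Prop)
    (T : ℝ≥0∞) : Prop where
  inj_reg : Function.Injective f
  inj_mem : Function.Injective g
  insensitive : Insensitive f g J
  one_le : 1 ≤ T
  reg : ∀ a r, (h (f a)).writesReg (f r) = false
  mem : ∀ a b, (h (f a)).writesMem (g b) = false
  triple : ∀ out S a, J out S → Triple (h (f a)) S T fun S' => J (out ++ [S.reg (f a)]) S'

theorem Embeds.setReg {f g : ℕ → ℕ} {s S : State w} (h : Embeds f g s S)
    (hf : Function.Injective f) (d : ℕ) (x : BitVec w) :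
    Embeds f g (s.setReg d x) (S.setReg (f d) x) :=
  ⟨fun r => by simp only [setReg_reg, hf.eq_iff, h.reg], h.mem⟩

theorem Embeds.setMem {f g : ℕ → ℕ} {s S : State w} (h : Embeds f g s S)
    (hg : Function.Injective g) (b : ℕ) (a x : BitVec w) :
    Embeds f g (s.setMem b a x) (S.setMem (g b) a x) :=
  ⟨h.reg, fun r => by simp only [setMem_mem, hg.eq_iff, h.mem]⟩

theorem Insensitive.setReg {f g : ℕ → ℕ} {J : List (BitVec w) → State w → Prop}
    (hJ : Insensitive f g J) {out : List (BitVec w)} {S : State w} (h : J out S) (d : ℕ)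
    (x : BitVec w) : J out (S.setReg (f d) x) :=
  hJ out S _ (fun r hr => by rw [setReg_reg, if_neg (hr d).symm]) (fun _ _ => rfl) rfl h

theorem Insensitive.setMem {f g : ℕ → ℕ} {J : List (BitVec w) → State w → Prop}
    (hJ : Insensitive f g J) {out : List (BitVec w)} {S : State w} (h : J out S) (b : ℕ)
    (a x : BitVec w) : J out (S.setMem (g b) a x) :=
  hJ out S _ (fun _ _ => rfl) (fun r hr => by rw [setMem_mem, if_neg (hr b).symm]) rfl h

/-- Whatever is left unchanged by `q` is left unchanged by `p`. The remaining pieces of a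
computation of `q` stand in this relation to `q`. -/
def Within (p q : Program) : Prop := ∀ ⦃w : ℕ⦄ (s s' : State w), Frame p s s' → Frame q s s'

/-- Apart from output instructions, the subroutine makes the same steps as the original
program. -/
theorem embed_step {f g : ℕ → ℕ} {h : ℕ → Program} {J : List (BitVec w) → State w → Prop}
    {T : ℝ≥0∞} (H : Handles f g h J T) (p : Program) (hp : ∀ a, p ≠ .emit a) (k rest : List Program)
    (s S : State w) (hE : Embeds f g s S) (hJ : J s.out S) :
    ∃ (μ : PMF (BitVec w)) (k' : BitVec w → List Program) (s' S' : BitVec w → State w),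
      step (p :: k, s) = μ.map (fun x => (k' x, s' x)) ∧
      step (p.embed f g h :: (k.map (·.embed f g h) ++ rest), S) =
        μ.map (fun x => ((k' x).map (·.embed f g h) ++ rest, S' x)) ∧
      ∀ x, Embeds f g (s' x) (S' x) ∧ J (s' x).out (S' x) ∧
        Frame (p.embed f g h) S (S' x) ∧
        ∀ q ∈ k' x, q ∈ k ∨ Within (q.embed f g h) (p.embed f g h) := by
  -- Only `rand` is a random step; the others are treated as a random step that ignores the drawn
  -- word.
  have pure_case : ∀ (k' : List Program) (s' S' : State w),
      step (p :: k, s) = PMF.pure (k', s') →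
      step (p.embed f g h :: (k.map (·.embed f g h) ++ rest), S) =
        PMF.pure (k'.map (·.embed f g h) ++ rest, S') →
      Embeds f g s' S' → J s'.out S' → Frame (p.embed f g h) S S' →
      (∀ q ∈ k', q ∈ k ∨ Within (q.embed f g h) (p.embed f g h)) →
      ∃ (μ : PMF (BitVec w)) (k' : BitVec w → List Program) (s' S' : BitVec w → State w),
      step (p :: k, s) = μ.map (fun x => (k' x, s' x)) ∧
      step (p.embed f g h :: (k.map (·.embed f g h) ++ rest), S) =
        μ.map (fun x => ((k' x).map (·.embed f g h) ++ rest, S' x)) ∧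
      ∀ x, Embeds f g (s' x) (S' x) ∧ J (s' x).out (S' x) ∧
        Frame (p.embed f g h) S (S' x) ∧
        ∀ q ∈ k' x, q ∈ k ∨ Within (q.embed f g h) (p.embed f g h) := by
    intro k' s' S' h1 h2 h3 h4 h5 h6
    refine ⟨PMF.pure 0, fun _ => k', fun _ => s', fun _ => S', ?_, ?_, fun _ => ⟨h3, h4, h5, h6⟩⟩
    · rw [h1, PMF.pure_map]
    · rw [h2, PMF.pure_map]
  cases p with
  | skip => exact pure_case k s S rfl rfl hE hJ Frame.rfl fun q hq => .inl hq
  | const d c =>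
    exact pure_case k _ _ rfl rfl (hE.setReg H.inj_reg _ _) (H.insensitive.setReg hJ _ _)
      (frame_setReg (by simp [Program.embed, Program.writesReg])) fun q hq => .inl hq
  | not d a =>
    refine pure_case k _ (S.setReg (f d) (~~~ (s.reg a))) rfl ?_ (hE.setReg H.inj_reg _ _)
      (H.insensitive.setReg hJ _ _) (frame_setReg (by simp [Program.embed, Program.writesReg]))
      fun q hq => .inl hq
    simp only [Program.embed, step, hE.reg]
  | op o d a b =>
    refine pure_case k _ (S.setReg (f d) (o.eval (s.reg a) (s.reg b))) rfl ?_
      (hE.setReg H.inj_reg _ _) (H.insensitive.setReg hJ _ _)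
      (frame_setReg (by simp [Program.embed, Program.writesReg])) fun q hq => .inl hq
    simp only [Program.embed, step, hE.reg]
  | load d m a =>
    refine pure_case k _ (S.setReg (f d) (s.mem m (s.reg a))) rfl ?_
      (hE.setReg H.inj_reg _ _) (H.insensitive.setReg hJ _ _)
      (frame_setReg (by simp [Program.embed, Program.writesReg])) fun q hq => .inl hq
    simp only [Program.embed, step, hE.reg, hE.mem]
  | store m a b =>
    refine pure_case k _ (S.setMem (g m) (s.reg a) (s.reg b)) rfl ?_
      (hE.setMem H.inj_mem _ _ _) (H.insensitive.setMem hJ _ _ _)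
      (frame_setMem (by simp [Program.embed, Program.writesMem])) fun q hq => .inl hq
    simp only [Program.embed, step, hE.reg]
  | rand d a =>
    refine ⟨randWord (s.reg a), fun _ => k, fun x => s.setReg d x, fun x => S.setReg (f d) x,
      rfl, ?_, fun x => ⟨hE.setReg H.inj_reg _ _, H.insensitive.setReg hJ _ _,
      frame_setReg (by simp [Program.embed, Program.writesReg]), fun q hq => .inl hq⟩⟩
    simp only [Program.embed, step, hE.reg]
  | emit a => exact absurd rfl (hp a)
  | seq p q =>
    refine pure_case (p :: q :: k) s S rfl rfl hE hJ Frame.rfl fun r hr => ?_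
    rcases List.mem_cons.1 hr with rfl | hr
    · exact .inr fun _ _ _ hF => hF.seq_left
    rcases List.mem_cons.1 hr with rfl | hr
    · exact .inr fun _ _ _ hF => hF.seq_right
    · exact .inl hr
  | ite a p q =>
    refine pure_case ((if s.reg a ≠ 0 then p else q) :: k) s S rfl ?_ hE hJ Frame.rfl
      fun r hr => ?_
    · simp only [Program.embed, step, hE.reg]
      by_cases ha : s.reg a ≠ 0
      · rw [if_pos ha, if_pos ha]; rfl
      · rw [if_neg ha, if_neg ha]; rfl
    · rcases List.mem_cons.1 hr with rfl | hr
      · by_cases ha : s.reg a ≠ 0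
        · rw [if_pos ha]; exact .inr fun _ _ _ hF => hF.ite_left
        · rw [if_neg ha]; exact .inr fun _ _ _ hF => hF.ite_right
      · exact .inl hr
  -- the remaining constructor is `while`
  | _ a p =>
    refine pure_case (if s.reg a ≠ 0 then p :: .while a p :: k else k) s S ?_ ?_ hE hJ Frame.rfl
      fun r hr => ?_
    · rw [step]
    · simp only [Program.embed, step, hE.reg]
      by_cases ha : s.reg a ≠ 0
      · rw [if_pos ha, if_pos ha]; rfl
      · rw [if_neg ha, if_neg ha]
    · by_cases ha : s.reg a ≠ 0
      · rw [if_pos ha] at hr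
        rcases List.mem_cons.1 hr with rfl | hr
        · exact .inr fun _ _ _ hF => hF.while
        rcases List.mem_cons.1 hr with rfl | hr
        · exact .inr fun _ _ _ hF => hF
        · exact .inl hr
      · rw [if_neg ha] at hr; exact .inl hr

/-- All outputs of halting computations that start in `c` are good. The subroutine rule must not use
more than this: its continuation may be analysed only after the subroutine has halted. -/
def Safe (good : List (BitVec w) → Prop) (c : Config w) : Prop :=
  ∀ t, ∀ c' ∈ (runFrom c t).support, Halted c' → good c'.2.out

theorem Safe.step {good : List (BitVec w) → Prop} {c c' : Config w} (h : Safe good c)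
    (hc : c' ∈ (step c).support) : Safe good c' := fun t c'' h1 h2 =>
  h (t + 1) c'' (by rw [runFrom_succ, PMF.mem_support_bind_iff]; exact ⟨c', hc, h1⟩) h2

/-- The expected number of steps of a subroutine with handled outputs and of what follows. The
continuation takes expected time at most `B` after every good output. -/
theorem embed_time {f g : ℕ → ℕ} {h : ℕ → Program} {J : List (BitVec w) → State w → Prop}
    {T : ℝ≥0∞} (H : Handles f g h J T) (good : List (BitVec w) → Prop) (P₀ : Program)
    (S₀ : State w) (rest : List Program) (B : ℝ≥0∞) : ∀ (t : ℕ) (p : Program) (k : List Program)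
      (s S : State w), Embeds f g s S → J s.out S → Safe good (p :: k, s) →
      (∀ q ∈ p :: k, Within (q.embed f g h) P₀) → Frame P₀ S₀ S →
      (∀ out S', good out → J out S' → Frame P₀ S₀ S' → timeUpTo t (rest, S') ≤ B) →
      timeUpTo (t + 1) ((p :: k).map (·.embed f g h) ++ rest, S) ≤
        T * timeUpTo (t + 1) (p :: k, s) + B := by
  intro t
  induction t with
  | zero =>
    intro p k s S hE hJ hS hW hF hB
    by_cases hp : ∃ a, p = .emit a
    · obtain ⟨a, rfl⟩ := hp
      rw [timeUpTo_cons_pure (show step (Program.emit a :: k, s) = PMF.pure (k, _) from rfl)]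
      have := (H.triple s.out S a hJ).time (k.map (·.embed f g h) ++ rest) 0 0 (by simp [timeUpTo])
      simp only [timeUpTo, add_zero, mul_one]
      exact (this.trans (by simp)).trans (le_add_right le_rfl)
    · push Not at hp
      obtain ⟨μ, k', s', S', h1, h2, h3⟩ := embed_step H p hp k rest s S hE hJ
      rw [List.map_cons, List.cons_append, timeUpTo, timeUpTo, h1, h2]
      simp only [timeUpTo, PMF.expect_const, add_zero, mul_one]
      exact H.one_le.trans (le_add_right le_rfl)
  | succ t ih =>
    intro p k s S hE hJ hS hW hF hB
    -- The induction hypothesis does not apply to a subroutine that has just halted; the bound for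
    -- the continuation does.
    have key : ∀ (k' : List Program) (s' S' : State w), Embeds f g s' S' → J s'.out S' →
        Safe good (k', s') → (∀ q ∈ k', Within (q.embed f g h) P₀) → Frame P₀ S₀ S' →
        timeUpTo (t + 1) (k'.map (·.embed f g h) ++ rest, S') ≤
          T * timeUpTo (t + 1) (k', s') + B := by
      intro k' s' S' hE' hJ' hS' hW' hF'
      cases k' with
      | nil =>
        have := hB s'.out S' (hS' 0 _ ((PMF.mem_support_pure_iff _ _).2 rfl) rfl) hJ' hF'
        exact this.trans (le_add_left le_rfl)
      | cons p' k' =>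
        exact ih p' k' s' S' hE' hJ' hS' hW' hF' fun out S'' h1 h2 h3 =>
          (timeUpTo_mono t _).trans (hB out S'' h1 h2 h3)
    by_cases hp : ∃ a, p = .emit a
    · obtain ⟨a, rfl⟩ := hp
      have hstep : step (Program.emit a :: k, s) = PMF.pure (k, s.emit (s.reg a)) := rfl
      rw [timeUpTo_cons_pure hstep]
      have h1 := (H.triple s.out S a hJ).time (k.map (·.embed f g h) ++ rest) (t + 1)
        (T * timeUpTo (t + 1) (k, s.emit (s.reg a)) + B) (by
          intro S' h2 h3
          refine key k _ S' ⟨fun r => ?_, fun b => ?_⟩ ?_ (hS.step ?_)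
            (fun q hq => hW q (List.mem_cons_of_mem _ hq))
            (hF.trans (hW (.emit a) (by simp) _ _ h3))
          · rw [h3.reg _ (H.reg a r)]; exact hE.reg r
          · rw [h3.mem _ (H.mem a b)]; exact hE.mem b
          · rw [hE.reg] at h2; exact h2
          · rw [hstep]; simp)
      refine h1.trans (le_of_eq ?_)
      ring
    · push Not at hp
      obtain ⟨μ, k', s', S', h1, h2, h3⟩ := embed_step H p hp k rest s S hE hJ
      rw [List.map_cons, List.cons_append, timeUpTo, timeUpTo, h1, h2, PMF.expect_map,
        PMF.expect_map, mul_add, mul_one, add_assoc]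
      refine add_le_add H.one_le ?_
      rw [← PMF.expect_const_mul, ← PMF.expect_const μ B, ← PMF.expect_add]
      refine PMF.expect_mono _ fun x hx => ?_
      obtain ⟨h4, h5, h6, h7⟩ := h3 x
      refine key _ _ _ h4 h5 (hS.step ?_) (fun q hq => ?_) (hF.trans (hW _ (by simp) _ _ h6))
      · rw [h1, PMF.mem_support_map_iff]; exact ⟨x, hx, rfl⟩
      · rcases h7 q hq with h8 | h8
        · exact hW q (List.mem_cons_of_mem _ h8)
        · exact fun _ _ _ h9 => hW p (by simp) _ _ (h8 _ _ h9)

/-- The probability to win with a subroutine and what follows is at least the probability that the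
subroutine halts, times a lower bound `x` for what follows after a good output. -/
theorem embed_win {f g : ℕ → ℕ} {h : ℕ → Program} {J : List (BitVec w) → State w → Prop}
    {T : ℝ≥0∞} (H : Handles f g h J T) (good good' : List (BitVec w) → Prop) (P₀ : Program)
    (S₀ : State w) (rest : List Program) (x : ℝ≥0∞)
    (hx : ∀ out S', good out → J out S' → Frame P₀ S₀ S' → x ≤ winProb good' (rest, S')) :
    ∀ (t : ℕ) (k : List Program) (s S : State w), Embeds f g s S → J s.out S → Safe good (k, s) →
      (∀ q ∈ k, Within (q.embed f g h) P₀) → Frame P₀ S₀ S →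
      winUpTo (fun _ => True) t (k, s) * x ≤
        winProb good' (k.map (·.embed f g h) ++ rest, S) := by
  intro t
  induction t with
  | zero =>
    intro k s S hE hJ hS hW hF
    cases k with
    | nil =>
      simpa [winUpTo] using hx s.out S (hS 0 _ ((PMF.mem_support_pure_iff _ _).2 rfl) rfl) hJ hF
    | cons p k => simp [winUpTo]
  | succ t ih =>
    intro k s S hE hJ hS hW hF
    cases k with
    | nil =>
      simpa [winUpTo] using hx s.out S (hS 0 _ ((PMF.mem_support_pure_iff _ _).2 rfl) rfl) hJ hF
    | cons p k =>
      by_cases hp : ∃ a, p = .emit a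
      · obtain ⟨a, rfl⟩ := hp
        have hstep : step (Program.emit a :: k, s) = PMF.pure (k, s.emit (s.reg a)) := rfl
        rw [winUpTo, hstep, PMF.expect_pure]
        refine (H.triple s.out S a hJ).win good' (k.map (·.embed f g h) ++ rest) _ ?_
        intro S' h2 h3
        refine ih k _ S' ⟨fun r => ?_, fun b => ?_⟩ ?_ (hS.step ?_)
          (fun q hq => hW q (List.mem_cons_of_mem _ hq)) (hF.trans (hW (.emit a) (by simp) _ _ h3))
        · rw [h3.reg _ (H.reg a r)]; exact hE.reg r
        · rw [h3.mem _ (H.mem a b)]; exact hE.mem b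
        · rw [hE.reg] at h2; exact h2
        · rw [hstep]; simp
      · push Not at hp
        obtain ⟨μ, k', s', S', h1, h2, h3⟩ := embed_step H p hp k rest s S hE hJ
        rw [List.map_cons, List.cons_append, winProb_cons, winUpTo, h1, h2, PMF.expect_map,
          PMF.expect_map, mul_comm, ← PMF.expect_const_mul]
        refine PMF.expect_mono _ fun y hy => ?_
        obtain ⟨h4, h5, h6, h7⟩ := h3 y
        rw [mul_comm]
        refine ih _ _ _ h4 h5 (hS.step ?_) (fun q hq => ?_) (hF.trans (hW _ (by simp) _ _ h6))
        · rw [h1, PMF.mem_support_map_iff]; exact ⟨y, hy, rfl⟩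
        · rcases h7 q hq with h8 | h8
          · exact hW q (List.mem_cons_of_mem _ h8)
          · exact fun _ _ _ h9 => hW p (by simp) _ _ (h8 _ _ h9)

/-- A program that halts almost surely does so within `t` steps with a probability that tends to
one. -/
theorem HaltsWith.iSup_winUpTo {P : Program} {s : State w} {good : List (BitVec w) → Prop}
    (h : HaltsWith P s good) : ⨆ t, winUpTo (fun _ => True) t ([P], s) = 1 := by
  apply le_antisymm
  · refine iSup_le fun t => ?_
    classical
    rw [winUpTo_eq, ← PMF.expect_indicator]
    exact PMF.expect_le _ fun c _ => by split_ifs <;> simp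
  · have h1 : ∀ t, 1 ≤ (⨆ t, winUpTo (fun _ => True) t ([P], s)) + probRunning P s t := by
      intro t
      rw [← expect_halted_add_running (runFrom ([P], s) t), probRunning, run_eq_runFrom]
      gcongr
      refine le_trans (le_of_eq ?_) (le_iSup _ t)
      rw [winUpTo_eq]; simp
    calc (1 : ℝ≥0∞) ≤ ⨅ t, ((⨆ t, winUpTo (fun _ => True) t ([P], s)) + probRunning P s t) :=
          le_iInf h1
      _ = _ := by rw [← ENNReal.add_iInf, h.1, add_zero]

theorem HaltsWith.safe {P : Program} {s : State w} {good : List (BitVec w) → Prop}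
    (h : HaltsWith P s good) : Safe good ([P], s) := fun t c hc hH =>
  h.2 t c (by rwa [run_eq_runFrom]) hH

/-- The subroutine rule: a correct program with handled outputs halts almost surely, with a good
list of outputs received, and takes at most `T` times as long as on its own. -/
theorem Triple.embed {f g : ℕ → ℕ} {h : ℕ → Program} {J : List (BitVec w) → State w → Prop}
    {T : ℝ≥0∞} (H : Handles f g h J T) {P : Program} {s S : State w}
    {good : List (BitVec w) → Prop} (hP : HaltsWith P s good) (hE : Embeds f g s S)
    (hJ : J s.out S) :
    Triple (P.embed f g h) S (T * expectedTime P s) (fun S' => ∃ out, good out ∧ J out S') := by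
  constructor
  · intro k t B hB
    have := embed_time H good (P.embed f g h) S k B t P [] s S hE hJ hP.safe
      (by simp [Within]) Frame.rfl (fun out S' h1 h2 h3 => hB S' ⟨out, h1, h2⟩ h3)
    refine this.trans ?_
    gcongr
    rw [expectedTime_eq]
    exact le_iSup (fun t => timeUpTo t ([P], s)) (t + 1)
  · intro good' k x hx
    have := fun t => embed_win H good good' (P.embed f g h) S k x
      (fun out S' h1 h2 h3 => hx S' ⟨out, h1, h2⟩ h3) t [P] s S hE hJ hP.safe
      (by simp [Within]) Frame.rfl
    calc x = (⨆ t, winUpTo (fun _ => True) t ([P], s)) * x := by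
          rw [HaltsWith.iSup_winUpTo hP, one_mul]
      _ = ⨆ t, winUpTo (fun _ => True) t ([P], s) * x := by rw [ENNReal.iSup_mul]
      _ ≤ _ := iSup_le this

theorem writesReg_embed {f g : ℕ → ℕ} {h : ℕ → Program} {r : ℕ} (hf : ∀ i, f i ≠ r)
    (hh : ∀ a, (h (f a)).writesReg r = false) (P : Program) :
    (P.embed f g h).writesReg r = false := by
  induction P with
  | emit a => exact hh a
  | _ => simp_all [Program.embed, Program.writesReg]

theorem writesMem_embed {f g : ℕ → ℕ} {h : ℕ → Program} {b : ℕ} (hg : ∀ i, g i ≠ b)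
    (hh : ∀ a, (h (f a)).writesMem b = false) (P : Program) :
    (P.embed f g h).writesMem b = false := by
  induction P with
  | emit a => exact hh a
  | _ => simp_all [Program.embed, Program.writesMem]

theorem emits_embed {f g : ℕ → ℕ} {h : ℕ → Program}
    (hh : ∀ a, (h (f a)).emits = false) (P : Program) :
    (P.embed f g h).emits = false := by
  induction P with
  | emit a => exact hh a
  | _ => simp_all [Program.embed, Program.emits]

end WordRAM

/-! ### Consequences of triples -/

namespace WordRAM

variable {w : ℕ}

/-- The rule for sequential composition with bounds that are natural numbers. -/
theorem Triple.seq_nat {p q : Program} {s : State w} (T T' : ℕ)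
    {Post Post' : State w → Prop} (h : Triple p s T Post)
    (h' : ∀ s', Post s' → Frame p s s' → Triple q s' T' Post') :
    Triple (.seq p q) s ((1 + T + T' : ℕ) : ℝ≥0∞) Post' :=
  (h.seq h').mono (by push_cast; exact le_rfl) fun _ h _ => h

/-- The rule for counting loops whose iterations have a common bound that is a natural number. -/
theorem Triple.forDown_nat {c e : ℕ} {body : Program} (N : ℕ) (T : ℕ) (s₀ : State w)
    (Inv : ℕ → State w → Prop) (hN : N < 2 ^ w)
    (hc : body.writesReg c = false) (he : body.writesReg e = false) (hce : c ≠ e)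
    (hrc : s₀.reg c = BitVec.ofNat w N) (hre : s₀.reg e = BitVec.ofNat w 1)
    (h0 : Inv N s₀) (hInv : ∀ j s x, Inv j s → Inv j (s.setReg c x))
    (hstep : ∀ j < N, ∀ s, s.reg c = BitVec.ofNat w j → Inv (j + 1) s →
      Frame (WordRAM.forDown c e body) s₀ s → Triple body s T (Inv j)) :
    Triple (WordRAM.forDown c e body) s₀ ((1 + N * (3 + T) : ℕ) : ℝ≥0∞) (Inv 0) :=
  (Triple.forDown N s₀ Inv (fun _ => T) hN hc he hce hrc hre h0 hInv hstep).mono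
    (by simp [mul_add]) fun _ h _ => h

theorem Triple.emit (s : State w) (a : ℕ) :
    Triple (.emit a) s (1 : ℕ) (fun s' => s' = s.emit (s.reg a)) :=
  (Triple.of_step (p := .emit a) (s' := s.emit (s.reg a)) (fun _ => rfl)
    ⟨fun _ _ => rfl, fun _ _ => rfl, fun h => by simp [Program.emits] at h⟩).mono
    (by simp) fun _ h _ => h

theorem Triple.haltsWith {P : Program} {s : State w} {T : ℝ≥0∞} {Post : State w → Prop}
    (h : Triple P s T Post) {good : List (BitVec w) → Prop} (hg : ∀ s', Post s' → good s'.out) :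
    HaltsWith P s good :=
  haltsWith_of_winProb (h.win good [] 1 fun s' hs' _ => by
    rw [winProb_halted, if_pos (hg s' hs')])

theorem Triple.expectedTime_le {P : Program} {s : State w} {T : ℝ≥0∞} {Post : State w → Prop}
    (h : Triple P s T Post) : expectedTime P s ≤ T := by
  rw [expectedTime_eq]
  refine iSup_le fun t => (timeUpTo_mono t _).trans ?_
  simpa using h.time [] t 0 fun s' _ _ => by rw [timeUpTo_halted]

/-! ### Exhaustive search for XOR triples -/

/-- The table that marks the elements of `X`; its addresses are the words themselves. -/
def marks (X : List (BitVec w)) : BitVec w → BitVec w :=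
  fun z => BitVec.ofNat w (if z ∈ X then 1 else 0)

/-- The flag `v` is `0` or `1`, and it is `1` only if there is a triple. -/
def FlagSound (X : List (BitVec w)) (v : BitVec w) : Prop :=
  v = 0#w ∨ v = 1#w ∧ HasXORTriple X

theorem FlagSound.or {X : List (BitVec w)} {v v' : BitVec w} (h : FlagSound X v)
    (h' : FlagSound X v') : FlagSound X (v ||| v') := by
  rcases h with rfl | ⟨rfl, h⟩ <;> rcases h' with rfl | ⟨rfl, h'⟩ <;> simp [FlagSound, *]

theorem FlagSound.or_eq_one_left {X : List (BitVec w)} {v v' : BitVec w} (h : v = 1#w)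
    (h' : FlagSound X v') : v ||| v' = 1#w := by
  rcases h' with rfl | ⟨rfl, h'⟩ <;> simp [h]

theorem FlagSound.or_eq_one_right {X : List (BitVec w)} {v v' : BitVec w} (h : FlagSound X v)
    (h' : v' = 1#w) : v ||| v' = 1#w := by
  rcases h with rfl | ⟨rfl, h⟩ <;> simp [h']

theorem flagSound_marks {X : List (BitVec w)} {x y : BitVec w} (hx : x ∈ X) (hy : y ∈ X) :
    FlagSound X (marks X (x ^^^ y)) := by
  unfold marks FlagSound
  by_cases h : x ^^^ y ∈ X
  · rw [if_pos h]; exact .inr ⟨rfl, x, hx, y, hy, _, h, rfl⟩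
  · rw [if_neg h]; exact .inl rfl

theorem arrayOf_map_toNat (X : List (BitVec w)) {i : ℕ} (hi : i < 2 ^ w) :
    arrayOf w (X.map BitVec.toNat) (BitVec.ofNat w i) = X.getD i 0 := by
  simp only [arrayOf, BitVec.toNat_ofNat, Nat.mod_eq_of_lt hi, List.getD_eq_getElem?_getD,
    List.getElem?_map]
  cases X[i]? <;> simp

theorem getD_mem {α : Type*} {X : List α} {i : ℕ} (hi : i < X.length) (d : α) :
    X.getD i d ∈ X := by
  rw [List.getD_eq_getElem _ _ hi]; exact List.getElem_mem hi

/-- The memory holds `X` and its length. -/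
structure Holds (X : List (BitVec w)) (s : State w) : Prop where
  len : s.reg 0 = BitVec.ofNat w X.length
  one : s.reg 1 = BitVec.ofNat w 1
  arr : s.mem 0 = arrayOf w (X.map BitVec.toNat)

theorem Holds.load {X : List (BitVec w)} {s : State w} (h : Holds X s) {i : ℕ} (hi : i < 2 ^ w) :
    s.mem 0 (BitVec.ofNat w i) = X.getD i 0 := by
  rw [h.arr, arrayOf_map_toNat X hi]

theorem Holds.frame {X : List (BitVec w)} {s s' : State w} (h : Holds X s) {p : Program}
    (hF : Frame p s s') (h0 : p.writesReg 0 = false) (h1 : p.writesReg 1 = false)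
    (hm : p.writesMem 0 = false) : Holds X s' :=
  ⟨(hF.reg 0 h0).trans h.len, (hF.reg 1 h1).trans h.one, (hF.mem 0 hm).trans h.arr⟩

/-- Mark the elements of the list in bank `0` in bank `1`. -/
def markLoop : Program :=
  .seq (.op .or 20 0 0) (forDown 20 1 (block [.load 21 0 20, .store 1 21 1]))

theorem markLoop_triple (X : List (BitVec w)) (hX : X.length < 2 ^ w) (s : State w)
    (h : Holds X s) (hm : s.mem 1 = fun _ => 0#w) :
    Triple markLoop s ((6 * X.length + 3 : ℕ) : ℝ≥0∞) (fun s' => s'.mem 1 = marks X) := by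
  refine (Triple.seq_nat 1 (1 + X.length * (3 + 3)) (Post := fun s' => s' = s.setReg 20 (s.reg 0))
    (Triple.straight 1 rfl le_rfl (by simp [BinOp.eval])) ?_).mono
    (by exact_mod_cast (by omega)) (fun _ h _ => h)
  rintro _ rfl -
  have key := Triple.forDown_nat (c := 20) (e := 1) (body := block [.load 21 0 20, .store 1 21 1])
    X.length 3 (s.setReg 20 (s.reg 0)) (fun j s => s.mem 1 = marks (X.drop j)) hX rfl rfl (by simp)
    (by simp [h.len]) (by simp [h.one]) ?_ (fun j s x h => h) ?_
  · simpa using key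
  · simp only [setReg_mem, hm, List.drop_length]; funext z; simp [marks]
  · intro j hj s' hj' hs' hF
    have h' : Holds X s' := (h.frame (p := .const 20 0) (s' := s.setReg 20 (s.reg 0))
      (frame_setReg (by simp [Program.writesReg])) rfl rfl rfl).frame hF rfl rfl rfl
    refine Triple.straight 3 rfl le_rfl ?_
    simp only [block, Program.exec, setMem_mem, setReg_reg, hj', setReg_mem,
      h'.load (show j < 2 ^ w by omega)]
    simp only [hs', h'.one]
    funext z
    simp only [if_true, Function.update_apply, marks, List.drop_eq_getElem_cons hj,
      List.mem_cons, List.getD_eq_getElem _ _ hj]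
    by_cases hz : z = X[j] <;> simp [hz]

/-- Raise the flag in register `2` if `X` contains an element and its sum with register `30`. -/
def scan : Program :=
  .seq (.op .or 21 0 0) (forDown 21 1
    (block [.load 31 0 21, .op .xor 31 31 30, .load 31 1 31, .op .or 2 2 31]))

theorem scan_triple (X : List (BitVec w)) (hX : X.length < 2 ^ w) (s : State w)
    (h : Holds X s) (hm : s.mem 1 = marks X) (hz : s.reg 30 ∈ X) (hf : FlagSound X (s.reg 2)) :
    Triple scan s ((10 * X.length + 3 : ℕ) : ℝ≥0∞) (fun s' => FlagSound X (s'.reg 2) ∧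
      (s.reg 2 = 1#w → s'.reg 2 = 1#w) ∧
      ∀ x ∈ X, x ^^^ s.reg 30 ∈ X → s'.reg 2 = 1#w) := by
  refine (Triple.seq_nat 1 (1 + X.length * (3 + 7)) (Post := fun s' => s' = s.setReg 21 (s.reg 0))
    (Triple.straight 1 rfl le_rfl (by simp [BinOp.eval])) ?_).mono
    (by exact_mod_cast (by omega)) (fun _ h _ => h)
  rintro _ rfl -
  have key := Triple.forDown_nat (c := 21) (e := 1)
    (body := block [.load 31 0 21, .op .xor 31 31 30, .load 31 1 31, .op .or 2 2 31])
    X.length 7 (s.setReg 21 (s.reg 0)) (fun j s' => FlagSound X (s'.reg 2) ∧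
      (s.reg 2 = 1#w → s'.reg 2 = 1#w) ∧
      ∀ i < X.length, j ≤ i → X.getD i 0 ^^^ s.reg 30 ∈ X → s'.reg 2 = 1#w) hX rfl rfl (by simp)
    (by simp [h.len]) (by simp [h.one]) ?_ (fun j s x h => by simpa using h) ?_
  · refine key.mono le_rfl ?_
    rintro s' ⟨h1, h2, h3⟩ -
    refine ⟨h1, h2, fun x hx hx' => ?_⟩
    obtain ⟨i, hi, rfl⟩ := List.getElem_of_mem hx
    exact h3 i hi (Nat.zero_le _) (by rwa [List.getD_eq_getElem _ _ hi])
  · refine ⟨by simpa using hf, by simp, fun i h1 h2 => absurd h1 (by omega)⟩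
  · rintro j hj s' hj' ⟨h1, h2, h3⟩ hF
    have h' : Holds X s' := (h.frame (p := .const 21 0) (s' := s.setReg 21 (s.reg 0))
      (frame_setReg (by simp [Program.writesReg])) rfl rfl rfl).frame hF rfl rfl rfl
    have hm' : s'.mem 1 = marks X := by rw [hF.mem 1 rfl]; exact hm
    have h30 : s'.reg 30 = s.reg 30 := by rw [hF.reg 30 rfl]; simp
    refine Triple.straight 7 rfl le_rfl ?_
    have hs := flagSound_marks (getD_mem hj 0) hz
    simp only [block, Program.exec, setReg_reg, hj', setReg_mem, BinOp.eval, hm', h30,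
      h'.load (show j < 2 ^ w by omega)]
    refine ⟨by simpa using h1.or hs, fun h4 => by simpa using hs.or_eq_one_left (h2 h4), ?_⟩
    intro i hi hij hiX
    rcases hij.eq_or_lt with rfl | hij
    · have h7 : marks X (X.getD j 0 ^^^ s.reg 30) = 1#w := by rw [marks, if_pos hiX]
      simpa using h1.or_eq_one_right h7
    · simpa using hs.or_eq_one_left (h3 i hi hij hiX)

/-- Exhaustive search for a triple. -/
def bruteForce : Program :=
  block [.const 1 1, markLoop, .op .or 22 0 0, forDown 22 1 (.seq (.load 30 0 22) scan), .emit 2]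

theorem flag_eq_of_hasXORTriple {X : List (BitVec w)} {v : BitVec w} (h : FlagSound X v)
    (h' : HasXORTriple X → v = 1#w) [Decidable (HasXORTriple X)] :
    v = BitVec.ofNat w (if HasXORTriple X then 1 else 0) := by
  by_cases hX : HasXORTriple X
  · rw [if_pos hX, h' hX]
  · rw [if_neg hX]
    rcases h with h | ⟨_, h⟩
    · exact h
    · exact absurd h hX

theorem bruteForce_triple (X : List (BitVec w)) (hX : X.length < 2 ^ w) (s : State w)
    (h0 : s.reg 0 = BitVec.ofNat w X.length) (hf : s.reg 2 = 0#w)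
    (ha : s.mem 0 = arrayOf w (X.map BitVec.toNat)) (hm : s.mem 1 = fun _ => 0#w)
    (ho : s.out = []) [Decidable (HasXORTriple X)] :
    Triple bruteForce s ((30 * X.length ^ 2 + 30 * X.length + 30 : ℕ) : ℝ≥0∞)
      (fun s' => s'.out = [BitVec.ofNat w (if HasXORTriple X then 1 else 0)]) := by
  set n := X.length with hn
  suffices H : Triple bruteForce s ((1 + 1 + (1 + (6 * n + 3) + (1 + 1 +
      (1 + (1 + n * (3 + (1 + 1 + (10 * n + 3)))) + 1))) : ℕ) : ℝ≥0∞)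
      (fun s' => s'.out = [BitVec.ofNat w (if HasXORTriple X then 1 else 0)]) by
    refine H.mono ?_ fun _ h _ => h
    rw [Nat.cast_le]; nlinarith
  refine Triple.seq_nat 1 _ (Post := fun s' => s' = s.setReg 1 1#w)
    (Triple.straight 1 rfl le_rfl rfl) ?_
  rintro _ rfl -
  have hH : Holds X (s.setReg 1 1#w) := ⟨by simp [h0, hn], by simp, ha⟩
  refine Triple.seq_nat (6 * n + 3) _ (markLoop_triple X hX _ hH hm) ?_
  intro s1 hs1 hF1
  have hH1 := hH.frame hF1 rfl rfl rfl
  have hf1 : s1.reg 2 = 0#w := by rw [hF1.reg 2 rfl]; simp [hf]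
  have ho1 : s1.out = [] := by rw [hF1.out rfl]; exact ho
  refine Triple.seq_nat 1 _ (Post := fun s' => s' = s1.setReg 22 (s1.reg 0))
    (Triple.straight 1 rfl le_rfl (by simp [BinOp.eval])) ?_
  rintro _ rfl -
  -- The outer loop: register 22 runs through the positions of the second summand.
  refine Triple.seq_nat (1 + n * (3 + (1 + 1 + (10 * n + 3)))) 1 (Triple.forDown_nat (c := 22)
    (e := 1) n _ _ (fun j s => FlagSound X (s.reg 2) ∧ ∀ i < n, j ≤ i → ∀ x ∈ X,
      x ^^^ X.getD i 0 ∈ X → s.reg 2 = 1#w) hX rfl rfl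
    (by simp) (by simp [hH1.len, hn]) (by simp [hH1.one]) ?_ (fun j s x h => by simpa using h)
    ?_) ?_
  · refine ⟨by simp [hf1, FlagSound], fun i h1 h2 => absurd h1 (by omega)⟩
  · rintro j hj s2 hj2 ⟨h1, h2⟩ hF2
    have hH2 : Holds X s2 := (hH1.frame (p := .const 22 0) (s' := s1.setReg 22 (s1.reg 0))
      (frame_setReg (by simp [Program.writesReg])) rfl rfl rfl).frame hF2 rfl rfl rfl
    have hm2 : s2.mem 1 = marks X := by rw [hF2.mem 1 rfl]; exact hs1
    refine Triple.seq_nat 1 _ (Post := fun s' => s' = s2.setReg 30 (X.getD j 0))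
      (Triple.straight 1 rfl le_rfl (by
        simp only [Program.exec, hj2, hH2.load (show j < 2 ^ w by omega)])) ?_
    rintro _ rfl -
    have hH3 : Holds X (s2.setReg 30 (X.getD j 0)) :=
      ⟨by simp [hH2.len], by simp [hH2.one], hH2.arr⟩
    refine (scan_triple X hX _ hH3 hm2 (by simpa using getD_mem hj 0) (by simpa using h1)).mono
      le_rfl ?_
    rintro s4 ⟨h4, h5, h6⟩ -
    refine ⟨h4, fun i hi hij x hx hxX => ?_⟩
    rcases hij.eq_or_lt with rfl | hij
    · exact h6 x hx (by simpa using hxX)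
    · exact h5 (by simpa using h2 i hi hij x hx hxX)
  · rintro s2 ⟨h1, h2⟩ hF2
    refine (Triple.emit s2 2).mono le_rfl ?_
    rintro _ rfl -
    have ho2 : s2.out = [] := by rw [hF2.out rfl]; exact ho1
    rw [State.emit, ho2, flag_eq_of_hasXORTriple h1]
    · rfl
    · rintro ⟨a, ha, b, hb, c, hc, rfl⟩
      obtain ⟨i, hi, rfl⟩ := List.getElem_of_mem hb
      exact h2 i hi (Nat.zero_le _) a ha (by rwa [List.getD_eq_getElem _ _ hi])

end WordRAM

/-! ### Programs that do not read their whole input -/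

namespace WordRAM

variable {w : ℕ}

/-- A single step depends on at most one cell of a memory bank. -/
theorem step_setMem (b : ℕ) (c c' : Config w) (h : c' ∈ (step c).support) :
    ∃ y : BitVec w, ∀ z ≠ y, ∀ v,
      (c'.1, c'.2.setMem b z v) ∈ (step (c.1, c.2.setMem b z v)).support := by
  obtain ⟨k, s⟩ := c
  have triv : ∀ (k' : List Program) (F : State w → State w),
      (∀ s, step (k, s) = PMF.pure (k', F s)) →
      (∀ z v, F (s.setMem b z v) = (F s).setMem b z v) →
      ∃ y : BitVec w, ∀ z ≠ y, ∀ v,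
      (c'.1, c'.2.setMem b z v) ∈ (step (k, s.setMem b z v)).support := by
    intro k' F h1 h2
    refine ⟨0, fun z _ v => ?_⟩
    rw [h1, PMF.support_pure, Set.mem_singleton_iff] at h
    subst h
    rw [h1, h2]; simp
  cases k with
  | nil => exact triv [] id (fun _ => rfl) fun _ _ => rfl
  | cons p k =>
    cases p with
    | skip => exact triv k id (fun _ => rfl) fun _ _ => rfl
    | const d a => exact triv k (fun s => s.setReg d _) (fun _ => rfl) fun _ _ => rfl
    | not d a => exact triv k (fun s => s.setReg d (~~~ (s.reg a))) (fun _ => rfl) fun _ _ => rfl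
    | op o d a e =>
      exact triv k (fun s => s.setReg d (o.eval (s.reg a) (s.reg e))) (fun _ => rfl) fun _ _ => rfl
    | load d m a =>
      refine ⟨s.reg a, fun z hz v => ?_⟩
      rw [step, PMF.support_pure, Set.mem_singleton_iff] at h
      subst h
      rw [step, PMF.support_pure, Set.mem_singleton_iff]
      have : (s.setMem b z v).mem m ((s.setMem b z v).reg a) = s.mem m (s.reg a) := by
        rw [setMem_mem, setMem_reg]
        split_ifs with hm
        · rw [Function.update_of_ne hz.symm, hm]
        · rfl
      rw [this]; rfl
    | store m a e =>
      refine ⟨s.reg a, fun z hz v => ?_⟩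
      rw [step, PMF.support_pure, Set.mem_singleton_iff] at h
      subst h
      rw [step, PMF.support_pure, Set.mem_singleton_iff]
      simp only [Prod.mk.injEq, true_and, setMem_reg]
      by_cases hm : m = b
      · subst hm
        simp only [State.setMem, Function.update_self, Function.update_idem]
        rw [Function.update_comm hz]
      · simp only [State.setMem]
        rw [Function.update_of_ne hm, Function.update_of_ne (Ne.symm hm), Function.update_comm hm]
    | rand d a =>
      refine ⟨0, fun z _ v => ?_⟩
      rw [step, PMF.mem_support_map_iff] at h ⊢
      obtain ⟨x, hx, rfl⟩ := h
      exact ⟨x, hx, rfl⟩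
    | emit a => exact triv k (fun s => s.emit (s.reg a)) (fun _ => rfl) fun _ _ => rfl
    | seq p q => exact triv (p :: q :: k) id (fun _ => rfl) fun _ _ => rfl
    | ite a p q =>
      refine ⟨0, fun z _ v => ?_⟩
      rw [step, PMF.support_pure, Set.mem_singleton_iff] at h ⊢
      subst h; rfl
    -- the remaining constructor is `while`
    | _ a p =>
      refine ⟨0, fun z _ v => ?_⟩
      rw [step, PMF.support_pure, Set.mem_singleton_iff] at h ⊢
      subst h
      rw [setMem_reg]

/-- A computation of `t` steps depends on at most `t` cells of a memory bank. -/
theorem runFrom_setMem (b : ℕ) (c : Config w) (t : ℕ) : ∀ c' ∈ (runFrom c t).support,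
    ∃ F : Finset (BitVec w), F.card ≤ t ∧ ∀ z ∉ F, ∀ v,
      (c'.1, c'.2.setMem b z v) ∈ (runFrom (c.1, c.2.setMem b z v) t).support := by
  induction t with
  | zero =>
    intro c' hc'
    rw [runFrom, PMF.support_pure, Set.mem_singleton_iff] at hc'
    subst hc'
    exact ⟨∅, by simp, fun z _ v => by simp [runFrom]⟩
  | succ t ih =>
    intro c' hc'
    rw [runFrom, PMF.mem_support_bind_iff] at hc'
    obtain ⟨c'', h1, h2⟩ := hc'
    obtain ⟨F, hF, h3⟩ := ih c'' h1
    obtain ⟨y, h4⟩ := step_setMem b c'' c' h2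
    classical
    refine ⟨insert y F, (Finset.card_insert_le _ _).trans (by omega), fun z hz v => ?_⟩
    rw [Finset.mem_insert, not_or] at hz
    rw [runFrom, PMF.mem_support_bind_iff]
    exact ⟨_, h3 z hz.2 v, h4 z hz.1 v⟩

/-- If every output changes when any one of the first `N` cells of a bank is modified, then the
program has to read all these cells: a computation of fewer steps, together with its output, is also
possible on some modified memory, where this output is wrong. -/
theorem le_expectedTime_of_sensitive {P : Program} {s : State w} {b N : ℕ} (hN : N ≤ 2 ^ w)
    {good : List (BitVec w) → Prop} (h : HaltsWith P s good)
    (h' : ∀ z < N, ∃ v, ∃ good' : List (BitVec w) → Prop,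
      HaltsWith P (s.setMem b (BitVec.ofNat w z) v) good' ∧ ∀ out, good out → ¬ good' out) :
    (N : ℝ≥0∞) ≤ expectedTime P s := by
  have hrun : ∀ t < N, probRunning P s t = 1 := by
    intro t ht
    have h1 : (run P s t).support ⊆ {c | ¬ Halted c} := by
      intro c hc hH
      obtain ⟨F, hF, h2⟩ := runFrom_setMem b ([P], s) t c (by rwa [← run_eq_runFrom])
      have h3 : ∃ z ∈ (Finset.range N).image (BitVec.ofNat w), z ∉ F := by
        refine Finset.exists_mem_notMem_of_card_lt_card ?_
        rw [Finset.card_image_of_injOn, Finset.card_range]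
        · omega
        · intro i hi j hj hij
          have := congrArg BitVec.toNat hij
          simp only [Finset.coe_range, Set.mem_Iio] at hi hj
          simpa [Nat.mod_eq_of_lt (hi.trans_le hN), Nat.mod_eq_of_lt (hj.trans_le hN)] using this
      obtain ⟨z, hz, hzF⟩ := h3
      obtain ⟨i, hi, rfl⟩ := Finset.mem_image.1 hz
      obtain ⟨v, good', h4, h5⟩ := h' i (Finset.mem_range.1 hi)
      refine h5 c.2.out (h.2 t c hc hH) (h4.2 t (c.1, c.2.setMem b (BitVec.ofNat w i) v) ?_ hH)
      rw [run_eq_runFrom]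
      exact h2 _ hzF v
    rw [probRunning, PMF.toOuterMeasure_apply_eq_one_iff]
    exact h1
  calc (N : ℝ≥0∞) = ∑ t ∈ Finset.range N, probRunning P s t := by
        rw [Finset.sum_congr rfl fun t ht => hrun t (Finset.mem_range.1 ht)]; simp
    _ ≤ _ := ENNReal.sum_le_tsum _

end WordRAM

/-! ### Families of sets of equal size -/

/-- A family of `a` lists of length `m` each. -/
def grid (a m : ℕ) (F : ℕ → ℕ → ℕ) : List (List ℕ) :=
  (List.range a).map fun i => (List.range m).map (F i)

@[simp] theorem length_grid (a m : ℕ) (F : ℕ → ℕ → ℕ) : (grid a m F).length = a := by simp [grid]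

theorem grid_succ (a m : ℕ) (F : ℕ → ℕ → ℕ) :
    grid (a + 1) m F = grid a m F ++ [(List.range m).map (F a)] := by
  simp [grid, List.range_succ]

theorem flatten_grid (a m : ℕ) (F : ℕ → ℕ → ℕ) :
    (grid a m F).flatten = (List.range (a * m)).map fun z => F (z / m) (z % m) := by
  induction a with
  | zero => simp [grid]
  | succ a ih =>
    rw [grid_succ, List.flatten_append, ih, Nat.succ_mul, List.range_add, List.map_append]
    simp only [List.flatten_singleton, List.map_map, List.append_cancel_left_eq]
    refine List.map_congr_left fun p hp => ?_
    have hp := List.mem_range.1 hp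
    have hm : 0 < m := by omega
    simp [Function.comp, Nat.add_div hm, Nat.mod_eq_of_lt hp, Nat.div_eq_of_lt hp, not_le.2 hp,
      Nat.mul_comm a m, Nat.mul_div_cancel_left _ hm]

theorem take_grid {a i : ℕ} (hi : i ≤ a) (m : ℕ) (F : ℕ → ℕ → ℕ) :
    (grid a m F).take i = grid i m F := by
  simp [grid, ← List.map_take, List.take_range, Nat.min_eq_left hi]

theorem offsets_grid (a m : ℕ) (F : ℕ → ℕ → ℕ) :
    offsets (grid a m F) = (List.range (a + 1)).map (· * m) := by
  rw [offsets, length_grid]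
  refine List.map_congr_left fun i hi => ?_
  rw [take_grid (Nat.lt_succ_iff.1 (List.mem_range.1 hi)), flatten_grid]; simp

theorem getD_grid {a i : ℕ} (hi : i < a) (m : ℕ) (F : ℕ → ℕ → ℕ) :
    (grid a m F).getD i [] = (List.range m).map (F i) := by
  rw [List.getD_eq_getElem _ _ (by simpa using hi)]; simp [grid]

theorem mem_grid {a m : ℕ} {F : ℕ → ℕ → ℕ} {S : List ℕ} :
    S ∈ grid a m F ↔ ∃ i < a, S = (List.range m).map (F i) := by
  simp [grid, eq_comm]

theorem arrayOf_map_range (w N : ℕ) (G : ℕ → ℕ) (x : BitVec w) :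
    arrayOf w ((List.range N).map G) x = if x.toNat < N then BitVec.ofNat w (G x.toNat) else 0 := by
  unfold arrayOf
  by_cases h : x.toNat < N
  · rw [if_pos h, List.getD_eq_getElem _ _ (by simpa using h)]; simp
  · rw [if_neg h, List.getD_eq_default _ _ (by simpa using h)]; rfl

/-! ### Instances on which the whole input has to be read -/

/-- All queries ask for disjoint sets `{0, …, m - 1}` and `{m}`, except that the element number `z`
of the first family (if there is one) is replaced by `m`. All answers are empty if `z = none`, and
some answer is not if this element belongs to a queried set. -/
def probeInstance (C a q m : ℕ) (z : Option ℕ) : SetIntersectionInstance where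
  c := C
  A := grid a m fun i p => if z = some (i * m + p) then m else p
  B := grid a 1 fun _ _ => m
  Q := (List.range q).map fun t => (t, t)

section

variable {C a q m : ℕ} {z : Option ℕ}

theorem probeInstance_left {t : ℕ} (ht : t < q) (hqa : q ≤ a) :
    (probeInstance C a q m z).left t =
      (List.range m).map fun p => if z = some (t * m + p) then m else p := by
  have : (probeInstance C a q m z).Q.getD t (0, 0) = (t, t) := by
    rw [List.getD_eq_getElem _ _ (by simpa [probeInstance] using ht)]; simp [probeInstance]
  rw [SetIntersectionInstance.left, this]
  exact getD_grid (by omega) _ _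

theorem probeInstance_right {t : ℕ} (ht : t < q) (hqa : q ≤ a) :
    (probeInstance C a q m z).right t = [m] := by
  have : (probeInstance C a q m z).Q.getD t (0, 0) = (t, t) := by
    rw [List.getD_eq_getElem _ _ (by simpa [probeInstance] using ht)]; simp [probeInstance]
  rw [SetIntersectionInstance.right, this]
  exact (getD_grid (by omega) _ _).trans (by simp)

theorem probeInstance_answers_none (hqa : q ≤ a) :
    (probeInstance C a q m none).answers = ∅ := by
  rw [Finset.eq_empty_iff_forall_notMem]
  rintro ⟨t, x⟩ h
  simp only [answers, Finset.mem_filter, Finset.mem_product, Finset.mem_range] at h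
  obtain ⟨⟨h1, -⟩, h2, h3⟩ := h
  have h1 : t < q := by simpa [probeInstance] using h1
  rw [probeInstance_left h1 hqa] at h2
  rw [probeInstance_right h1 hqa] at h3
  simp at h2 h3
  omega

theorem probeInstance_answers_some (hqa : q ≤ a) (hC : m < C) {i : ℕ} (hi : i < q * m) :
    (probeInstance C a q m (some i)).answers ≠ ∅ := by
  have hm : 0 < m := Nat.pos_of_ne_zero (by rintro rfl; simp at hi)
  have ht : i / m < q := Nat.div_lt_of_lt_mul (by rwa [Nat.mul_comm])
  refine Finset.ne_empty_of_mem (a := (i / m, m)) ?_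
  simp only [answers, Finset.mem_filter, Finset.mem_product, Finset.mem_range]
  refine ⟨⟨by simpa [probeInstance] using ht, hC⟩, ?_, ?_⟩
  · rw [probeInstance_left ht hqa, List.mem_map]
    exact ⟨i % m, by simpa using Nat.mod_lt _ hm, by simp [Nat.div_add_mod']⟩
  · rw [probeInstance_right ht hqa]; simp

/-- The instances have the required sizes, whichever element is replaced. -/
theorem probeInstance_allowed {γ δ K : ℝ} {n w : ℕ} (hqa : q ≤ a) (hC : m < C)
    (hCw : C < 2 ^ w) (haw : a < 2 ^ w) (hamw : a * m < 2 ^ w)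
    (h1 : (n : ℝ) ^ (1 + δ - γ) / K ≤ C) (h2 : (C : ℝ) ≤ K * (n : ℝ) ^ (1 + δ - γ))
    (h3 : √((n : ℝ) ^ (1 + δ + γ)) / K ≤ a) (h4 : (a : ℝ) ≤ K * √((n : ℝ) ^ (1 + δ + γ)))
    (hm : 1 ≤ m) (h5 : (m : ℝ) ≤ K * (n : ℝ) ^ (1 - γ))
    (h6 : (n : ℝ) ^ (1 + γ) / K ≤ q) (h7 : (q : ℝ) ≤ K * (n : ℝ) ^ (1 + γ)) :
    (probeInstance C a q m z).Allowed γ δ K n w := by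
  refine ⟨⟨?_, ?_⟩, ⟨hCw, ?_, ?_, ?_, ?_, ?_⟩, ⟨h1, h2⟩, ?_, ⟨?_, ?_⟩, ?_, ?_, ?_⟩
  · intro S hS
    rcases List.mem_append.1 hS with hS | hS
    · obtain ⟨i, hi, rfl⟩ := mem_grid.1 hS
      refine ⟨List.Nodup.map_on ?_ List.nodup_range, ?_⟩
      · intro x hx y hy hxy
        rw [List.mem_range] at hx hy
        split_ifs at hxy with h8 h9 h9
        · rw [h8, Option.some.injEq] at h9; omega
        · omega
        · omega
        · exact hxy
      · intro x hx
        obtain ⟨p, hp, rfl⟩ := List.mem_map.1 hx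
        rw [List.mem_range] at hp
        dsimp only [probeInstance]
        split_ifs <;> omega
    · obtain ⟨i, hi, rfl⟩ := mem_grid.1 hS
      simpa [probeInstance] using hC
  · simp [probeInstance]; intro t ht; omega
  · simpa [probeInstance] using haw
  · simpa [probeInstance] using haw
  · simp [probeInstance]; omega
  · simpa [probeInstance, flatten_grid] using hamw
  · simpa [probeInstance, flatten_grid] using haw
  · simp [probeInstance]
  · simpa [probeInstance] using h3
  · simpa [probeInstance] using h4
  · intro S hS
    rcases List.mem_append.1 hS with hS | hS
    · obtain ⟨i, hi, rfl⟩ := mem_grid.1 hS; simpa using h5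
    · obtain ⟨i, hi, rfl⟩ := mem_grid.1 hS
      refine le_trans ?_ h5
      simpa using hm
  · simpa [probeInstance] using h6
  · simpa [probeInstance] using h7

/-- Replacing an element means modifying one memory cell of the input. -/
theorem probeInstance_input (w : ℕ) {i : ℕ} (hi : i < a * m) (haw : a * m < 2 ^ w) :
    (probeInstance C a q m (some i)).input w =
      ((probeInstance C a q m none).input w).setMem 1 (BitVec.ofNat w i) (BitVec.ofNat w m) := by
  simp only [SetIntersectionInstance.input, initState, State.setMem, State.mk.injEq]
  refine ⟨by simp [probeInstance], ?_, trivial⟩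
  funext b
  by_cases hb : b = 1
  · subst hb
    rw [Function.update_self]
    funext x
    simp only [probeInstance, flatten_grid, Function.update_apply]
    simp only [List.getD_cons_succ, List.getD_cons_zero, arrayOf_map_range, Nat.div_add_mod',
      Option.some.injEq]
    by_cases hx : x = BitVec.ofNat w i
    · subst hx
      simp [Nat.mod_eq_of_lt (hi.trans haw), hi]
    · have : i ≠ x.toNat := by
        rintro rfl; exact hx (by simp)
      simp [hx, this]
  · rw [Function.update_of_ne hb]
    rcases b with _ | _ | b
    · simp [probeInstance, offsets_grid]
    · exact absurd rfl hb
    · simp [probeInstance]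

/-- A correct program reads all elements of all queried sets of the first family, since any one of
them may turn an empty output into a nonempty one. -/
theorem probeInstance_time {W : ℕ → Set ℕ} {γ δ K : ℝ} {P : Program}
    (hP : SolvesSetIntersection W γ δ K P) {n w : ℕ} (hw : w ∈ W n) (hqa : q ≤ a) (hC : m < C)
    (hamw : a * m < 2 ^ w)
    (hall : ∀ z, (probeInstance C a q m z).Allowed γ δ K n w) :
    ((q * m : ℕ) : ℝ≥0∞) ≤ expectedTime P ((probeInstance C a q m none).input w) := by
  have hqm : q * m ≤ a * m := Nat.mul_le_mul_right _ hqa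
  refine le_expectedTime_of_sensitive (b := 1) (by omega) (hP n w hw _ (hall none)) ?_
  intro i hi
  refine ⟨BitVec.ofNat w m, (probeInstance C a q m (some i)).CorrectOutput w, ?_, ?_⟩
  · rw [← probeInstance_input w (by omega) hamw]
    exact hP n w hw _ (hall _)
  · rintro out ⟨L, -, h1, rfl⟩ ⟨L', -, h2, h3⟩
    rw [probeInstance_answers_none hqa, List.toFinset_eq_empty_iff] at h1
    subst h1
    cases L' with
    | nil => exact probeInstance_answers_some hqa hC hi h2.symm
    | cons p L' => simp at h3

end

/-! ### Word lengths -/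

/-- The numbers that describe the instances fit into a word, even with an additional constant
factor: the exponent `κ` of the word length is strictly larger than theirs. -/
theorem AdmissibleWordLengths.rpow_lt {γ δ : ℝ} {W : ℕ → Set ℕ} (h : AdmissibleWordLengths γ δ W)
    {e : ℝ} (he : e ≤ 1 + δ - γ ∨ e ≤ 1 + γ ∨ e ≤ (3 + δ - γ) / 2) (M : ℝ) :
    ∀ᶠ n : ℕ in atTop, ∀ w ∈ W n, M * (n : ℝ) ^ e < 2 ^ w := by
  obtain ⟨-, ⟨κ, h1, h2, h3, h4⟩, -⟩ := h
  have hκ : 0 < κ - e := by rcases he with he | he | he <;> linarith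
  have h5 : ∀ᶠ n : ℕ in atTop, M < (n : ℝ) ^ (κ - e) :=
    ((tendsto_rpow_atTop hκ).comp tendsto_natCast_atTop_atTop).eventually_gt_atTop M
  filter_upwards [h4, h5, eventually_ge_atTop 1] with n h6 h7 h8 w hw
  have hn : (0 : ℝ) < n := by exact_mod_cast h8
  calc M * (n : ℝ) ^ e < (n : ℝ) ^ (κ - e) * (n : ℝ) ^ e := by
        have := Real.rpow_pos_of_pos hn e
        gcongr
    _ = (n : ℝ) ^ κ := by rw [← Real.rpow_add hn]; ring_nf
    _ = (2 : ℝ) ^ (κ * Real.logb 2 n) := by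
        rw [mul_comm, Real.rpow_mul (by norm_num), Real.rpow_logb (by norm_num) (by norm_num) hn]
    _ ≤ (2 : ℝ) ^ (w : ℝ) := Real.rpow_le_rpow_of_exponent_le (by norm_num) (h6 w hw)
    _ = 2 ^ w := Real.rpow_natCast _ _

theorem div_two_le_floor {x : ℝ} (hx : 1 ≤ x) : x / 2 ≤ ⌊x⌋₊ := by
  have h1 := Nat.lt_floor_add_one x
  have h2 : (1 : ℝ) ≤ ⌊x⌋₊ := by exact_mod_cast (Nat.one_le_floor_iff x).2 hx
  linarith

/-- If the sets of the queries contain more than `n²` elements altogether, then it takes time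
`Ω(n²)` to read them. -/
theorem exists_slow_instance {γ δ K : ℝ} (hγ₁ : γ < 1) (hδ : 0 < δ) (hγδ : 1 + γ ≤ δ)
    (hγ₀ : 0 ≤ γ)
    (hK : 4 ≤ K) {W : ℕ → Set ℕ} (hW : AdmissibleWordLengths γ δ W) {P : Program}
    (hP : SolvesSetIntersection W γ δ K P) :
    ∀ᶠ n : ℕ in atTop, ∀ w ∈ W n, ∃ I : SetIntersectionInstance, I.Allowed γ δ K n w ∧
      I.outputSize = 0 ∧ ENNReal.ofReal ((n : ℝ) ^ 2 / 4) ≤ expectedTime P (I.input w) := by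
  filter_upwards [hW.rpow_lt (e := 1 + δ - γ) (.inl le_rfl) 3,
    hW.rpow_lt (e := (3 + δ - γ) / 2) (.inr (.inr le_rfl)) 1, eventually_ge_atTop 1]
    with n h1 h2 hn w hw
  have hn1 : (1 : ℝ) ≤ n := by exact_mod_cast hn
  have hn0 : (0 : ℝ) < n := by linarith
  have hone : ∀ e : ℝ, 0 ≤ e → 1 ≤ (n : ℝ) ^ e := fun e he => Real.one_le_rpow hn1 he
  set xC := (n : ℝ) ^ (1 + δ - γ) with hxC
  set xa := √((n : ℝ) ^ (1 + δ + γ)) with hxa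
  set xm := (n : ℝ) ^ (1 - γ) with hxm
  set xq := (n : ℝ) ^ (1 + γ) with hxq
  have hC1 : 1 ≤ xC := hone _ (by linarith)
  have hm1 : 1 ≤ xm := hone _ (by linarith)
  have hq1 : 1 ≤ xq := hone _ (by linarith)
  have hxa' : xa = (n : ℝ) ^ ((1 + δ + γ) / 2) := by
    rw [hxa, Real.sqrt_eq_rpow, ← Real.rpow_mul hn0.le]; ring_nf
  have hqa : xq ≤ xa := by
    rw [hxa']; exact Real.rpow_le_rpow_of_exponent_le hn1 (by linarith)
  have hmC : xm ≤ xC := Real.rpow_le_rpow_of_exponent_le hn1 (by linarith)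
  have ha1 : 1 ≤ xa := hq1.trans hqa
  have hfC := Nat.lt_floor_add_one xC
  have hfC' := Nat.floor_le (zero_le_one.trans hC1)
  have hfa := div_two_le_floor ha1
  have hfa' := Nat.floor_le (zero_le_one.trans ha1)
  have hfm := div_two_le_floor hm1
  have hfm' := Nat.floor_le (zero_le_one.trans hm1)
  have hfq := div_two_le_floor hq1
  have hfq' := Nat.floor_le (zero_le_one.trans hq1)
  have hqa' : ⌊xq⌋₊ ≤ ⌊xa⌋₊ := Nat.floor_mono hqa
  have hm1' : 1 ≤ ⌊xm⌋₊ := (Nat.one_le_floor_iff _).2 hm1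
  have hmC' : ⌊xm⌋₊ < ⌊xC⌋₊ + 1 := Nat.lt_succ_of_le (Nat.floor_mono hmC)
  have hdiv : ∀ x : ℝ, 0 ≤ x → x / K ≤ x / 2 := fun x hx =>
    div_le_div_of_nonneg_left hx (by norm_num) (by linarith)
  have hmul : ∀ x : ℝ, 1 ≤ x → 4 * x ≤ K * x := fun x hx => by gcongr
  -- This is the total size of a family, the reason for the third condition on the word length.
  have ham : xa * xm = (n : ℝ) ^ ((3 + δ - γ) / 2) := by
    rw [hxa', hxm, ← Real.rpow_add hn0]; ring_nf
  have hamw : ⌊xa⌋₊ * ⌊xm⌋₊ < 2 ^ w := by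
    have : ((⌊xa⌋₊ * ⌊xm⌋₊ : ℕ) : ℝ) < 2 ^ w := by
      push_cast
      calc (⌊xa⌋₊ : ℝ) * ⌊xm⌋₊ ≤ xa * xm := by gcongr
        _ < 2 ^ w := by rw [ham]; simpa using h2 w hw
    exact_mod_cast this
  have hCw : ⌊xC⌋₊ + 1 < 2 ^ w := by
    have : ((⌊xC⌋₊ + 1 : ℕ) : ℝ) < 2 ^ w := by push_cast; linarith [h1 w hw]
    exact_mod_cast this
  have hall : ∀ z, (probeInstance (⌊xC⌋₊ + 1) ⌊xa⌋₊ ⌊xq⌋₊ ⌊xm⌋₊ z).Allowed γ δ K n w := by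
    intro z
    refine probeInstance_allowed hqa' hmC' hCw ?_ hamw ?_ ?_ ?_ ?_ hm1' ?_ ?_ ?_
    · nlinarith
    · push_cast; linarith [hdiv xC (by linarith)]
    · push_cast; linarith [hmul xC hC1]
    · linarith [hdiv xa (by linarith)]
    · linarith [hmul xa ha1]
    · linarith [hmul xm hm1]
    · linarith [hdiv xq (by linarith)]
    · linarith [hmul xq hq1]
  refine ⟨_, hall none, ?_, le_trans ?_ (probeInstance_time hP hw hqa' hmC' hamw hall)⟩
  · rw [outputSize, probeInstance_answers_none hqa', Finset.card_empty]
  · rw [← ENNReal.ofReal_natCast]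
    refine ENNReal.ofReal_le_ofReal ?_
    have : xq * xm = (n : ℝ) ^ 2 := by
      rw [hxq, hxm, ← Real.rpow_add hn0, ← Real.rpow_natCast]; norm_num
    rw [← this]
    push_cast
    calc xq * xm / 4 = (xq / 2) * (xm / 2) := by ring
      _ ≤ _ := by gcongr

theorem bruteForce_input {w : ℕ} (X : List (BitVec w)) (hX : X.length < 2 ^ w)
    [Decidable (HasXORTriple X)] :
    Triple bruteForce (threeXORInput X) ((30 * X.length ^ 2 + 30 * X.length + 30 : ℕ) : ℝ≥0∞)
      (fun s' => s'.out = [BitVec.ofNat w (if HasXORTriple X then 1 else 0)]) := by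
  refine bruteForce_triple X hX _ ?_ ?_ ?_ ?_ ?_
  · simp [threeXORInput, initState]
  · simp [threeXORInput, initState]
  · simp [threeXORInput, initState]
  · funext z; simp [threeXORInput, initState, arrayOf]
  · rfl

theorem bruteForce_solves {W : ℕ → Set ℕ} (hW : ∀ n, ∀ w ∈ W n, n < 2 ^ w) :
    SolvesThreeXOR W bruteForce := by
  classical
  rintro n w hw X - rfl
  have := (bruteForce_input X (hW _ w hw)).haltsWith (good := fun out =>
    out = [BitVec.ofNat w (if HasXORTriple X then 1 else 0)]) fun _ h => h
  convert this

/-- The theorem for parameters for which the sets have more than `n²` elements altogether: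
exhaustive search shows that the hypothesis claims at most a bound `O(n²)`, and reading the sets
takes time `Ω(n²)`. -/
theorem setIntersectionRequires_of_large {γ δ K : ℝ} (hγ₀ : 0 ≤ γ) (hγ₁ : γ < 1) (hδ : 0 < δ)
    (hγδ : 1 + γ ≤ δ) (hK : 4 ≤ K) {W : ℕ → Set ℕ} (hW : AdmissibleWordLengths γ δ W)
    {g : ℕ → ℝ} (hg : ∀ᶠ n in atTop, 0 < g n) (h : ThreeXORRequires W g) :
    SetIntersectionRequires W γ δ K g := by
  intro P hP
  obtain ⟨c, hc, h1⟩ := h bruteForce (bruteForce_solves hW.1)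
  -- `n ^ 2 / 4` compares with the time `30 * n ^ 2 + 30 * n + 30 ≤ 90 * n ^ 2` of the search.
  refine ⟨c / 360, by positivity, ?_⟩
  filter_upwards [h1, hg, exists_slow_instance hγ₁ hδ hγδ hγ₀ hK hW hP, eventually_ge_atTop 1]
    with n ⟨w, hw, X, _, hXn, h2⟩ h3 h4 hn
  obtain ⟨I, h5, h6, h7⟩ := h4 w hw
  refine ⟨w, hw, PMF.pure I, ?_, ?_, ?_⟩
  · intro I' hI'
    rw [PMF.support_pure, Set.mem_singleton_iff] at hI'
    rwa [hI']
  · change (PMF.pure I).expect _ ≤ _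
    rw [PMF.expect_pure, h6]; simp
  · change _ ≤ (PMF.pure I).expect _
    rw [PMF.expect_pure]
    refine le_trans (ENNReal.ofReal_le_ofReal ?_) h7
    classical
    have h8 := h2.trans (bruteForce_input X (by rw [hXn]; exact hW.1 n w hw)).expectedTime_le
    rw [hXn, ← ENNReal.ofReal_natCast, ENNReal.ofReal_le_ofReal_iff (by positivity)] at h8
    push_cast at h8
    have hn1 : (1 : ℝ) ≤ n := by exact_mod_cast hn
    nlinarith

namespace WordRAM

/-! ### The parity of a word -/

/-- The base-`B` number all of whose `J` digits are one. -/
def repunit (B J : ℕ) : ℕ := ∑ j ∈ Finset.range J, B ^ j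

theorem repunit_add (B i j : ℕ) : repunit B (i + j) = repunit B i + B ^ i * repunit B j := by
  simp only [repunit, Finset.sum_range_add, Finset.mul_sum, pow_add]

theorem pred_mul_repunit_add_one {B : ℕ} (hB : 1 ≤ B) (J : ℕ) :
    (B - 1) * repunit B J + 1 = B ^ J := by
  induction J with
  | zero => simp [repunit]
  | succ J ih =>
    rw [repunit_add]
    simp only [repunit, Finset.sum_range_one, pow_zero, mul_one] at ih ⊢
    rw [mul_add, add_right_comm, ih, pow_succ]
    obtain ⟨C, rfl⟩ := Nat.exists_eq_add_of_le' hB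
    simp; ring

/-- Masking with a repunit extracts one bit from each block. -/
theorem land_repunit (b : ℕ) (hb : 0 < b) (J : ℕ) : ∀ y : ℕ,
    y &&& repunit (2 ^ b) J =
      ∑ j ∈ Finset.range J, (y.testBit (j * b)).toNat * (2 ^ b) ^ j := by
  induction J with
  | zero => intro y; simp [repunit]
  | succ J ih =>
    intro y
    have hB : 1 < 2 ^ b := Nat.one_lt_two_pow hb.ne'
    have h1 : repunit (2 ^ b) (J + 1) = 2 ^ b * repunit (2 ^ b) J + 1 := by
      rw [add_comm, repunit_add]; simp [repunit, add_comm]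
    rw [← Nat.div_add_mod (y &&& repunit (2 ^ b) (J + 1)) (2 ^ b), Nat.and_div_two_pow,
      Nat.and_mod_two_pow, h1, Nat.mul_add_div (by positivity), Nat.mul_add_mod,
      Nat.div_eq_of_lt hB, Nat.mod_eq_of_lt hB, add_zero, ih, Finset.sum_range_succ']
    rw [Finset.mul_sum]
    congr 1
    · refine Finset.sum_congr rfl fun j _ => ?_
      rw [Nat.testBit_div_two_pow, pow_succ]
      have : j * b + b = (j + 1) * b := by ring
      rw [this]; ring
    · rw [Nat.and_one_is_mod, Nat.mod_mod_of_dvd _ (dvd_pow_self 2 hb.ne')]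
      simp [Nat.testBit_zero]
      rcases Nat.mod_two_eq_zero_or_one y with h | h <;> simp [h]

/-- Multiplication with a repunit adds up the digits: the sum is found in position `J - 1`. The sums
in lower positions do not produce carries, and everything above contributes an even number. -/
theorem mul_repunit_div {B J : ℕ} (hB : 2 ∣ B) (hB0 : B ≠ 0) (hJ : J ≤ B) (hJ0 : 0 < J)
    (β : ℕ → ℕ) (hβ : ∀ j, β j ≤ 1) :
    ((∑ j ∈ Finset.range J, β j * B ^ j) * repunit B J / B ^ (J - 1)) % 2 =
      (∑ j ∈ Finset.range J, β j) % 2 := by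
  have hB2 : 2 ≤ B := Nat.le_of_dvd (Nat.pos_of_ne_zero hB0) hB
  obtain ⟨N, rfl⟩ := Nat.exists_eq_add_of_le' hJ0
  have hterm : ∀ j ∈ Finset.range (N + 1), B ^ j * repunit B (N + 1) =
      B ^ j * repunit B (N - j) + B ^ N + B ^ (N + 1) * repunit B j := by
    intro j hj
    have hj : j ≤ N := Nat.lt_succ_iff.1 (Finset.mem_range.1 hj)
    have h1 : N + 1 = (N - j) + 1 + j := by omega
    conv_lhs => rw [h1, repunit_add, repunit_add]
    have h2 : B ^ N = B ^ j * B ^ (N - j) := by rw [← pow_add]; congr 1; omega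
    rw [pow_succ B N, h2]
    simp only [repunit, Finset.sum_range_one, pow_zero, pow_succ B (N - j)]
    ring
  have hsum : (∑ j ∈ Finset.range (N + 1), β j * B ^ j) * repunit B (N + 1) =
      (∑ j ∈ Finset.range (N + 1), β j * (B ^ j * repunit B (N - j))) +
      B ^ N * ((∑ j ∈ Finset.range (N + 1), β j) +
        B * ∑ j ∈ Finset.range (N + 1), β j * repunit B j) := by
    rw [Finset.sum_mul]
    rw [Finset.sum_congr rfl fun j hj => by rw [mul_assoc, hterm j hj]]
    simp only [mul_add, Finset.sum_add_distrib, Finset.mul_sum]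
    rw [add_assoc]
    congr 1
    congr 1
    · exact Finset.sum_congr rfl fun j _ => by ring
    · exact Finset.sum_congr rfl fun j _ => by rw [pow_succ]; ring
  have hlow : ∑ j ∈ Finset.range (N + 1), β j * (B ^ j * repunit B (N - j)) < B ^ N := by
    have h1 : (B - 1) * ∑ j ∈ Finset.range (N + 1), β j * (B ^ j * repunit B (N - j)) ≤
        (B - 1) * (B ^ N - 1) := by
      calc _ = ∑ j ∈ Finset.range (N + 1), (B - 1) * (β j * (B ^ j * repunit B (N - j))) :=
            Finset.mul_sum _ _ _
        _ ≤ ∑ j ∈ Finset.range (N + 1), (if j < N then B ^ N - 1 else 0) := by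
          refine Finset.sum_le_sum fun j hj => ?_
          have hj : j ≤ N := Nat.lt_succ_iff.1 (Finset.mem_range.1 hj)
          split_ifs with hjN
          · have h2 := pred_mul_repunit_add_one (show 1 ≤ B by omega) (N - j)
            have h3 : B ^ j * B ^ (N - j) = B ^ N := by rw [← pow_add]; congr 1; omega
            have h4 : 1 ≤ B ^ j := Nat.one_le_pow _ _ (by omega)
            calc (B - 1) * (β j * (B ^ j * repunit B (N - j)))
                ≤ (B - 1) * (1 * (B ^ j * repunit B (N - j))) := by gcongr; exact hβ j
              _ = B ^ j * ((B - 1) * repunit B (N - j)) := by ring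
              _ ≤ B ^ N - 1 := by
                  have : B ^ j * ((B - 1) * repunit B (N - j)) + B ^ j = B ^ N := by
                    rw [← h3, ← h2]; ring
                  omega
          · have : N - j = 0 := by omega
            simp [this, repunit]
        _ = N * (B ^ N - 1) := by
          rw [Finset.sum_range_succ, if_neg (lt_irrefl N), add_zero,
            Finset.sum_congr rfl fun j hj => if_pos (Finset.mem_range.1 hj)]
          simp
        _ ≤ _ := Nat.mul_le_mul_right _ (by omega)
    have h2 := Nat.le_of_mul_le_mul_left h1 (by omega)
    have h3 : 1 ≤ B ^ N := Nat.one_le_pow _ _ (by omega)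
    omega
  rw [hsum, Nat.add_sub_cancel, Nat.add_mul_div_left _ _ (by positivity), Nat.div_eq_of_lt hlow,
    zero_add, Nat.add_mod, Nat.mod_eq_zero_of_dvd (hB.mul_right _)]
  simp

/-- A bit as an element of the field with two elements. -/
def bitZ (b : Bool) : ZMod 2 := if b then 1 else 0

theorem bitZ_xor (a b : Bool) : bitZ (a ^^ b) = bitZ a + bitZ b := by
  cases a <;> cases b <;> decide

variable {w : ℕ}

/-- The sum of `t` consecutive bits of `x`, starting with bit `i`. -/
def blockSum (x : BitVec w) (i t : ℕ) : ZMod 2 :=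
  ∑ j ∈ Finset.range t, bitZ (x.getLsbD (i + j))

/-- The sum of all bits of a word. -/
def parity (x : BitVec w) : ZMod 2 := blockSum x 0 w

theorem blockSum_add (x : BitVec w) (i t t' : ℕ) :
    blockSum x i (t + t') = blockSum x i t + blockSum x (i + t) t' := by
  simp only [blockSum, Finset.sum_range_add, add_assoc]

theorem blockSum_of_le {t : ℕ} (h : w ≤ t) (x : BitVec w) : blockSum x 0 t = parity x := by
  obtain ⟨d, rfl⟩ := Nat.exists_eq_add_of_le h
  rw [blockSum_add, parity, add_eq_left, blockSum]
  refine Finset.sum_eq_zero fun j _ => ?_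
  rw [BitVec.getLsbD_of_ge _ _ (by omega)]; rfl

theorem parity_xor (x y : BitVec w) : parity (x ^^^ y) = parity x + parity y := by
  simp only [parity, blockSum, BitVec.getLsbD_xor, bitZ_xor, Finset.sum_add_distrib]

/-- The parity as a word. -/
def parityWord (x : BitVec w) : BitVec w := BitVec.ofNat w (parity x).val

theorem bitZ_fold (x : BitVec w) (u i : ℕ) :
    bitZ ((x ^^^ (x >>> u)).getLsbD i) = bitZ (x.getLsbD i) + bitZ (x.getLsbD (u + i)) := by
  rw [BitVec.getLsbD_xor, bitZ_xor, BitVec.getLsbD_ushiftRight]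

/-- Folding a word at position `u` adds up blocks of length `u` in pairs. -/
theorem blockSum_fold (x : BitVec w) (u i : ℕ) :
    blockSum (x ^^^ (x >>> u)) i u = blockSum x i (u + u) := by
  simp only [blockSum, bitZ_fold, Finset.sum_add_distrib, Finset.sum_range_add]
  congr 1
  exact Finset.sum_congr rfl fun j _ => by congr 2; ring

/-- Adding up adjacent blocks of bits, `i` times: bit `j` of the result is the sum of the `2 ^ i`
bits from `j` on (`bitZ_foldBits`). -/
def foldBits (x : BitVec w) : ℕ → BitVec w
  | 0 => x
  | i + 1 => foldBits x i ^^^ (foldBits x i >>> 2 ^ i)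

theorem bitZ_foldBits (x : BitVec w) (k i : ℕ) :
    bitZ ((foldBits x k).getLsbD i) = blockSum x i (2 ^ k) := by
  induction k generalizing i with
  | zero => simp [foldBits, blockSum]
  | succ k ih => rw [foldBits, bitZ_fold, ih, ih, pow_succ, mul_two, blockSum_add, add_comm i]

theorem blockSum_mul (x : BitVec w) (b J : ℕ) :
    blockSum x 0 (J * b) = ∑ j ∈ Finset.range J, blockSum x (j * b) b := by
  induction J with
  | zero => simp [blockSum]
  | succ J ih => rw [Nat.succ_mul, blockSum_add, ih, Finset.sum_range_succ, zero_add]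

/-- The numbers used in the computation of parities: `2 ^ κ` is the length and `J` is the number of
blocks. Two times `J` blocks cover the word, and a block can hold the number `J`, so that adding up
`J` bits does not produce a carry into the next block. -/
structure ParityParams (w κ J : ℕ) : Prop where
  pos : 0 < J
  lt : J * 2 ^ κ < w
  le : w ≤ J * 2 ^ κ + J * 2 ^ κ
  digits : J ≤ 2 ^ 2 ^ κ

theorem bitZ_toNat (b : Bool) : ((b.toNat : ℕ) : ZMod 2) = bitZ b := by cases b <;> simp [bitZ]

/-- The computation of the parity by folding, masking and multiplication, with three operations per
folding and a bounded number of further ones. The first folding, by `J * 2 ^ κ`, is a fold of the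
whole word; the `κ` other ones add up the bits of each block in its lowest bit. -/
theorem parityWord_eq {κ J : ℕ} (h : ParityParams w κ J) (x : BitVec w) :
    (((foldBits (x ^^^ (x >>> (J * 2 ^ κ))) κ &&& BitVec.ofNat w (repunit (2 ^ 2 ^ κ) J)) *
      BitVec.ofNat w (repunit (2 ^ 2 ^ κ) J)) >>> (J * 2 ^ κ - 2 ^ κ)) &&& 1#w =
      parityWord x := by
  set b := 2 ^ κ with hb
  set u := J * b with hu
  have hb0 : 0 < b := by positivity
  set y := foldBits (x ^^^ (x >>> u)) κ with hy
  have hJpos := h.pos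
  have hw : u < w := h.lt
  have hub : u - b < w := by omega
  have hrep : repunit (2 ^ b) J < 2 ^ w := by
    have h1 := pred_mul_repunit_add_one (B := 2 ^ b) Nat.one_le_two_pow J
    have h2 : (2 ^ b) ^ J < 2 ^ w := by
      rw [← pow_mul, mul_comm]; exact Nat.pow_lt_pow_right (by norm_num) hw
    have h3 : 1 ≤ 2 ^ b - 1 := by
      have := Nat.one_lt_two_pow hb0.ne'; omega
    have h4 := Nat.mul_le_mul_right (repunit (2 ^ b) J) h3
    omega
  have hval : (parity x).val = (∑ j ∈ Finset.range J, (y.toNat.testBit (j * b)).toNat) % 2 := by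
    have h1 : parity x =
        ((∑ j ∈ Finset.range J, (y.toNat.testBit (j * b)).toNat : ℕ) : ZMod 2) := by
      push_cast
      simp only [bitZ_toNat, BitVec.testBit_toNat]
      rw [← blockSum_of_le h.le x, ← hb, ← hu, ← blockSum_fold, hu, blockSum_mul]
      exact Finset.sum_congr rfl fun j _ => (bitZ_foldBits _ _ _).symm
    rw [h1, ZMod.val_natCast]
  apply BitVec.eq_of_toNat_eq
  rw [parityWord, hval, BitVec.toNat_and, BitVec.toNat_ushiftRight, BitVec.toNat_mul,
    BitVec.toNat_and, BitVec.toNat_ofNat, Nat.mod_eq_of_lt hrep, land_repunit b hb0]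
  have hone : (1#w).toNat = 1 := by simp; omega
  have hBJ : (2 ^ b) ^ (J - 1) = 2 ^ (u - b) := by
    rw [← pow_mul]; congr 1; rw [hu, Nat.mul_sub, mul_one, mul_comm]
  rw [hone, Nat.and_one_is_mod, Nat.shiftRight_eq_div_pow, BitVec.toNat_ofNat]
  have hlt2 : ∀ a : ℕ, a % 2 < 2 ^ w := fun a =>
    (Nat.mod_lt _ (by norm_num)).trans_le (by
      calc 2 = 2 ^ 1 := rfl
        _ ≤ 2 ^ w := Nat.pow_le_pow_right (by norm_num) (by omega))
  rw [Nat.mod_eq_of_lt (hlt2 _)]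
  have hmod : ∀ a : ℕ, a % 2 ^ w / 2 ^ (u - b) % 2 = a / 2 ^ (u - b) % 2 := by
    intro a
    have := Nat.testBit_mod_two_pow a w (u - b)
    simp only [hub, decide_true, Bool.true_and, Nat.testBit_eq_decide_div_mod_eq] at this
    have h1 := Nat.mod_two_eq_zero_or_one (a % 2 ^ w / 2 ^ (u - b))
    have h2 := Nat.mod_two_eq_zero_or_one (a / 2 ^ (u - b))
    rcases h1 with h1 | h1 <;> rcases h2 with h2 | h2 <;> simp_all
  rw [hmod, ← hBJ]
  exact mul_repunit_div (dvd_pow_self 2 hb0.ne') (by positivity) h.digits h.pos _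
    fun j => by cases y.toNat.testBit (j * b) <;> simp

end WordRAM

namespace WordRAM

variable {w : ℕ}

/-! ### Arithmetic on words -/

theorem eval_shiftRight {k : ℕ} (hk : k < 2 ^ w) (x : BitVec w) :
    BinOp.shiftRight.eval x (BitVec.ofNat w k) = x >>> k := by
  simp only [BinOp.eval, BitVec.toNat_ofNat, Nat.mod_eq_of_lt hk]

theorem eval_shiftLeft {k : ℕ} (hk : k < 2 ^ w) (x : BitVec w) :
    BinOp.shiftLeft.eval x (BitVec.ofNat w k) = x <<< k := by
  simp only [BinOp.eval, BitVec.toNat_ofNat, Nat.mod_eq_of_lt hk]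

theorem eval_lt {a b : ℕ} (ha : a < 2 ^ w) (hb : b < 2 ^ w) :
    BinOp.lt.eval (BitVec.ofNat w a) (BitVec.ofNat w b) =
      BitVec.ofNat w (if a < b then 1 else 0) := by
  simp only [BinOp.eval, BitVec.toNat_ofNat, Nat.mod_eq_of_lt ha, Nat.mod_eq_of_lt hb]
  split_ifs <;> rfl

theorem eval_add (a b : ℕ) :
    BinOp.add.eval (BitVec.ofNat w a) (BitVec.ofNat w b) = BitVec.ofNat w (a + b) := by
  rw [BinOp.eval, BitVec.ofNat_add]

theorem eval_sub {a b : ℕ} (h : b ≤ a) :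
    BinOp.sub.eval (BitVec.ofNat w a) (BitVec.ofNat w b) = BitVec.ofNat w (a - b) := by
  obtain ⟨d, rfl⟩ := Nat.exists_eq_add_of_le' h
  rw [BinOp.eval, BitVec.ofNat_add, BitVec.add_sub_cancel, Nat.add_sub_cancel]

theorem ofNat_shiftLeft (a k : ℕ) : BitVec.ofNat w a <<< k = BitVec.ofNat w (a * 2 ^ k) := by
  apply BitVec.eq_of_toNat_eq
  simp [Nat.shiftLeft_eq]

theorem ofNat_shiftRight {a : ℕ} (ha : a < 2 ^ w) (k : ℕ) :
    BitVec.ofNat w a >>> k = BitVec.ofNat w (a / 2 ^ k) := by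
  apply BitVec.eq_of_toNat_eq
  rw [BitVec.toNat_ushiftRight, Nat.shiftRight_eq_div_pow, BitVec.toNat_ofNat,
    Nat.mod_eq_of_lt ha, BitVec.toNat_ofNat,
    Nat.mod_eq_of_lt ((Nat.div_le_self _ _).trans_lt ha)]

theorem ofNat_mask {a : ℕ} (ha : a < 2 ^ w) {k : ℕ} (hk : k ≤ w) :
    BitVec.ofNat w a &&& BitVec.ofNat w (2 ^ k - 1) = BitVec.ofNat w (a % 2 ^ k) := by
  apply BitVec.eq_of_toNat_eq
  have h1 : 2 ^ k ≤ 2 ^ w := Nat.pow_le_pow_right (by norm_num) hk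
  have h2 : 0 < 2 ^ k := by positivity
  rw [BitVec.toNat_and, BitVec.toNat_ofNat, BitVec.toNat_ofNat, BitVec.toNat_ofNat,
    Nat.mod_eq_of_lt ha, Nat.mod_eq_of_lt (by omega : 2 ^ k - 1 < 2 ^ w),
    Nat.and_two_pow_sub_one_eq_mod, Nat.mod_eq_of_lt ((Nat.mod_le _ _).trans_lt ha)]

theorem ofNat_ite_ne_zero (hw : 0 < w) (p : Prop) [Decidable p] :
    BitVec.ofNat w (if p then 1 else 0) ≠ 0 ↔ p := by
  have h1 : BitVec.ofNat w 1 ≠ 0#w := ofNat_ne_zero one_ne_zero (Nat.one_lt_two_pow hw.ne')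
  by_cases h : p <;> simp [h, h1]

/-! ### Computing parities -/

/-- Replaces the word in register `31` by its parity. The loop does the `κ` foldings by the powers
of two `reg 34` below the block length `reg 11`; the last line extracts the lowest bits of the
blocks and adds them up by a multiplication, as in `parityWord_eq`. -/
def parityCode : Program :=
  block [.op .shiftRight 33 31 10, .op .xor 31 31 33, .op .or 34 1 1, .op .lt 35 34 11,
    .while 35 (block [.op .shiftRight 33 31 34, .op .xor 31 31 33, .op .add 34 34 34,
      .op .lt 35 34 11]),
    block [.op .and 31 31 12, .op .mul 31 31 12, .op .shiftRight 31 31 13, .op .and 31 31 1]]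

/-- The registers hold the numbers that are needed for the computation of parities. -/
structure ParityReady (κ J : ℕ) (s : State w) : Prop where
  one : s.reg 1 = BitVec.ofNat w 1
  u : s.reg 10 = BitVec.ofNat w (J * 2 ^ κ)
  b : s.reg 11 = BitVec.ofNat w (2 ^ κ)
  m : s.reg 12 = BitVec.ofNat w (repunit (2 ^ 2 ^ κ) J)
  d : s.reg 13 = BitVec.ofNat w (J * 2 ^ κ - 2 ^ κ)

theorem ParityReady.congr {κ J : ℕ} {s s' : State w} (h : ParityReady κ J s)
    (hr : ∀ r ∈ [1, 10, 11, 12, 13], s'.reg r = s.reg r) : ParityReady κ J s' :=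
  ⟨(hr _ (by simp)).trans h.one, (hr _ (by simp)).trans h.u, (hr _ (by simp)).trans h.b,
    (hr _ (by simp)).trans h.m, (hr _ (by simp)).trans h.d⟩

theorem Triple.seq_straight {p q : Program} {s : State w} (T T' : ℕ) {Post : State w → Prop}
    (hp : p.straight = true) (hT : p.cost ≤ T) (h : Triple q (p.exec s) T' Post) :
    Triple (.seq p q) s ((1 + T + T' : ℕ) : ℝ≥0∞) Post :=
  Triple.seq_nat T T' (Triple.straight T hp hT (Post := fun s' => s' = p.exec s) rfl)
    (by rintro _ rfl -; exact h)

theorem Triple.while_nat {a : ℕ} {p : Program} (N T : ℕ) (s₀ : State w)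
    (Inv : ℕ → State w → Prop) (h0 : Inv N s₀)
    (hstep : ∀ j < N, ∀ s, Inv (j + 1) s → Frame (.while a p) s₀ s →
      s.reg a ≠ 0 ∧ Triple p s T (Inv j))
    (hend : ∀ s, Inv 0 s → Frame (.while a p) s₀ s → s.reg a = 0) :
    Triple (.while a p) s₀ ((1 + N * (1 + T) : ℕ) : ℝ≥0∞) (Inv 0) :=
  (Triple.while N s₀ Inv (fun _ => T) h0 hstep hend).mono (by simp [mul_add]) fun _ h _ => h

theorem two_pow_lt_two_pow_of_lt {κ J : ℕ} (h : ParityParams w κ J) : 2 ^ κ < 2 ^ w := by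
  have h1 := h.pos
  have h2 := h.lt
  have h3 : 2 ^ κ ≤ J * 2 ^ κ := Nat.le_mul_of_pos_left _ h1
  exact lt_trans (lt_of_le_of_lt h3 h2) Nat.lt_two_pow_self

theorem parityCode_triple {κ J : ℕ} (h : ParityParams w κ J) (s : State w)
    (hs : ParityReady κ J s) :
    Triple parityCode s ((8 * κ + 30 : ℕ) : ℝ≥0∞)
      (fun s' => s'.reg 31 = parityWord (s.reg 31)) := by
  have hκ := two_pow_lt_two_pow_of_lt h
  have hu : J * 2 ^ κ < 2 ^ w := h.lt.trans Nat.lt_two_pow_self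
  have hw : 0 < w := lt_of_le_of_lt (Nat.zero_le _) h.lt
  have h1w : 1 < 2 ^ w := Nat.one_lt_two_pow hw.ne'
  have hpow : ∀ i ≤ κ, 2 ^ i < 2 ^ w := fun i hi =>
    (Nat.pow_le_pow_right (by norm_num) hi).trans_lt hκ
  set x := s.reg 31 with hx
  set x1 := x ^^^ (x >>> (J * 2 ^ κ)) with hx1
  suffices H : Triple parityCode s ((1 + 1 + (1 + 1 + (1 + 1 + (1 + 1 +
      (1 + (1 + κ * (1 + 7)) + 7)))) : ℕ) : ℝ≥0∞) (fun s' => s'.reg 31 = parityWord x) from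
    H.mono (by rw [Nat.cast_le]; omega) fun _ h _ => h
  refine Triple.seq_straight 1 _ rfl le_rfl (Triple.seq_straight 1 _ rfl le_rfl
    (Triple.seq_straight 1 _ rfl le_rfl (Triple.seq_straight 1 _ rfl le_rfl ?_)))
  set s1 := Program.exec (.op .lt 35 34 11) (Program.exec (.op .or 34 1 1)
    (Program.exec (.op .xor 31 31 33) (Program.exec (.op .shiftRight 33 31 10) s))) with hs1
  have hready : ParityReady κ J s1 := hs.congr (by simp [hs1])
  refine Triple.seq_nat (1 + κ * (1 + 7)) 7 (Triple.while_nat κ 7 s1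
    (fun j s => j ≤ κ ∧ s.reg 31 = foldBits x1 (κ - j) ∧ s.reg 34 = BitVec.ofNat w (2 ^ (κ - j)) ∧
      s.reg 35 = BitVec.ofNat w (if 0 < j then 1 else 0)) ?_ ?_ ?_) ?_
  · refine ⟨le_rfl, ?_, ?_, ?_⟩
    · simp only [hs1, Program.exec, setReg_reg, hs.u, eval_shiftRight hu]
      simp [BinOp.eval, foldBits, hx1, hx]
    · simp [hs1, hs.one, BinOp.eval]
    · have := eval_lt (w := w) (a := 2 ^ 0) (b := 2 ^ κ) (by simpa using h1w) hκ
      simp only [hs1, Program.exec, setReg_reg, hs.b, hs.one]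
      simp only [BinOp.eval, BitVec.or_self] at this ⊢
      simp only [pow_zero] at this
      refine Eq.trans ?_ (this.trans ?_)
      · simp
      · congr 1
        by_cases hk : 0 < κ
        · rw [if_pos (Nat.one_lt_two_pow hk.ne'), if_pos hk]
        · obtain rfl : κ = 0 := by omega
          simp
  · rintro j hj s2 ⟨h1, h2, h3, h4⟩ hF
    have hready2 : ParityReady κ J s2 := hready.congr fun r hr => hF.reg r (by
      fin_cases hr <;> rfl)
    refine ⟨by rw [h4, ofNat_ite_ne_zero hw]; omega, ?_⟩
    refine Triple.straight 7 rfl le_rfl ⟨by omega, ?_, ?_, ?_⟩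
    · have e : κ - j = (κ - (j + 1)) + 1 := by omega
      simp +decide only [block, Program.exec, setReg_reg, ↓reduceIte, h2, h3,
        eval_shiftRight (hpow _ (Nat.sub_le _ _))]
      simp [BinOp.eval, e, foldBits]
    · have e : κ - j = (κ - (j + 1)) + 1 := by omega
      simp +decide only [block, Program.exec, setReg_reg, ↓reduceIte, h3, eval_add, e, pow_succ,
        mul_two]
    · have e : 2 ^ (κ - (j + 1)) + 2 ^ (κ - (j + 1)) = 2 ^ (κ - j) := by
        rw [← two_mul, ← pow_succ']; congr 1; omega
      simp +decide only [block, Program.exec, setReg_reg, ↓reduceIte, h3, eval_add, e, hready2.b]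
      rw [eval_lt (hpow _ (Nat.sub_le _ _)) hκ]
      congr 1
      have : 2 ^ (κ - j) < 2 ^ κ ↔ 0 < j := by
        rw [Nat.pow_lt_pow_iff_right (by norm_num)]; omega
      simp only [this]
  · rintro s2 ⟨-, -, -, h4⟩ -
    rw [h4]; simp
  · rintro s2 ⟨-, h2, -, -⟩ hF
    have hready2 : ParityReady κ J s2 := hready.congr fun r hr => hF.reg r (by
      fin_cases hr <;> rfl)
    have hd : J * 2 ^ κ - 2 ^ κ < 2 ^ w := (Nat.sub_le _ _).trans_lt hu
    refine Triple.straight 7 rfl le_rfl ?_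
    rw [← parityWord_eq h x]
    simp +decide only [block, Program.exec, setReg_reg, ↓reduceIte, h2, hready2.one, hready2.m,
      hready2.d, eval_shiftRight hd]
    simp only [BinOp.eval, Nat.sub_zero, hx1]

/-- Computes the numbers that are needed for the computation of parities, without knowing the word
length: the first loop doubles `reg 34` until a word of ones is shifted to zero, which gives `2 ^
⌈log w⌉`; the second one finds the least power of two `2 ^ κ ≥ ⌈log w⌉`; the third one builds the
repunit by doubling its number of digits. -/
def paritySetup : Program :=
  block [block [.not 33 15, .op .or 34 1 1, .op .shiftRight 35 33 34],
    .while 35 (block [.op .add 34 34 34, .op .shiftRight 35 33 34]),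
    block [.op .shiftRight 10 34 1, .op .or 11 1 1, .op .shiftLeft 36 1 11, .op .lt 35 36 34],
    .while 35 (block [.op .add 11 11 11, .op .shiftLeft 36 1 11, .op .lt 35 36 34]),
    block [.op .or 12 1 1, .op .or 36 11 11, .op .lt 35 36 10],
    .while 35 (block [.op .shiftLeft 37 12 36, .op .add 12 12 37, .op .add 36 36 36,
      .op .lt 35 36 10]),
    .op .sub 13 10 11]

theorem allOnes_shiftRight_ne_zero (k : ℕ) : (~~~ 0#w) >>> k ≠ 0#w ↔ k < w := by
  constructor
  · intro h
    by_contra hk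
    refine h (BitVec.eq_of_toNat_eq ?_)
    simp [Nat.shiftRight_eq_div_pow]
    exact (Nat.sub_lt (by positivity) one_pos).trans_le
      (Nat.pow_le_pow_right (by norm_num) (by omega))
  · intro hk h
    have := congrArg BitVec.toNat h
    simp [Nat.shiftRight_eq_div_pow] at this
    have h1 : 2 ^ k < 2 ^ w := Nat.pow_lt_pow_right (by norm_num) hk
    omega

/-- The exponent of the block length: the blocks have the length `2 ^ κ ≥ ⌈log w⌉`. -/
def blockExp (w : ℕ) : ℕ := Nat.clog 2 (Nat.clog 2 w)

/-- The number of blocks; together they have half the length `2 ^ ⌈log w⌉`. -/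
def blockNum (w : ℕ) : ℕ := 2 ^ (Nat.clog 2 w - 1 - blockExp w)

theorem two_pow_clog_lt {n : ℕ} (hn : 1 < n) : 2 ^ Nat.clog 2 n < 2 * n := by
  have h1 := Nat.pow_pred_clog_lt_self (b := 2) (by norm_num) hn
  have h2 : 0 < Nat.clog 2 n := Nat.clog_pos (by norm_num) hn
  calc 2 ^ Nat.clog 2 n = 2 * 2 ^ (Nat.clog 2 n).pred := by
        rw [← pow_succ']; congr 1; exact (Nat.succ_pred_eq_of_pos h2).symm
    _ < 2 * n := by omega

theorem clog_facts (hw : 32 ≤ w) : 5 ≤ Nat.clog 2 w ∧ 2 ^ Nat.clog 2 w < 2 * w ∧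
    w ≤ 2 ^ Nat.clog 2 w ∧ 2 ^ blockExp w < 2 * Nat.clog 2 w ∧
    Nat.clog 2 w ≤ 2 ^ blockExp w ∧ blockExp w ≤ Nat.clog 2 w - 1 := by
  have h1 : w ≤ 2 ^ Nat.clog 2 w := Nat.le_pow_clog (by norm_num) _
  have h2 : 5 ≤ Nat.clog 2 w := by
    by_contra h
    have : 2 ^ Nat.clog 2 w ≤ 2 ^ 4 := Nat.pow_le_pow_right (by norm_num) (by omega)
    omega
  have h3 : 2 ^ blockExp w < 2 * Nat.clog 2 w := two_pow_clog_lt (by omega)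
  refine ⟨h2, two_pow_clog_lt (by omega), h1, h3, Nat.le_pow_clog (by norm_num) _, ?_⟩
  have h4 : ∀ L, 5 ≤ L → 2 * L ≤ 2 ^ (L - 1) := by
    intro L hL
    induction L, hL using Nat.le_induction with
    | base => norm_num
    | succ L hL ih =>
      have : L + 1 - 1 = (L - 1) + 1 := by omega
      rw [this, pow_succ]; omega
  have h5 := h3.trans_le (h4 _ h2)
  exact ((Nat.pow_lt_pow_iff_right (by norm_num)).1 h5).le

theorem parityParams (hw : 32 ≤ w) : ParityParams w (blockExp w) (blockNum w) := by
  obtain ⟨h1, h2, h3, h4, h5, h6⟩ := clog_facts hw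
  have hu : blockNum w * 2 ^ blockExp w = 2 ^ (Nat.clog 2 w - 1) := by
    rw [blockNum, ← pow_add]; congr 1; omega
  have hL : 2 ^ Nat.clog 2 w = 2 ^ (Nat.clog 2 w - 1) + 2 ^ (Nat.clog 2 w - 1) := by
    rw [← two_mul, ← pow_succ']; congr 1; omega
  refine ⟨by unfold blockNum; positivity, by rw [hu]; omega, by rw [hu]; omega, ?_⟩
  exact Nat.pow_le_pow_right (by norm_num) (by omega)

theorem paritySetup_triple (hw : 32 ≤ w) (s : State w)
    (h1 : s.reg 1 = BitVec.ofNat w 1) (h0 : s.reg 15 = 0#w) :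
    Triple paritySetup s ((30 * Nat.clog 2 w + 60 : ℕ) : ℝ≥0∞)
      (ParityReady (blockExp w) (blockNum w)) := by
  obtain ⟨hL5, hL2, hLw, hκ2, hκ, hκL⟩ := clog_facts hw
  have hwpos : 0 < w := by omega
  set L := Nat.clog 2 w with hL
  set κ := blockExp w with hκdef
  have hww : ∀ k, k < 2 * w → k < 2 ^ w := by
    intro k hk
    have h2 : w < 2 ^ (w - 1) := by
      have h3 : ∀ v, 32 ≤ v → v < 2 ^ (v - 1) := by
        intro v hv
        induction v, hv using Nat.le_induction with
        | base => norm_num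
        | succ v hv ih =>
          have : v + 1 - 1 = (v - 1) + 1 := by omega
          rw [this, pow_succ]; omega
      exact h3 w hw
    have h4 : 2 ^ w = 2 * 2 ^ (w - 1) := by rw [← pow_succ']; congr 1; omega
    omega
  have hpL : ∀ i ≤ L, 2 ^ i < 2 * w := fun i hi =>
    (Nat.pow_le_pow_right (by norm_num) hi).trans_lt hL2
  have hLw' : L < w := by
    have : L < 2 ^ L := Nat.lt_two_pow_self
    by_contra hc
    have h3 : 2 ^ w ≤ 2 ^ L := Nat.pow_le_pow_right (by norm_num) (by omega)
    have h4 := hww (2 ^ L) hL2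
    omega
  have hκw : 2 ^ κ < w := by
    have h3 : 2 * L ≤ 2 ^ (L - 1) := by
      have h4 : ∀ L, 5 ≤ L → 2 * L ≤ 2 ^ (L - 1) := by
        intro L hL
        induction L, hL using Nat.le_induction with
        | base => norm_num
        | succ L hL ih =>
          have : L + 1 - 1 = (L - 1) + 1 := by omega
          rw [this, pow_succ]; omega
      exact h4 L hL5
    have h4 : 2 ^ L = 2 * 2 ^ (L - 1) := by rw [← pow_succ']; congr 1; omega
    omega
  have hpκ : ∀ i ≤ κ, 2 ^ i < w := fun i hi =>
    (Nat.pow_le_pow_right (by norm_num) hi).trans_lt hκw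
  have h1w : 1 < 2 ^ w := Nat.one_lt_two_pow (by omega)
  set μ := L - 1 - κ with hμ
  suffices H : Triple paritySetup s ((1 + 5 + (1 + (1 + L * (1 + 3)) + (1 + 7 +
      (1 + (1 + κ * (1 + 5)) + (1 + 5 + (1 + (1 + μ * (1 + 7)) + 1))))) : ℕ) : ℝ≥0∞)
      (ParityReady κ (2 ^ μ)) from
    H.mono (by rw [Nat.cast_le]; omega) fun _ h _ => h
  -- the first loop: the least power of two that is not less than `w`
  refine Triple.seq_straight 5 _ rfl le_rfl (Triple.seq_nat _ _ (Triple.while_nat L 3 _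
    (fun j s => j ≤ L ∧ s.reg 33 = ~~~ 0#w ∧ s.reg 34 = BitVec.ofNat w (2 ^ (L - j)) ∧
      s.reg 35 = (~~~ 0#w) >>> 2 ^ (L - j)) ?_ ?_ ?_) ?_)
  · refine ⟨le_rfl, by simp [h0], by simp [BinOp.eval, h1], ?_⟩
    have := eval_shiftRight (w := w) (k := 1) h1w (~~~ 0#w)
    simp +decide only [block, Program.exec, setReg_reg, ↓reduceIte, h0, h1]
    simpa [BinOp.eval] using this
  · rintro j hj s1 ⟨h2, h3, h4, h5⟩ -
    have h6 : 2 ^ (L - (j + 1)) < w := by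
      have h7 := Nat.pow_pred_clog_lt_self (b := 2) (by norm_num) (show 1 < w by omega)
      exact (Nat.pow_le_pow_right (by norm_num) (by rw [← hL, Nat.pred_eq_sub_one]; omega)).trans_lt
        h7
    have e : 2 ^ (L - (j + 1)) + 2 ^ (L - (j + 1)) = 2 ^ (L - j) := by
      rw [← two_mul, ← pow_succ']; congr 1; omega
    refine ⟨by rw [h5]; exact (allOnes_shiftRight_ne_zero _).2 h6, ?_⟩
    refine Triple.straight 3 rfl le_rfl ⟨by omega, by simp [h3], ?_, ?_⟩
    · simp +decide only [block, Program.exec, setReg_reg, ↓reduceIte, h4, eval_add, e]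
    · simp +decide only [block, Program.exec, setReg_reg, ↓reduceIte, h4, eval_add, e, h3]
      exact eval_shiftRight (hww _ (hpL _ (Nat.sub_le _ _))) _
  · rintro s1 ⟨-, -, -, h5⟩ -
    by_contra h6
    rw [h5] at h6
    have := (allOnes_shiftRight_ne_zero _).1 h6
    simp at this; omega
  rintro s1 ⟨-, -, h4, -⟩ hF1
  have hone1 : s1.reg 1 = BitVec.ofNat w 1 := by rw [hF1.reg 1 rfl]; simp [h1]
  rw [Nat.sub_zero] at h4
  -- the second loop: the block length
  refine Triple.seq_straight 7 _ rfl le_rfl (Triple.seq_nat _ _ (Triple.while_nat κ 5 _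
    (fun j s => j ≤ κ ∧ s.reg 11 = BitVec.ofNat w (2 ^ (κ - j)) ∧
      s.reg 35 = BitVec.ofNat w (if 2 ^ (κ - j) < L then 1 else 0)) ?_ ?_ ?_) ?_)
  · refine ⟨le_rfl, by simp [BinOp.eval, hone1], ?_⟩
    have e1 : (BinOp.or.eval (BitVec.ofNat w 1) (BitVec.ofNat w 1)) = BitVec.ofNat w 1 := by
      simp [BinOp.eval]
    simp +decide only [block, Program.exec, setReg_reg, ↓reduceIte, h4, hone1]
    rw [e1, eval_shiftLeft h1w, ofNat_shiftLeft, one_mul, Nat.sub_self, pow_zero,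
      eval_lt (hww _ (hpL 1 (by omega))) (hww _ (hpL _ le_rfl))]
    congr 1
    simp only [Nat.pow_lt_pow_iff_right (show 1 < 2 by norm_num)]
  · rintro j hj s2 ⟨h2, h3, h5⟩ hF2
    have h34 : s2.reg 34 = BitVec.ofNat w (2 ^ L) := by rw [hF2.reg 34 rfl]; simp [h4]
    have hone2 : s2.reg 1 = BitVec.ofNat w 1 := by rw [hF2.reg 1 rfl]; simp [hone1]
    have h6 : 2 ^ (κ - (j + 1)) < L := by
      have h7 := Nat.pow_pred_clog_lt_self (b := 2) (by norm_num) (show 1 < L by omega)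
      exact (Nat.pow_le_pow_right (by norm_num)
        (by rw [hκdef, blockExp, ← hL, Nat.pred_eq_sub_one] at *; omega)).trans_lt h7
    have e : 2 ^ (κ - (j + 1)) + 2 ^ (κ - (j + 1)) = 2 ^ (κ - j) := by
      rw [← two_mul, ← pow_succ']; congr 1; omega
    refine ⟨by rw [h5, ofNat_ite_ne_zero hwpos]; exact h6, ?_⟩
    refine Triple.straight 5 rfl le_rfl ⟨by omega, ?_, ?_⟩
    · simp +decide only [block, Program.exec, setReg_reg, ↓reduceIte, h3, eval_add, e]
    · have h7 : 2 ^ (κ - j) < w := hpκ _ (Nat.sub_le _ _)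
      simp +decide only [block, Program.exec, setReg_reg, ↓reduceIte, h3, eval_add, e, hone2, h34]
      rw [eval_shiftLeft (hww _ (by omega)), ofNat_shiftLeft, one_mul,
        eval_lt (Nat.pow_lt_pow_right (by norm_num) h7) (hww _ hL2)]
      simp only [Nat.pow_lt_pow_iff_right (show 1 < 2 by norm_num)]
  · rintro s2 ⟨-, -, h5⟩ -
    rw [h5, Nat.sub_zero, if_neg (not_lt.2 hκ)]; rfl
  rintro s2 ⟨-, h3, -⟩ hF2
  rw [Nat.sub_zero] at h3
  have hone2 : s2.reg 1 = BitVec.ofNat w 1 := by rw [hF2.reg 1 rfl]; simp [hone1]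
  have h10 : s2.reg 10 = BitVec.ofNat w (2 ^ (L - 1)) := by
    rw [hF2.reg 10 rfl]
    have e : 2 ^ L / 2 ^ 1 = 2 ^ (L - 1) := by
      rw [Nat.pow_div (by omega) (by norm_num)]
    simp +decide only [block, Program.exec, setReg_reg, ↓reduceIte, h4, hone1]
    rw [eval_shiftRight h1w, ofNat_shiftRight (hww _ hL2), e]
  have hpu : ∀ i ≤ μ, 2 ^ (κ + i) < 2 * w := fun i hi => hpL _ (by omega)
  -- the third loop: the repunit
  refine Triple.seq_straight 5 _ rfl le_rfl (Triple.seq_nat _ _ (Triple.while_nat μ 7 _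
    (fun j s => j ≤ μ ∧ s.reg 12 = BitVec.ofNat w (repunit (2 ^ 2 ^ κ) (2 ^ (μ - j))) ∧
      s.reg 36 = BitVec.ofNat w (2 ^ (κ + (μ - j))) ∧
      s.reg 35 = BitVec.ofNat w (if 0 < j then 1 else 0)) ?_ ?_ ?_) ?_)
  · refine ⟨le_rfl, ?_, ?_, ?_⟩
    · simp [BinOp.eval, hone2, repunit]
    · simp [BinOp.eval, h3]
    · have e1 : ∀ x : BitVec w, BinOp.or.eval x x = x := by simp [BinOp.eval]
      simp +decide only [block, Program.exec, setReg_reg, ↓reduceIte, h3, h10, e1]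
      rw [eval_lt (hww _ (hpL _ (by omega))) (hww _ (hpL _ (by omega)))]
      congr 1
      have : 2 ^ κ < 2 ^ (L - 1) ↔ 0 < μ := by
        rw [Nat.pow_lt_pow_iff_right (by norm_num)]; omega
      simp only [this]
  · rintro j hj s3 ⟨h5, h6, h7, h8⟩ hF3
    have h10' : s3.reg 10 = BitVec.ofNat w (2 ^ (L - 1)) := by
      rw [hF3.reg 10 rfl]; simp [h10]
    have e : 2 ^ (κ + (μ - (j + 1))) + 2 ^ (κ + (μ - (j + 1))) = 2 ^ (κ + (μ - j)) := by
      rw [← two_mul, ← pow_succ']; congr 1; omega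
    refine ⟨by rw [h8, ofNat_ite_ne_zero hwpos]; omega, ?_⟩
    refine Triple.straight 7 rfl le_rfl ⟨by omega, ?_, ?_, ?_⟩
    · simp +decide only [block, Program.exec, setReg_reg, ↓reduceIte, h6, h7,
        eval_shiftLeft (hww _ (hpu _ (Nat.sub_le _ _))), ofNat_shiftLeft]
      rw [eval_add]
      congr 1
      have e2 : μ - j = (μ - (j + 1)) + 1 := by omega
      rw [e2, pow_succ, mul_two, repunit_add, ← pow_mul, ← pow_add, mul_comm (repunit _ _)]
    · simp +decide only [block, Program.exec, setReg_reg, ↓reduceIte, h7, eval_add, e]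
    · simp +decide only [block, Program.exec, setReg_reg, ↓reduceIte, h7, eval_add, h10']
      rw [e, eval_lt (hww _ (hpu _ (Nat.sub_le _ _))) (hww _ (hpL _ (by omega)))]
      congr 1
      have : 2 ^ (κ + (μ - j)) < 2 ^ (L - 1) ↔ 0 < j := by
        rw [Nat.pow_lt_pow_iff_right (by norm_num)]; omega
      simp only [this]
  · rintro s3 ⟨-, -, -, h8⟩ -
    rw [h8]; simp
  rintro s3 ⟨-, h6, -, -⟩ hF3
  have hone3 : s3.reg 1 = BitVec.ofNat w 1 := by rw [hF3.reg 1 rfl]; simp [hone2]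
  have h11 : s3.reg 11 = BitVec.ofNat w (2 ^ κ) := by rw [hF3.reg 11 rfl]; simp [h3]
  have hu : 2 ^ μ * 2 ^ κ = 2 ^ (L - 1) := by rw [← pow_add]; congr 1; omega
  have h10' : s3.reg 10 = BitVec.ofNat w (2 ^ μ * 2 ^ κ) := by
    rw [hu, hF3.reg 10 rfl]; simp [h10]
  rw [Nat.sub_zero] at h6
  refine Triple.straight 1 rfl le_rfl ⟨by simp [hone3], by simp [h10'], by simp [h11],
    by simp [h6], ?_⟩
  exact (congrArg₂ BinOp.sub.eval h10' h11).trans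
    (eval_sub (Nat.le_mul_of_pos_left _ (by positivity)))

end WordRAM

namespace WordRAM

variable {w : ℕ}

/-! ### Random linear hash functions -/

theorem expect_randWord (v : BitVec w) (F : BitVec w → ℝ≥0∞) :
    (randWord v).expect F =
      (((v - 1).toNat + 1 : ℕ) : ℝ≥0∞)⁻¹ *
        ∑ i ∈ Finset.range ((v - 1).toNat + 1), F (BitVec.ofNat w i) := by
  have h : randWord v = (PMF.uniformOfFintype (Fin ((v - 1).toNat + 1))).map
      fun i => BitVec.ofNat w i.val := by
    change PMF.map _ (PMF.map Fin.val _) = _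
    rw [PMF.map_comp]
    rfl
  rw [h, PMF.expect_map]
  unfold PMF.expect
  rw [tsum_fintype]
  simp only [PMF.uniformOfFintype_apply, Fintype.card_fin]
  rw [← Finset.mul_sum, Finset.sum_range]

/-- The word zero stands for the number `2 ^ w`, so that all words are equally likely. -/
theorem expect_randWord_zero (F : BitVec w → ℝ≥0∞) :
    (randWord 0).expect F =
      ((2 ^ w : ℕ) : ℝ≥0∞)⁻¹ * ∑ i ∈ Finset.range (2 ^ w), F (BitVec.ofNat w i) := by
  have : ((0 : BitVec w) - 1).toNat + 1 = 2 ^ w := by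
    have h : 0 < 2 ^ w := by positivity
    rcases Nat.eq_zero_or_pos w with rfl | hw
    · simp
    · have := Nat.one_lt_two_pow hw.ne'
      simp [Nat.mod_eq_of_lt this]
      omega
  rw [expect_randWord, this]

/-- The uniform distribution on words is invariant under translations. -/
theorem expect_randWord_xor (e : BitVec w) (F : BitVec w → ℝ≥0∞) :
    (randWord 0).expect (fun v => F (v ^^^ e)) = (randWord 0).expect F := by
  rw [expect_randWord_zero, expect_randWord_zero]
  congr 1
  refine Finset.sum_nbij' (fun i => (BitVec.ofNat w i ^^^ e).toNat)
    (fun i => (BitVec.ofNat w i ^^^ e).toNat) ?_ ?_ ?_ ?_ ?_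
  · intro i _; exact Finset.mem_range.2 (BitVec.isLt _)
  · intro i _; exact Finset.mem_range.2 (BitVec.isLt _)
  · intro i hi
    rw [BitVec.ofNat_toNat, BitVec.setWidth_eq, BitVec.xor_assoc, BitVec.xor_self, BitVec.xor_zero,
      BitVec.toNat_ofNat, Nat.mod_eq_of_lt (Finset.mem_range.1 hi)]
  · intro i hi
    rw [BitVec.ofNat_toNat, BitVec.setWidth_eq, BitVec.xor_assoc, BitVec.xor_self, BitVec.xor_zero,
      BitVec.toNat_ofNat, Nat.mod_eq_of_lt (Finset.mem_range.1 hi)]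
  · intro i _; rw [BitVec.ofNat_toNat, BitVec.setWidth_eq]

theorem and_xor_distrib (v x y : BitVec w) : v &&& (x ^^^ y) = (v &&& x) ^^^ (v &&& y) := by
  apply BitVec.eq_of_getLsbD_eq
  intro i hi
  simp only [BitVec.getLsbD_and, BitVec.getLsbD_xor, Bool.and_xor_distrib_left]

theorem parity_twoPow {i : ℕ} (hi : i < w) : parity (BitVec.twoPow w i) = 1 := by
  simp only [parity, blockSum, BitVec.getLsbD_twoPow, hi, decide_true, Bool.true_and, zero_add]
  rw [Finset.sum_eq_single i]
  · simp [bitZ]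
  · intro j _ hj
    simp [bitZ, hj.symm]
  · intro h; simp [hi] at h

/-- A random linear form takes the value zero at a nonzero point with probability one half: flipping
the coefficient at a position where the point has a one changes the value. -/
theorem expect_parity_eq_zero {z : BitVec w} (hz : z ≠ 0#w) :
    (randWord 0).expect (fun v => if parity (v &&& z) = 0 then 1 else 0) = 2⁻¹ := by
  obtain ⟨i, hi, hzi⟩ : ∃ i, i < w ∧ z.getLsbD i = true := by
    by_contra hcon
    push Not at hcon
    refine hz (BitVec.eq_of_getLsbD_eq fun i hi => ?_)
    simpa using hcon i hi
  have hand : BitVec.twoPow w i &&& z = BitVec.twoPow w i := by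
    apply BitVec.eq_of_getLsbD_eq
    intro j hj
    simp only [BitVec.getLsbD_and, BitVec.getLsbD_twoPow]
    by_cases hij : i = j
    · subst hij; simp [hzi]
    · simp [hij]
  have h1 := expect_randWord_xor (BitVec.twoPow w i)
    (fun v => if parity (v &&& z) = 0 then 1 else 0)
  have h2 : ∀ v : BitVec w, (if parity ((v ^^^ BitVec.twoPow w i) &&& z) = 0 then (1 : ℝ≥0∞)
      else 0) + (if parity (v &&& z) = 0 then 1 else 0) = 1 := by
    intro v
    have h3 : parity ((v ^^^ BitVec.twoPow w i) &&& z) = parity (v &&& z) + 1 := by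
      rw [BitVec.and_comm _ z, and_xor_distrib, BitVec.and_comm z, BitVec.and_comm z, hand,
        parity_xor, parity_twoPow hi]
    rw [h3]
    generalize parity (v &&& z) = q
    have : ∀ q : ZMod 2, q = 0 ∨ q = 1 := by decide
    rcases this q with rfl | rfl
    · simp
    · rw [if_pos (by decide), if_neg (by decide), add_zero]
  have h4 : (randWord 0).expect (fun v : BitVec w => if parity (v &&& z) = 0 then (1 : ℝ≥0∞) else 0)
      + (randWord 0).expect (fun v : BitVec w => if parity (v &&& z) = 0 then (1 : ℝ≥0∞) else 0)
      = 1 := by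
    conv_lhs => enter [1]; rw [← h1]
    rw [← PMF.expect_add]
    simp only [h2, PMF.expect_const]
  rw [← two_mul] at h4
  exact (ENNReal.eq_inv_of_mul_eq_one_left (by rwa [mul_comm]))

/-- The law of a list of independent samples. -/
noncomputable def drawMany {α : Type*} (ν : PMF α) : ℕ → PMF (List α)
  | 0 => PMF.pure []
  | r + 1 => ν.bind fun v => (drawMany ν r).map (v :: ·)

theorem mem_drawMany {α : Type*} {ν : PMF α} {r : ℕ} {l : List α}
    (h : l ∈ (drawMany ν r).support) : l.length = r ∧ ∀ a ∈ l, a ∈ ν.support := by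
  induction r generalizing l with
  | zero => simp [drawMany] at h; simp [h]
  | succ r ih =>
    rw [drawMany, PMF.mem_support_bind_iff] at h
    obtain ⟨v, hv, h⟩ := h
    rw [PMF.mem_support_map_iff] at h
    obtain ⟨l', h', rfl⟩ := h
    refine ⟨by simp [ih h'], fun a ha => ?_⟩
    rcases List.mem_cons.1 ha with rfl | ha
    · exact hv
    · exact (ih h').2 a ha

/-- The probability that none of `r` independent samples has a certain property. -/
theorem expect_drawMany_forall {α : Type*} (ν : PMF α) (p : α → Prop) [DecidablePred p] (r : ℕ) :
    (drawMany ν r).expect (fun l => if ∀ v ∈ l, p v then 1 else 0) =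
      (ν.expect fun v => if p v then 1 else 0) ^ r := by
  induction r with
  | zero => simp [drawMany, PMF.expect_pure]
  | succ r ih =>
    rw [drawMany, PMF.expect_bind]
    have h1 : ∀ v : α, ((drawMany ν r).map (v :: ·)).expect
        (fun l => if ∀ v ∈ l, p v then 1 else 0) =
        (ν.expect fun v => if p v then 1 else 0) ^ r * (if p v then 1 else 0) := by
      intro v
      rw [PMF.expect_map, ← ih]
      by_cases hv : p v
      · simp [hv]
      · simp [hv, PMF.expect_const]
    simp only [h1]
    rw [PMF.expect_const_mul, pow_succ]

/-- The rule for a counting loop in which every iteration draws an independent sample. -/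
theorem Spec.forDown {α : Type*} {c e : ℕ} {body : Program} (N : ℕ) (T : ℕ) (s₀ : State w)
    (ν : PMF α) (Inv : List α → State w → Prop) (hN : N < 2 ^ w)
    (hc : body.writesReg c = false) (he : body.writesReg e = false) (hce : c ≠ e)
    (hrc : s₀.reg c = BitVec.ofNat w N) (hre : s₀.reg e = BitVec.ofNat w 1)
    (h0 : Inv [] s₀) (hInv : ∀ l s x, Inv l s → Inv l (s.setReg c x))
    (hstep : ∀ l s, l.length < N → Inv l s → Frame (WordRAM.forDown c e body) s₀ s →
      Spec body s T ν fun a => Inv (l ++ [a])) :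
    Spec (WordRAM.forDown c e body) s₀ ((1 + N * (3 + T) : ℕ) : ℝ≥0∞) (drawMany ν N)
      (fun l s => l.length = N ∧ Inv l s) := by
  have hbody : ∀ j < N, ∀ l s, l.length + (j + 1) = N → s.reg c = BitVec.ofNat w (j + 1) →
      Inv l s → Frame (WordRAM.forDown c e body) s₀ s →
      Spec (.seq (.op .sub c c e) body) s (1 + 1 + T) ν
        (fun a s' => s'.reg c = BitVec.ofNat w j ∧ Inv (l ++ [a]) s') := by
    intro j hj l s hl hs hI hF
    refine Triple.seq_spec (Post := fun s' => s' = s.setReg c (BitVec.ofNat w j)) ?_ ?_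
    · refine (Triple.exec (.op .sub c c e) s rfl).mono (by simp [Program.cost]) ?_
      rintro _ rfl _
      have : s.reg e = BitVec.ofNat w 1 := by
        rw [← hre]; exact hF.reg e (by simp [WordRAM.forDown, Program.writesReg, he, hce])
      rw [Program.exec, hs, this, BinOp.eval, ofNat_sub_one]
    · rintro _ rfl hF'
      refine (hstep l _ (by omega) (hInv _ _ _ hI) (hF.trans hF'.seq_left.while)).mono le_rfl ?_
      intro a s' hs' hF''
      exact ⟨by rw [hF''.reg c hc, setReg_reg, if_pos rfl], hs'⟩
  constructor
  · intro k t B hB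
    suffices H : ∀ n ≤ N, ∀ l s, l.length + n = N → s.reg c = BitVec.ofNat w n → Inv l s →
        Frame (WordRAM.forDown c e body) s₀ s →
        timeUpTo (t + 1) (WordRAM.forDown c e body :: k, s) ≤
          ((1 + n * (3 + T) : ℕ) : ℝ≥0∞) + (drawMany ν n).expect fun l' => B (l ++ l') by
      simpa using H N le_rfl [] s₀ (by simp) hrc h0 Frame.rfl
    intro n
    induction n with
    | zero =>
      intro _ l s _ hs hI hF
      rw [WordRAM.forDown, timeUpTo_cons_pure (show _ = PMF.pure (k, s) by simp [step, hs])]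
      simp only [drawMany, PMF.expect_pure, List.append_nil, Nat.zero_mul, add_zero, Nat.cast_one]
      gcongr
      exact hB l s ⟨by omega, hI⟩ hF
    | succ n ih =>
      intro hn l s hl hs hI hF
      have h1 : s.reg c ≠ 0 := by rw [hs]; exact ofNat_ne_zero (by omega) (by omega)
      have h2 := hbody n hn l s hl hs hI hF
      rw [WordRAM.forDown, timeUpTo_cons_pure (show _ = PMF.pure
        (.seq (.op .sub c c e) body :: WordRAM.forDown c e body :: k, s) by
          rw [step, if_pos h1, WordRAM.forDown])]
      have h3 : timeUpTo t (.seq (.op .sub c c e) body :: WordRAM.forDown c e body :: k, s) ≤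
          (1 + 1 + T) + ν.expect fun a => ((1 + n * (3 + T) : ℕ) : ℝ≥0∞) +
            (drawMany ν n).expect fun l' => B (l ++ [a] ++ l') := by
        refine (timeUpTo_monotone (show t ≤ t + 1 + 1 by omega) _).trans ?_
        exact h2.time _ _ _ fun a s' h4 h5 => ih (by omega) (l ++ [a]) s'
          (by simp; omega) h4.1 h4.2 (hF.trans h5.while)
      refine (add_le_add le_rfl h3).trans (le_of_eq ?_)
      rw [PMF.expect_add, PMF.expect_const, drawMany, PMF.expect_bind]
      simp only [PMF.expect_map, List.append_assoc, List.singleton_append]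
      push_cast
      ring
  · intro good k x hx
    suffices H : ∀ n ≤ N, ∀ l s, l.length + n = N → s.reg c = BitVec.ofNat w n → Inv l s →
        Frame (WordRAM.forDown c e body) s₀ s →
        x ≤ winProb good (WordRAM.forDown c e body :: k, s) from
      H N le_rfl [] s₀ (by simp) hrc h0 Frame.rfl
    intro n
    induction n with
    | zero =>
      intro _ l s _ hs hI hF
      rw [WordRAM.forDown, winProb_cons_pure (show _ = PMF.pure (k, s) by simp [step, hs])]
      exact hx l s ⟨by omega, hI⟩ hF
    | succ n ih =>
      intro hn l s hl hs hI hF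
      have h1 : s.reg c ≠ 0 := by rw [hs]; exact ofNat_ne_zero (by omega) (by omega)
      have h2 := hbody n hn l s hl hs hI hF
      rw [WordRAM.forDown, winProb_cons_pure (show _ = PMF.pure
        (.seq (.op .sub c c e) body :: WordRAM.forDown c e body :: k, s) by
          rw [step, if_pos h1, WordRAM.forDown])]
      exact h2.win _ _ _ fun a s' h4 h5 => ih (by omega) (l ++ [a]) s'
          (by simp; omega) h4.1 h4.2 (hF.trans h5.while)

/-- The law of a list of independent random words. -/
noncomputable abbrev drawWords (w r : ℕ) : PMF (List (BitVec w)) := drawMany (randWord 0) r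

theorem length_of_mem_drawWords {r : ℕ} {l : List (BitVec w)} (h : l ∈ (drawWords w r).support) :
    l.length = r := (mem_drawMany h).1

/-- The linear hash function given by a list of linear forms: the parities of `v &&& x` are the
binary digits of the hash value. -/
def hashWord (l : List (BitVec w)) (x : BitVec w) : BitVec w :=
  l.foldl (fun a v => (a <<< 1) ^^^ parityWord (v &&& x)) 0

theorem hashWord_concat (l : List (BitVec w)) (v x : BitVec w) :
    hashWord (l ++ [v]) x = (hashWord l x <<< 1) ^^^ parityWord (v &&& x) := by
  simp [hashWord]

theorem parityWord_xor (x y : BitVec w) :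
    parityWord (x ^^^ y) = parityWord x ^^^ parityWord y := by
  simp only [parityWord, parity_xor]
  have : ∀ q : ZMod 2, q = 0 ∨ q = 1 := by decide
  rcases this (parity x) with h | h <;> rcases this (parity y) with h' | h' <;>
    (simp only [h, h']; simp; try rfl)

theorem hashWord_xor (l : List (BitVec w)) (x y : BitVec w) :
    hashWord l (x ^^^ y) = hashWord l x ^^^ hashWord l y := by
  induction l using List.reverseRecOn with
  | nil => simp [hashWord]
  | append_singleton l v ih =>
    rw [hashWord_concat, hashWord_concat, hashWord_concat, ih, and_xor_distrib,
      parityWord_xor, BitVec.shiftLeft_xor_distrib]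
    ac_rfl

theorem two_mul_xor_le_one (a : ℕ) {b : ℕ} (hb : b ≤ 1) : 2 * a ^^^ b = 2 * a + b := by
  interval_cases b
  · simp
  · apply Nat.eq_of_testBit_eq
    intro i
    cases i with
    | zero => simp [Nat.testBit_zero]
    | succ i =>
      rw [Nat.testBit_xor, Nat.testBit_succ, Nat.testBit_succ, Nat.testBit_succ]
      have h1 : (2 * a + 1) / 2 = a := by omega
      simp [h1]

theorem val_parity_le (x : BitVec w) : (parity x).val ≤ 1 :=
  Nat.lt_succ_iff.1 (ZMod.val_lt (parity x))

/-- The digits of a hash value are parities: it has as many of them as there are linear forms, and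
it vanishes only if all the parities do. -/
theorem toNat_hashWord (l : List (BitVec w)) (hl : l.length ≤ w) (x : BitVec w) :
    (hashWord l x).toNat < 2 ^ l.length ∧
      (hashWord l x = 0#w → ∀ v ∈ l, parity (v &&& x) = 0) := by
  induction l using List.reverseRecOn with
  | nil => simp [hashWord]
  | append_singleton l v ih =>
    rw [List.length_append, List.length_singleton] at hl
    obtain ⟨h1, h2⟩ := ih (by omega)
    have hp : 2 ^ (l.length + 1) ≤ 2 ^ w := Nat.pow_le_pow_right (by norm_num) hl
    rw [pow_succ] at hp
    have h3 := val_parity_le (v &&& x)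
    have h4 : (hashWord (l ++ [v]) x).toNat =
        2 * (hashWord l x).toNat + (parity (v &&& x)).val := by
      rw [hashWord_concat, BitVec.toNat_xor, BitVec.toNat_shiftLeft, parityWord, BitVec.toNat_ofNat,
        Nat.shiftLeft_eq, pow_one, Nat.mod_eq_of_lt (by omega), Nat.mod_eq_of_lt (by omega),
        mul_comm, two_mul_xor_le_one _ h3]
    constructor
    · rw [h4, List.length_append, List.length_singleton, pow_succ]; omega
    · intro h u hu
      rw [h] at h4
      simp only [BitVec.toNat_zero] at h4
      rcases List.mem_append.1 hu with hu | hu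
      · exact h2 (BitVec.eq_of_toNat_eq (by simp; omega)) u hu
      · rw [List.mem_singleton.1 hu]
        exact (ZMod.val_eq_zero _).1 (by omega)

/-- The hash value of a nonzero word is rarely zero. By linearity this bounds the probability that
two given words have the same hash value. -/
theorem expect_hashWord_eq_zero {z : BitVec w} (hz : z ≠ 0#w) {r : ℕ} (hr : r ≤ w) :
    (drawWords w r).expect (fun l => if hashWord l z = 0#w then 1 else 0) ≤ (2 ^ r)⁻¹ := by
  have key : (drawWords w r).expect
      (fun l => if ∀ v ∈ l, parity (v &&& z) = 0 then 1 else 0) = (2 ^ r)⁻¹ := by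
    have h := expect_drawMany_forall (randWord 0) (fun v => parity (v &&& z) = 0) r
    rw [expect_parity_eq_zero hz, ← ENNReal.inv_pow] at h
    convert h
  rw [← key]
  refine PMF.expect_mono _ fun l hl => ?_
  by_cases h : hashWord l z = 0#w
  · rw [if_pos h, if_pos ((toNat_hashWord l (by rwa [length_of_mem_drawWords hl]) z).2 h)]
  · simp [h]

/-- The law of a pair of independent hash functions. -/
noncomputable def drawPair (w r₁ r₂ : ℕ) : PMF (List (BitVec w) × List (BitVec w)) :=
  (drawWords w r₁).bind fun l₁ => (drawWords w r₂).map fun l₂ => (l₁, l₂)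

theorem mem_drawPair {r₁ r₂ : ℕ} {l : List (BitVec w) × List (BitVec w)}
    (h : l ∈ (drawPair w r₁ r₂).support) : l.1.length = r₁ ∧ l.2.length = r₂ := by
  rw [drawPair, PMF.mem_support_bind_iff] at h
  obtain ⟨l₁, h1, h⟩ := h
  rw [PMF.mem_support_map_iff] at h
  obtain ⟨l₂, h2, rfl⟩ := h
  exact ⟨length_of_mem_drawWords h1, length_of_mem_drawWords h2⟩

theorem expect_drawPair_fst {r₁ r₂ : ℕ} (F : List (BitVec w) → ℝ≥0∞) :
    (drawPair w r₁ r₂).expect (fun l => F l.1) = (drawWords w r₁).expect F := by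
  simp only [drawPair, PMF.expect_bind, PMF.expect_map, PMF.expect_const]

theorem expect_drawPair_eq_zero {z : BitVec w} (hz : z ≠ 0#w) {r₁ r₂ : ℕ} (h1 : r₁ ≤ w)
    (h2 : r₂ ≤ w) :
    (drawPair w r₁ r₂).expect
      (fun l => if hashWord l.1 z = 0#w ∧ hashWord l.2 z = 0#w then 1 else 0) ≤
      (2 ^ (r₁ + r₂))⁻¹ := by
  simp only [drawPair, PMF.expect_bind, PMF.expect_map]
  have h3 : ∀ l₁ : List (BitVec w), (drawWords w r₂).expect
      (fun l₂ => if hashWord l₁ z = 0#w ∧ hashWord l₂ z = 0#w then (1 : ℝ≥0∞) else 0) ≤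
      (2 ^ r₂)⁻¹ * (if hashWord l₁ z = 0#w then 1 else 0) := by
    intro l₁
    by_cases h : hashWord l₁ z = 0#w
    · simp only [h, true_and, if_true, mul_one]; exact expect_hashWord_eq_zero hz h2
    · simp [h, PMF.expect_const]
  refine (PMF.expect_mono _ fun l₁ _ => h3 l₁).trans ?_
  rw [PMF.expect_const_mul, pow_add, ENNReal.mul_inv (by simp) (by simp), mul_comm]
  gcongr
  exact expect_hashWord_eq_zero hz h1

end WordRAM

/-! ### Distributing the elements to buckets -/

section Buckets

variable (h₁ h₂ : ℕ → ℕ) (cap : ℕ)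

/-- The element `k` cannot be added to `G`: its two hash values occur already, or its bucket is
full. -/
def IsBad (G : List ℕ) (k : ℕ) : Prop :=
  (∃ g ∈ G, h₁ g = h₁ k ∧ h₂ g = h₂ k) ∨ cap ≤ (G.filter (h₁ · = h₁ k)).length

open Classical in
/-- The elements that have been put into buckets, in the order of insertion, when the elements
of a list are treated from the last one to the first one. -/
noncomputable def goodList : List ℕ → List ℕ
  | [] => []
  | k :: l => if IsBad h₁ h₂ cap (goodList l) k then goodList l else goodList l ++ [k]

/-- The element in position `p` of bucket `u`. -/
noncomputable def slotOf (G : List ℕ) (u p : ℕ) : Option ℕ := (G.filter (h₁ · = u))[p]?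

/-- The elements that have been put into buckets when the elements `n - 1, …, j` have been treated.
-/
noncomputable def goodAfter (n j : ℕ) : List ℕ := goodList h₁ h₂ cap (List.range' j (n - j))

variable {h₁ h₂ cap}

theorem mem_of_mem_goodList {l : List ℕ} {k : ℕ} (h : k ∈ goodList h₁ h₂ cap l) : k ∈ l := by
  induction l with
  | nil => simp [goodList] at h
  | cons j l ih =>
    rw [goodList] at h
    split_ifs at h
    · exact List.mem_cons_of_mem _ (ih h)
    · rcases List.mem_append.1 h with h | h
      · exact List.mem_cons_of_mem _ (ih h)
      · simp at h; simp [h]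

theorem goodList_pairwise (l : List ℕ) :
    (goodList h₁ h₂ cap l).Pairwise fun a b => ¬ (h₁ a = h₁ b ∧ h₂ a = h₂ b) := by
  induction l with
  | nil => simp [goodList]
  | cons j l ih =>
    rw [goodList]
    split_ifs with hb
    · exact ih
    · rw [List.pairwise_append]
      refine ⟨ih, List.pairwise_singleton _ _, fun a ha b hb' h => hb (.inl ⟨a, ha, ?_⟩)⟩
      rw [List.mem_singleton] at hb'
      rwa [← hb']

theorem length_filter_goodList_le (l : List ℕ) (u : ℕ) :
    ((goodList h₁ h₂ cap l).filter (h₁ · = u)).length ≤ cap := by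
  induction l with
  | nil => simp [goodList]
  | cons j l ih =>
    rw [goodList]
    split_ifs with hb
    · exact ih
    · rw [List.filter_append, List.length_append]
      by_cases hu : h₁ j = u
      · have : ¬ cap ≤ ((goodList h₁ h₂ cap l).filter (h₁ · = h₁ j)).length := fun h => hb (.inr h)
        rw [hu] at this
        simp [hu]; omega
      · simpa [hu] using ih

theorem goodAfter_self (n : ℕ) : goodAfter h₁ h₂ cap n n = [] := by simp [goodAfter, goodList]

open Classical in
theorem goodAfter_eq {n j : ℕ} (hj : j < n) : goodAfter h₁ h₂ cap n j =
    if IsBad h₁ h₂ cap (goodAfter h₁ h₂ cap n (j + 1)) j then goodAfter h₁ h₂ cap n (j + 1)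
    else goodAfter h₁ h₂ cap n (j + 1) ++ [j] := by
  rw [goodAfter, show n - j = n - (j + 1) + 1 by omega, List.range'_succ, goodList]; rfl

theorem mem_goodAfter {n j k : ℕ} (h : k ∈ goodAfter h₁ h₂ cap n j) : j ≤ k ∧ k < n := by
  have := mem_of_mem_goodList h
  rw [List.mem_range'_1] at this
  omega

theorem slotOf_spec {n u p k : ℕ} (h : slotOf h₁ (goodAfter h₁ h₂ cap n 0) u p = some k) :
    k < n ∧ h₁ k = u := by
  have := List.mem_of_getElem? h
  rw [List.mem_filter] at this
  exact ⟨(mem_goodAfter this.1).2, by simpa using this.2⟩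

/-- Different elements of a bucket have different second hash values. -/
theorem slotOf_injective {n u p p' k k' : ℕ}
    (h : slotOf h₁ (goodAfter h₁ h₂ cap n 0) u p = some k)
    (h' : slotOf h₁ (goodAfter h₁ h₂ cap n 0) u p' = some k') (hk : h₂ k = h₂ k') : p = p' := by
  have hu := (slotOf_spec h).2.trans (slotOf_spec h').2.symm
  have hp := ((goodList_pairwise (h₁ := h₁) (h₂ := h₂) (cap := cap)
    (List.range' 0 (n - 0))).filter (h₁ · = u))
  rw [List.pairwise_iff_getElem] at hp
  unfold slotOf at h h'
  obtain ⟨h1, h2⟩ := List.getElem?_eq_some_iff.1 h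
  obtain ⟨h3, h4⟩ := List.getElem?_eq_some_iff.1 h'
  rcases lt_trichotomy p p' with hlt | heq | hlt
  · exact absurd ⟨by erw [h2, h4]; exact hu, by erw [h2, h4]; exact hk⟩ (hp p p' h1 h3 hlt)
  · exact heq
  · exact absurd ⟨by erw [h2, h4]; exact hu.symm, by erw [h2, h4]; exact hk.symm⟩
      (hp p' p h3 h1 hlt)

theorem exists_slotOf {n k : ℕ} (h : k ∈ goodAfter h₁ h₂ cap n 0) :
    ∃ p < cap, slotOf h₁ (goodAfter h₁ h₂ cap n 0) (h₁ k) p = some k := by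
  have : k ∈ (goodAfter h₁ h₂ cap n 0).filter (h₁ · = h₁ k) := by simp [h]
  obtain ⟨p, hp, hk⟩ := List.getElem_of_mem this
  refine ⟨p, hp.trans_le (length_filter_goodList_le _ _), ?_⟩
  unfold slotOf
  rw [List.getElem?_eq_getElem hp, hk]

end Buckets

/-! ### Counting the elements that do not find a place -/

section Counting

open Classical in
/-- The number of elements that are not put into buckets. -/
noncomputable def badCount (h₁ h₂ : ℕ → ℕ) (cap n : ℕ) : ℕ :=
  ((Finset.range n).filter fun j => IsBad h₁ h₂ cap (goodAfter h₁ h₂ cap n (j + 1)) j).card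

/-- The number of pairs with the same value. -/
def collisions (h : ℕ → ℕ) (n : ℕ) : ℕ :=
  ((Finset.range n ×ˢ Finset.range n).filter fun p => h p.1 = h p.2).card

/-- The number of pairs of different elements for which both values agree. -/
def doubleCollisions (h₁ h₂ : ℕ → ℕ) (n : ℕ) : ℕ :=
  ((Finset.range n ×ˢ Finset.range n).filter
    fun p => p.1 ≠ p.2 ∧ h₁ p.1 = h₁ p.2 ∧ h₂ p.1 = h₂ p.2).card

/-- The number of elements whose buckets exceed the capacity. -/
def overfull (h : ℕ → ℕ) (cap n : ℕ) : ℕ :=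
  ((Finset.range n).filter fun j => cap ≤ ((Finset.range n).filter fun g => h g = h j).card).card

/-- An element without a place has its two hash values in common with another element, or belongs to
an overfull bucket. -/
theorem badCount_le (h₁ h₂ : ℕ → ℕ) (cap n : ℕ) :
    badCount h₁ h₂ cap n ≤ doubleCollisions h₁ h₂ n + overfull h₁ cap n := by
  classical
  unfold badCount
  refine (Finset.card_le_card (t := ((Finset.range n ×ˢ Finset.range n).filter
    fun p => p.1 ≠ p.2 ∧ h₁ p.1 = h₁ p.2 ∧ h₂ p.1 = h₂ p.2).image Prod.snd ∪
    (Finset.range n).filter fun j => cap ≤ ((Finset.range n).filter fun g => h₁ g = h₁ j).card)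
    ?_).trans ((Finset.card_union_le _ _).trans (add_le_add Finset.card_image_le le_rfl))
  intro j hj
  rw [Finset.mem_filter, Finset.mem_range] at hj
  rw [Finset.mem_union]
  obtain ⟨hj, ⟨g, hg, h⟩ | h⟩ := hj
  · have := mem_goodAfter hg
    refine .inl (Finset.mem_image.2 ⟨(g, j), ?_, rfl⟩)
    simp only [Finset.mem_filter, Finset.mem_product, Finset.mem_range]
    exact ⟨⟨this.2, hj⟩, by omega, h⟩
  · refine .inr (Finset.mem_filter.2 ⟨Finset.mem_range.2 hj, h.trans ?_⟩)
    have hnd : ((goodAfter h₁ h₂ cap n (j + 1)).filter (h₁ · = h₁ j)).Nodup := by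
      refine List.Nodup.filter _ ?_
      exact (goodList_pairwise _).imp fun {a b} h (hab : a = b) => h (by rw [hab]; exact ⟨rfl, rfl⟩)
    rw [← List.toFinset_card_of_nodup hnd]
    refine Finset.card_le_card fun g hg => ?_
    simp only [List.mem_toFinset, List.mem_filter, decide_eq_true_eq] at hg
    simp only [Finset.mem_filter, Finset.mem_range]
    exact ⟨(mem_goodAfter hg.1).2, hg.2⟩

/-- A second moment bound: a bucket of at least twice the average size contributes to the variance
of the bucket sizes at least in proportion to its size. -/
theorem overfull_le {h : ℕ → ℕ} {cap n R : ℕ} (hR : ∀ k < n, h k < R) (hcap : 2 * n ≤ R * cap) :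
    n * overfull h cap n + 2 * n ^ 2 ≤ 2 * R * collisions h n := by
  set c : ℕ → ℕ := fun u => ((Finset.range n).filter fun g => h g = u).card with hc
  have hmaps : ∀ k ∈ Finset.range n, h k ∈ Finset.range R :=
    fun k hk => Finset.mem_range.2 (hR k (Finset.mem_range.1 hk))
  have h1 : ∑ u ∈ Finset.range R, c u = n := by
    rw [← Finset.card_eq_sum_card_fiberwise hmaps, Finset.card_range]
  have h2 : collisions h n = ∑ u ∈ Finset.range R, c u ^ 2 := by
    rw [collisions, Finset.card_eq_sum_card_fiberwise (f := fun p => h p.1) (t := Finset.range R)]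
    · refine Finset.sum_congr rfl fun u _ => ?_
      rw [hc, sq, ← Finset.card_product]
      congr 1
      ext ⟨a, b⟩
      simp only [Finset.mem_filter, Finset.mem_product]
      constructor
      · rintro ⟨⟨⟨h3, h4⟩, h5⟩, h6⟩; exact ⟨⟨h3, h6⟩, h4, h5 ▸ h6⟩
      · rintro ⟨⟨h3, h4⟩, h5, h6⟩; exact ⟨⟨⟨h3, h5⟩, h4.trans h6.symm⟩, h4⟩
    · intro p hp
      simp only [Finset.coe_filter, Finset.mem_product, Set.mem_ofPred_eq] at hp
      exact hmaps _ hp.1.1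
  have h3 : overfull h cap n = ∑ u ∈ Finset.range R, if cap ≤ c u then c u else 0 := by
    rw [overfull, Finset.card_eq_sum_card_fiberwise (f := h) (t := Finset.range R)]
    · refine Finset.sum_congr rfl fun u _ => ?_
      rw [Finset.filter_filter]
      split_ifs with hu
      · congr 1
        ext k
        simp only [Finset.mem_filter]
        exact ⟨fun h => ⟨h.1, h.2.2⟩, fun h => ⟨h.1, by rw [h.2]; exact hu, h.2⟩⟩
      · rw [Finset.card_eq_zero, Finset.filter_eq_empty_iff]
        rintro k - ⟨h4, rfl⟩
        exact hu h4
    · intro p hp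
      exact hmaps _ (Finset.mem_filter.1 hp).1
  -- With `x = R * c u` this is `2 * (x - n) ^ 2 ≥ n * x` for `x ≥ 2 * n`, and
  -- `2 * (x - n) ^ 2 ≥ 0` otherwise.
  have h4 : ∀ u, R * n * (if cap ≤ c u then c u else 0) + 4 * n * R * c u ≤
      2 * R ^ 2 * c u ^ 2 + 2 * n ^ 2 := by
    intro u
    split_ifs with hu
    · have : 2 * n ≤ R * c u := hcap.trans (Nat.mul_le_mul_left _ hu)
      zify at this ⊢
      nlinarith
    · zify
      nlinarith [sq_nonneg ((R : ℤ) * c u - n)]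
  have h5 := Finset.sum_le_sum fun u (_ : u ∈ Finset.range R) => h4 u
  rw [Finset.sum_add_distrib, Finset.sum_add_distrib, ← Finset.mul_sum, ← Finset.mul_sum,
    ← Finset.mul_sum, ← h2, ← h3, h1, Finset.sum_const, Finset.card_range, smul_eq_mul] at h5
  rcases Nat.eq_zero_or_pos R with rfl | hRpos
  · rcases Nat.eq_zero_or_pos n with rfl | hn
    · simp
    · exact absurd (hR 0 hn) (by simp)
  · refine Nat.le_of_mul_le_mul_left ?_ hRpos
    nlinarith

end Counting

/-! ### The instance of SetIntersection -/

section Instance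

/-- The element in position `p` of the set number `i` of the first family: the upper half of the
hash value of the element in the bucket `i / 2 ^ s` is shifted by `i % 2 ^ s`.  Empty positions
are filled with elements that occur in this family only. -/
def entryA (s : ℕ) (h₂ : ℕ → ℕ) (slot : ℕ → ℕ → Option ℕ) (i p : ℕ) : ℕ :=
  (slot (i / 2 ^ s) p).elim (2 ^ (2 * s) + p) fun k => h₂ k ^^^ (i % 2 ^ s * 2 ^ s)

/-- The corresponding element of the second family, in which the lower half is shifted. -/
def entryB (s : ℕ) (h₂ : ℕ → ℕ) (slot : ℕ → ℕ → Option ℕ) (i p : ℕ) : ℕ :=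
  (slot (i / 2 ^ s) p).elim (2 * 2 ^ (2 * s) + p) fun k => h₂ k ^^^ (i % 2 ^ s)

/-- The instance for elements `0, …, n - 1` with hash values `h₁ k < 2 ^ r` and
`h₂ k < 2 ^ (2 * s)`, of which some are distributed to buckets of size `2 ^ τ`.  The query number
`k * 2 ^ r + u` is responsible for the sums `a ⊕ b = k` with `a` in bucket `u`. -/
def hashInstance (n r s τ : ℕ) (h₁ h₂ : ℕ → ℕ) (slot : ℕ → ℕ → Option ℕ) :
    SetIntersectionInstance where
  c := 2 ^ (2 * s + 2)
  A := grid (2 ^ (r + s)) (2 ^ τ) (entryA s h₂ slot)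
  B := grid (2 ^ (r + s)) (2 ^ τ) (entryB s h₂ slot)
  Q := (List.range (n * 2 ^ r)).map fun t =>
    (t % 2 ^ r * 2 ^ s + h₂ (t / 2 ^ r) / 2 ^ s,
      (t % 2 ^ r ^^^ h₁ (t / 2 ^ r)) * 2 ^ s + h₂ (t / 2 ^ r) % 2 ^ s)

/-- The assumptions on hash values and buckets: a bucket contains only elements with the
corresponding value of `h₁`, and no two with the same value of `h₂`, so that the sets of the
instance have no repeated elements. -/
structure GoodSlots (n r s τ : ℕ) (h₁ h₂ : ℕ → ℕ) (slot : ℕ → ℕ → Option ℕ) : Prop where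
  le : τ ≤ 2 * s
  lt₁ : ∀ k < n, h₁ k < 2 ^ r
  lt₂ : ∀ k < n, h₂ k < 2 ^ (2 * s)
  mem : ∀ u p k, slot u p = some k → k < n ∧ h₁ k = u
  inj : ∀ u p p' k k', slot u p = some k → slot u p' = some k' → h₂ k = h₂ k' → p = p'

variable {n r s τ : ℕ} {h₁ h₂ : ℕ → ℕ} {slot : ℕ → ℕ → Option ℕ}

theorem xor_mul_two_pow (hi : ℕ) {lo s : ℕ} (h : lo < 2 ^ s) :
    (hi * 2 ^ s) ^^^ lo = hi * 2 ^ s + lo := by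
  rw [Nat.mul_comm, Nat.two_pow_add_eq_or_of_lt h]
  apply Nat.eq_of_testBit_eq
  intro i
  rw [Nat.testBit_xor, Nat.testBit_or, Nat.testBit_two_pow_mul]
  by_cases his : s ≤ i
  · rw [Nat.testBit_lt_two_pow (h.trans_le (Nat.pow_le_pow_right (by norm_num) his))]; simp
  · simp [his]

theorem xor_eq_xor_iff {a b x y : ℕ} : a ^^^ x = b ^^^ y ↔ a ^^^ b = x ^^^ y := by
  constructor
  · intro h
    have := congrArg (fun z => z ^^^ b ^^^ x) h
    calc a ^^^ b = a ^^^ x ^^^ b ^^^ x := by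
          rw [Nat.xor_right_comm a x b, Nat.xor_assoc, Nat.xor_self, Nat.xor_zero]
      _ = b ^^^ y ^^^ b ^^^ x := this
      _ = x ^^^ y := by
          rw [Nat.xor_right_comm b y b, Nat.xor_self, Nat.zero_xor, Nat.xor_comm]
  · intro h
    have := congrArg (fun z => z ^^^ b ^^^ x) h
    calc a ^^^ x = a ^^^ b ^^^ b ^^^ x := by rw [Nat.xor_assoc a b b, Nat.xor_self, Nat.xor_zero]
      _ = x ^^^ y ^^^ b ^^^ x := this
      _ = b ^^^ y := by
          rw [Nat.xor_assoc x y b, Nat.xor_comm x, Nat.xor_assoc, Nat.xor_self, Nat.xor_zero,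
            Nat.xor_comm]

theorem two_pow_two_mul (s : ℕ) : 2 ^ (2 * s) = 2 ^ s * 2 ^ s := by rw [two_mul, pow_add]

theorem GoodSlots.hi_lt (h : GoodSlots n r s τ h₁ h₂ slot) {k : ℕ} (hk : k < n) :
    h₂ k / 2 ^ s < 2 ^ s :=
  Nat.div_lt_of_lt_mul (by rw [← two_pow_two_mul]; exact h.lt₂ k hk)

theorem shift_lt {x y s : ℕ} (hx : x < 2 ^ (2 * s)) (hy : y < 2 ^ s) :
    x ^^^ (y * 2 ^ s) < 2 ^ (2 * s) := by
  refine Nat.xor_lt_two_pow hx ?_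
  rw [two_pow_two_mul]
  exact Nat.mul_lt_mul_of_pos_right hy (by positivity)

theorem shift_lt' {x y s : ℕ} (hx : x < 2 ^ (2 * s)) (hy : y < 2 ^ s) :
    x ^^^ y < 2 ^ (2 * s) :=
  Nat.xor_lt_two_pow hx (hy.trans_le (Nat.pow_le_pow_right (by norm_num) (by omega)))

/-- Elements of the first family that fill empty positions lie in `[2 ^ (2 * s), 2 * 2 ^ (2 * s))`;
all the others are smaller. -/
theorem GoodSlots.entryA_lt (h : GoodSlots n r s τ h₁ h₂ slot) (i : ℕ) {p : ℕ} (hp : p < 2 ^ τ) :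
    entryA s h₂ slot i p < 2 * 2 ^ (2 * s) ∧
      (slot (i / 2 ^ s) p = none ↔ 2 ^ (2 * s) ≤ entryA s h₂ slot i p) := by
  have h1 : 2 ^ τ ≤ 2 ^ (2 * s) := Nat.pow_le_pow_right (by norm_num) h.le
  have h2 : i % 2 ^ s < 2 ^ s := Nat.mod_lt _ (by positivity)
  unfold entryA
  cases hs : slot (i / 2 ^ s) p with
  | none => simp; omega
  | some k =>
    have := shift_lt (h.lt₂ k (h.mem _ _ _ hs).1) h2
    simp; omega

/-- Elements of the second family that fill empty positions are at least `2 * 2 ^ (2 * s)`, so they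
do not occur in the first family; all the others are less than `2 ^ (2 * s)`. -/
theorem GoodSlots.entryB_lt (h : GoodSlots n r s τ h₁ h₂ slot) (i : ℕ) {p : ℕ} (hp : p < 2 ^ τ) :
    entryB s h₂ slot i p < 4 * 2 ^ (2 * s) ∧
      (slot (i / 2 ^ s) p = none → 2 * 2 ^ (2 * s) ≤ entryB s h₂ slot i p) ∧
      (slot (i / 2 ^ s) p ≠ none → entryB s h₂ slot i p < 2 ^ (2 * s)) := by
  have h1 : 2 ^ τ ≤ 2 ^ (2 * s) := Nat.pow_le_pow_right (by norm_num) h.le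
  have h2 : i % 2 ^ s < 2 ^ s := Nat.mod_lt _ (by positivity)
  unfold entryB
  cases hs : slot (i / 2 ^ s) p with
  | none => simp; omega
  | some k =>
    have := shift_lt' (h.lt₂ k (h.mem _ _ _ hs).1) h2
    simp; omega

theorem GoodSlots.entryA_inj (h : GoodSlots n r s τ h₁ h₂ slot) {i p p' : ℕ} (hp : p < 2 ^ τ)
    (hp' : p' < 2 ^ τ) (he : entryA s h₂ slot i p = entryA s h₂ slot i p') : p = p' := by
  have h1 := (h.entryA_lt i hp).2
  have h2 := (h.entryA_lt i hp').2
  rw [← he, ← h1] at h2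
  cases hs : slot (i / 2 ^ s) p with
  | none =>
    have hs' := h2.2 hs
    simp only [entryA, hs, hs', Option.elim] at he
    omega
  | some k =>
    cases hs' : slot (i / 2 ^ s) p' with
    | none => rw [h2.1 hs'] at hs; cases hs
    | some k' =>
      simp only [entryA, hs, hs', Option.elim] at he
      exact h.inj _ _ _ _ _ hs hs' (Nat.xor_left_injective he)

theorem GoodSlots.entryB_inj (h : GoodSlots n r s τ h₁ h₂ slot) {i p p' : ℕ} (hp : p < 2 ^ τ)
    (hp' : p' < 2 ^ τ) (he : entryB s h₂ slot i p = entryB s h₂ slot i p') : p = p' := by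
  obtain ⟨-, h1, h1'⟩ := h.entryB_lt i hp
  obtain ⟨-, h2, h2'⟩ := h.entryB_lt i hp'
  have hpos : 0 < 2 ^ (2 * s) := by positivity
  cases hs : slot (i / 2 ^ s) p with
  | none =>
    cases hs' : slot (i / 2 ^ s) p' with
    | none => simp only [entryB, hs, hs', Option.elim] at he; omega
    | some k' =>
      have := h1 hs
      have := h2' (by simp [hs'])
      omega
  | some k =>
    cases hs' : slot (i / 2 ^ s) p' with
    | none =>
      have := h1' (by simp [hs])
      have := h2 hs'
      omega
    | some k' =>
      simp only [entryB, hs, hs', Option.elim] at he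
      exact h.inj _ _ _ _ _ hs hs' (Nat.xor_left_injective he)

theorem query_lt {u v r s : ℕ} (hu : u < 2 ^ r) (hv : v < 2 ^ s) : u * 2 ^ s + v < 2 ^ (r + s) := by
  rw [pow_add]
  calc u * 2 ^ s + v < u * 2 ^ s + 2 ^ s := by omega
    _ = (u + 1) * 2 ^ s := by ring
    _ ≤ _ := Nat.mul_le_mul_right _ hu

theorem query_div {u v s : ℕ} (hv : v < 2 ^ s) : (u * 2 ^ s + v) / 2 ^ s = u := by
  rw [Nat.mul_comm, Nat.mul_add_div (by positivity), Nat.div_eq_of_lt hv, add_zero]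

theorem query_mod {u v s : ℕ} (hv : v < 2 ^ s) : (u * 2 ^ s + v) % 2 ^ s = v := by
  rw [Nat.mul_comm, Nat.mul_add_mod, Nat.mod_eq_of_lt hv]

theorem GoodSlots.valid (h : GoodSlots n r s τ h₁ h₂ slot) :
    (hashInstance n r s τ h₁ h₂ slot).Valid := by
  have hc : 2 ^ (2 * s + 2) = 4 * 2 ^ (2 * s) := by rw [pow_add]; omega
  constructor
  · intro S hS
    simp only [hashInstance, List.mem_append, mem_grid] at hS
    rcases hS with ⟨i, -, rfl⟩ | ⟨i, -, rfl⟩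
    · refine ⟨?_, fun x hx => ?_⟩
      · refine List.Nodup.map_on (fun p hp p' hp' he => ?_) List.nodup_range
        exact h.entryA_inj (List.mem_range.1 hp) (List.mem_range.1 hp') he
      · obtain ⟨p, hp, rfl⟩ := List.mem_map.1 hx
        have := (h.entryA_lt i (List.mem_range.1 hp)).1
        simp only [hashInstance]; omega
    · refine ⟨?_, fun x hx => ?_⟩
      · refine List.Nodup.map_on (fun p hp p' hp' he => ?_) List.nodup_range
        exact h.entryB_inj (List.mem_range.1 hp) (List.mem_range.1 hp') he
      · obtain ⟨p, hp, rfl⟩ := List.mem_map.1 hx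
        have := (h.entryB_lt i (List.mem_range.1 hp)).1
        simp only [hashInstance]; omega
  · intro q hq
    simp only [hashInstance, List.mem_map, List.mem_range] at hq
    obtain ⟨t, ht, rfl⟩ := hq
    have hk : t / 2 ^ r < n := Nat.div_lt_of_lt_mul (by rwa [Nat.mul_comm])
    have hu : t % 2 ^ r < 2 ^ r := Nat.mod_lt _ (by positivity)
    simp only [hashInstance, length_grid]
    exact ⟨query_lt hu (h.hi_lt hk), query_lt (Nat.xor_lt_two_pow hu (h.lt₁ _ hk))
      (Nat.mod_lt _ (by positivity))⟩

theorem hashInstance_left {t : ℕ} (ht : t < n * 2 ^ r) (h : GoodSlots n r s τ h₁ h₂ slot) :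
    (hashInstance n r s τ h₁ h₂ slot).left t = (List.range (2 ^ τ)).map
      (entryA s h₂ slot (t % 2 ^ r * 2 ^ s + h₂ (t / 2 ^ r) / 2 ^ s)) := by
  have hk : t / 2 ^ r < n := Nat.div_lt_of_lt_mul (by rwa [Nat.mul_comm])
  have hu : t % 2 ^ r < 2 ^ r := Nat.mod_lt _ (by positivity)
  have hQ : (hashInstance n r s τ h₁ h₂ slot).Q.getD t (0, 0) =
      (t % 2 ^ r * 2 ^ s + h₂ (t / 2 ^ r) / 2 ^ s,
      (t % 2 ^ r ^^^ h₁ (t / 2 ^ r)) * 2 ^ s + h₂ (t / 2 ^ r) % 2 ^ s) := by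
    rw [List.getD_eq_getElem _ _ (by simpa [hashInstance] using ht)]; simp [hashInstance]
  rw [SetIntersectionInstance.left, hQ]
  exact getD_grid (query_lt hu (h.hi_lt hk)) _ _

theorem hashInstance_right {t : ℕ} (ht : t < n * 2 ^ r) (h : GoodSlots n r s τ h₁ h₂ slot) :
    (hashInstance n r s τ h₁ h₂ slot).right t = (List.range (2 ^ τ)).map
      (entryB s h₂ slot ((t % 2 ^ r ^^^ h₁ (t / 2 ^ r)) * 2 ^ s + h₂ (t / 2 ^ r) % 2 ^ s)) := by
  have hk : t / 2 ^ r < n := Nat.div_lt_of_lt_mul (by rwa [Nat.mul_comm])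
  have hu : t % 2 ^ r < 2 ^ r := Nat.mod_lt _ (by positivity)
  have hQ : (hashInstance n r s τ h₁ h₂ slot).Q.getD t (0, 0) =
      (t % 2 ^ r * 2 ^ s + h₂ (t / 2 ^ r) / 2 ^ s,
      (t % 2 ^ r ^^^ h₁ (t / 2 ^ r)) * 2 ^ s + h₂ (t / 2 ^ r) % 2 ^ s) := by
    rw [List.getD_eq_getElem _ _ (by simpa [hashInstance] using ht)]; simp [hashInstance]
  rw [SetIntersectionInstance.right, hQ]
  exact getD_grid (query_lt (Nat.xor_lt_two_pow hu (h.lt₁ _ hk)) (Nat.mod_lt _ (by positivity))) _ _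

/-- The triples of elements that are consistent with the hash values. -/
def hashTriples (n : ℕ) (h₁ h₂ : ℕ → ℕ) : Finset (ℕ × ℕ × ℕ) :=
  (Finset.range n ×ˢ Finset.range n ×ˢ Finset.range n).filter fun q =>
    h₁ q.2.1 ^^^ h₁ q.2.2 = h₁ q.1 ∧ h₂ q.2.1 ^^^ h₂ q.2.2 = h₂ q.1

/-- Every element of an intersection comes from a triple of elements that is consistent with the
hash values. -/
theorem GoodSlots.outputSize_le (h : GoodSlots n r s τ h₁ h₂ slot) :
    (hashInstance n r s τ h₁ h₂ slot).outputSize ≤ (hashTriples n h₁ h₂).card := by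
  refine (Finset.card_le_card (t := (hashTriples n h₁ h₂).image fun q =>
    (q.1 * 2 ^ r + h₁ q.2.1, h₂ q.2.1 ^^^ (h₂ q.1 / 2 ^ s * 2 ^ s))) ?_).trans Finset.card_image_le
  rintro ⟨t, x⟩ hx
  simp only [answers, Finset.mem_filter, Finset.mem_product, Finset.mem_range] at hx
  obtain ⟨⟨ht, -⟩, hl, hr⟩ := hx
  have ht : t < n * 2 ^ r := by simpa [hashInstance] using ht
  have hk : t / 2 ^ r < n := Nat.div_lt_of_lt_mul (by rwa [Nat.mul_comm])
  have hu : t % 2 ^ r < 2 ^ r := Nat.mod_lt _ (by positivity)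
  have hpos : 0 < 2 ^ (2 * s) := by positivity
  have hmod : h₂ (t / 2 ^ r) % 2 ^ s < 2 ^ s := Nat.mod_lt _ (by positivity)
  rw [hashInstance_left ht h, List.mem_map] at hl
  rw [hashInstance_right ht h, List.mem_map] at hr
  obtain ⟨p, hp, hpx⟩ := hl
  obtain ⟨p', hp', hpx'⟩ := hr
  have hA := h.entryA_lt (t % 2 ^ r * 2 ^ s + h₂ (t / 2 ^ r) / 2 ^ s) (List.mem_range.1 hp)
  have hB := h.entryB_lt ((t % 2 ^ r ^^^ h₁ (t / 2 ^ r)) * 2 ^ s + h₂ (t / 2 ^ r) % 2 ^ s)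
    (List.mem_range.1 hp')
  rw [hpx] at hA
  rw [hpx'] at hB
  simp only [entryA, query_div (h.hi_lt hk), query_mod (h.hi_lt hk)] at hpx hA
  simp only [entryB, query_div hmod, query_mod hmod] at hpx' hB
  cases ha : slot (t % 2 ^ r) p with
  | none =>
    have h1 := hA.2.1 ha
    cases hb : slot (t % 2 ^ r ^^^ h₁ (t / 2 ^ r)) p' with
    | none => have := hB.2.1 hb; omega
    | some b => have := hB.2.2 (by simp [hb]); omega
  | some a =>
    cases hb : slot (t % 2 ^ r ^^^ h₁ (t / 2 ^ r)) p' with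
    | none =>
      have := hB.2.1 hb
      have := hA.2.not.1 (by simp [ha])
      omega
    | some b =>
      rw [ha, Option.elim] at hpx
      rw [hb, Option.elim] at hpx'
      obtain ⟨ha1, ha2⟩ := h.mem _ _ _ ha
      obtain ⟨hb1, hb2⟩ := h.mem _ _ _ hb
      refine Finset.mem_image.2 ⟨(t / 2 ^ r, a, b), ?_, ?_⟩
      · simp only [hashTriples, Finset.mem_filter, Finset.mem_product, Finset.mem_range]
        refine ⟨⟨hk, ha1, hb1⟩, ?_, ?_⟩
        · rw [ha2, hb2, ← Nat.xor_assoc, Nat.xor_self, Nat.zero_xor]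
        · rw [xor_eq_xor_iff.1 (hpx.trans hpx'.symm), xor_mul_two_pow _ hmod, Nat.div_add_mod']
      · simp only [ha2, Nat.div_add_mod', hpx]

/-- A true sum of elements in buckets occurs in the output: for `h₂ a ⊕ h₂ b = h₂ k`, shifting `h₂
a` by the upper half of `h₂ k` and `h₂ b` by the lower half gives the same number. -/
theorem GoodSlots.mem_answers (h : GoodSlots n r s τ h₁ h₂ slot) {k a b p p' : ℕ} (hk : k < n)
    (hp : p < 2 ^ τ) (hp' : p' < 2 ^ τ) (ha : slot (h₁ a) p = some a)
    (hb : slot (h₁ b) p' = some b) (hab₁ : h₁ a ^^^ h₁ b = h₁ k) (hab₂ : h₂ a ^^^ h₂ b = h₂ k) :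
    (k * 2 ^ r + h₁ a, h₂ a ^^^ (h₂ k / 2 ^ s * 2 ^ s)) ∈
      (hashInstance n r s τ h₁ h₂ slot).answers := by
  have ha1 := h.lt₁ a (h.mem _ _ _ ha).1
  have ht : k * 2 ^ r + h₁ a < n * 2 ^ r := by
    calc k * 2 ^ r + h₁ a < k * 2 ^ r + 2 ^ r := by omega
      _ = (k + 1) * 2 ^ r := by ring
      _ ≤ _ := Nat.mul_le_mul_right _ hk
  have hmod : h₂ k % 2 ^ s < 2 ^ s := Nat.mod_lt _ (by positivity)
  simp only [answers, Finset.mem_filter, Finset.mem_product, Finset.mem_range]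
  rw [hashInstance_left ht h, hashInstance_right ht h, query_div ha1, query_mod ha1]
  refine ⟨⟨by simpa [hashInstance] using ht, ?_⟩, ?_, ?_⟩
  · simp only [hashInstance]
    refine (shift_lt (h.lt₂ a (h.mem _ _ _ ha).1) (h.hi_lt hk)).trans_le ?_
    exact Nat.pow_le_pow_right (by norm_num) (by omega)
  · refine List.mem_map.2 ⟨p, List.mem_range.2 hp, ?_⟩
    rw [entryA, query_div (h.hi_lt hk), query_mod (h.hi_lt hk), ha, Option.elim]
  · refine List.mem_map.2 ⟨p', List.mem_range.2 hp', ?_⟩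
    rw [entryB, query_div hmod, query_mod hmod, ← hab₁, ← Nat.xor_assoc, Nat.xor_self,
      Nat.zero_xor, hb, Option.elim]
    refine (xor_eq_xor_iff.2 ?_).symm
    rw [hab₂, xor_mul_two_pow _ hmod, Nat.div_add_mod']

theorem goodSlots_none (hτ : τ ≤ 2 * s) :
    GoodSlots n r s τ (fun _ => 0) (fun _ => 0) (fun _ _ => none) :=
  ⟨hτ, fun _ _ => by positivity, fun _ _ => by positivity, by simp, by simp⟩

/-- With empty buckets, all intersections are empty. -/
theorem hashInstance_none_answers (hτ : τ ≤ 2 * s) :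
    (hashInstance n r s τ (fun _ => 0) (fun _ => 0) (fun _ _ => none)).answers = ∅ := by
  have h := goodSlots_none (n := n) (r := r) hτ
  rw [Finset.eq_empty_iff_forall_notMem]
  rintro ⟨t, x⟩ hx
  simp only [answers, Finset.mem_filter, Finset.mem_product, Finset.mem_range] at hx
  obtain ⟨⟨ht, -⟩, hl, hr⟩ := hx
  have ht : t < n * 2 ^ r := by simpa [hashInstance] using ht
  rw [hashInstance_left ht h, List.mem_map] at hl
  rw [hashInstance_right ht h, List.mem_map] at hr
  obtain ⟨p, hp, rfl⟩ := hl
  obtain ⟨p', hp', hpx'⟩ := hr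
  have h1 : 2 ^ τ ≤ 2 ^ (2 * s) := Nat.pow_le_pow_right (by norm_num) hτ
  have := List.mem_range.1 hp
  simp only [entryA, entryB, Option.elim] at hpx'
  omega

theorem goodSlots_slotOf (hτ : τ ≤ 2 * s) (hl₁ : ∀ k < n, h₁ k < 2 ^ r)
    (hl₂ : ∀ k < n, h₂ k < 2 ^ (2 * s)) :
    GoodSlots n r s τ h₁ h₂ (slotOf h₁ (goodAfter h₁ h₂ (2 ^ τ) n 0)) :=
  ⟨hτ, hl₁, hl₂, fun _ _ _ h => slotOf_spec h, fun _ _ _ _ _ h h' hk => slotOf_injective h h' hk⟩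

end Instance

/-! ### Expectations over the hash functions -/

namespace WordRAM

variable {w : ℕ}

/-- The hash value of the element number `k` of a list, as a number. -/
def hashValue (X : List (BitVec w)) (l : List (BitVec w)) (k : ℕ) : ℕ :=
  (hashWord l (X.getD k 0#w)).toNat

theorem hashValue_lt (X : List (BitVec w)) {l : List (BitVec w)} (hl : l.length ≤ w) (k : ℕ) :
    hashValue X l k < 2 ^ l.length := (toNat_hashWord l hl _).1

theorem hashValue_eq_iff {X l : List (BitVec w)} {i j : ℕ} :
    hashValue X l i = hashValue X l j ↔ hashWord l (X.getD i 0#w ^^^ X.getD j 0#w) = 0#w := by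
  rw [hashValue, hashValue, ← BitVec.toNat_eq, hashWord_xor, BitVec.xor_eq_zero_iff]

theorem hashValue_xor_eq_iff {X l : List (BitVec w)} {k a b : ℕ} :
    hashValue X l a ^^^ hashValue X l b = hashValue X l k ↔
      hashWord l (X.getD a 0#w ^^^ X.getD b 0#w ^^^ X.getD k 0#w) = 0#w := by
  rw [hashValue, hashValue, hashValue, ← BitVec.toNat_xor, ← BitVec.toNat_eq, hashWord_xor,
    hashWord_xor, BitVec.xor_eq_zero_iff]

theorem getD_xor_ne_zero {X : List (BitVec w)} (hX : X.Nodup) {i j : ℕ} (hi : i < X.length)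
    (hj : j < X.length) (hij : i ≠ j) : X.getD i 0#w ^^^ X.getD j 0#w ≠ 0#w := by
  rw [Ne, BitVec.xor_eq_zero_iff, List.getD_eq_getElem _ _ hi, List.getD_eq_getElem _ _ hj,
    hX.getElem_inj_iff]
  exact hij

theorem cast_card_filter {ι : Type*} (s : Finset ι) (p : ι → Prop) [DecidablePred p] :
    ((s.filter p).card : ℝ≥0∞) = ∑ i ∈ s, if p i then 1 else 0 := by
  rw [Finset.card_filter]; push_cast; rfl

variable {X : List (BitVec w)} {r₁ r₂ : ℕ}

theorem expect_doubleCollisions (hX : X.Nodup) (h1 : r₁ ≤ w) (h2 : r₂ ≤ w) :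
    (drawPair w r₁ r₂).expect (fun l => (doubleCollisions (hashValue X l.1) (hashValue X l.2)
      X.length : ℝ≥0∞)) ≤ (X.length : ℝ≥0∞) ^ 2 * (2 ^ (r₁ + r₂))⁻¹ := by
  simp only [doubleCollisions, cast_card_filter]
  rw [PMF.expect_sum]
  refine (Finset.sum_le_card_nsmul _ _ ((2 ^ (r₁ + r₂))⁻¹) ?_).trans (le_of_eq ?_)
  · rintro ⟨i, j⟩ hij
    simp only [Finset.mem_product, Finset.mem_range] at hij
    by_cases h : i = j
    · simp [h, PMF.expect_const]
    · refine le_trans (PMF.expect_mono _ fun l _ => ?_) (expect_drawPair_eq_zero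
        (getD_xor_ne_zero hX hij.1 hij.2 h) h1 h2)
      simp only [hashValue_eq_iff, ne_eq, h, not_false_eq_true, true_and]
      exact le_rfl
  · rw [Finset.card_product, Finset.card_range, nsmul_eq_mul]; push_cast; ring

/-- The expected number of pairs with the same hash value, among them the `n` trivial ones. -/
theorem expect_collisions (hX : X.Nodup) (h1 : r₁ ≤ w) :
    (drawPair w r₁ r₂).expect (fun l => (collisions (hashValue X l.1) X.length : ℝ≥0∞)) ≤
      X.length + (X.length : ℝ≥0∞) ^ 2 * (2 ^ r₁)⁻¹ := by
  rw [expect_drawPair_fst fun l => (collisions (hashValue X l) X.length : ℝ≥0∞)]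
  simp only [collisions, cast_card_filter]
  rw [PMF.expect_sum, Finset.sum_product]
  have h3 : ∀ i ∈ Finset.range X.length, ∑ j ∈ Finset.range X.length,
      (drawWords w r₁).expect (fun l => if hashValue X l i = hashValue X l j then 1 else 0) ≤
      1 + X.length * (2 ^ r₁)⁻¹ := by
    intro i hi
    rw [← Finset.add_sum_erase _ _ hi]
    refine add_le_add (by simp [PMF.expect_const]) ?_
    refine (Finset.sum_le_card_nsmul _ _ ((2 ^ r₁)⁻¹) ?_).trans ?_
    · intro j hj
      rw [Finset.mem_erase, Finset.mem_range] at hj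
      refine le_trans (PMF.expect_mono _ fun l _ => ?_) (expect_hashWord_eq_zero
        (getD_xor_ne_zero hX (Finset.mem_range.1 hi) hj.2 hj.1.symm) h1)
      simp only [hashValue_eq_iff]
      exact le_rfl
    · rw [nsmul_eq_mul]
      gcongr
      exact (Finset.card_erase_le).trans (by simp)
  refine (Finset.sum_le_card_nsmul _ _ _ h3).trans (le_of_eq ?_)
  rw [Finset.card_range, nsmul_eq_mul]; ring

/-- Few elements are not put into buckets: double collisions are counted by linearity of the
expectation, and the elements of overfull buckets by the second moment of the bucket sizes. -/
theorem expect_badCount (hX : X.Nodup) (h1 : r₁ ≤ w) (h2 : r₂ ≤ w) {cap : ℕ}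
    (hcap : 2 * X.length ≤ 2 ^ r₁ * cap) (hn : 0 < X.length) :
    (drawPair w r₁ r₂).expect (fun l => (badCount (hashValue X l.1) (hashValue X l.2) cap
      X.length : ℝ≥0∞)) ≤ (X.length : ℝ≥0∞) ^ 2 * (2 ^ (r₁ + r₂))⁻¹ + 2 * 2 ^ r₁ := by
  set n := X.length with hndef
  have hover : (drawPair w r₁ r₂).expect (fun l => (overfull (hashValue X l.1) cap n : ℝ≥0∞)) ≤
      2 * 2 ^ r₁ := by
    have h3 : (drawPair w r₁ r₂).expect (fun l => (n : ℝ≥0∞) * overfull (hashValue X l.1) cap n +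
        2 * n ^ 2) ≤ (drawPair w r₁ r₂).expect
        (fun l => 2 * 2 ^ r₁ * (collisions (hashValue X l.1) n : ℝ≥0∞)) := by
      refine PMF.expect_mono _ fun l hl => ?_
      have hl1 := (mem_drawPair hl).1
      have := overfull_le (h := hashValue X l.1) (R := 2 ^ r₁) (cap := cap) (n := n)
        (fun k _ => by have := hashValue_lt X (l := l.1) (by omega) k; rwa [hl1] at this) hcap
      exact_mod_cast this
    rw [PMF.expect_add, PMF.expect_const, PMF.expect_const_mul, PMF.expect_const_mul] at h3
    have h4 := h3.trans (mul_le_mul_right (expect_collisions (r₂ := r₂) hX h1) _)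
    have h5 : (2 * 2 ^ r₁ : ℝ≥0∞) * (n + n ^ 2 * (2 ^ r₁)⁻¹) = n * (2 * 2 ^ r₁) + 2 * n ^ 2 := by
      have : (2 ^ r₁ : ℝ≥0∞) * (2 ^ r₁)⁻¹ = 1 := ENNReal.mul_inv_cancel (by simp) (by simp)
      calc (2 * 2 ^ r₁ : ℝ≥0∞) * (n + n ^ 2 * (2 ^ r₁)⁻¹)
          = n * (2 * 2 ^ r₁) + 2 * n ^ 2 * (2 ^ r₁ * (2 ^ r₁)⁻¹) := by ring
        _ = _ := by rw [this, mul_one]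
    rw [← hndef, h5] at h4
    have h6 := ENNReal.le_of_add_le_add_right (by
      exact ENNReal.mul_ne_top (by simp) (by simp)) h4
    rwa [ENNReal.mul_le_mul_iff_right (by simpa using hn.ne') (by simp)] at h6
  calc (drawPair w r₁ r₂).expect
        (fun l => (badCount (hashValue X l.1) (hashValue X l.2) cap n : ℝ≥0∞))
      ≤ (drawPair w r₁ r₂).expect (fun l => (doubleCollisions (hashValue X l.1) (hashValue X l.2) n
        : ℝ≥0∞) + overfull (hashValue X l.1) cap n) :=
        PMF.expect_mono _ fun l _ => by exact_mod_cast badCount_le _ _ _ _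
    _ ≤ _ := by
        rw [PMF.expect_add]
        exact add_le_add (expect_doubleCollisions hX h1 h2) hover

/-- The pairs of elements whose sum belongs to the list. -/
def sumPairs (X : List (BitVec w)) : Finset (ℕ × ℕ) :=
  (Finset.range X.length ×ˢ Finset.range X.length).filter
    fun p => X.getD p.1 0#w ^^^ X.getD p.2 0#w ∈ X

/-- Apart from the true sums, few triples are consistent with the hash values. -/
theorem expect_hashTriples (hX : X.Nodup) (h1 : r₁ ≤ w) (h2 : r₂ ≤ w) :
    (drawPair w r₁ r₂).expect (fun l => ((hashTriples X.length (hashValue X l.1)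
      (hashValue X l.2)).card : ℝ≥0∞)) ≤
      (sumPairs X).card + (X.length : ℝ≥0∞) ^ 3 * (2 ^ (r₁ + r₂))⁻¹ := by
  set n := X.length with hndef
  set S := Finset.range n ×ˢ Finset.range n ×ˢ Finset.range n with hS
  have h3 : ∀ l : List (BitVec w) × List (BitVec w),
      ((hashTriples n (hashValue X l.1) (hashValue X l.2)).card : ℝ≥0∞) ≤
      (sumPairs X).card + ∑ q ∈ S, if X.getD q.2.1 0#w ^^^ X.getD q.2.2 0#w ^^^ X.getD q.1 0#w ≠ 0#w
        ∧ hashWord l.1 (X.getD q.2.1 0#w ^^^ X.getD q.2.2 0#w ^^^ X.getD q.1 0#w) = 0#w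
        ∧ hashWord l.2 (X.getD q.2.1 0#w ^^^ X.getD q.2.2 0#w ^^^ X.getD q.1 0#w) = 0#w
        then 1 else 0 := by
    intro l
    rw [← cast_card_filter]
    -- The third element of a true sum is determined by the other two.
    have h4 : ((S.filter fun q =>
        X.getD q.2.1 0#w ^^^ X.getD q.2.2 0#w ^^^ X.getD q.1 0#w = 0#w)).card
        ≤ (sumPairs X).card := by
      refine Finset.card_le_card_of_injOn Prod.snd ?_ ?_
      · rintro ⟨k, a, b⟩ hq
        simp only [hS, Finset.coe_filter, Finset.mem_product, Finset.mem_range,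
          Set.mem_ofPred_eq] at hq
        simp only [sumPairs, Finset.coe_filter, Finset.mem_product, Finset.mem_range,
          Set.mem_ofPred_eq]
        refine ⟨hq.1.2, ?_⟩
        rw [BitVec.xor_eq_zero_iff.1 hq.2]
        exact getD_mem hq.1.1 _
      · rintro ⟨k, a, b⟩ hq ⟨k', a', b'⟩ hq' heq
        simp only [hS, Finset.coe_filter, Finset.mem_product, Finset.mem_range,
          Set.mem_ofPred_eq] at hq hq'
        simp only [Prod.mk.injEq] at heq
        obtain ⟨rfl, rfl⟩ := heq
        have h5 := BitVec.xor_eq_zero_iff.1 hq.2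
        rw [BitVec.xor_eq_zero_iff.1 hq'.2, List.getD_eq_getElem _ _ hq.1.1,
          List.getD_eq_getElem _ _ hq'.1.1, hX.getElem_inj_iff] at h5
        rw [h5]
    refine le_trans ?_ (add_le_add_left (Nat.cast_le.2 h4) _)
    norm_cast
    refine (Finset.card_le_card ?_).trans (Finset.card_union_le _ _)
    intro q hq
    simp only [hashTriples, Finset.mem_filter, hashValue_xor_eq_iff] at hq
    rw [Finset.mem_union, Finset.mem_filter, Finset.mem_filter]
    by_cases h0 : X.getD q.2.1 0#w ^^^ X.getD q.2.2 0#w ^^^ X.getD q.1 0#w = 0#w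
    · exact .inl ⟨hq.1, h0⟩
    · exact .inr ⟨hq.1, h0, hq.2⟩
  refine (PMF.expect_mono _ fun l _ => h3 l).trans ?_
  rw [PMF.expect_add, PMF.expect_const, PMF.expect_sum]
  gcongr
  refine (Finset.sum_le_card_nsmul _ _ ((2 ^ (r₁ + r₂))⁻¹) ?_).trans (le_of_eq ?_)
  · intro q _
    by_cases h0 : X.getD q.2.1 0#w ^^^ X.getD q.2.2 0#w ^^^ X.getD q.1 0#w = 0#w
    · simp only [h0, ne_eq, not_true_eq_false, false_and, if_false, PMF.expect_const, zero_le]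
    · refine le_trans (PMF.expect_mono _ fun l _ => ?_) (expect_drawPair_eq_zero h0 h1 h2)
      simp only [ne_eq, h0, not_false_eq_true, true_and]
      exact le_rfl
  · rw [hS, Finset.card_product, Finset.card_product, Finset.card_range, nsmul_eq_mul]
    push_cast; ring

/-! ### Sampling pairs of elements -/

/-- The law of a pair of independent addresses of elements. -/
noncomputable def drawIndices (w n : ℕ) : PMF (BitVec w × BitVec w) :=
  (randWord (BitVec.ofNat w n)).bind fun i => (randWord (BitVec.ofNat w n)).map fun j => (i, j)

theorem expect_randWord_ofNat {n : ℕ} (hn : 0 < n) (hw : n < 2 ^ w) (F : BitVec w → ℝ≥0∞) :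
    (randWord (BitVec.ofNat w n)).expect F =
      (n : ℝ≥0∞)⁻¹ * ∑ i ∈ Finset.range n, F (BitVec.ofNat w i) := by
  have : (BitVec.ofNat w n - 1).toNat + 1 = n := by
    obtain ⟨m, rfl⟩ : ∃ m, n = m + 1 := ⟨n - 1, by omega⟩
    have h := ofNat_sub_one (w := w) m
    rw [show (1 : BitVec w) = BitVec.ofNat w 1 from rfl, h, BitVec.toNat_ofNat,
      Nat.mod_eq_of_lt (by omega)]
  rw [expect_randWord, this]

/-- The pair of addresses `p` does not exhibit a sum that belongs to the list. -/
def Misses (X : List (BitVec w)) (p : BitVec w × BitVec w) : Prop :=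
  ¬ (X.getD p.1.toNat 0#w ∈ X ∧ X.getD p.2.toNat 0#w ∈ X ∧
    X.getD p.1.toNat 0#w ^^^ X.getD p.2.toNat 0#w ∈ X)

instance (X : List (BitVec w)) : DecidablePred (Misses X) := fun _ => by
  unfold Misses; infer_instance

/-- A random pair of addresses exhibits one of the sums with the probability given by their number.
-/
theorem expect_misses (X : List (BitVec w)) (hX : X.length < 2 ^ w) (h0 : 0 < X.length) :
    (drawIndices w X.length).expect (fun p => if Misses X p then 1 else 0) * X.length ^ 2 +
      (sumPairs X).card = X.length ^ 2 := by
  set n := X.length with hn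
  have h1 : (drawIndices w n).expect (fun p => if Misses X p then 1 else 0) * n ^ 2 =
      ∑ p ∈ Finset.range n ×ˢ Finset.range n,
        if ¬ X.getD p.1 0#w ^^^ X.getD p.2 0#w ∈ X then (1 : ℝ≥0∞) else 0 := by
    have hn1 : (n : ℝ≥0∞)⁻¹ * n = 1 := ENNReal.inv_mul_cancel (by simpa using h0.ne') (by simp)
    simp only [drawIndices, PMF.expect_bind, PMF.expect_map, expect_randWord_ofNat h0 hX]
    rw [← Finset.mul_sum, Finset.sum_product]
    have h2 : ∀ i < n, ∀ j < n, (Misses X (BitVec.ofNat w i, BitVec.ofNat w j) ↔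
        ¬ X.getD i 0#w ^^^ X.getD j 0#w ∈ X) := by
      intro i hi j hj
      simp only [Misses, BitVec.toNat_ofNat, Nat.mod_eq_of_lt (hi.trans hX),
        Nat.mod_eq_of_lt (hj.trans hX), getD_mem hi, getD_mem hj, true_and]
    rw [Finset.sum_congr rfl fun i hi => Finset.sum_congr rfl fun j hj => by
      rw [if_congr (h2 i (Finset.mem_range.1 hi) j (Finset.mem_range.1 hj)) rfl rfl]]
    generalize (∑ i ∈ Finset.range n, ∑ j ∈ Finset.range n,
      if ¬ X.getD i 0#w ^^^ X.getD j 0#w ∈ X then (1 : ℝ≥0∞) else 0) = Z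
    calc (n : ℝ≥0∞)⁻¹ * ((n : ℝ≥0∞)⁻¹ * Z) * n ^ 2
        = ((n : ℝ≥0∞)⁻¹ * n) * ((n : ℝ≥0∞)⁻¹ * n) * Z := by ring
      _ = Z := by rw [hn1]; ring
  rw [h1, sumPairs, ← cast_card_filter, ← Nat.cast_add, add_comm,
    Finset.card_filter_add_card_filter_not, Finset.card_product, Finset.card_range]
  push_cast; ring

/-- If there are many sums, then probably one of them is found by `m` samples. With `ρ` for the
probability of a miss, this is `ρ ^ m * m * (1 - ρ) ≤ 1`, a consequence of the inequality of
Bernoulli and of `ρ * (2 - ρ) ≤ 1`. -/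
theorem misses_pow_mul_le (X : List (BitVec w)) (hX : X.length < 2 ^ w) (h0 : 0 < X.length)
    (m : ℕ) :
    ((drawIndices w X.length).expect fun p => if Misses X p then 1 else 0) ^ m *
      (sumPairs X).card * m ≤ X.length ^ 2 := by
  have h1 := expect_misses X hX h0
  set n := X.length
  generalize (drawIndices w n).expect (fun p => if Misses X p then 1 else 0) = ρ at h1 ⊢
  set S := (sumPairs X).card
  have hn : (n : ℝ≥0∞) ^ 2 ≠ 0 := by simp [h0.ne']
  have hn' : (n : ℝ≥0∞) ^ 2 ≠ ⊤ := by simp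
  have hρ : ρ ≠ ⊤ := by
    intro h
    rw [h, ENNReal.top_mul hn, top_add] at h1
    exact hn' h1.symm
  lift ρ to NNReal using hρ
  have h2 : ρ * (n : NNReal) ^ 2 + S = (n : NNReal) ^ 2 := by exact_mod_cast h1
  suffices H : (ρ : NNReal) ^ m * S * m ≤ (n : NNReal) ^ 2 by exact_mod_cast H
  have h3 : (ρ : ℝ) * (n : ℝ) ^ 2 + S = (n : ℝ) ^ 2 := by exact_mod_cast h2
  suffices H : (ρ : ℝ) ^ m * S * m ≤ (n : ℝ) ^ 2 by exact_mod_cast H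
  have hnpos : (0 : ℝ) < (n : ℝ) ^ 2 := by positivity
  have hρ0 : (0 : ℝ) ≤ ρ := ρ.2
  have hS : (S : ℝ) = (1 - ρ) * (n : ℝ) ^ 2 := by linarith
  have hρ1 : (ρ : ℝ) ≤ 1 := by
    by_contra h
    have : (S : ℝ) < 0 := by rw [hS]; nlinarith
    exact absurd (Nat.cast_nonneg (α := ℝ) S) (not_le.2 this)
  have h4 : (ρ : ℝ) ^ m * (1 + m * (1 - ρ)) ≤ 1 := by
    calc (ρ : ℝ) ^ m * (1 + m * (1 - ρ)) ≤ (ρ : ℝ) ^ m * (1 + (1 - ρ)) ^ m := by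
          gcongr
          exact one_add_mul_le_pow (by linarith) m
      _ = (ρ * (1 + (1 - ρ)) : ℝ) ^ m := (mul_pow _ _ _).symm
      _ ≤ 1 := pow_le_one₀ (by nlinarith) (by nlinarith [sq_nonneg ((ρ : ℝ) - 1)])
  have h5 : (0 : ℝ) ≤ (ρ : ℝ) ^ m := by positivity
  have h6 : (ρ : ℝ) ^ m * (m * (1 - ρ)) ≤ 1 := by nlinarith
  calc (ρ : ℝ) ^ m * S * m = ((ρ : ℝ) ^ m * (m * (1 - ρ))) * (n : ℝ) ^ 2 := by rw [hS]; ring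
    _ ≤ 1 * (n : ℝ) ^ 2 := by gcongr
    _ = _ := one_mul _

end WordRAM

namespace WordRAM

variable {w : ℕ}

/-! ### Subroutines -/

theorem ofNat_ne_ofNat {a b : ℕ} (h : a ≠ b) (ha : a < 2 ^ w) (hb : b < 2 ^ w) :
    BitVec.ofNat w a ≠ BitVec.ofNat w b := by
  intro h1
  have := congrArg BitVec.toNat h1
  rw [BitVec.toNat_ofNat, BitVec.toNat_ofNat, Nat.mod_eq_of_lt ha, Nat.mod_eq_of_lt hb] at this
  exact h this

theorem eval_or_self (x : BitVec w) : BinOp.or.eval x x = x := by simp [BinOp.eval]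

theorem eval_shl {k : ℕ} (hk : k < 2 ^ w) (a : ℕ) :
    BinOp.shiftLeft.eval (BitVec.ofNat w a) (BitVec.ofNat w k) = BitVec.ofNat w (a * 2 ^ k) := by
  rw [eval_shiftLeft hk, ofNat_shiftLeft]

theorem eval_shr {a k : ℕ} (ha : a < 2 ^ w) (hk : k < 2 ^ w) :
    BinOp.shiftRight.eval (BitVec.ofNat w a) (BitVec.ofNat w k) = BitVec.ofNat w (a / 2 ^ k) := by
  rw [eval_shiftRight hk, ofNat_shiftRight ha]

theorem eval_and_mask {a k : ℕ} (ha : a < 2 ^ w) (hk : k ≤ w) :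
    BinOp.and.eval (BitVec.ofNat w a) (BitVec.ofNat w (2 ^ k - 1)) =
      BitVec.ofNat w (a % 2 ^ k) := by
  rw [BinOp.eval, ofNat_mask ha hk]

theorem eval_xor (a b : ℕ) :
    BinOp.xor.eval (BitVec.ofNat w a) (BitVec.ofNat w b) = BitVec.ofNat w (a ^^^ b) := by
  rw [BinOp.eval]
  apply BitVec.eq_of_toNat_eq
  rw [BitVec.toNat_xor, BitVec.toNat_ofNat, BitVec.toNat_ofNat, BitVec.toNat_ofNat,
    Nat.xor_mod_two_pow]

/-- Run `P` on the input `n` in the area number `j` of the registers and memory banks, and keep the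
last word of its output in the register `d`. The area number `j < 3` consists of the registers `64 +
3 * i + j` and of the banks `16 + 3 * b + j`; all lower numbers belong to the reduction itself. -/
def powerCode (P : Program) (j d : ℕ) : Program :=
  .seq (.op .or (64 + j) 0 0)
    (P.embed (fun r => 64 + 3 * r + j) (fun b => 16 + 3 * b + j) fun a => .op .or d a a)

/-- The last output word of the subroutine is available in the register `d`; keeping a word takes
one step, like outputting it, so that the subroutine is not slowed down. -/
theorem powerCode_triple {P : Program} {j d n : ℕ} (hd : d < 64) {good : List (BitVec w) → Prop}
    (hP : HaltsWith P (initState w [n] []) good) (S : State w) (h0 : S.reg 0 = BitVec.ofNat w n)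
    (hreg : ∀ r, S.reg (64 + 3 * r + j) = 0#w) (hmem : ∀ b, S.mem (16 + 3 * b + j) = fun _ => 0#w) :
    Triple (powerCode P j d) S (3 + expectedTime P (initState w [n] []))
      (fun S' => ∃ out, good out ∧ ∀ x, out.getLast? = some x → S'.reg d = x) := by
  have H : Handles (w := w) (fun r => 64 + 3 * r + j) (fun b => 16 + 3 * b + j)
      (fun a => .op .or d a a) (fun out S => ∀ x, out.getLast? = some x → S.reg d = x) 1 := by
    refine ⟨fun a b h => ?_, fun a b h => ?_, ?_, le_rfl, fun a r => ?_, fun a b => rfl, ?_⟩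
    · have h : 64 + 3 * a + j = 64 + 3 * b + j := h
      omega
    · have h : 16 + 3 * a + j = 16 + 3 * b + j := h
      omega
    · intro out S S' h1 _ _ h2 x hx
      rw [h1 d fun i => by change 64 + 3 * i + j ≠ d; omega, h2 x hx]
    · simp only [Program.writesReg]; simp; omega
    · intro out S a _
      refine (Triple.straight 1 rfl le_rfl ?_).mono (by simp) fun _ h _ => h
      intro x hx
      simp only [List.getLast?_concat, Option.some.injEq] at hx
      simp [BinOp.eval, ← hx]
  refine (Triple.seq (T := (1 : ℕ)) (T' := 1 * expectedTime P (initState w [n] []))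
    (Triple.straight 1 rfl le_rfl (Post := fun S' => S' = S.setReg (64 + j) (S.reg 0))
      (by simp [BinOp.eval])) ?_).mono ?_
    fun _ h _ => h
  · rintro _ rfl -
    refine Triple.embed H hP ⟨fun r => ?_, fun b => ?_⟩ (by simp [initState])
    · rcases Nat.eq_zero_or_pos r with rfl | hr
      · simp [initState, h0]
      · rw [setReg_reg, if_neg (by omega), hreg]
        simp [initState, show r ≠ 0 by omega]
    · rw [setReg_mem, hmem]; funext z; simp [initState, arrayOf]
  · rw [one_mul]; gcongr; norm_num

theorem writesReg_powerCode {P : Program} {j d r : ℕ} (h : ∀ i, 64 + 3 * i + j ≠ r) (hd : d ≠ r) :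
    (powerCode P j d).writesReg r = false := by
  rw [powerCode, Program.writesReg, writesReg_embed h (by simp [Program.writesReg, hd])]
  simpa [Program.writesReg] using h 0

theorem writesMem_powerCode {P : Program} {j d b : ℕ} (h : ∀ i, 16 + 3 * i + j ≠ b) :
    (powerCode P j d).writesMem b = false := by
  rw [powerCode, Program.writesMem, writesMem_embed h (by simp [Program.writesMem])]
  simp [Program.writesMem]

theorem emits_powerCode {P : Program} {j d : ℕ} : (powerCode P j d).emits = false := by
  rw [powerCode, Program.emits, emits_embed (by simp [Program.emits])]
  simp [Program.emits]

/-- Decide whether the number in register `0` is at least `N`, by counting down its copy in register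
`20`. The number `N` need not fit into a word, therefore it cannot be loaded and compared. -/
def ifLarge : ℕ → Program → Program → Program
  | 0, p, _ => p
  | N + 1, p, q => .ite 20 (.seq (.op .sub 20 20 1) (ifLarge N p q)) q

theorem ifLarge_triple {p q : Program} {T T' : ℝ≥0∞} {Post : State w → Prop} (N : ℕ) :
    ∀ (n : ℕ) (s : State w), n < 2 ^ w → s.reg 20 = BitVec.ofNat w n →
      s.reg 1 = BitVec.ofNat w 1 → (N ≤ n → ∀ x, Triple p (s.setReg 20 x) T Post) →
      (n < N → ∀ x, Triple q (s.setReg 20 x) T' Post) →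
      Triple (ifLarge N p q) s (3 * N + if N ≤ n then T else T') Post := by
  induction N with
  | zero =>
    intro n s _ h20 _ hp _
    have := hp (Nat.zero_le _) (s.reg 20)
    have hs : s.setReg 20 (s.reg 20) = s := by simp [State.setReg]
    rw [hs] at this
    simpa [ifLarge] using this
  | succ N ih =>
    intro n s hn h20 h1 hp hq
    rcases Nat.eq_zero_or_pos n with rfl | hpos
    · have := hq (by omega) (s.reg 20)
      have hs : s.setReg 20 (s.reg 20) = s := by simp [State.setReg]
      rw [hs] at this
      refine (Triple.ite (fun h => absurd (by simp [h20]) h) fun _ => this).mono ?_ fun _ h _ => h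
      rw [if_neg (by omega)]
      gcongr
      push_cast
      rw [mul_add]
      exact le_add_left (by norm_num)
    · have h2 : s.reg 20 ≠ 0 := by rw [h20]; exact ofNat_ne_zero hpos.ne' hn
      obtain ⟨m, rfl⟩ : ∃ m, n = m + 1 := ⟨n - 1, by omega⟩
      have key := ih m (s.setReg 20 (BitVec.ofNat w m)) (by omega) (by simp) (by simpa using h1)
        (fun h x => by simpa [State.setReg] using hp (by omega) x)
        (fun h x => by simpa [State.setReg] using hq (by omega) x)
      refine (Triple.ite (T := 1 + 1 + (3 * N + if N ≤ m then T else T')) (fun _ => ?_)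
        fun h => absurd h h2).mono ?_ fun _ h _ => h
      · refine Triple.seq (Post := fun s' => s' = s.setReg 20 (BitVec.ofNat w m))
          ((Triple.straight 1 rfl le_rfl ?_).mono (by simp) fun _ h _ => h) ?_
        · rw [Program.exec, h20, h1, BinOp.eval, ofNat_sub_one]
        · rintro _ rfl -; exact key
      · rw [if_congr (show N + 1 ≤ m + 1 ↔ N ≤ m by omega) rfl rfl]
        push_cast
        rw [mul_add, ← add_assoc, ← add_assoc, ← add_assoc, add_comm (3 * (N : ℝ≥0∞))]
        gcongr
        norm_num

/-! ### The parameters of the reduction -/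

/-- The numbers that are used by the reduction fit into words.  The buckets are numbered with `r`
bits and have size `2 ^ τ`, the second hash function has `2 * s` bits, and `2 ^ d` pairs of
elements are sampled. -/
structure Sizes (w n r d s τ : ℕ) : Prop where
  hw : 32 ≤ w
  pos : 0 < n
  lt : n < 2 ^ w
  d_lt : 2 ^ d < 2 ^ w
  r_le : r ≤ Nat.log 2 n
  s_eq : s = (Nat.log 2 n + d - r) / 2
  τ_eq : τ = Nat.log 2 n - r + 2
  query_lt : n * 2 ^ r < 2 ^ w
  fill_lt : 2 ^ (r + s + τ) < 2 ^ w
  c_lt : 2 ^ (2 * s + 2) < 2 ^ w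
  τ_le : τ ≤ 2 * s

/-- The memory holds the parameters of the reduction and the table of the elements of `X`. The
registers are used as follows: `0` has the length of the list, `1` the constant one, `2` the flag,
`3`, `4`, `5`, `6` the numbers `r`, `d`, `s`, `τ`, and `7`, `8`, `9` the masks with `r`, `s` and `τ`
ones; `10` to `13` belong to the computation of parities, `15` is zero, `20` to `37` are temporary,
and `40` to `46` serve for receiving the answers of the subroutine. Bank `0` has the list and bank
`1` the marks of its elements; the hash values are in banks `2` and `3`, the buckets in `4`, `5` and
`6`, and bank `7` numbers the hash values that occur. -/
structure Ready (X : List (BitVec w)) (r d s τ : ℕ) (S : State w) : Prop extends Holds X S where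
  reg_r : S.reg 3 = BitVec.ofNat w r
  reg_d : S.reg 4 = BitVec.ofNat w d
  reg_s : S.reg 5 = BitVec.ofNat w s
  reg_τ : S.reg 6 = BitVec.ofNat w τ
  mr : S.reg 7 = BitVec.ofNat w (2 ^ r - 1)
  ms : S.reg 8 = BitVec.ofNat w (2 ^ s - 1)
  mτ : S.reg 9 = BitVec.ofNat w (2 ^ τ - 1)
  zero : S.reg 15 = 0#w
  parity : ParityReady (blockExp w) (blockNum w) S
  tab : S.mem 1 = marks X

theorem Ready.congr {X : List (BitVec w)} {r d s τ : ℕ} {S S' : State w} (h : Ready X r d s τ S)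
    (hr : ∀ i ∈ [0, 1, 3, 4, 5, 6, 7, 8, 9, 10, 11, 12, 13, 15], S'.reg i = S.reg i)
    (h0 : S'.mem 0 = S.mem 0) (h1 : S'.mem 1 = S.mem 1) : Ready X r d s τ S' where
  len := (hr _ (by simp)).trans h.len
  one := (hr _ (by simp)).trans h.one
  arr := h0.trans h.arr
  reg_r := (hr _ (by simp)).trans h.reg_r
  reg_d := (hr _ (by simp)).trans h.reg_d
  reg_s := (hr _ (by simp)).trans h.reg_s
  reg_τ := (hr _ (by simp)).trans h.reg_τ
  mr := (hr _ (by simp)).trans h.mr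
  ms := (hr _ (by simp)).trans h.ms
  mτ := (hr _ (by simp)).trans h.mτ
  zero := (hr _ (by simp)).trans h.zero
  parity := h.parity.congr fun i hi => hr i (by simp at hi ⊢; omega)
  tab := h1.trans h.tab

/-- The program changes neither the parameters nor the tables of the elements, that is, none of the
cells on which `Ready` depends. -/
def Program.keeps (p : Program) : Bool :=
  [0, 1, 3, 4, 5, 6, 7, 8, 9, 10, 11, 12, 13, 15].all (fun i => !p.writesReg i) &&
    (!p.writesMem 0 && !p.writesMem 1)

theorem Ready.frame {X : List (BitVec w)} {r d s τ : ℕ} {S S' : State w} (h : Ready X r d s τ S)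
    {p : Program} (hF : Frame p S S') (hp : p.keeps = true) : Ready X r d s τ S' := by
  simp only [Program.keeps, Bool.and_eq_true, List.all_eq_true, Bool.not_eq_true'] at hp
  exact h.congr (fun i hi => hF.reg i (hp.1 i hi)) (hF.mem 0 hp.2.1) (hF.mem 1 hp.2.2)

/-- Computes the parameters from the exponents in the registers `3` and `4`, and marks the elements
of the list. The loop determines the binary logarithm of the length of the list; the other
parameters follow by the formulas of `Sizes`. -/
def setup : Program :=
  block [.op .or 20 0 0, .op .shiftRight 20 20 1, .const 14 0,
    .while 20 (block [.op .add 14 14 1, .op .shiftRight 20 20 1]),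
    block [.op .add 5 14 4, .op .sub 5 5 3, .op .shiftRight 5 5 1,
      .op .sub 6 14 3, .op .add 6 6 1, .op .add 6 6 1],
    block [.op .shiftLeft 7 1 3, .op .sub 7 7 1, .op .shiftLeft 8 1 5, .op .sub 8 8 1,
      .op .shiftLeft 9 1 6, .op .sub 9 9 1],
    paritySetup, markLoop]

theorem setup_triple {X : List (BitVec w)} {r d s τ : ℕ} (hs : Sizes w X.length r d s τ)
    (S : State w) (h : Holds X S) (h3 : S.reg 3 = BitVec.ofNat w r)
    (h4 : S.reg 4 = BitVec.ofNat w d) (h15 : S.reg 15 = 0#w) (hm : S.mem 1 = fun _ => 0#w) :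
    Triple setup S ((12 * X.length + 30 * Nat.clog 2 w + 120 : ℕ) : ℝ≥0∞)
      (Ready X r d s τ) := by
  set n := X.length with hn
  set L := Nat.log 2 n with hL
  have hw0 : 0 < w := by have := hs.hw; omega
  have h1w : 1 < 2 ^ w := Nat.one_lt_two_pow hw0.ne'
  have hLn : L ≤ n := Nat.log_le_self _ _
  have hLw : L < w := by
    have h1 : 2 ^ L ≤ n := Nat.pow_log_le_self 2 hs.pos.ne'
    exact (Nat.pow_lt_pow_iff_right (by norm_num)).1 (h1.trans_lt hs.lt)
  have hdw : d < w := (Nat.pow_lt_pow_iff_right (by norm_num)).1 hs.d_lt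
  have hfw := (Nat.pow_lt_pow_iff_right (by norm_num)).1 hs.fill_lt
  have h2w : 2 * w < 2 ^ w := by
    have : ∀ v, 32 ≤ v → 2 * v < 2 ^ v := by
      intro v hv
      induction v, hv using Nat.le_induction with
      | base => norm_num
      | succ v hv ih => rw [pow_succ]; omega
    exact this w hs.hw
  have hr : r ≤ L := hs.r_le
  have hs' : s = (L + d - r) / 2 := hs.s_eq
  have hτ' : τ = L - r + 2 := hs.τ_eq
  have hpow : ∀ k, 1 ≤ 2 ^ k := fun k => Nat.one_le_two_pow
  suffices H : Triple setup S ((1 + 1 + (1 + 1 + (1 + 1 + (1 + (1 + L * (1 + 3)) + (1 + 11 +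
      (1 + 11 + (1 + (30 * Nat.clog 2 w + 60) + (6 * n + 3))))))) : ℕ) : ℝ≥0∞)
      (Ready X r d s τ) from H.mono (by rw [Nat.cast_le]; omega) fun _ h _ => h
  refine Triple.seq_straight 1 _ rfl le_rfl (Triple.seq_straight 1 _ rfl le_rfl
    (Triple.seq_straight 1 _ rfl le_rfl ?_))
  simp only [Program.exec, setReg_reg, h.len, h.one, eval_or_self, ↓reduceIte,
    show (1 : ℕ) ≠ 20 by decide, eval_shr hs.lt h1w, ← hn]
  set S1 : State w := ((S.setReg 20 (BitVec.ofNat w n)).setReg 20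
    (BitVec.ofNat w (n / 2 ^ 1))).setReg 14 (BitVec.ofNat w 0) with hS1
  have hreg1 : ∀ i, i ≠ 20 → i ≠ 14 → S1.reg i = S.reg i := by
    intro i h1 h2; simp [hS1, h1, h2]
  -- before the loop, register `20` is halved once, so that it runs exactly `⌊log₂ n⌋` times
  refine Triple.seq_nat (1 + L * (1 + 3)) _ (Triple.while_nat L 3 S1
    (fun j s => s.reg 14 = BitVec.ofNat w (L - j) ∧ s.reg 20 = BitVec.ofNat w (n / 2 ^ (L - j + 1)))
    (by simp [hS1]) ?_ ?_) ?_
  · rintro j hj s' ⟨h5, h6⟩ hF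
    have h7 : n / 2 ^ (L - (j + 1) + 1) < 2 ^ w := (Nat.div_le_self _ _).trans_lt hs.lt
    have h1' : s'.reg 1 = BitVec.ofNat w 1 := by
      rw [hF.reg 1 rfl, hreg1 1 (by simp) (by simp), h.one]
    refine ⟨?_, Triple.straight 3 rfl le_rfl ?_⟩
    · rw [h6]
      refine ofNat_ne_zero (Nat.div_pos ?_ (by positivity)).ne' h7
      calc 2 ^ (L - (j + 1) + 1) ≤ 2 ^ L := Nat.pow_le_pow_right (by norm_num) (by omega)
        _ ≤ n := Nat.pow_log_le_self 2 hs.pos.ne'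
    · simp +decide only [block, Program.exec, setReg_reg, ↓reduceIte, h5, h6, h1', eval_add,
        eval_shr h7 h1w, Nat.div_div_eq_div_mul, ← pow_add]
      rw [show L - (j + 1) + 1 = L - j by omega]
      exact ⟨rfl, rfl⟩
  · rintro s' ⟨h5, h6⟩ _
    rw [h6, Nat.div_eq_of_lt]
    · rfl
    · rw [Nat.sub_zero]; exact Nat.lt_pow_succ_log_self (by norm_num) n
  rintro S2 ⟨h14, -⟩ hF2
  rw [Nat.sub_zero] at h14
  have hreg2 : ∀ i, i ≠ 20 → i ≠ 14 → S2.reg i = S.reg i := by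
    intro i h1 h2
    rw [← hreg1 i h1 h2]
    exact hF2.reg i (by simp [Program.writesReg]; omega)
  have hmem2 : S2.mem = S.mem := by
    funext b
    rw [hF2.mem b (by simp [Program.writesMem])]; rfl
  have e1 := hreg2 1 (by simp) (by simp)
  have e3 := hreg2 3 (by simp) (by simp)
  have e4 := hreg2 4 (by simp) (by simp)
  rw [h.one] at e1; rw [h3] at e3; rw [h4] at e4
  refine Triple.seq_straight 11 _ rfl le_rfl (Triple.seq_straight 11 _ rfl le_rfl ?_)
  set S4 := Program.exec (block [.op .shiftLeft 7 1 3, .op .sub 7 7 1, .op .shiftLeft 8 1 5,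
    .op .sub 8 8 1, .op .shiftLeft 9 1 6, .op .sub 9 9 1]) (Program.exec (block [.op .add 5 14 4,
    .op .sub 5 5 3, .op .shiftRight 5 5 1, .op .sub 6 14 3, .op .add 6 6 1, .op .add 6 6 1]) S2)
    with hS4
  have f0 : L + d - r < 2 ^ w := by omega
  have fr : r < 2 ^ w := by omega
  have fs : s < 2 ^ w := by omega
  have fτ : τ < 2 ^ w := by omega
  have hall : (S4.reg 5 = BitVec.ofNat w s ∧ S4.reg 6 = BitVec.ofNat w τ) ∧
      S4.reg 7 = BitVec.ofNat w (2 ^ r - 1) ∧ S4.reg 8 = BitVec.ofNat w (2 ^ s - 1) ∧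
      S4.reg 9 = BitVec.ofNat w (2 ^ τ - 1) := by
    have hτ2 : L - r + 1 + 1 = τ := by omega
    have hs2 : (L + d - r) / 2 = s := by omega
    simp +decide only [hS4, block, Program.exec, setReg_reg, ↓reduceIte, e1, e3, e4, h14, eval_add,
      eval_sub (show r ≤ L + d by omega), eval_shr f0 h1w, pow_one, hs2, hτ2, eval_sub hr,
      eval_shl fr, eval_shl fs, eval_shl fτ, one_mul, eval_sub (hpow _), and_self]
  have hreg4 : ∀ i, i ∉ [5, 6, 7, 8, 9] → S4.reg i = S2.reg i := by
    intro i hi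
    simp only [List.mem_cons, List.not_mem_nil, or_false, not_or] at hi
    simp only [hS4, block, Program.exec, setReg_reg, hi, ↓reduceIte]
  have hmem4 : S4.mem = S.mem := by rw [← hmem2]; rfl
  have hH4 : Holds X S4 := ⟨by rw [hreg4 0 (by simp), hreg2 0 (by simp) (by simp), h.len],
    by rw [hreg4 1 (by simp), e1], by rw [hmem4, h.arr]⟩
  refine Triple.seq_nat _ _ (paritySetup_triple hs.hw S4 hH4.one
    (by rw [hreg4 15 (by simp), hreg2 15 (by simp) (by simp), h15])) ?_
  intro S5 hS5 hF5
  have hH5 := hH4.frame hF5 rfl rfl rfl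
  refine (markLoop_triple X hs.lt S5 hH5 (by rw [hF5.mem 1 rfl, hmem4, hm])).mono le_rfl ?_
  intro S6 hS6 hF6
  have hreg6 : ∀ i, paritySetup.writesReg i = false → markLoop.writesReg i = false →
      S6.reg i = S4.reg i := fun i h1 h2 => (hF6.reg i h2).trans (hF5.reg i h1)
  refine { hH5.frame hF6 rfl rfl rfl with
    reg_r := ?_, reg_d := ?_, reg_s := ?_, reg_τ := ?_, mr := ?_, ms := ?_, mτ := ?_, zero := ?_,
    parity := ?_, tab := hS6 }
  · rw [hreg6 3 rfl rfl, hreg4 3 (by simp), e3]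
  · rw [hreg6 4 rfl rfl, hreg4 4 (by simp), e4]
  · rw [hreg6 5 rfl rfl, hall.1.1]
  · rw [hreg6 6 rfl rfl, hall.1.2]
  · rw [hreg6 7 rfl rfl, hall.2.1]
  · rw [hreg6 8 rfl rfl, hall.2.2.1]
  · rw [hreg6 9 rfl rfl, hall.2.2.2]
  · rw [hreg6 15 rfl rfl, hreg4 15 (by simp), hreg2 15 (by simp) (by simp), h15]
  · exact hS5.congr fun i hi => hF6.reg i (by
      simp only [List.mem_cons, List.not_mem_nil, or_false] at hi
      rcases hi with rfl | rfl | rfl | rfl | rfl <;> rfl)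

end WordRAM

namespace WordRAM

variable {w : ℕ}

/-! ### Random choices -/

theorem Spec.rand (s : State w) (d a : ℕ) :
    Spec (.rand d a) s 1 (randWord (s.reg a)) (fun x s' => s' = s.setReg d x) := by
  have hstep : ∀ k, step (Program.rand d a :: k, s) =
      (randWord (s.reg a)).map fun x => (k, s.setReg d x) := fun k => by rw [step]
  have hF : ∀ x, Frame (.rand d a) s (s.setReg d x) := fun x =>
    frame_setReg (by simp [Program.writesReg])
  constructor
  · intro k t B hB
    change 1 + (step (Program.rand d a :: k, s)).expect (timeUpTo t) ≤ _
    rw [hstep, PMF.expect_map]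
    gcongr
    exact PMF.expect_mono _ fun x _ => hB x _ rfl (hF x)
  · intro good k x hx
    rw [winProb_cons, hstep, PMF.expect_map]
    exact PMF.le_expect _ fun y _ => hx y _ rfl (hF y)

theorem Spec.map_outcome {α β : Type*} {p : Program} {s : State w} {T : ℝ≥0∞} {μ : PMF α}
    {Post : α → State w → Prop} {Post' : β → State w → Prop} (h : Spec p s T μ Post) (f : α → β)
    (hf : ∀ a s', Post a s' → Post' (f a) s') : Spec p s T (μ.map f) Post' :=
  ⟨fun k t B hB => by
      rw [PMF.expect_map]
      exact h.time k t _ fun a s' h1 h2 => hB _ s' (hf a s' h1) h2,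
    fun good k x hx => h.win good k x fun a s' h1 h2 => hx _ s' (hf a s' h1) h2⟩

theorem Spec.seq_nat {α β : Type*} {p q : Program} {s : State w} (T T' : ℕ)
    {μ : PMF α} {ν : α → PMF β} {Post : α → State w → Prop} {Post' : β → State w → Prop}
    (h : Spec p s T μ Post)
    (h' : ∀ a s', Post a s' → Frame p s s' → Spec q s' T' (ν a) Post') :
    Spec (.seq p q) s ((1 + T + T' : ℕ) : ℝ≥0∞) (μ.bind ν) Post' :=
  (Spec.seq (T' := fun _ => (T' : ℝ≥0∞)) h h').mono (by rw [PMF.expect_const]; push_cast; rfl)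
    fun _ _ h _ => h

theorem Spec.seq_triple_nat {α : Type*} {p q : Program} {s : State w} (T T' : ℕ)
    {μ : PMF α} {Post Post' : α → State w → Prop} (h : Spec p s T μ Post)
    (h' : ∀ a s', Post a s' → Frame p s s' → Triple q s' T' (Post' a)) :
    Spec (.seq p q) s ((1 + T + T' : ℕ) : ℝ≥0∞) μ Post' :=
  (Spec.seq_triple (T' := fun _ => (T' : ℝ≥0∞)) h h').mono
    (by rw [PMF.expect_const]; push_cast; rfl) fun _ _ h _ => h

theorem Triple.seq_spec_nat {α : Type*} {p q : Program} {s : State w} (T T' : ℕ)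
    {μ : PMF α} {Post : State w → Prop} {Post' : α → State w → Prop} (h : Triple p s T Post)
    (h' : ∀ s', Post s' → Frame p s s' → Spec q s' T' μ Post') :
    Spec (.seq p q) s ((1 + T + T' : ℕ) : ℝ≥0∞) μ Post' :=
  (Triple.seq_spec h h').mono (by push_cast; rfl) fun _ _ h _ => h

theorem arrayOf_map_toNat' (X : List (BitVec w)) (i : BitVec w) :
    arrayOf w (X.map BitVec.toNat) i = X.getD i.toNat 0#w := by
  have := arrayOf_map_toNat X i.isLt
  rwa [BitVec.ofNat_toNat, BitVec.setWidth_eq] at this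

/-- Random pairs of elements are tested; if the sum of one of them belongs to the list, then the
flag in register `2` is raised. The two elements are looked up in the table as well, so that the
flag is sound for all words `i` and `j` that are used as addresses. -/
def sampleLoop : Program :=
  .seq (.op .shiftLeft 22 1 4) (forDown 22 1 (.seq (.rand 23 0) (.seq (.rand 24 0)
    (block [.load 25 0 23, .load 26 0 24, .op .xor 25 25 26, .load 25 1 25, .load 26 0 23,
      .load 27 0 24, .load 26 1 26, .load 27 1 27, .op .and 25 25 26, .op .and 25 25 27,
      .op .or 2 2 25]))))

theorem flagSound_and (X : List (BitVec w)) (x y : BitVec w) :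
    FlagSound X (marks X (x ^^^ y) &&& marks X x &&& marks X y) := by
  unfold marks FlagSound
  by_cases hx : x ∈ X
  · by_cases hy : y ∈ X
    · by_cases hxy : x ^^^ y ∈ X
      · refine .inr ⟨?_, x, hx, y, hy, _, hxy, rfl⟩
        simp [hx, hy, hxy]
      · simp [hxy]
    · simp [hy]
  · simp [hx]

theorem flag_and_eq_one {X : List (BitVec w)} {x y : BitVec w} (hx : x ∈ X) (hy : y ∈ X)
    (hxy : x ^^^ y ∈ X) : marks X (x ^^^ y) &&& marks X x &&& marks X y = 1#w := by
  simp [marks, hx, hy, hxy]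

/-- The flag is raised if a pair of the sample has its sum in the list, and it is never raised
wrongly. -/
theorem sampleLoop_spec {X : List (BitVec w)} {r d s τ : ℕ} (hs : Sizes w X.length r d s τ)
    (S : State w) (h : Ready X r d s τ S) (hf : FlagSound X (S.reg 2)) :
    Spec sampleLoop S ((3 + 2 ^ d * 28 : ℕ) : ℝ≥0∞) (drawMany (drawIndices w X.length) (2 ^ d))
      (fun l S' => FlagSound X (S'.reg 2) ∧ ((∃ p ∈ l, ¬ Misses X p) → S'.reg 2 = 1#w)) := by
  have hd : d < 2 ^ w := (Nat.lt_two_pow_self (n := d)).trans hs.d_lt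
  refine (Triple.seq_spec_nat 1 (1 + 2 ^ d * (3 + 25))
    (Post := fun S' => S' = S.setReg 22 (BitVec.ofNat w (2 ^ d)))
    (Triple.straight 1 rfl le_rfl ?_) ?_).mono (by rw [Nat.cast_le]; omega) fun _ _ h _ => h
  · simp only [Program.exec, h.one, h.reg_d, eval_shl hd, one_mul]
  rintro _ rfl -
  have h1 : Ready X r d s τ (S.setReg 22 (BitVec.ofNat w (2 ^ d))) :=
    h.frame (p := .const 22 0) (frame_setReg (by simp [Program.writesReg])) rfl
  refine (Spec.forDown (2 ^ d) 25 _ _ (fun l S' => FlagSound X (S'.reg 2) ∧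
    ((∃ p ∈ l, ¬ Misses X p) → S'.reg 2 = 1#w)) hs.d_lt rfl rfl (by simp) (by simp) h1.one
    ⟨by simpa using hf, by simp⟩ (fun l S' x hS' => by simpa using hS') ?_).mono le_rfl
    fun _ _ h _ => h.2
  rintro l S1 - ⟨h2, h3⟩ hF
  have hR := h1.frame hF rfl
  refine (Spec.seq_nat 1 23 (μ := randWord (BitVec.ofNat w X.length)) (ν := fun i =>
    (randWord (BitVec.ofNat w X.length)).map fun j => (i, j))
    (Post := fun i s' => s' = S1.setReg 23 i) ?_ ?_).mono le_rfl fun _ _ h _ => h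
  · have := Spec.rand S1 23 0
    rw [hR.len] at this
    exact this.mono (by simp) fun _ _ h _ => h
  rintro i _ rfl -
  have hR2 : Ready X r d s τ (S1.setReg 23 i) :=
    hR.frame (p := .const 23 0) (frame_setReg (by simp [Program.writesReg])) rfl
  refine Spec.map_outcome (Post := fun j s' => FlagSound X (s'.reg 2) ∧
    ((∃ p ∈ l ++ [(i, j)], ¬ Misses X p) → s'.reg 2 = 1#w)) ?_ _ fun _ _ h => h
  refine Spec.seq_triple_nat 1 21 (Post := fun j s' => s' = (S1.setReg 23 i).setReg 24 j) ?_ ?_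
  · have := Spec.rand (S1.setReg 23 i) 24 0
    rw [hR2.len] at this
    exact this.mono (by simp) fun _ _ h _ => h
  rintro j _ rfl -
  refine Triple.straight 21 rfl le_rfl ?_
  have hX0 : ∀ i, S1.mem 0 i = X.getD i.toNat 0#w := fun i => by
    rw [hR.arr, arrayOf_map_toNat']
  have hv : (Program.exec (block [.load 25 0 23, .load 26 0 24, .op .xor 25 25 26, .load 25 1 25,
      .load 26 0 23, .load 27 0 24, .load 26 1 26, .load 27 1 27, .op .and 25 25 26,
      .op .and 25 25 27, .op .or 2 2 25]) ((S1.setReg 23 i).setReg 24 j)).reg 2 = S1.reg 2 |||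
      (marks X (X.getD i.toNat 0#w ^^^ X.getD j.toNat 0#w) &&& marks X (X.getD i.toNat 0#w) &&&
        marks X (X.getD j.toNat 0#w)) := by
    simp +decide only [block, Program.exec, setReg_reg, setReg_mem, ↓reduceIte, hX0, hR.tab,
      BinOp.eval]
  rw [hv]
  have hsound := flagSound_and X (X.getD i.toNat 0#w) (X.getD j.toNat 0#w)
  refine ⟨h2.or hsound, ?_⟩
  rintro ⟨p, hp, hpX⟩
  rcases List.mem_append.1 hp with hp | hp
  · exact FlagSound.or_eq_one_left (h3 ⟨p, hp, hpX⟩) hsound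
  · rw [List.mem_singleton] at hp
    subst hp
    simp only [Misses, not_not] at hpX
    exact h2.or_eq_one_right (flag_and_eq_one hpX.1 hpX.2.1 hpX.2.2)

/-- Draws one linear form and appends the corresponding bits to the hash values in bank `b`.
Register `15` is zero, which stands for `2 ^ w` as the range of a random number, so that the form is
a uniformly random word. -/
def hashStep (b : ℕ) : Program :=
  .seq (.rand 32 15) (.seq (.op .or 21 0 0) (forDown 21 1 (block [
    block [.load 31 0 21, .op .and 31 32 31], parityCode,
    block [.load 36 b 21, .op .shiftLeft 36 36 1, .op .xor 36 36 31, .store b 21 36]])))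

/-- The hash values of all elements are stored in bank `b`. -/
def HashBank (X : List (BitVec w)) (b : ℕ) (l : List (BitVec w)) (S : State w) : Prop :=
  ∀ k < X.length, S.mem b (BitVec.ofNat w k) = hashWord l (X.getD k 0#w)

theorem hashStep_spec {X : List (BitVec w)} {r d s τ b : ℕ} (hs : Sizes w X.length r d s τ)
    (hb : b = 2 ∨ b = 3) (S : State w) (h : Ready X r d s τ S) (l : List (BitVec w))
    (hl : HashBank X b l S) :
    Spec (hashStep b) S ((5 + X.length * (8 * blockExp w + 50) : ℕ) : ℝ≥0∞) (randWord 0)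
      (fun v => HashBank X b (l ++ [v])) := by
  have hw0 : 0 < w := by have := hs.hw; omega
  have h1w : 1 < 2 ^ w := Nat.one_lt_two_pow hw0.ne'
  set n := X.length with hn
  refine (Spec.seq_triple_nat 1 (1 + 1 + (1 + n * (3 + (1 + 3 + (1 + (8 * blockExp w + 30) + 7)))))
    (Post := fun v s' => s' = S.setReg 32 v) ?_ ?_).mono
    (by rw [Nat.cast_le]; nlinarith) fun _ _ h _ => h
  · have := Spec.rand S 32 15
    rw [h.zero] at this
    exact this.mono (by simp) fun _ _ h _ => h
  rintro v _ rfl -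
  have h1 : Ready X r d s τ (S.setReg 32 v) :=
    h.frame (p := .const 32 0) (frame_setReg (by simp [Program.writesReg])) rfl
  refine Triple.seq_nat 1 _ (Post := fun s' => s' = (S.setReg 32 v).setReg 21 (BitVec.ofNat w n))
    (Triple.straight 1 rfl le_rfl (by simp only [Program.exec, h1.len, eval_or_self, hn])) ?_
  rintro _ rfl -
  set S1 := (S.setReg 32 v).setReg 21 (BitVec.ofNat w n) with hS1
  have h2 : Ready X r d s τ S1 :=
    h1.frame (p := .const 21 0) (frame_setReg (by simp [Program.writesReg])) rfl
  refine (Triple.forDown_nat n _ S1 (fun j s' => ∀ k < n, s'.mem b (BitVec.ofNat w k) =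
    hashWord (if j ≤ k then l ++ [v] else l) (X.getD k 0#w)) hs.lt rfl rfl (by simp)
    (by simp [hS1]) h2.one ?_ (fun j s' x hs' => by simpa using hs') ?_).mono le_rfl
    fun s' h3 _ k hk => by have := h3 k hk; rwa [if_pos (Nat.zero_le _)] at this
  · intro k hk
    rw [if_neg (by omega)]
    exact hl k hk
  intro j hj S2 hj2 hI hF
  have hkeep : (forDown 21 1 (block [block [.load 31 0 21, .op .and 31 32 31], parityCode,
    block [.load 36 b 21, .op .shiftLeft 36 36 1, .op .xor 36 36 31, .store b 21 36]])).keeps =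
      true := by rcases hb with rfl | rfl <;> rfl
  have h3 := h2.frame hF hkeep
  have h32 : S2.reg 32 = v := by
    rw [hF.reg 32 (by rcases hb with rfl | rfl <;> rfl)]; simp [hS1]
  refine Triple.seq_straight 3 _ rfl le_rfl ?_
  set S3 := Program.exec (block [.load 31 0 21, .op .and 31 32 31]) S2 with hS3
  have hF3 : Frame (block [.load 31 0 21, .op .and 31 32 31]) S2 S3 := exec_frame S2
  have h31 : S3.reg 31 = v &&& X.getD j 0#w := by
    simp +decide only [hS3, block, Program.exec, setReg_reg, ↓reduceIte, hj2, h32, BinOp.eval,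
      h3.load (show j < 2 ^ w from hj.trans hs.lt)]
    rfl
  have h4 := h3.frame hF3 rfl
  refine Triple.seq_nat _ _ (parityCode_triple (parityParams hs.hw) S3 h4.parity) ?_
  intro S4 h5 hF4
  have h6 := h4.frame hF4 rfl
  rw [h31] at h5
  have hmem : ∀ b, S4.mem b = S2.mem b := fun b => by rw [hF4.mem b rfl, hF3.mem b rfl]
  have hj4 : S4.reg 21 = BitVec.ofNat w j := by rw [hF4.reg 21 rfl, hF3.reg 21 rfl, hj2]
  refine Triple.straight 7 rfl le_rfl ?_
  intro k hk
  have hval : (Program.exec (block [.load 36 b 21, .op .shiftLeft 36 36 1, .op .xor 36 36 31,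
      .store b 21 36]) S4).mem b = Function.update (S4.mem b) (BitVec.ofNat w j)
      ((S4.mem b (BitVec.ofNat w j) <<< 1) ^^^ parityWord (v &&& X.getD j 0#w)) := by
    simp +decide only [block, Program.exec, setReg_reg, setMem_mem, setReg_mem, ↓reduceIte, hj4, h5,
      h6.one, eval_shiftLeft h1w]
    rfl
  refine (congrFun hval _).trans ?_
  rw [hmem, Function.update_apply]
  by_cases hkj : k = j
  · subst hkj
    rw [if_pos rfl, if_pos le_rfl, hI k hk, if_neg (by omega), hashWord_concat]
  · rw [if_neg (ofNat_ne_ofNat hkj (hk.trans hs.lt) (hj.trans hs.lt)), hI k hk,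
      if_congr (show j + 1 ≤ k ↔ j ≤ k by omega) rfl rfl]

/-- Draws the two hash functions and computes the hash values of all elements. -/
def hashLoops : Program :=
  .seq (.op .or 23 3 3) (.seq (forDown 23 1 (hashStep 2))
    (.seq (.op .add 23 5 5) (forDown 23 1 (hashStep 3))))

theorem hashLoops_spec {X : List (BitVec w)} {r d s τ : ℕ} (hs : Sizes w X.length r d s τ)
    (S : State w) (h : Ready X r d s τ S) (h2 : S.mem 2 = fun _ => 0#w)
    (h3 : S.mem 3 = fun _ => 0#w) :
    Spec hashLoops S ((7 + (r + 2 * s) * (8 + X.length * (8 * blockExp w + 50)) : ℕ) : ℝ≥0∞)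
      (drawPair w r (2 * s)) (fun l S' => (l.1.length = r ∧ HashBank X 2 l.1 S') ∧
        l.2.length = 2 * s ∧ HashBank X 3 l.2 S') := by
  have hfw := (Nat.pow_lt_pow_iff_right (by norm_num)).1 hs.fill_lt
  have hcw := (Nat.pow_lt_pow_iff_right (by norm_num)).1 hs.c_lt
  have hwlt : w < 2 ^ w := Nat.lt_two_pow_self
  set t := 5 + X.length * (8 * blockExp w + 50) with ht
  refine (Triple.seq_spec_nat 1 (1 + (1 + r * (3 + t)) + (1 + 1 + (1 + 2 * s * (3 + t))))
    (Post := fun S' => S' = S.setReg 23 (BitVec.ofNat w r))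
    (Triple.straight 1 rfl le_rfl (by simp only [Program.exec, h.reg_r, eval_or_self])) ?_).mono
    (by rw [Nat.cast_le, ht]; apply le_of_eq; ring) fun _ _ h _ => h
  rintro _ rfl -
  set S0 := S.setReg 23 (BitVec.ofNat w r) with hS0
  have h0 : Ready X r d s τ S0 :=
    h.frame (p := .const 23 0) (frame_setReg (by simp [Program.writesReg])) rfl
  refine Spec.seq_nat _ _ (Spec.forDown r t S0 (randWord 0) (fun l S' => HashBank X 2 l S')
    (by omega) rfl rfl (by simp) (by simp [hS0]) h0.one ?_ (fun _ _ _ h => h) ?_) ?_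
  · intro k _; simp [hS0, h2, hashWord]
  · intro l S1 _ h4 hF
    exact hashStep_spec hs (.inl rfl) S1 (h0.frame hF rfl) l h4
  rintro l S1 ⟨hlen, hl⟩ hF1
  have h1 := h0.frame hF1 rfl
  refine Spec.map_outcome (Post := fun l' S' => (l.length = r ∧ HashBank X 2 l S') ∧
    l'.length = 2 * s ∧ HashBank X 3 l' S') ?_ _
    fun _ _ h => h
  refine Triple.seq_spec_nat 1 _ (Post := fun S' => S' = S1.setReg 23 (BitVec.ofNat w (2 * s)))
    (Triple.straight 1 rfl le_rfl
      (by simp only [Program.exec, h1.reg_s, eval_add, two_mul])) ?_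
  rintro _ rfl -
  set S2 := S1.setReg 23 (BitVec.ofNat w (2 * s)) with hS2
  have h5 : Ready X r d s τ S2 :=
    h1.frame (p := .const 23 0) (frame_setReg (by simp [Program.writesReg])) rfl
  refine (Spec.forDown (2 * s) t S2 (randWord 0) (fun l S' => HashBank X 3 l S')
    (by omega) rfl rfl (by simp) (by simp [hS2]) h5.one ?_ (fun _ _ _ h => h) ?_).mono le_rfl ?_
  · intro k _
    rw [hS2, setReg_mem, hF1.mem 3 rfl]; simp [hS0, h3, hashWord]
  · intro l S1 _ h4 hF
    exact hashStep_spec hs (.inr rfl) S1 (h5.frame hF rfl) l h4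
  · rintro l' S3 ⟨hlen', hl'⟩ hF3
    refine ⟨⟨hlen, fun k hk => ?_⟩, hlen', hl'⟩
    rw [hF3.mem 2 rfl]
    exact hl k hk

end WordRAM

namespace WordRAM

variable {w : ℕ}

/-! ### Filling the buckets -/

/-- The memory holds the hash values of the elements. -/
structure Hashed (X : List (BitVec w)) (r d s τ : ℕ) (h₁ h₂ : ℕ → ℕ) (S : State w) : Prop
    extends Ready X r d s τ S where
  bank₁ : ∀ k < X.length, S.mem 2 (BitVec.ofNat w k) = BitVec.ofNat w (h₁ k)
  bank₂ : ∀ k < X.length, S.mem 3 (BitVec.ofNat w k) = BitVec.ofNat w (h₂ k)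

theorem Hashed.frame {X : List (BitVec w)} {r d s τ : ℕ} {h₁ h₂ : ℕ → ℕ} {S S' : State w}
    (h : Hashed X r d s τ h₁ h₂ S) {p : Program} (hF : Frame p S S') (hp : p.keeps = true)
    (h2 : p.writesMem 2 = false) (h3 : p.writesMem 3 = false) : Hashed X r d s τ h₁ h₂ S' :=
  ⟨h.toReady.frame hF hp, by rw [hF.mem 2 h2]; exact h.bank₁, by rw [hF.mem 3 h3]; exact h.bank₂⟩

theorem HashBank.hashed {X : List (BitVec w)} {r d s τ : ℕ} {S : State w}
    {l : List (BitVec w) × List (BitVec w)} (h : Ready X r d s τ S) (h1 : HashBank X 2 l.1 S)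
    (h2 : HashBank X 3 l.2 S) : Hashed X r d s τ (hashValue X l.1) (hashValue X l.2) S :=
  ⟨h, fun k hk => by rw [h1 k hk, hashValue, BitVec.ofNat_toNat, BitVec.setWidth_eq],
    fun k hk => by rw [h2 k hk, hashValue, BitVec.ofNat_toNat, BitVec.setWidth_eq]⟩

/-- Bank `7` holds a representative `ι y < n` of every value `y` of the second hash function. The
values `h₂ k` range up to `2 ^ (2 * s)`, whereas a pair consisting of `ι (h₂ k)` and `h₁ k` fits
into a word and can address a table. -/
def IdBank (n : ℕ) (h₂ ι : ℕ → ℕ) (S : State w) : Prop :=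
  ∀ k < n, S.mem 7 (BitVec.ofNat w (h₂ k)) = BitVec.ofNat w (ι (h₂ k)) ∧ ι (h₂ k) < n ∧
    h₂ (ι (h₂ k)) = h₂ k

/-- Chooses a representative for every value of the second hash function. -/
def idPass : Program :=
  .seq (.op .or 21 0 0) (forDown 21 1 (block [.load 24 3 21, .store 7 24 21]))

theorem idPass_triple {X : List (BitVec w)} {r d s τ : ℕ} {h₁ h₂ : ℕ → ℕ}
    (hs : Sizes w X.length r d s τ) (hlt : ∀ k < X.length, h₂ k < 2 ^ (2 * s)) (S : State w)
    (h : Hashed X r d s τ h₁ h₂ S) :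
    Triple idPass S ((3 + X.length * 6 : ℕ) : ℝ≥0∞) (fun S' => ∃ ι, IdBank X.length h₂ ι S') := by
  set n := X.length with hn
  have hlt' : ∀ k < n, h₂ k < 2 ^ w := fun k hk => (hlt k hk).trans
    ((Nat.pow_lt_pow_right (by norm_num) (by omega)).trans hs.c_lt)
  refine (Triple.seq_nat 1 (1 + n * (3 + 3)) (Post := fun S' => S' = S.setReg 21 (BitVec.ofNat w n))
    (Triple.straight 1 rfl le_rfl (by simp only [Program.exec, h.len, eval_or_self, hn])) ?_).mono
    (by rw [Nat.cast_le]; omega) fun _ h _ => h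
  rintro _ rfl -
  set S1 := S.setReg 21 (BitVec.ofNat w n) with hS1
  have h1 : Hashed X r d s τ h₁ h₂ S1 :=
    h.frame (p := .const 21 0) (frame_setReg (by simp [Program.writesReg])) rfl rfl rfl
  refine (Triple.forDown_nat n 3 S1 (fun j S' => ∀ k < n, j ≤ k → ∃ k' < n,
    S'.mem 7 (BitVec.ofNat w (h₂ k)) = BitVec.ofNat w k' ∧ h₂ k' = h₂ k) hs.lt rfl rfl (by simp)
    (by simp [hS1]) h1.one (fun k _ _ => by omega) (fun _ _ _ h => h) ?_).mono le_rfl ?_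
  · intro j hj S2 hj2 hI hF
    have h2 := h1.frame hF rfl rfl rfl
    refine Triple.straight 3 rfl le_rfl ?_
    intro k hk hjk
    simp +decide only [block, Program.exec, setReg_reg, setMem_mem, setReg_mem, ↓reduceIte, hj2,
      h2.bank₂ j hj, Function.update_apply]
    by_cases hkj : h₂ k = h₂ j
    · exact ⟨j, hj, by rw [if_pos (by rw [hkj])], hkj.symm⟩
    · rw [if_neg (ofNat_ne_ofNat hkj (hlt' k hk) (hlt' j hj))]
      exact hI k hk (by rcases hjk.eq_or_lt with rfl | h; exacts [absurd rfl hkj, h])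
  · intro S' hS' _
    refine ⟨fun y => (S'.mem 7 (BitVec.ofNat w y)).toNat, fun k hk => ?_⟩
    obtain ⟨k', hk', h3, h4⟩ := hS' k hk (Nat.zero_le _)
    simp only [h3, BitVec.toNat_ofNat, Nat.mod_eq_of_lt (hk'.trans hs.lt)]
    exact ⟨trivial, hk', h4⟩

/-- The buckets hold the elements of `G`: bank `4` has the sizes of the buckets, bank `5` their
contents, and bank `6` gives access to the elements of a bucket by their hash values.  Here `0`
stands for an absent element, and `k + 1` for the element `k`. -/
structure Buckets (X : List (BitVec w)) (r τ : ℕ) (h₁ h₂ ι : ℕ → ℕ) (G : List ℕ) (S : State w) :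
    Prop where
  mem_tab : ∀ g ∈ G, S.mem 6 (BitVec.ofNat w (ι (h₂ g) * 2 ^ r + h₁ g)) = BitVec.ofNat w (g + 1)
  notMem_tab : ∀ y < X.length, ∀ u < 2 ^ r, (∀ g ∈ G, ι (h₂ g) = y → h₁ g ≠ u) →
    S.mem 6 (BitVec.ofNat w (y * 2 ^ r + u)) = 0#w
  size : ∀ u < 2 ^ r, S.mem 4 (BitVec.ofNat w u) = BitVec.ofNat w (G.filter (h₁ · = u)).length
  slot : ∀ u < 2 ^ r, ∀ p < 2 ^ τ, S.mem 5 (BitVec.ofNat w (u * 2 ^ τ + p)) =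
    BitVec.ofNat w ((slotOf h₁ G u p).elim 0 (· + 1))

/-- The flag is correct for the sums that involve elements `k ≥ j` outside the buckets: it is raised
if such an element and another one have their sum in the list. -/
structure Scanned (X : List (BitVec w)) (j : ℕ) (G : List ℕ) (S : State w) : Prop where
  sound : FlagSound X (S.reg 2)
  found : ∀ k < X.length, j ≤ k → k ∉ G → ∀ x ∈ X, x ^^^ X.getD k 0 ∈ X → S.reg 2 = 1#w

theorem key_ne {y u y' u' r : ℕ} (hu : u < 2 ^ r) (hu' : u' < 2 ^ r) (h : y = y' → u ≠ u') :
    y * 2 ^ r + u ≠ y' * 2 ^ r + u' := by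
  intro he
  have h1 := congrArg (· / 2 ^ r) he
  have h2 := congrArg (· % 2 ^ r) he
  simp only [query_div hu, query_div hu', query_mod hu, query_mod hu'] at h1 h2
  exact h h1 h2

theorem key_lt {n y u r : ℕ} (hy : y < n) (hu : u < 2 ^ r) : y * 2 ^ r + u < n * 2 ^ r := by
  calc y * 2 ^ r + u < y * 2 ^ r + 2 ^ r := by omega
    _ = (y + 1) * 2 ^ r := by ring
    _ ≤ _ := Nat.mul_le_mul_right _ hy

/-- Puts the element in register `22` into its bucket, or compares it with all other elements if
there is already an element with the same pair of hash values or if the bucket is full. -/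
def bucketStep : Program :=
  .seq (block [.load 24 3 22, .load 25 7 24, .load 26 2 22, .op .shiftLeft 25 25 3,
      .op .add 25 25 26, .load 27 6 25, .load 28 4 26, .op .lt 29 9 28, .op .or 27 27 29])
    (.ite 27 (.seq (.load 30 0 22) scan) (block [.op .add 29 22 1, .store 6 25 29,
      .op .shiftLeft 27 26 6, .op .add 27 27 28, .store 5 27 29, .op .add 28 28 1,
      .store 4 26 28]))

theorem eval_or (x y : BitVec w) : BinOp.or.eval x y = x ||| y := rfl

theorem or_ne_zero_iff (x y : BitVec w) : x ||| y ≠ 0 ↔ x ≠ 0 ∨ y ≠ 0 := by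
  have : x ||| y = 0 ↔ x = 0 ∧ y = 0 := BitVec.or_eq_zero_iff
  rw [Ne, this]; tauto

/-- An element that is not bad is added to the tables, at an address that is not in use. -/
theorem Buckets.insert {X : List (BitVec w)} {r d s τ j : ℕ} {h₁ h₂ ι : ℕ → ℕ} {G : List ℕ}
    {S S' : State w} (hs : Sizes w X.length r d s τ) (hlt₁ : ∀ k < X.length, h₁ k < 2 ^ r)
    (hι : ∀ k < X.length, ι (h₂ k) < X.length ∧ h₂ (ι (h₂ k)) = h₂ k) (hj : j < X.length)
    (hG : ∀ g ∈ G, g < X.length) (hB : Buckets X r τ h₁ h₂ ι G S)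
    (hbad : ¬ IsBad h₁ h₂ (2 ^ τ) G j)
    (h6 : S'.mem 6 = Function.update (S.mem 6) (BitVec.ofNat w (ι (h₂ j) * 2 ^ r + h₁ j))
      (BitVec.ofNat w (j + 1)))
    (h5 : S'.mem 5 = Function.update (S.mem 5)
      (BitVec.ofNat w (h₁ j * 2 ^ τ + (G.filter (h₁ · = h₁ j)).length)) (BitVec.ofNat w (j + 1)))
    (h4 : S'.mem 4 = Function.update (S.mem 4) (BitVec.ofNat w (h₁ j))
      (BitVec.ofNat w ((G.filter (h₁ · = h₁ j)).length + 1))) :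
    Buckets X r τ h₁ h₂ ι (G ++ [j]) S' := by
  set m := (G.filter (h₁ · = h₁ j)).length with hm
  have hr2 : 2 ^ r ≤ X.length * 2 ^ r := Nat.le_mul_of_pos_left _ hs.pos
  have hmτ : m < 2 ^ τ := by
    by_contra h
    exact hbad (.inr (by omega))
  have hslot : ∀ u < 2 ^ r, ∀ p < 2 ^ τ, u * 2 ^ τ + p < 2 ^ w := by
    intro u hu p hp
    refine (query_lt hu hp).trans_le (le_trans ?_ hs.fill_lt.le)
    exact Nat.pow_le_pow_right (by norm_num) (by omega)
  have hkey : ∀ y < X.length, ∀ u < 2 ^ r, y * 2 ^ r + u < 2 ^ w := fun y hy u hu =>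
    (key_lt hy hu).trans hs.query_lt
  have hιinj : ∀ g ∈ G, ι (h₂ g) = ι (h₂ j) → h₁ g ≠ h₁ j := by
    intro g hg h7 h8
    refine hbad (.inl ⟨g, hg, h8, ?_⟩)
    rw [← (hι g (hG g hg)).2, h7, (hι j hj).2]
  refine ⟨?_, ?_, ?_, ?_⟩
  · intro g hg
    rw [h6, Function.update_apply]
    rcases List.mem_append.1 hg with hg | hg
    · rw [if_neg, hB.mem_tab g hg]
      have hgn := hG g hg
      exact ofNat_ne_ofNat (key_ne (hlt₁ g hgn) (hlt₁ j hj) (hιinj g hg))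
        (hkey _ (hι g hgn).1 _ (hlt₁ g hgn)) (hkey _ (hι j hj).1 _ (hlt₁ j hj))
    · rw [List.mem_singleton] at hg
      subst hg
      rw [if_pos rfl]
  · intro y hy u hu hG'
    rw [h6, Function.update_apply, if_neg, hB.notMem_tab y hy u hu fun g hg =>
      hG' g (List.mem_append_left _ hg)]
    refine ofNat_ne_ofNat (key_ne hu (hlt₁ j hj) fun h7 h8 => ?_) (hkey _ hy _ hu)
      (hkey _ (hι j hj).1 _ (hlt₁ j hj))
    exact hG' j (by simp) h7.symm h8.symm
  · intro u hu
    rw [h4, Function.update_apply, List.filter_append, List.length_append]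
    by_cases huj : u = h₁ j
    · subst huj
      simp [hm]
    · have := hs.query_lt
      rw [if_neg (ofNat_ne_ofNat huj (by omega) (by have := hlt₁ j hj; omega)), hB.size u hu]
      simp [Ne.symm huj]
  · intro u hu p hp
    rw [h5, Function.update_apply]
    have hfilt : (G ++ [j]).filter (h₁ · = u) =
        G.filter (h₁ · = u) ++ if h₁ j = u then [j] else [] := by
      rw [List.filter_append]
      by_cases huj : h₁ j = u <;> simp [huj]
    by_cases hup : u = h₁ j ∧ p = m
    · obtain ⟨rfl, rfl⟩ := hup
      rw [if_pos rfl, slotOf, hfilt, if_pos rfl, hm, List.getElem?_concat_length]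
      simp
    · rw [if_neg, hB.slot u hu p hp]
      · congr 2
        rw [slotOf, slotOf, hfilt]
        by_cases huj : h₁ j = u
        · subst huj
          have hpm : p ≠ m := fun h => hup ⟨rfl, h⟩
          rw [if_pos rfl]
          rcases lt_or_ge p m with hlt | hge
          · rw [List.getElem?_append_left (by omega)]
          · rw [List.getElem?_eq_none (by omega), List.getElem?_eq_none (by simp; omega)]
        · rw [if_neg huj, List.append_nil]
      · refine ofNat_ne_ofNat (key_ne hp hmτ fun h7 h8 => hup ⟨h7, h8⟩) (hslot u hu p hp)
          (hslot _ (hlt₁ j hj) _ hmτ)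

open Classical in
/-- One step takes constant time, unless the element is bad and has to be compared with all others.
-/
theorem bucketStep_triple {X : List (BitVec w)} {r d s τ j : ℕ} {h₁ h₂ ι : ℕ → ℕ}
    (hs : Sizes w X.length r d s τ) (hlt₁ : ∀ k < X.length, h₁ k < 2 ^ r)
    (hj : j < X.length) (S : State w)
    (h : Hashed X r d s τ h₁ h₂ S) (hid : IdBank X.length h₂ ι S)
    (hjS : S.reg 22 = BitVec.ofNat w j)
    (hB : Buckets X r τ h₁ h₂ ι (goodAfter h₁ h₂ (2 ^ τ) X.length (j + 1)) S)
    (hSc : Scanned X (j + 1) (goodAfter h₁ h₂ (2 ^ τ) X.length (j + 1)) S) :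
    Triple bucketStep S (40 + (10 * X.length + 10 : ℕ) *
        if IsBad h₁ h₂ (2 ^ τ) (goodAfter h₁ h₂ (2 ^ τ) X.length (j + 1)) j then 1 else 0)
      (fun S' => Buckets X r τ h₁ h₂ ι (goodAfter h₁ h₂ (2 ^ τ) X.length j) S' ∧
        Scanned X j (goodAfter h₁ h₂ (2 ^ τ) X.length j) S') := by
  set n := X.length with hn
  set G := goodAfter h₁ h₂ (2 ^ τ) n (j + 1) with hG
  have hw0 : 0 < w := by have := hs.hw; omega
  have hfw := (Nat.pow_lt_pow_iff_right (by norm_num)).1 hs.fill_lt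
  have hwlt : w < 2 ^ w := Nat.lt_two_pow_self
  have hGmem : ∀ g ∈ G, g < n := fun g hg => (mem_goodAfter hg).2
  have hιj := hid j hj
  have h1j := hlt₁ j hj
  set m := (G.filter (h₁ · = h₁ j)).length with hm
  have hmle : m ≤ 2 ^ τ := length_filter_goodList_le _ _
  have hτw : 2 ^ τ < 2 ^ w := Nat.pow_lt_pow_right (by norm_num) (by omega)
  have hτ1 : 1 ≤ 2 ^ τ := Nat.one_le_two_pow
  set S1 := Program.exec (block [.load 24 3 22, .load 25 7 24, .load 26 2 22,
    .op .shiftLeft 25 25 3, .op .add 25 25 26, .load 27 6 25, .load 28 4 26, .op .lt 29 9 28,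
    .op .or 27 27 29]) S with hS1
  have hF1 : Frame (block [.load 24 3 22, .load 25 7 24, .load 26 2 22,
    .op .shiftLeft 25 25 3, .op .add 25 25 26, .load 27 6 25, .load 28 4 26, .op .lt 29 9 28,
    .op .or 27 27 29]) S S1 := exec_frame S
  have hregs : S1.reg 25 = BitVec.ofNat w (ι (h₂ j) * 2 ^ r + h₁ j) ∧
      S1.reg 26 = BitVec.ofNat w (h₁ j) ∧ S1.reg 28 = BitVec.ofNat w m ∧
      S1.reg 27 = S.mem 6 (BitVec.ofNat w (ι (h₂ j) * 2 ^ r + h₁ j)) |||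
        BitVec.ofNat w (if 2 ^ τ - 1 < m then 1 else 0) := by
    simp +decide only [hS1, block, Program.exec, setReg_reg, setReg_mem, ↓reduceIte, hjS,
      h.bank₂ j hj, hιj.1, h.bank₁ j hj, h.reg_r, eval_shl (show r < 2 ^ w by omega), eval_add,
      hB.size _ h1j, h.mτ, eval_lt (show 2 ^ τ - 1 < 2 ^ w by omega) (show m < 2 ^ w by omega),
      eval_or, ← hm, and_self]
  have hmem1 : ∀ b, S1.mem b = S.mem b := fun b => hF1.mem b rfl
  have hbad_iff : S1.reg 27 ≠ 0 ↔ IsBad h₁ h₂ (2 ^ τ) G j := by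
    rw [hregs.2.2.2, or_ne_zero_iff, ofNat_ite_ne_zero hw0, IsBad]
    refine or_congr ?_ (by rw [← hm]; omega)
    constructor
    · intro h7
      by_contra h8
      refine h7 (hB.notMem_tab _ hιj.2.1 _ h1j fun g hg h9 h10 => h8 ⟨g, hg, h10, ?_⟩)
      rw [← (hid g (hGmem g hg)).2.2, h9, hιj.2.2]
    · rintro ⟨g, hg, h7, h8⟩
      rw [← h7, ← h8, hB.mem_tab g hg]
      have := hGmem g hg
      exact ofNat_ne_zero (by omega) (by have := hs.lt; omega)
  have hj1 : S1.reg 22 = BitVec.ofNat w j := by rw [hF1.reg 22 rfl, hjS]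
  have h2S : S1.reg 2 = S.reg 2 := hF1.reg 2 rfl
  have hH1 := h.frame hF1 rfl rfl rfl
  have hgood := goodAfter_eq (h₁ := h₁) (h₂ := h₂) (cap := 2 ^ τ) hj
  rw [← hG] at hgood
  by_cases hbad : IsBad h₁ h₂ (2 ^ τ) G j
  · rw [if_pos hbad] at hgood
    rw [hgood, if_pos hbad]
    refine (Triple.seq_nat 17 (1 + (1 + 1 + (10 * n + 3))) (Post := fun S' => S' = S1)
      (Triple.straight 17 rfl le_rfl rfl) ?_).mono ?_ fun _ h _ => h
    · rintro _ rfl -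
      refine (Triple.ite (T := ((1 + 1 + (10 * n + 3) : ℕ) : ℝ≥0∞)) (fun _ => ?_)
        fun h0 => absurd h0 (hbad_iff.2 hbad)).mono (by push_cast; rfl) fun _ h _ => h
      refine Triple.seq_nat 1 _ (Post := fun S' => S' = S1.setReg 30 (X.getD j 0))
        (Triple.straight 1 rfl le_rfl (by
          simp only [Program.exec, hj1, hH1.load (show j < 2 ^ w from hj.trans hs.lt)])) ?_
      rintro _ rfl -
      have hR : Ready X r d s τ (S1.setReg 30 (X.getD j 0)) := hH1.toReady.frame
        (p := .const 30 0) (frame_setReg (by simp [Program.writesReg])) rfl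
      refine (scan_triple X hs.lt _ hR.toHolds hR.tab (by simpa using getD_mem hj 0)
        (by simpa [h2S] using hSc.sound)).mono le_rfl ?_
      rintro S2 ⟨h7, h8, h9⟩ hF2
      have hmem2 : ∀ b, S2.mem b = S.mem b := fun b => by rw [hF2.mem b rfl, setReg_mem, hmem1]
      refine ⟨⟨?_, ?_, ?_, ?_⟩, h7, ?_⟩
      · rw [hmem2]; exact hB.mem_tab
      · rw [hmem2]; exact hB.notMem_tab
      · rw [hmem2]; exact hB.size
      · rw [hmem2]; exact hB.slot
      · intro k hk hjk hkG x hx hxX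
        rcases hjk.eq_or_lt with rfl | hlt
        · exact h9 x hx (by simpa using hxX)
        · exact h8 (by simpa [h2S] using hSc.found k hk hlt hkG x hx hxX)
    · rw [mul_one]
      exact_mod_cast (by omega : 1 + 17 + (1 + (1 + 1 + (10 * n + 3))) ≤ 40 + (10 * n + 10))
  · rw [if_neg hbad] at hgood
    rw [hgood, if_neg hbad, mul_zero, add_zero]
    refine (Triple.seq_nat 17 (1 + 13) (Post := fun S' => S' = S1)
      (Triple.straight 17 rfl le_rfl rfl) ?_).mono (by norm_num) fun _ h _ => h
    rintro _ rfl -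
    refine (Triple.ite (T := (13 : ℕ)) (fun h0 => absurd (hbad_iff.1 h0) hbad)
      fun _ => ?_).mono (by norm_num) fun _ h _ => h
    refine Triple.straight 13 rfl le_rfl ?_
    set p : Program := block [.op .add 29 22 1, .store 6 25 29, .op .shiftLeft 27 26 6,
      .op .add 27 27 28, .store 5 27 29, .op .add 28 28 1, .store 4 26 28] with hp
    have h2' : (p.exec S1).reg 2 = S.reg 2 := by rw [(exec_frame S1).reg 2 rfl, h2S]
    refine ⟨hB.insert hs hlt₁ (fun k hk => (hid k hk).2) hj hGmem hbad ?_ ?_ ?_, ?_⟩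
    · simp +decide only [hp, block, Program.exec, setReg_reg, setReg_mem, setMem_mem, setMem_reg,
        ↓reduceIte, hregs.1, hj1, hH1.one, eval_add, hmem1]
    · simp +decide only [hp, block, Program.exec, setReg_reg, setReg_mem, setMem_mem, setMem_reg,
        ↓reduceIte, hregs.1, hregs.2.1, hregs.2.2.1, hj1, hH1.one, hH1.reg_τ, eval_add, hmem1,
        eval_shl (show τ < 2 ^ w by omega), ← hm]
    · simp +decide only [hp, block, Program.exec, setReg_reg, setReg_mem, setMem_mem, setMem_reg,
        ↓reduceIte, hregs.1, hregs.2.1, hregs.2.2.1, hj1, hH1.one, eval_add, hmem1, ← hm]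
    · refine ⟨by rw [h2']; exact hSc.sound, fun k hk hjk hkG x hx hxX => ?_⟩
      rw [h2']
      rw [List.mem_append, List.mem_singleton, not_or] at hkG
      exact hSc.found k hk (by omega) hkG.1 x hx hxX

/-- Distributes the elements to the buckets. -/
def bucketPass : Program := .seq (.op .or 22 0 0) (forDown 22 1 bucketStep)

/-- The elements are distributed in linear time, apart from time `O(n)` for every bad element. -/
theorem bucketPass_triple {X : List (BitVec w)} {r d s τ : ℕ} {h₁ h₂ ι : ℕ → ℕ}
    (hs : Sizes w X.length r d s τ) (hlt₁ : ∀ k < X.length, h₁ k < 2 ^ r) (S : State w)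
    (h : Hashed X r d s τ h₁ h₂ S) (hid : IdBank X.length h₂ ι S)
    (h4 : S.mem 4 = fun _ => 0#w) (h5 : S.mem 5 = fun _ => 0#w) (h6 : S.mem 6 = fun _ => 0#w)
    (hf : FlagSound X (S.reg 2)) :
    Triple bucketPass S ((3 + 43 * X.length : ℕ) +
        (10 * X.length + 10 : ℕ) * (badCount h₁ h₂ (2 ^ τ) X.length : ℝ≥0∞))
      (fun S' => Buckets X r τ h₁ h₂ ι (goodAfter h₁ h₂ (2 ^ τ) X.length 0) S' ∧
        Scanned X 0 (goodAfter h₁ h₂ (2 ^ τ) X.length 0) S') := by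
  classical
  set n := X.length with hn
  set T : ℕ → ℝ≥0∞ := fun j => 40 + (10 * n + 10 : ℕ) *
    if IsBad h₁ h₂ (2 ^ τ) (goodAfter h₁ h₂ (2 ^ τ) n (j + 1)) j then 1 else 0 with hT
  refine (Triple.seq (T := (1 : ℕ)) (Post := fun S' => S' = S.setReg 22 (BitVec.ofNat w n))
    (Triple.straight 1 rfl le_rfl (by simp only [Program.exec, h.len, eval_or_self, hn]))
    (T' := 1 + ∑ j ∈ Finset.range n, (3 + T j)) ?_).mono ?_ fun _ h _ => h
  · rintro _ rfl -
    set S1 := S.setReg 22 (BitVec.ofNat w n) with hS1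
    have h1 : Hashed X r d s τ h₁ h₂ S1 :=
      h.frame (p := .const 22 0) (frame_setReg (by simp [Program.writesReg])) rfl rfl rfl
    refine Triple.forDown (c := 22) (e := 1) (body := bucketStep) n S1
      (fun j S' => Buckets X r τ h₁ h₂ ι (goodAfter h₁ h₂ (2 ^ τ) n j) S' ∧
        Scanned X j (goodAfter h₁ h₂ (2 ^ τ) n j) S')
      T hs.lt rfl rfl (by simp) (by simp [hS1]) h1.one ?_ ?_ ?_
    · rw [goodAfter_self]
      refine ⟨⟨by simp, fun y _ u _ _ => by simp [hS1, h6], fun u _ => by simp [hS1, h4],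
        fun u _ p _ => by simp [hS1, h5, slotOf]⟩, by simpa [hS1] using hf, fun k _ _ => by omega⟩
    · rintro j S' x ⟨h7, h8⟩
      exact ⟨⟨h7.mem_tab, h7.notMem_tab, h7.size, h7.slot⟩, by simpa using h8.sound,
        by simpa using h8.found⟩
    · rintro j hj S2 hj2 ⟨h7, h8⟩ hF
      have hid2 : IdBank n h₂ ι S2 := by
        intro k hk
        rw [hF.mem 7 rfl]
        exact hid k hk
      exact bucketStep_triple hs hlt₁ hj S2 (h1.frame hF rfl rfl rfl) hid2 hj2 h7 h8
  · rw [hT, badCount, cast_card_filter, Finset.mul_sum, Finset.sum_add_distrib,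
      Finset.sum_add_distrib, Finset.sum_const, Finset.sum_const, Finset.card_range, ← add_assoc,
      ← add_assoc, ← add_assoc]
    gcongr ?_ + _
    simp only [nsmul_eq_mul]
    push_cast
    apply le_of_eq
    ring

end WordRAM

namespace WordRAM

variable {w : ℕ}

/-! ### Writing down the instance -/

/-- The cells `j, …, N - 1` hold the values of `F`, and all others hold zero: the state of an array
that is written from its end to its beginning. -/
def Filled (N : ℕ) (F : ℕ → ℕ) (j : ℕ) (m : BitVec w → BitVec w) : Prop :=
  m = fun x => if j ≤ x.toNat ∧ x.toNat < N then BitVec.ofNat w (F x.toNat) else 0#w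

theorem filled_zero (N : ℕ) (F : ℕ → ℕ) : Filled N F N (fun _ : BitVec w => 0#w) := by
  funext x
  rw [if_neg (by omega)]

theorem Filled.step {N j : ℕ} {F : ℕ → ℕ} {m : BitVec w → BitVec w} (h : Filled N F (j + 1) m)
    (hj : j < N) (hN : N ≤ 2 ^ w) :
    Filled N F j (Function.update m (BitVec.ofNat w j) (BitVec.ofNat w (F j))) := by
  unfold Filled at h
  funext x
  rw [Function.update_apply, h]
  by_cases hx : x.toNat = j
  · have : x = BitVec.ofNat w j := by rw [← hx, BitVec.ofNat_toNat, BitVec.setWidth_eq]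
    rw [if_pos this, if_pos ⟨hx.ge, hx ▸ hj⟩, hx]
  · have : x ≠ BitVec.ofNat w j := by
      rintro rfl
      rw [BitVec.toNat_ofNat, Nat.mod_eq_of_lt (hj.trans_le hN)] at hx
      exact hx rfl
    rw [if_neg this]
    exact if_congr (by omega) rfl rfl

theorem Filled.eq_arrayOf {N : ℕ} {F : ℕ → ℕ} {m : BitVec w → BitVec w} (h : Filled N F 0 m) :
    m = arrayOf w ((List.range N).map F) := by
  funext x
  rw [arrayOf_map_range, h]
  exact if_congr (by simp) rfl rfl

/-- Writes the entry number `reg 22` of the lists of elements of both families. The number splits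
into the number of the set and a position of `τ` bits, and the number of the set into the bucket and
a shift of `s` bits. An empty position yields a filler, which differs from all hash values and from
the fillers of the other family. -/
def fillStep : Program :=
  .seq (block [.op .shiftRight 24 22 6, .op .and 25 22 9, .op .shiftRight 26 24 5,
      .op .and 27 24 8, .op .shiftLeft 28 26 6, .op .add 28 28 25, .load 28 5 28])
    (.seq (.ite 28 (block [.op .sub 28 28 1, .load 28 3 28, .op .shiftLeft 29 27 5,
        .op .xor 29 28 29, .op .xor 28 28 27]) (block [.op .add 29 17 25, .op .add 28 18 25]))
      (block [.store 21 22 29, .store 27 22 28]))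

theorem fillStep_triple {X : List (BitVec w)} {r d s τ j : ℕ} {h₁ h₂ ι : ℕ → ℕ} {G : List ℕ}
    (hs : Sizes w X.length r d s τ) (hG : ∀ g ∈ G, g < X.length)
    (S : State w) (h : Hashed X r d s τ h₁ h₂ S) (hB : Buckets X r τ h₁ h₂ ι G S)
    (h17 : S.reg 17 = BitVec.ofNat w (2 ^ (2 * s)))
    (h18 : S.reg 18 = BitVec.ofNat w (2 * 2 ^ (2 * s)))
    (hj : j < 2 ^ (r + s) * 2 ^ τ) (hjS : S.reg 22 = BitVec.ofNat w j) :
    Triple fillStep S ((31 : ℕ) : ℝ≥0∞) (fun S' =>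
      S'.mem 21 = Function.update (S.mem 21) (BitVec.ofNat w j)
        (BitVec.ofNat w (entryA s h₂ (slotOf h₁ G) (j / 2 ^ τ) (j % 2 ^ τ))) ∧
      S'.mem 27 = Function.update (S.mem 27) (BitVec.ofNat w j)
        (BitVec.ofNat w (entryB s h₂ (slotOf h₁ G) (j / 2 ^ τ) (j % 2 ^ τ)))) := by
  have hfw := (Nat.pow_lt_pow_iff_right (by norm_num)).1 hs.fill_lt
  have hwlt : w < 2 ^ w := Nat.lt_two_pow_self
  have hjw : j < 2 ^ w := by rw [← pow_add] at hj; exact hj.trans hs.fill_lt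
  have hi : j / 2 ^ τ < 2 ^ w := (Nat.div_le_self _ _).trans_lt hjw
  have hu : j / 2 ^ τ / 2 ^ s < 2 ^ r := by
    rw [Nat.div_div_eq_div_mul]
    refine Nat.div_lt_of_lt_mul ?_
    rw [pow_add] at hj
    calc j < 2 ^ r * 2 ^ s * 2 ^ τ := hj
      _ = _ := by ring
  have hp : j % 2 ^ τ < 2 ^ τ := Nat.mod_lt _ (by positivity)
  have hslot := hB.slot _ hu _ hp
  refine Triple.straight 31 rfl (by decide) ?_
  set S1 := Program.exec (block [.op .shiftRight 24 22 6, .op .and 25 22 9, .op .shiftRight 26 24 5,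
      .op .and 27 24 8, .op .shiftLeft 28 26 6, .op .add 28 28 25, .load 28 5 28]) S with hS1
  have hreg : S1.reg 25 = BitVec.ofNat w (j % 2 ^ τ) ∧
      S1.reg 27 = BitVec.ofNat w (j / 2 ^ τ % 2 ^ s) ∧
      S1.reg 28 =
        BitVec.ofNat w ((slotOf h₁ G (j / 2 ^ τ / 2 ^ s) (j % 2 ^ τ)).elim 0 (· + 1)) := by
    simp +decide only [hS1, block, Program.exec, setReg_reg, setReg_mem, ↓reduceIte, hjS, h.reg_τ,
      h.mτ, h.reg_s, h.ms, eval_shr hjw (show τ < 2 ^ w by omega), eval_and_mask hjw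
      (show τ ≤ w by omega), eval_shr hi (show s < 2 ^ w by omega), eval_and_mask hi
      (show s ≤ w by omega), eval_shl (show τ < 2 ^ w by omega), eval_add, hslot, and_self]
  have hfix : ∀ i, i < 24 → S1.reg i = S.reg i := fun i hi => (exec_frame S).reg i (by
    simp [Program.writesReg, block]; omega)
  have hmem : ∀ b, S1.mem b = S.mem b := fun b => (exec_frame S).mem b rfl
  have e1 := hfix 1 (by norm_num)
  have e5 := hfix 5 (by norm_num)
  have e17 := hfix 17 (by norm_num)
  have e18 := hfix 18 (by norm_num)
  have e22 := hfix 22 (by norm_num)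
  rw [h.one] at e1; rw [h.reg_s] at e5; rw [h17] at e17; rw [h18] at e18; rw [hjS] at e22
  obtain ⟨h25, h27, h28⟩ := hreg
  rw [fillStep, Program.exec, ← hS1]
  cases hsl : slotOf h₁ G (j / 2 ^ τ / 2 ^ s) (j % 2 ^ τ) with
  | none =>
    rw [hsl, Option.elim] at h28
    have hz : ¬ S1.reg 28 ≠ 0 := not_not_intro h28
    simp +decide only [block, Program.exec, setReg_reg, setReg_mem, setMem_mem, setMem_reg,
      ↓reduceIte, hz, h25, e17, e18, e22, eval_add, hmem, entryA, entryB, hsl,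
      Option.elim, and_self]
  | some k =>
    rw [hsl, Option.elim] at h28
    have hk : k < X.length := hG k (List.mem_filter.1 (List.mem_of_getElem? hsl)).1
    have hne : S1.reg 28 ≠ 0 := by
      rw [h28]; exact ofNat_ne_zero (by omega) (by have := hs.lt; omega)
    have hne' : BitVec.ofNat w (k + 1) ≠ 0 := h28 ▸ hne
    simp +decide only [block, Program.exec, setReg_reg, setReg_mem, setMem_mem, setMem_reg,
      ↓reduceIte, eq_true hne', h28, e1, e5, e22, h27, eval_sub (show 1 ≤ k + 1 by omega),
      Nat.add_sub_cancel, hmem, h.bank₂ k hk, eval_shl (show s < 2 ^ w by omega), eval_xor, entryA,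
      entryB, hsl, Option.elim, and_self]

/-- Writes the offset number `reg 22`, which is the same for both families since all sets have the
same size. -/
def offsetStep : Program :=
  block [.op .shiftLeft 24 22 6, .store 18 22 24, .store 24 22 24]

/-- Writes the query number `reg 22`, which splits into an element `k` and a bucket `u` of `r` bits.
The buckets `u` and `u ⊕ h₁ k` are intersected, shifted by the upper and by the lower half of `h₂
k`. -/
def queryStep : Program :=
  block [.op .shiftRight 24 22 3, .op .and 25 22 7, .load 26 3 24, .load 27 2 24,
    .op .shiftRight 28 26 5, .op .and 29 26 8, .op .shiftLeft 31 25 5, .op .add 31 31 28,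
    .store 30 22 31, .op .xor 25 25 27, .op .shiftLeft 25 25 5, .op .add 25 25 29,
    .store 33 22 25]

theorem queryStep_triple {X : List (BitVec w)} {r d s τ t : ℕ} {h₁ h₂ : ℕ → ℕ}
    (hs : Sizes w X.length r d s τ) (hlt₂ : ∀ k < X.length, h₂ k < 2 ^ (2 * s))
    (S : State w) (h : Hashed X r d s τ h₁ h₂ S)
    (ht : t < X.length * 2 ^ r) (htS : S.reg 22 = BitVec.ofNat w t) :
    Triple queryStep S ((25 : ℕ) : ℝ≥0∞) (fun S' =>
      S'.mem 30 = Function.update (S.mem 30) (BitVec.ofNat w t)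
        (BitVec.ofNat w (t % 2 ^ r * 2 ^ s + h₂ (t / 2 ^ r) / 2 ^ s)) ∧
      S'.mem 33 = Function.update (S.mem 33) (BitVec.ofNat w t)
        (BitVec.ofNat w ((t % 2 ^ r ^^^ h₁ (t / 2 ^ r)) * 2 ^ s + h₂ (t / 2 ^ r) % 2 ^ s))) := by
  have hfw := (Nat.pow_lt_pow_iff_right (by norm_num)).1 hs.fill_lt
  have hwlt : w < 2 ^ w := Nat.lt_two_pow_self
  have htw := ht.trans hs.query_lt
  have hk : t / 2 ^ r < X.length := Nat.div_lt_of_lt_mul (by rwa [Nat.mul_comm])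
  have hh : h₂ (t / 2 ^ r) < 2 ^ w := (hlt₂ _ hk).trans
    ((Nat.pow_lt_pow_right (by norm_num) (by omega)).trans hs.c_lt)
  refine Triple.straight 25 rfl (by decide) ?_
  simp +decide only [queryStep, block, Program.exec, setReg_reg, setReg_mem, setMem_mem, setMem_reg,
    ↓reduceIte, htS, h.reg_r, h.mr, h.reg_s, h.ms, eval_shr htw (show r < 2 ^ w by omega),
    eval_and_mask htw (show r ≤ w by omega), h.bank₁ _ hk, h.bank₂ _ hk,
    eval_shr hh (show s < 2 ^ w by omega), eval_and_mask hh (show s ≤ w by omega),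
    eval_shl (show s < 2 ^ w by omega), eval_add, eval_xor, and_self]

/-- Writes the instance into area `2`: the registers `66`, `69`, `72`, `75` receive the four sizes,
and the banks `18`, `21`, `24`, `27`, `30`, `33` the six arrays. -/
def build : Program :=
  block [block [.op .add 17 5 5, .op .shiftLeft 17 1 17, .op .add 18 17 17, .op .add 66 18 18,
      .op .add 69 3 5, .op .shiftLeft 69 1 69, .op .or 72 69 69, .op .shiftLeft 75 0 3,
      .op .add 22 3 5, .op .add 22 22 6, .op .shiftLeft 22 1 22],
    forDown 22 1 fillStep,
    .op .add 22 69 1, forDown 22 1 offsetStep,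
    .op .or 22 75 75, forDown 22 1 queryStep]

theorem Buckets.congr {X : List (BitVec w)} {r τ : ℕ} {h₁ h₂ ι : ℕ → ℕ} {G : List ℕ}
    {S S' : State w} (h : Buckets X r τ h₁ h₂ ι G S) (h4 : S'.mem 4 = S.mem 4)
    (h5 : S'.mem 5 = S.mem 5) (h6 : S'.mem 6 = S.mem 6) : Buckets X r τ h₁ h₂ ι G S' :=
  ⟨by rw [h6]; exact h.mem_tab, by rw [h6]; exact h.notMem_tab, by rw [h4]; exact h.size,
    by rw [h5]; exact h.slot⟩

theorem build_triple {X : List (BitVec w)} {r d s τ : ℕ} {h₁ h₂ ι : ℕ → ℕ} {G : List ℕ}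
    (hs : Sizes w X.length r d s τ) (hlt₂ : ∀ k < X.length, h₂ k < 2 ^ (2 * s))
    (hG : ∀ g ∈ G, g < X.length)
    (S : State w) (h : Hashed X r d s τ h₁ h₂ S) (hB : Buckets X r τ h₁ h₂ ι G S)
    (hreg : ∀ i, S.reg (64 + 3 * i + 2) = 0#w) (hmem : ∀ b, S.mem (16 + 3 * b + 2) = fun _ => 0#w) :
    Triple build S ((50 + 50 * 2 ^ (r + s + τ) + 30 * (X.length * 2 ^ r) : ℕ) : ℝ≥0∞)
      (Embeds (fun i => 64 + 3 * i + 2) (fun b => 16 + 3 * b + 2)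
        ((hashInstance X.length r s τ h₁ h₂ (slotOf h₁ G)).input w)) := by
  set n := X.length with hn
  have hfw := (Nat.pow_lt_pow_iff_right (by norm_num)).1 hs.fill_lt
  have hcw := (Nat.pow_lt_pow_iff_right (by norm_num)).1 hs.c_lt
  have hwlt : w < 2 ^ w := Nat.lt_two_pow_self
  have hτ1 : 1 ≤ τ := by have := hs.τ_eq; omega
  have hA2 : 2 * 2 ^ (r + s) ≤ 2 ^ (r + s + τ) := by
    rw [← pow_succ']; exact Nat.pow_le_pow_right (by norm_num) (by omega)
  have hApos : 1 ≤ 2 ^ (r + s) := Nat.one_le_two_pow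
  have hAw : 2 ^ (r + s) + 1 < 2 ^ w := by have := hs.fill_lt; omega
  suffices H : Triple build S ((1 + 21 + (1 + (1 + 2 ^ (r + s + τ) * (3 + 31)) + (1 + 1 +
      (1 + (1 + (2 ^ (r + s) + 1) * (3 + 5)) + (1 + 1 + (1 + n * 2 ^ r * (3 + 25)))))) : ℕ) : ℝ≥0∞)
      (Embeds (fun i => 64 + 3 * i + 2) (fun b => 16 + 3 * b + 2)
        ((hashInstance n r s τ h₁ h₂ (slotOf h₁ G)).input w)) from
    H.mono (by rw [Nat.cast_le]; omega) fun _ h _ => h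
  refine Triple.seq_straight 21 _ rfl (by decide) ?_
  set p1 : Program := block [.op .add 17 5 5, .op .shiftLeft 17 1 17, .op .add 18 17 17,
    .op .add 66 18 18, .op .add 69 3 5, .op .shiftLeft 69 1 69, .op .or 72 69 69,
    .op .shiftLeft 75 0 3, .op .add 22 3 5, .op .add 22 22 6, .op .shiftLeft 22 1 22] with hp1
  set S1 := p1.exec S with hS1
  have hF1 : Frame p1 S S1 := exec_frame S
  have hr1 : S1.reg 17 = BitVec.ofNat w (2 ^ (2 * s)) ∧
      S1.reg 18 = BitVec.ofNat w (2 * 2 ^ (2 * s)) ∧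
      S1.reg 66 = BitVec.ofNat w (2 ^ (2 * s + 2)) ∧ S1.reg 69 = BitVec.ofNat w (2 ^ (r + s)) ∧
      S1.reg 72 = BitVec.ofNat w (2 ^ (r + s)) ∧ S1.reg 75 = BitVec.ofNat w (n * 2 ^ r) ∧
      S1.reg 22 = BitVec.ofNat w (2 ^ (r + s + τ)) := by
    have h4 : 2 ^ (2 * s) + 2 ^ (2 * s) + (2 ^ (2 * s) + 2 ^ (2 * s)) = 2 ^ (2 * s + 2) := by
      rw [pow_add]; ring
    simp +decide only [hS1, hp1, block, Program.exec, setReg_reg, ↓reduceIte, h.reg_s, h.reg_r,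
      h.reg_τ, h.one, h.len, eval_add, ← two_mul s, eval_shl (show 2 * s < 2 ^ w by omega),
      eval_shl (show r + s < 2 ^ w by omega), eval_shl (show r + s + τ < 2 ^ w by omega),
      eval_shl (show r < 2 ^ w by omega), one_mul, eval_or_self, h4, ← hn, and_self]
    rw [← two_mul]
    simp only [and_self]
  obtain ⟨r17, r18, r66, r69, r72, r75, r22⟩ := hr1
  have hH1 := h.frame hF1 rfl rfl rfl
  have hm1 : ∀ b, S1.mem b = S.mem b := fun b => hF1.mem b rfl
  refine Triple.seq_nat _ _ (Triple.forDown_nat (2 ^ (r + s + τ)) 31 S1 (fun j S' =>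
    Filled (2 ^ (r + s + τ)) (fun z => entryA s h₂ (slotOf h₁ G) (z / 2 ^ τ) (z % 2 ^ τ)) j
      (S'.mem 21) ∧
    Filled (2 ^ (r + s + τ)) (fun z => entryB s h₂ (slotOf h₁ G) (z / 2 ^ τ) (z % 2 ^ τ)) j
      (S'.mem 27)) hs.fill_lt rfl rfl (by simp) r22 hH1.one ?_ (fun _ _ _ h => h) ?_) ?_
  · rw [hm1, hm1, show S.mem 21 = fun _ => 0#w from hmem 1,
      show S.mem 27 = fun _ => 0#w from hmem 3]
    exact ⟨filled_zero _ _, filled_zero _ _⟩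
  · rintro j hj S2 hj2 ⟨h5, h6⟩ hF2
    have hB2 : Buckets X r τ h₁ h₂ ι G S2 := hB.congr (by rw [hF2.mem 4 rfl, hm1])
      (by rw [hF2.mem 5 rfl, hm1]) (by rw [hF2.mem 6 rfl, hm1])
    refine (fillStep_triple hs hG S2 (hH1.frame hF2 rfl rfl rfl) hB2 (by rw [hF2.reg 17 rfl, r17])
      (by rw [hF2.reg 18 rfl, r18]) (by rwa [← pow_add]) hj2).mono le_rfl ?_
    rintro S3 ⟨h7, h8⟩ -
    rw [h7, h8]
    exact ⟨h5.step hj hs.fill_lt.le, h6.step hj hs.fill_lt.le⟩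
  rintro S2 ⟨h21, h27⟩ hF2
  have hH2 := hH1.frame hF2 rfl rfl rfl
  refine Triple.seq_straight 1 _ rfl le_rfl ?_
  have hS3 : Program.exec (.op .add 22 69 1) S2 =
      S2.setReg 22 (BitVec.ofNat w (2 ^ (r + s) + 1)) := by
    simp only [Program.exec, hF2.reg 69 rfl, r69, hH2.one, eval_add]
  rw [hS3]
  set S3 := S2.setReg 22 (BitVec.ofNat w (2 ^ (r + s) + 1)) with hS3'
  have hF3 : Frame (.const 22 0) S2 S3 := frame_setReg (by simp [Program.writesReg])
  have hH3 := hH2.frame hF3 rfl rfl rfl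
  refine Triple.seq_nat _ _ (Triple.forDown_nat (2 ^ (r + s) + 1) 5 S3 (fun j S' =>
    Filled (2 ^ (r + s) + 1) (· * 2 ^ τ) j (S'.mem 18) ∧
    Filled (2 ^ (r + s) + 1) (· * 2 ^ τ) j (S'.mem 24)) hAw rfl rfl (by simp) (by simp [hS3'])
    hH3.one ?_ (fun _ _ _ h => h) ?_) ?_
  · rw [hF3.mem 18 rfl, hF3.mem 24 rfl, hF2.mem 18 rfl, hF2.mem 24 rfl, hm1, hm1,
      show S.mem 18 = fun _ => 0#w from hmem 0, show S.mem 24 = fun _ => 0#w from hmem 2]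
    exact ⟨filled_zero _ _, filled_zero _ _⟩
  · rintro j hj S4 hj4 ⟨h5, h6⟩ hF4
    have hH4 := hH3.frame hF4 rfl rfl rfl
    refine Triple.straight 5 rfl (by decide) ?_
    simp +decide only [offsetStep, block, Program.exec, setReg_reg, setReg_mem, setMem_mem,
      setMem_reg, ↓reduceIte, hj4, hH4.reg_τ, eval_shl (show τ < 2 ^ w by omega)]
    exact ⟨h5.step hj hAw.le, h6.step hj hAw.le⟩
  rintro S4 ⟨h18, h24⟩ hF4
  have hH4 := hH3.frame hF4 rfl rfl rfl
  refine Triple.seq_straight 1 _ rfl le_rfl ?_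
  have hS5 : Program.exec (.op .or 22 75 75) S4 = S4.setReg 22 (BitVec.ofNat w (n * 2 ^ r)) := by
    simp only [Program.exec, hF4.reg 75 rfl, hF3.reg 75 rfl, hF2.reg 75 rfl, r75, eval_or_self]
  rw [hS5]
  set S5 := S4.setReg 22 (BitVec.ofNat w (n * 2 ^ r)) with hS5'
  have hF5 : Frame (.const 22 0) S4 S5 := frame_setReg (by simp [Program.writesReg])
  have hH5 := hH4.frame hF5 rfl rfl rfl
  refine (Triple.forDown_nat (n * 2 ^ r) 25 S5 (fun j S' =>
    Filled (n * 2 ^ r) (fun t => t % 2 ^ r * 2 ^ s + h₂ (t / 2 ^ r) / 2 ^ s) j (S'.mem 30) ∧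
    Filled (n * 2 ^ r) (fun t => (t % 2 ^ r ^^^ h₁ (t / 2 ^ r)) * 2 ^ s + h₂ (t / 2 ^ r) % 2 ^ s) j
      (S'.mem 33)) hs.query_lt rfl rfl (by simp) (by simp [hS5'])
    hH5.one ?_ (fun _ _ _ h => h) ?_).mono le_rfl ?_
  · rw [hF5.mem 30 rfl, hF5.mem 33 rfl, hF4.mem 30 rfl, hF4.mem 33 rfl, hF3.mem 30 rfl,
      hF3.mem 33 rfl, hF2.mem 30 rfl, hF2.mem 33 rfl, hm1, hm1,
      show S.mem 30 = fun _ => 0#w from hmem 4, show S.mem 33 = fun _ => 0#w from hmem 5]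
    exact ⟨filled_zero _ _, filled_zero _ _⟩
  · rintro j hj S6 hj6 ⟨h5, h6⟩ hF6
    refine (queryStep_triple hs hlt₂ S6 (hH5.frame hF6 rfl rfl rfl) hj hj6).mono le_rfl ?_
    rintro S7 ⟨h7, h8⟩ -
    rw [h7, h8]
    exact ⟨h5.step hj hs.query_lt.le, h6.step hj hs.query_lt.le⟩
  rintro S6 ⟨h30, h33⟩ hF6
  have hreg6 : ∀ i, i ∉ [22, 24, 25, 26, 27, 28, 29, 31] → S6.reg i = S1.reg i := by
    intro i hi
    simp only [List.mem_cons, List.not_mem_nil, or_false, not_or] at hi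
    rw [hF6.reg i, hF5.reg i, hF4.reg i, hF3.reg i, hF2.reg i] <;>
      simp [forDown, fillStep, offsetStep, queryStep, Program.writesReg] <;> omega
  have hmem6 : ∀ b, b ∉ [18, 21, 24, 27, 30, 33] → S6.mem b = S.mem b := by
    intro b hb
    simp only [List.mem_cons, List.not_mem_nil, or_false, not_or] at hb
    rw [hF6.mem b, hF5.mem b, hF4.mem b, hF3.mem b, hF2.mem b, hm1] <;>
      simp [forDown, fillStep, offsetStep, queryStep, Program.writesMem] <;> omega
  have g21 : S6.mem 21 = S2.mem 21 := by
    rw [hF6.mem 21 rfl, hF5.mem 21 rfl, hF4.mem 21 rfl, hF3.mem 21 rfl]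
  have g27 : S6.mem 27 = S2.mem 27 := by
    rw [hF6.mem 27 rfl, hF5.mem 27 rfl, hF4.mem 27 rfl, hF3.mem 27 rfl]
  have g18 : S6.mem 18 = S4.mem 18 := by rw [hF6.mem 18 rfl, hF5.mem 18 rfl]
  have g24 : S6.mem 24 = S4.mem 24 := by rw [hF6.mem 24 rfl, hF5.mem 24 rfl]
  constructor
  · intro i
    rcases lt_or_ge i 4 with hi | hi
    · rw [hreg6 _ (by simp; omega)]
      interval_cases i
      · exact r66
      · exact r69.trans (by simp [SetIntersectionInstance.input, initState, hashInstance])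
      · exact r72.trans (by simp [SetIntersectionInstance.input, initState, hashInstance])
      · exact r75.trans (by simp [SetIntersectionInstance.input, initState, hashInstance])
    · rw [hreg6 _ (by simp; omega), hF1.reg _ (by simp [hp1, Program.writesReg]; omega), hreg]
      simp only [SetIntersectionInstance.input, initState]
      rw [List.getD_eq_default _ _ (by simpa using hi)]
  · intro b
    rcases lt_or_ge b 6 with hb | hb
    · simp only [SetIntersectionInstance.input, initState]
      interval_cases b
      · refine (g18.trans h18.eq_arrayOf).trans ?_
        simp only [List.getD_cons_zero, hashInstance, offsets_grid]
      · refine (g21.trans h21.eq_arrayOf).trans ?_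
        simp only [List.getD_cons_succ, List.getD_cons_zero, hashInstance, flatten_grid, ← pow_add]
      · refine (g24.trans h24.eq_arrayOf).trans ?_
        simp only [List.getD_cons_succ, List.getD_cons_zero, hashInstance, offsets_grid]
      · refine (g27.trans h27.eq_arrayOf).trans ?_
        simp only [List.getD_cons_succ, List.getD_cons_zero, hashInstance, flatten_grid, ← pow_add]
      · refine h30.eq_arrayOf.trans ?_
        simp only [List.getD_cons_succ, List.getD_cons_zero, hashInstance, List.map_map]
        rfl
      · refine h33.eq_arrayOf.trans ?_
        simp only [List.getD_cons_succ, List.getD_cons_zero, hashInstance, List.map_map]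
        rfl
    · rw [hmem6 _ (by simp; omega), hmem]
      simp only [SetIntersectionInstance.input, initState]
      rw [List.getD_eq_default _ _ (by simpa using hb)]
      funext z; simp [arrayOf]

end WordRAM

namespace WordRAM

variable {w : ℕ}

/-! ### Reading the answers -/

/-- The output stream of a list of pairs. -/
def flatPairs (L : List (BitVec w × BitVec w)) : List (BitVec w) := L.flatMap fun p => [p.1, p.2]

theorem flatPairs_append (L : List (BitVec w × BitVec w)) (p : BitVec w × BitVec w) :
    flatPairs (L ++ [p]) = flatPairs L ++ [p.1] ++ [p.2] := by simp [flatPairs]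

theorem append_eq_flatPairs {out : List (BitVec w)} {x : BitVec w}
    {L : List (BitVec w × BitVec w)} (h : out ++ [x] = flatPairs L) :
    ∃ L' y, out = flatPairs L' ++ [y] ∧ L = L' ++ [(y, x)] := by
  rcases List.eq_nil_or_concat L with rfl | ⟨L', p, rfl⟩
  · simp [flatPairs] at h
  · rw [List.concat_eq_append, flatPairs_append] at h
    obtain ⟨h1, h2⟩ := List.append_inj' h rfl
    rw [List.singleton_inj] at h2
    exact ⟨L', p.1, h1, by rw [List.concat_eq_append, h2]⟩

/-- The element of the list to which the answer `(t, x)` refers. The query number `t` gives an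
element `k` and a bucket; undoing the shift of `x` by the upper half of `h₂ k` gives the second hash
value of the reported element, and the table in bank `6` gives the element itself. -/
def reportedElem (S : State w) (t x : BitVec w) : BitVec w :=
  S.mem 0 (BinOp.sub.eval (S.mem 6 (BinOp.add.eval (BinOp.shiftLeft.eval (S.mem 7 (BinOp.xor.eval
    (BinOp.shiftLeft.eval (BinOp.shiftRight.eval (S.mem 3 (BinOp.shiftRight.eval t (S.reg 3)))
      (S.reg 5)) (S.reg 5)) x)) (S.reg 3)) (BinOp.and.eval t (S.reg 7)))) (S.reg 1))

/-- Whether the answer `(t, x)` comes from a triple of elements. A false answer, or a meaningless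
one, may lead to arbitrary cells; the three tests for membership ensure that the value `1` is never
wrong, whatever the words `t` and `x` are. -/
def report (S : State w) (t x : BitVec w) : BitVec w :=
  S.mem 1 (reportedElem S t x ^^^ S.mem 0 (BinOp.shiftRight.eval t (S.reg 3))) &&&
    S.mem 1 (reportedElem S t x) &&& S.mem 1 (S.mem 0 (BinOp.shiftRight.eval t (S.reg 3)))

/-- Treats the answer whose two components are in the registers `41` and `46`. -/
def decode : Program :=
  block [.op .shiftRight 42 41 3, .op .and 43 41 7, .load 44 3 42, .op .shiftRight 44 44 5,
    .op .shiftLeft 44 44 5, .op .xor 44 44 46, .load 44 7 44, .op .shiftLeft 44 44 3,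
    .op .add 44 44 43, .load 44 6 44, .op .sub 44 44 1, .load 44 0 44, .load 45 0 42,
    .op .xor 46 44 45, .load 46 1 46, .load 44 1 44, .load 45 1 45, .op .and 46 46 44,
    .op .and 46 46 45, .op .or 2 2 46, .const 40 0]

/-- What is done instead of writing the register `a` to the output: register `40` tells whether
this is the second component of an answer, the first one being in register `41`. -/
def receive (a : ℕ) : Program :=
  .seq (.op .or 46 a a) (.ite 40 decode (block [.op .or 41 46 46, .const 40 1]))

theorem receive_writesReg (a : ℕ) {i : ℕ} (h2 : i ≠ 2) (h : i < 40 ∨ 46 < i) :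
    (receive a).writesReg i = false := by
  simp [receive, decode, Program.writesReg]
  omega

/-- The state after the words `out` have been received, where `S₀` is the state before. After an
even number of words the next one is the first component of an answer; after an odd number the first
component `y` is kept in register `41`. -/
structure Received (X : List (BitVec w)) (S₀ : State w) (out : List (BitVec w)) (S : State w) :
    Prop where
  reg : ∀ i < 40, i ≠ 2 → S.reg i = S₀.reg i
  mem : ∀ b < 16, S.mem b = S₀.mem b
  output : S.out = S₀.out
  sound : FlagSound X (S.reg 2)
  mono : S₀.reg 2 = 1#w → S.reg 2 = 1#w
  even : ∀ L, out = flatPairs L → S.reg 40 = 0#w ∧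
    ∀ p ∈ L, report S₀ p.1 p.2 = 1#w → S.reg 2 = 1#w
  odd : ∀ L y, out = flatPairs L ++ [y] → S.reg 40 = 1#w ∧ S.reg 41 = y ∧
    ∀ p ∈ L, report S₀ p.1 p.2 = 1#w → S.reg 2 = 1#w

theorem receive_triple {X : List (BitVec w)} {S₀ S : State w} {out : List (BitVec w)} (hw : 0 < w)
    (hm : S₀.mem 1 = marks X) (h : Received X S₀ out S) (a : ℕ) :
    Triple (receive a) S ((60 : ℕ) : ℝ≥0∞) (Received X S₀ (out ++ [S.reg a])) := by
  have h10 : (1#w : BitVec w) ≠ 0#w := ofNat_ne_zero one_ne_zero (Nat.one_lt_two_pow hw.ne')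
  refine Triple.straight 60 rfl (Nat.le_of_ble_eq_true rfl) ?_
  have hF := exec_frame (p := receive a) S
  have hreg : ∀ i < 40, i ≠ 2 → ((receive a).exec S).reg i = S₀.reg i := fun i hi h2 =>
    (hF.reg i (receive_writesReg a h2 (.inl hi))).trans (h.reg i hi h2)
  have hmem : ∀ b < 16, ((receive a).exec S).mem b = S₀.mem b := fun b hb =>
    (hF.mem b rfl).trans (h.mem b hb)
  have hout : ((receive a).exec S).out = S₀.out := (hF.out rfl).trans h.output
  set x := S.reg a with hx
  have hS1 : (receive a).exec S = if S.reg 40 ≠ 0 then decode.exec (S.setReg 46 x)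
      else ((S.setReg 46 x).setReg 41 x).setReg 40 (1#w) := by
    simp +decide only [receive, block, Program.exec, eval_or_self, setReg_reg, ↓reduceIte, ← hx]
  by_cases h40 : S.reg 40 = 0
  · rw [if_neg (not_not_intro h40)] at hS1
    have e2 : ((receive a).exec S).reg 2 = S.reg 2 := by rw [hS1]; simp
    refine ⟨hreg, hmem, hout, e2 ▸ h.sound, fun h1 => e2 ▸ h.mono h1, ?_, ?_⟩
    · intro L hL
      obtain ⟨L', y, h1, -⟩ := append_eq_flatPairs hL
      exact absurd ((h.odd L' y h1).1.symm.trans h40) h10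
    · intro L y hL
      obtain ⟨h1, h2⟩ := List.append_inj' hL rfl
      rw [List.singleton_inj] at h2
      rw [e2]
      exact ⟨by rw [hS1]; simp, by rw [hS1, ← h2]; simp, (h.even L h1).2⟩
  · rw [if_pos h40] at hS1
    have e1 := h.reg 1 (by norm_num) (by norm_num)
    have e3 := h.reg 3 (by norm_num) (by norm_num)
    have e5 := h.reg 5 (by norm_num) (by norm_num)
    have e7 := h.reg 7 (by norm_num) (by norm_num)
    have m0 := h.mem 0 (by norm_num)
    have m1 := h.mem 1 (by norm_num)
    have m3 := h.mem 3 (by norm_num)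
    have m6 := h.mem 6 (by norm_num)
    have m7 := h.mem 7 (by norm_num)
    have e2 : ((receive a).exec S).reg 2 = S.reg 2 ||| report S₀ (S.reg 41) x := by
      rw [hS1]
      simp +decide only [decode, block, Program.exec, setReg_reg, setReg_mem, ↓reduceIte, e1, e3,
        e5, e7, m0, m1, m3, m6, m7, report, reportedElem]
      rfl
    have e40 : ((receive a).exec S).reg 40 = 0#w := by
      rw [hS1]
      simp +decide only [decode, block, Program.exec, setReg_reg, ↓reduceIte]
    have hsound : FlagSound X (report S₀ (S.reg 41) x) := by
      rw [report, hm]; exact flagSound_and _ _ _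
    refine ⟨hreg, hmem, hout, e2 ▸ h.sound.or hsound,
      fun h1 => e2 ▸ FlagSound.or_eq_one_left (h.mono h1) hsound, ?_, ?_⟩
    · intro L hL
      obtain ⟨L', y, h1, rfl⟩ := append_eq_flatPairs hL
      obtain ⟨-, h2, h3⟩ := h.odd L' y h1
      refine ⟨e40, fun p hp hpr => ?_⟩
      rw [e2]
      rcases List.mem_append.1 hp with hp | hp
      · exact FlagSound.or_eq_one_left (h3 p hp hpr) hsound
      · rw [List.mem_singleton] at hp
        subst hp
        rw [h2]
        exact h.sound.or_eq_one_right hpr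
    · intro L y hL
      exact absurd (h.even L (List.append_inj' hL rfl).1).1 h40

/-- Receiving the output words in this way qualifies as a treatment of the outputs of a subroutine
that runs in area `2`. -/
theorem handles_receive {X : List (BitVec w)} {S₀ : State w} (hw : 0 < w)
    (hm : S₀.mem 1 = marks X) :
    Handles (fun i => 64 + 3 * i + 2) (fun b => 16 + 3 * b + 2) receive (Received X S₀)
      ((60 : ℕ) : ℝ≥0∞) where
  inj_reg := fun i j h => by simp only at h; omega
  inj_mem := fun i j h => by simp only at h; omega
  insensitive := fun out S S' h1 h2 h3 h => by
    have hr : ∀ i < 64, S'.reg i = S.reg i := fun i hi => h1 i fun j => by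
      show 64 + 3 * j + 2 ≠ i; omega
    refine ⟨fun i hi h4 => (hr i (by omega)).trans (h.reg i hi h4),
      fun b hb => (h2 b fun j => by show 16 + 3 * j + 2 ≠ b; omega).trans (h.mem b hb),
      h3.trans h.output, ?_, ?_, ?_, ?_⟩
    · rw [hr 2 (by norm_num)]; exact h.sound
    · rw [hr 2 (by norm_num)]; exact h.mono
    · rw [hr 2 (by norm_num), hr 40 (by norm_num)]; exact h.even
    · rw [hr 2 (by norm_num), hr 40 (by norm_num), hr 41 (by norm_num)]; exact h.odd
  one_le := by norm_num
  reg := fun a r => receive_writesReg _ (by omega) (.inr (by omega))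
  mem := fun a b => rfl
  triple := fun out S a h => receive_triple hw hm h _

/-- The answer that stems from a true sum of elements in the buckets is recognized. -/
theorem report_eq_one {X : List (BitVec w)} {r d s τ : ℕ} {h₁ h₂ ι : ℕ → ℕ} {G : List ℕ}
    (hs : Sizes w X.length r d s τ) (hlt₁ : ∀ k < X.length, h₁ k < 2 ^ r)
    (hlt₂ : ∀ k < X.length, h₂ k < 2 ^ (2 * s)) {S : State w} (h : Hashed X r d s τ h₁ h₂ S)
    (hB : Buckets X r τ h₁ h₂ ι G S) (hid : IdBank X.length h₂ ι S) {a k : ℕ}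
    (ha : a < X.length) (hk : k < X.length) (haG : a ∈ G) (hX : X.getD a 0 ^^^ X.getD k 0 ∈ X) :
    report S (BitVec.ofNat w (k * 2 ^ r + h₁ a))
      (BitVec.ofNat w (h₂ a ^^^ (h₂ k / 2 ^ s * 2 ^ s))) = 1#w := by
  have hfw := (Nat.pow_lt_pow_iff_right (by norm_num)).1 hs.fill_lt
  have hwlt : w < 2 ^ w := Nat.lt_two_pow_self
  have ht : k * 2 ^ r + h₁ a < 2 ^ w := (key_lt hk (hlt₁ a ha)).trans hs.query_lt
  have hh : h₂ k < 2 ^ w := (hlt₂ _ hk).trans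
    ((Nat.pow_lt_pow_right (by norm_num) (by omega)).trans hs.c_lt)
  have hxor : h₂ k / 2 ^ s * 2 ^ s ^^^ (h₂ a ^^^ (h₂ k / 2 ^ s * 2 ^ s)) = h₂ a := by
    rw [Nat.xor_comm, Nat.xor_assoc, Nat.xor_self, Nat.xor_zero]
  have hn := hs.lt
  have e1 : BinOp.shiftRight.eval (BitVec.ofNat w (k * 2 ^ r + h₁ a)) (S.reg 3) =
      BitVec.ofNat w k := by
    rw [h.reg_r, eval_shr ht (by omega), query_div (hlt₁ a ha)]
  have e2 : reportedElem S (BitVec.ofNat w (k * 2 ^ r + h₁ a))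
      (BitVec.ofNat w (h₂ a ^^^ (h₂ k / 2 ^ s * 2 ^ s))) = X.getD a 0 := by
    rw [reportedElem, e1, h.bank₂ k hk, h.reg_s, eval_shr hh (by omega), eval_shl (by omega),
      eval_xor, hxor, (hid a ha).1, h.reg_r, eval_shl (by omega), h.mr, eval_and_mask ht (by omega),
      query_mod (hlt₁ a ha), eval_add, hB.mem_tab a haG, h.one, eval_sub (by omega),
      Nat.add_sub_cancel, h.load (by omega)]
  rw [report, e2, e1, h.load (by omega), h.tab]
  exact flag_and_eq_one (getD_mem ha 0) (getD_mem hk 0) hX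

/-- The given program as a subroutine in area `2`, which reports its answers. -/
def consult (P : Program) : Program :=
  P.embed (fun i => 64 + 3 * i + 2) (fun b => 16 + 3 * b + 2) receive

/-- After the subroutine the flag tells whether there is a triple. For `a ⊕ b = k`, if `a` or `b` is
outside the buckets, then the triple was found while the buckets were filled; otherwise `a` is an
answer to the query for `k` and the bucket of `a`. -/
theorem consult_triple {X : List (BitVec w)} {r d s τ : ℕ} {h₁ h₂ ι : ℕ → ℕ} {P : Program}
    [Decidable (HasXORTriple X)]
    (hs : Sizes w X.length r d s τ) (hlt₁ : ∀ k < X.length, h₁ k < 2 ^ r)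
    (hlt₂ : ∀ k < X.length, h₂ k < 2 ^ (2 * s))
    (hlin₁ : ∀ a b k, X.getD a 0 ^^^ X.getD b 0 = X.getD k 0 → h₁ a ^^^ h₁ b = h₁ k)
    (hlin₂ : ∀ a b k, X.getD a 0 ^^^ X.getD b 0 = X.getD k 0 → h₂ a ^^^ h₂ b = h₂ k)
    {S : State w} (h : Hashed X r d s τ h₁ h₂ S)
    (hB : Buckets X r τ h₁ h₂ ι (goodAfter h₁ h₂ (2 ^ τ) X.length 0) S)
    (hid : IdBank X.length h₂ ι S) (hsc : Scanned X 0 (goodAfter h₁ h₂ (2 ^ τ) X.length 0) S)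
    (h40 : S.reg 40 = 0#w)
    (hP : HaltsWith P ((hashInstance X.length r s τ h₁ h₂
      (slotOf h₁ (goodAfter h₁ h₂ (2 ^ τ) X.length 0))).input w)
      ((hashInstance X.length r s τ h₁ h₂
        (slotOf h₁ (goodAfter h₁ h₂ (2 ^ τ) X.length 0))).CorrectOutput w))
    (hE : Embeds (fun i => 64 + 3 * i + 2) (fun b => 16 + 3 * b + 2)
      ((hashInstance X.length r s τ h₁ h₂
        (slotOf h₁ (goodAfter h₁ h₂ (2 ^ τ) X.length 0))).input w) S) :
    Triple (consult P) S ((60 : ℕ) * expectedTime P ((hashInstance X.length r s τ h₁ h₂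
        (slotOf h₁ (goodAfter h₁ h₂ (2 ^ τ) X.length 0))).input w))
      (fun S' => S'.reg 2 = BitVec.ofNat w (if HasXORTriple X then 1 else 0) ∧
        S'.out = S.out) := by
  have hw : 0 < w := by have := hs.hw; omega
  have h10 : (1#w : BitVec w) ≠ 0#w := ofNat_ne_zero one_ne_zero (Nat.one_lt_two_pow hw.ne')
  refine (Triple.embed (handles_receive (X := X) (S₀ := S) hw h.tab) hP hE ?_).mono le_rfl ?_
  · refine ⟨fun _ _ _ => rfl, fun _ _ => rfl, rfl, hsc.sound, fun h => h, ?_, ?_⟩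
    · rintro L hL
      rcases L with _ | ⟨p, L⟩
      · exact ⟨h40, by simp⟩
      · simp [flatPairs, SetIntersectionInstance.input, initState] at hL
    · intro L y hL
      simp [SetIntersectionInstance.input, initState] at hL
  rintro S' ⟨out, ⟨L, -, hL, rfl⟩, hR⟩ -
  refine ⟨flag_eq_of_hasXORTriple hR.sound ?_, hR.output⟩
  rintro ⟨x, hx, y, hy, z, hz, hxyz⟩
  obtain ⟨a, ha, rfl⟩ := List.getElem_of_mem hx
  obtain ⟨b, hb, rfl⟩ := List.getElem_of_mem hy
  obtain ⟨k, hk, rfl⟩ := List.getElem_of_mem hz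
  have hba : X[b] ^^^ X[a] = X[k] := by rw [BitVec.xor_comm]; exact hxyz
  have hak : X[a] ^^^ X[k] = X[b] := by
    rw [← hxyz, ← BitVec.xor_assoc, BitVec.xor_self, BitVec.zero_xor]
  by_cases haG : a ∈ goodAfter h₁ h₂ (2 ^ τ) X.length 0
  swap
  · refine hR.mono (hsc.found a ha (Nat.zero_le _) haG X[b] hy ?_)
    rw [List.getD_eq_getElem _ _ ha, hba]; exact hz
  by_cases hbG : b ∈ goodAfter h₁ h₂ (2 ^ τ) X.length 0
  swap
  · refine hR.mono (hsc.found b hb (Nat.zero_le _) hbG X[a] hx ?_)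
    rw [List.getD_eq_getElem _ _ hb, hxyz]; exact hz
  obtain ⟨p, hp, hpa⟩ := exists_slotOf haG
  obtain ⟨p', hp', hpb⟩ := exists_slotOf hbG
  have hsum : X.getD a 0 ^^^ X.getD b 0 = X.getD k 0 := by
    rwa [List.getD_eq_getElem _ _ ha, List.getD_eq_getElem _ _ hb, List.getD_eq_getElem _ _ hk]
  have hans := (goodSlots_slotOf hs.τ_le hlt₁ hlt₂).mem_answers hk hp hp' hpa hpb
    (hlin₁ a b k hsum) (hlin₂ a b k hsum)
  rw [← hL, List.mem_toFinset] at hans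
  have hrep := report_eq_one hs hlt₁ hlt₂ h hB hid ha hk haG (by
    rw [List.getD_eq_getElem _ _ ha, List.getD_eq_getElem _ _ hk, hak]; exact hy)
  have heven := hR.even (L.map fun p => (BitVec.ofNat w p.1, BitVec.ofNat w p.2))
    (by rw [flatPairs, List.flatMap_map])
  exact heven.2 _ (List.mem_map_of_mem hans) hrep

end WordRAM

namespace WordRAM

variable {w : ℕ}

/-! ### The program for 3XOR -/

/-- The area number `j` of registers and memory banks has not been used. -/
structure Fresh (j : ℕ) (S : State w) : Prop where
  reg : ∀ i, S.reg (64 + 3 * i + j) = 0#w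
  mem : ∀ b, S.mem (16 + 3 * b + j) = fun _ => 0#w

theorem Fresh.frame {j : ℕ} {S S' : State w} (h : Fresh j S) {p : Program} (hF : Frame p S S')
    (hr : ∀ i, p.writesReg (64 + 3 * i + j) = false)
    (hm : ∀ b, p.writesMem (16 + 3 * b + j) = false) : Fresh j S' :=
  ⟨fun i => (hF.reg _ (hr i)).trans (h.reg i), fun b => (hF.mem _ (hm b)).trans (h.mem b)⟩

/-- The instance for hash functions that are given by lists of linear forms. -/
noncomputable def reducedInstance (X : List (BitVec w)) (r s τ : ℕ)
    (l : List (BitVec w) × List (BitVec w)) : SetIntersectionInstance :=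
  hashInstance X.length r s τ (hashValue X l.1) (hashValue X l.2)
    (slotOf (hashValue X l.1)
      (goodAfter (hashValue X l.1) (hashValue X l.2) (2 ^ τ) X.length 0))

theorem hashValue_linear {X l : List (BitVec w)} (a b k : ℕ)
    (h : X.getD a 0 ^^^ X.getD b 0 = X.getD k 0) :
    hashValue X l a ^^^ hashValue X l b = hashValue X l k := by
  rw [hashValue_xor_eq_iff]
  have h0 : hashWord l 0#w = 0#w := by
    have := hashWord_xor l 0#w 0#w
    rwa [BitVec.xor_self, BitVec.xor_self] at this
  have : X.getD a 0#w ^^^ X.getD b 0#w ^^^ X.getD k 0#w = 0#w := by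
    rw [BitVec.xor_eq_zero_iff]; exact h
  rw [this, h0]

/-- Hash the elements, write down the instance, solve it, and output the flag. -/
def mainStage (P : Program) : Program :=
  .seq hashLoops (.seq idPass (.seq bucketPass (.seq build (.seq (consult P) (.emit 2)))))

/-- A bound for the expected running time of the main part for given hash functions. -/
noncomputable def stageTime (P : Program) (X : List (BitVec w)) (r s τ : ℕ)
    (l : List (BitVec w) × List (BitVec w)) : ℝ≥0∞ :=
  ((100 + 50 * X.length + 50 * 2 ^ (r + s + τ) + 30 * (X.length * 2 ^ r) : ℕ) : ℝ≥0∞) +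
    (10 * X.length + 10 : ℕ) *
      (badCount (hashValue X l.1) (hashValue X l.2) (2 ^ τ) X.length : ℝ≥0∞) +
    (60 : ℕ) * expectedTime P ((reducedInstance X r s τ l).input w)

/-- The main part is correct for every choice of the hash functions; its time is averaged over them.
-/
theorem mainStage_triple {X : List (BitVec w)} {r d s τ : ℕ} {P : Program}
    [Decidable (HasXORTriple X)] (hs : Sizes w X.length r d s τ) (S : State w)
    (h : Ready X r d s τ S) (hm : ∀ b, 2 ≤ b → b < 7 → S.mem b = fun _ => 0#w) (hfr : Fresh 2 S)
    (h40 : S.reg 40 = 0#w) (hf : FlagSound X (S.reg 2)) (hout : S.out = [])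
    (hP : ∀ l : List (BitVec w) × List (BitVec w), l.1.length = r → l.2.length = 2 * s →
      HaltsWith P ((reducedInstance X r s τ l).input w)
        ((reducedInstance X r s τ l).CorrectOutput w)) :
    Triple (mainStage P) S
      (1 + (7 + (r + 2 * s) * (8 + X.length * (8 * blockExp w + 50)) : ℕ) +
        (drawPair w r (2 * s)).expect (stageTime P X r s τ))
      (fun S' => S'.out = [BitVec.ofNat w (if HasXORTriple X then 1 else 0)]) := by
  have hfw := (Nat.pow_lt_pow_iff_right (by norm_num)).1 hs.fill_lt
  have hcw := (Nat.pow_lt_pow_iff_right (by norm_num)).1 hs.c_lt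
  refine (Spec.toTriple (Post := fun _ S' => S'.out =
      [BitVec.ofNat w (if HasXORTriple X then 1 else 0)])
    (Spec.seq_triple (hashLoops_spec hs S h (hm 2 le_rfl (by norm_num))
      (hm 3 (by norm_num) (by norm_num))) ?_)).mono le_rfl fun _ ⟨_, h⟩ _ => h
  rintro l S1 ⟨⟨hl1, hb1⟩, hl2, hb2⟩ hF1
  have hlt₁ : ∀ k < X.length, hashValue X l.1 k < 2 ^ r := fun k _ => by
    have := hashValue_lt X (l := l.1) (by omega) k; rwa [hl1] at this
  have hlt₂ : ∀ k < X.length, hashValue X l.2 k < 2 ^ (2 * s) := fun k _ => by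
    have := hashValue_lt X (l := l.2) (by omega) k; rwa [hl2] at this
  have hP' := hP l hl1 hl2
  have hH1 := HashBank.hashed (h.frame hF1 rfl) hb1 hb2
  set h₁ := hashValue X l.1 with hh₁
  set h₂ := hashValue X l.2 with hh₂
  set n := X.length with hn
  set G := goodAfter h₁ h₂ (2 ^ τ) n 0 with hG
  have hfr1 : Fresh 2 S1 := hfr.frame hF1
    (fun i => by simp [hashLoops, hashStep, parityCode, forDown, block, Program.writesReg]; omega)
    (fun b => by simp [hashLoops, hashStep, parityCode, forDown, block, Program.writesMem]; omega)
  have hm1 : ∀ b, 4 ≤ b → b < 7 → S1.mem b = fun _ => 0#w := fun b h4 h7 =>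
    (hF1.mem b (by
      simp [hashLoops, hashStep, parityCode, forDown, block, Program.writesMem]; omega)).trans
      (hm b (by omega) h7)
  set E := expectedTime P ((reducedInstance X r s τ l).input w) with hE
  set T3 : ℝ≥0∞ := 1 + (60 : ℕ) * E + (1 : ℕ) with hT3
  set T2 : ℝ≥0∞ := 1 + (50 + 50 * 2 ^ (r + s + τ) + 30 * (n * 2 ^ r) : ℕ) + T3 with hT2
  set T1 : ℝ≥0∞ := 1 + ((3 + 43 * n : ℕ) + (10 * n + 10 : ℕ) * (badCount h₁ h₂ (2 ^ τ) n : ℝ≥0∞)) +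
    T2 with hT1
  refine (Triple.seq (T' := T1) (idPass_triple hs hlt₂ S1 hH1) ?_).mono ?_ fun _ h _ => h
  swap
  · calc _ = ((61 + 49 * n + 50 * 2 ^ (r + s + τ) + 30 * (n * 2 ^ r) : ℕ) : ℝ≥0∞) +
          (10 * n + 10 : ℕ) * (badCount h₁ h₂ (2 ^ τ) n : ℝ≥0∞) + (60 : ℕ) * E := by
            simp only [hT1, hT2, hT3]; push_cast; ring
      _ ≤ _ := by rw [stageTime]; gcongr <;> norm_num
  rintro S2 ⟨ι, hid⟩ hF2
  have hH2 := hH1.frame hF2 rfl rfl rfl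
  have hfr2 : Fresh 2 S2 := hfr1.frame hF2
    (fun i => by simp [idPass, forDown, block, Program.writesReg]; omega)
    (fun b => by simp [idPass, forDown, block, Program.writesMem]; omega)
  have hf2 : FlagSound X (S2.reg 2) := by rw [hF2.reg 2 rfl, hF1.reg 2 rfl]; exact hf
  refine Triple.seq (T' := T2) (bucketPass_triple hs hlt₁ S2 hH2 hid
    ((hF2.mem 4 rfl).trans (hm1 4 le_rfl (by norm_num)))
    ((hF2.mem 5 rfl).trans (hm1 5 (by norm_num) (by norm_num)))
    ((hF2.mem 6 rfl).trans (hm1 6 (by norm_num) (by norm_num))) hf2) ?_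
  rintro S3 ⟨hB3, hsc3⟩ hF3
  have hH3 := hH2.frame hF3 rfl rfl rfl
  have hfr3 : Fresh 2 S3 := hfr2.frame hF3
    (fun i => by simp [bucketPass, bucketStep, scan, forDown, block, Program.writesReg]; omega)
    (fun b => by simp [bucketPass, bucketStep, scan, forDown, block, Program.writesMem]; omega)
  refine Triple.seq (T' := T3) (build_triple hs hlt₂ (fun g hg => (mem_goodAfter hg).2) S3 hH3 hB3
    hfr3.reg hfr3.mem) ?_
  intro S4 hE4 hF4
  have hH4 := hH3.frame hF4 rfl rfl rfl
  have hid4 : IdBank n h₂ ι S4 := by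
    intro k hk; rw [hF4.mem 7 rfl, hF3.mem 7 rfl]; exact hid k hk
  have hsc4 : Scanned X 0 G S4 := by
    have h2 : S4.reg 2 = S3.reg 2 := hF4.reg 2 rfl
    exact ⟨h2 ▸ hsc3.sound, h2 ▸ hsc3.found⟩
  have hB4 := hB3.congr (hF4.mem 4 rfl) (hF4.mem 5 rfl) (hF4.mem 6 rfl)
  have h404 : S4.reg 40 = 0#w := by
    rw [hF4.reg 40 rfl, hF3.reg 40 rfl, hF2.reg 40 rfl, hF1.reg 40 rfl, h40]
  have hout4 : S4.out = [] := by
    rw [hF4.out rfl, hF3.out rfl, hF2.out rfl, hF1.out rfl, hout]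
  refine Triple.seq (consult_triple hs hlt₁ hlt₂ hashValue_linear hashValue_linear hH4 hB4 hid4
    hsc4 h404 hP' hE4) ?_
  rintro S5 ⟨h2, hout5⟩ -
  refine (Triple.emit S5 2).mono le_rfl ?_
  rintro _ rfl -
  rw [State.emit, h2, hout5, hout4]
  rfl

/-- The reduction for large inputs: compute the parameters, draw a sample, and proceed to the main
part unless the sample contains a pair whose sum belongs to the list. -/
def largeStage (Pγ Pδ P : Program) : Program :=
  .seq (powerCode Pγ 0 3) (.seq (powerCode Pδ 1 4) (.seq setup (.seq sampleLoop
    (.ite 2 (.emit 2) (mainStage P)))))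

/-- The probability that a random pair of addresses does not exhibit a sum that belongs to the list.
-/
noncomputable def missProb (X : List (BitVec w)) : ℝ≥0∞ :=
  (drawIndices w X.length).expect fun p => if Misses X p then 1 else 0

/-- The main part is run only if all `2 ^ d` pairs of the sample miss, so that its expected time is
multiplied by the probability of this event. -/
theorem sampled_triple {X : List (BitVec w)} {r d s τ : ℕ} {P : Program}
    [Decidable (HasXORTriple X)] (hs : Sizes w X.length r d s τ) (S : State w)
    (h : Ready X r d s τ S) (hm : ∀ b, 2 ≤ b → b < 7 → S.mem b = fun _ => 0#w) (hfr : Fresh 2 S)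
    (h40 : S.reg 40 = 0#w) (hf : S.reg 2 = 0#w) (hout : S.out = [])
    (hP : ∀ l : List (BitVec w) × List (BitVec w), l.1.length = r → l.2.length = 2 * s →
      HaltsWith P ((reducedInstance X r s τ l).input w)
        ((reducedInstance X r s τ l).CorrectOutput w)) :
    Triple (.seq sampleLoop (.ite 2 (.emit 2) (mainStage P))) S
      ((6 + 2 ^ d * 28 : ℕ) + missProb X ^ 2 ^ d *
        (1 + (7 + (r + 2 * s) * (8 + X.length * (8 * blockExp w + 50)) : ℕ) +
        (drawPair w r (2 * s)).expect (stageTime P X r s τ)))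
      (fun S' => S'.out = [BitVec.ofNat w (if HasXORTriple X then 1 else 0)]) := by
  have hw : 0 < w := by have := hs.hw; omega
  have h10 : (1#w : BitVec w) ≠ 0#w := ofNat_ne_zero one_ne_zero (Nat.one_lt_two_pow hw.ne')
  set T : ℝ≥0∞ := 1 + (7 + (r + 2 * s) * (8 + X.length * (8 * blockExp w + 50)) : ℕ) +
    (drawPair w r (2 * s)).expect (stageTime P X r s τ) with hT
  refine (Spec.toTriple (Post := fun _ S' => S'.out =
      [BitVec.ofNat w (if HasXORTriple X then 1 else 0)])
    (Spec.seq_triple (T' := fun l => 2 + T * if ∀ p ∈ l, Misses X p then 1 else 0)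
      (sampleLoop_spec hs S h (.inl hf)) ?_)).mono ?_ fun _ ⟨_, h⟩ _ => h
  · rintro l S1 ⟨hf1, hl⟩ hF
    refine (Triple.ite (T := 1 + T * if ∀ p ∈ l, Misses X p then 1 else 0) (fun h2 => ?_)
      fun h2 => ?_).mono (by rw [← add_assoc, one_add_one_eq_two]) fun _ h _ => h
    · refine (Triple.emit S1 2).mono (by simp) ?_
      rintro _ rfl -
      rcases hf1 with h3 | ⟨h3, h4⟩
      · exact absurd h3 h2
      · rw [State.emit, h3, hF.out rfl, hout, if_pos h4]; rfl
    · rw [if_pos, mul_one]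
      · exact (mainStage_triple hs S1 (h.frame hF rfl)
          (fun b h3 h4 => (hF.mem b rfl).trans (hm b h3 h4))
          (hfr.frame hF
            (fun i => by simp [sampleLoop, forDown, block, Program.writesReg]; omega)
            (fun b => rfl))
          ((hF.reg 40 rfl).trans h40) hf1 ((hF.out rfl).trans hout) hP).mono
          le_add_self fun _ h _ => h
      · intro p hp
        by_contra hpX
        exact h10 ((hl ⟨p, hp, hpX⟩).symm.trans h2)
  · have key : (drawMany (drawIndices w X.length) (2 ^ d)).expect
        (fun l => if ∀ p ∈ l, Misses X p then 1 else 0) = missProb X ^ 2 ^ d := by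
      rw [missProb, ← expect_drawMany_forall]
      congr!
    rw [PMF.expect_add, PMF.expect_const, PMF.expect_const_mul, key, mul_comm T, ← add_assoc]
    gcongr
    push_cast
    apply le_of_eq
    ring

theorem largeStage_triple {X : List (BitVec w)} {Pγ Pδ P : Program} [Decidable (HasXORTriple X)]
    {goodγ goodδ : ℕ → Prop} {B : ℝ≥0∞} {S : State w}
    (hγ : HaltsWith Pγ (initState w [X.length] [])
      fun out => ∃ r, goodγ r ∧ out = [BitVec.ofNat w r])
    (hδ : HaltsWith Pδ (initState w [X.length] [])
      fun out => ∃ d, goodδ d ∧ out = [BitVec.ofNat w d])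
    (hB : ∀ r d, goodγ r → goodδ d → ∃ s τ, Sizes w X.length r d s τ ∧
      (∀ l : List (BitVec w) × List (BitVec w), l.1.length = r → l.2.length = 2 * s →
        HaltsWith P ((reducedInstance X r s τ l).input w)
          ((reducedInstance X r s τ l).CorrectOutput w)) ∧
      ((12 * X.length + 30 * Nat.clog 2 w + 127 + 2 ^ d * 28 : ℕ) + missProb X ^ 2 ^ d *
        (1 + (7 + (r + 2 * s) * (8 + X.length * (8 * blockExp w + 50)) : ℕ) +
          (drawPair w r (2 * s)).expect (stageTime P X r s τ)) : ℝ≥0∞) ≤ B)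
    (h : Holds X S) (hreg : ∀ i, 2 ≤ i → i ≠ 20 → S.reg i = 0#w)
    (hmem : ∀ b, 1 ≤ b → S.mem b = fun _ => 0#w) (hout : S.out = []) :
    Triple (largeStage Pγ Pδ P) S (8 + expectedTime Pγ (initState w [X.length] []) +
        expectedTime Pδ (initState w [X.length] []) + B)
      (fun S' => S'.out = [BitVec.ofNat w (if HasXORTriple X then 1 else 0)]) := by
  set Eγ := expectedTime Pγ (initState w [X.length] [])
  set Eδ := expectedTime Pδ (initState w [X.length] [])
  refine (Triple.seq (T' := 1 + (3 + Eδ) + B) (powerCode_triple (j := 0) (d := 3) (by norm_num) hγ S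
    h.len (fun i => hreg _ (by omega) (by omega)) (fun b => hmem _ (by omega))) ?_).mono
    (le_of_eq (by ring)) fun _ h _ => h
  rintro S1 ⟨_, ⟨r, hr, rfl⟩, h3⟩ hF1
  have h3 := h3 _ rfl
  have k1 : ∀ i, i < 64 → i ≠ 3 → (powerCode Pγ 0 3).writesReg i = false := fun i hi hi' =>
    writesReg_powerCode (fun _ => by omega) hi'.symm
  have m1 : ∀ b, b < 16 → (powerCode Pγ 0 3).writesMem b = false := fun b hb =>
    writesMem_powerCode (fun _ => by omega)
  refine Triple.seq (powerCode_triple (j := 1) (d := 4) (by norm_num) hδ S1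
    ((hF1.reg 0 (k1 0 (by norm_num) (by norm_num))).trans h.len)
    (fun i => (hF1.reg _ (writesReg_powerCode (fun _ => by omega) (by omega))).trans
      (hreg _ (by omega) (by omega)))
    (fun b => (hF1.mem _ (writesMem_powerCode (fun _ => by omega))).trans (hmem _ (by omega)))) ?_
  rintro S2 ⟨_, ⟨d, hd, rfl⟩, h4⟩ hF2
  have h4 := h4 _ rfl
  have k2 : ∀ i, i < 64 → i ≠ 4 → (powerCode Pδ 1 4).writesReg i = false := fun i hi hi' =>
    writesReg_powerCode (fun _ => by omega) hi'.symm
  have m2 : ∀ b, b < 16 → (powerCode Pδ 1 4).writesMem b = false := fun b hb =>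
    writesMem_powerCode (fun _ => by omega)
  obtain ⟨s, τ, hs, hP, hT⟩ := hB r d hr hd
  have e2 : ∀ i, i < 64 → i ≠ 3 → i ≠ 4 → S2.reg i = S.reg i := fun i hi h3 h4 =>
    (hF2.reg i (k2 i hi h4)).trans (hF1.reg i (k1 i hi h3))
  have f2 : ∀ b, b < 16 → S2.mem b = S.mem b := fun b hb =>
    (hF2.mem b (m2 b hb)).trans (hF1.mem b (m1 b hb))
  have hH2 : Holds X S2 := ⟨(e2 0 (by norm_num) (by norm_num) (by norm_num)).trans h.len,
    (e2 1 (by norm_num) (by norm_num) (by norm_num)).trans h.one, (f2 0 (by norm_num)).trans h.arr⟩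
  have hfr2 : Fresh 2 S2 := by
    refine ⟨fun i => ?_, fun b => ?_⟩
    · rw [hF2.reg _ (writesReg_powerCode (fun _ => by omega) (by omega)),
        hF1.reg _ (writesReg_powerCode (fun _ => by omega) (by omega)),
        hreg _ (by omega) (by omega)]
    · rw [hF2.mem _ (writesMem_powerCode (fun _ => by omega)),
        hF1.mem _ (writesMem_powerCode (fun _ => by omega)), hmem _ (by omega)]
  refine (Triple.seq (setup_triple hs S2 hH2
    ((hF2.reg 3 (k2 3 (by norm_num) (by norm_num))).trans h3) h4 ?_ ?_)
      (T' := (6 + 2 ^ d * 28 : ℕ) + missProb X ^ 2 ^ d *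
        (1 + (7 + (r + 2 * s) * (8 + X.length * (8 * blockExp w + 50)) : ℕ) +
        (drawPair w r (2 * s)).expect (stageTime P X r s τ))) ?_).mono ?_ fun _ h _ => h
  · rw [e2 15 (by norm_num) (by norm_num) (by norm_num), hreg 15 (by norm_num) (by norm_num)]
  · rw [f2 1 (by norm_num), hmem 1 le_rfl]
  · intro S3 hR3 hF3
    have k3 : ∀ i, i ∈ [2, 40] ∨ 64 ≤ i → setup.writesReg i = false := by
      intro i hi
      simp [setup, paritySetup, markLoop, forDown, block, Program.writesReg] at hi ⊢
      omega
    have m3 : ∀ b, 2 ≤ b → setup.writesMem b = false := by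
      intro b hb
      simp [setup, paritySetup, markLoop, forDown, block, Program.writesMem]
      omega
    have hout3 : S3.out = [] := by
      rw [hF3.out rfl, hF2.out emits_powerCode, hF1.out emits_powerCode, hout]
    refine sampled_triple hs S3 hR3 (fun b hb hb' => ?_) ?_ ?_ ?_ hout3 hP
    · rw [hF3.mem b (m3 b hb), f2 b (by omega), hmem b (by omega)]
    · exact hfr2.frame hF3 (fun i => k3 _ (.inr (by omega))) fun b => m3 _ (by omega)
    · rw [hF3.reg 40 (k3 _ (by simp)), e2 40 (by norm_num) (by norm_num) (by norm_num),
        hreg 40 (by norm_num) (by norm_num)]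
    · rw [hF3.reg 2 (k3 _ (by simp)), e2 2 (by norm_num) (by norm_num) (by norm_num),
        hreg 2 le_rfl (by norm_num)]
  · refine le_trans (le_of_eq ?_) hT
    push_cast
    ring

/-- The program that solves 3XOR with the help of a program for SetIntersection. Lists of fewer than
`N` elements are searched exhaustively, since the estimates for the sizes hold only for large
inputs. -/
def reduction (N : ℕ) (Pγ Pδ P : Program) : Program :=
  .seq (.const 1 1) (.seq (.op .or 20 0 0) (ifLarge N (largeStage Pγ Pδ P) bruteForce))

theorem reduction_triple {X : List (BitVec w)} {N : ℕ} {Pγ Pδ P : Program}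
    [Decidable (HasXORTriple X)] {T : ℝ≥0∞} (hX : X.length < 2 ^ w)
    (hlarge : N ≤ X.length → ∀ S : State w, Holds X S →
      (∀ i, 2 ≤ i → i ≠ 20 → S.reg i = 0#w) → (∀ b, 1 ≤ b → S.mem b = fun _ => 0#w) →
      S.out = [] → Triple (largeStage Pγ Pδ P) S T
        (fun S' => S'.out = [BitVec.ofNat w (if HasXORTriple X then 1 else 0)])) :
    Triple (reduction N Pγ Pδ P) (threeXORInput X)
      (4 + (3 * N + if N ≤ X.length then T else
        ((30 * X.length ^ 2 + 30 * X.length + 30 : ℕ) : ℝ≥0∞)))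
      (fun S' => S'.out = [BitVec.ofNat w (if HasXORTriple X then 1 else 0)]) := by
  set S := threeXORInput X with hS
  have hreg : ∀ i, 1 ≤ i → S.reg i = 0#w := fun i hi => by
    simp only [hS, threeXORInput, initState]
    rw [List.getD_eq_default _ _ (by simpa using hi)]
  have hmem : ∀ b, 1 ≤ b → S.mem b = fun _ => 0#w := fun b hb => by
    simp only [hS, threeXORInput, initState]
    rw [List.getD_eq_default _ _ (by simpa using hb)]
    funext z; simp [arrayOf]
  have h0 : S.reg 0 = BitVec.ofNat w X.length := rfl
  have ha : S.mem 0 = arrayOf w (X.map BitVec.toNat) := rfl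
  set S1 := S.setReg 1 1#w with hS1
  set S2 := S1.setReg 20 (BitVec.ofNat w X.length) with hS2
  refine (Triple.seq (T := (1 : ℕ)) (Post := fun S' => S' = S1)
    (Triple.straight 1 rfl le_rfl rfl) (T' := 1 + (1 : ℕ) + (3 * N + if N ≤ X.length then T else
        ((30 * X.length ^ 2 + 30 * X.length + 30 : ℕ) : ℝ≥0∞))) ?_).mono ?_ fun _ h _ => h
  · rintro _ rfl -
    refine Triple.seq (T := (1 : ℕ)) (Post := fun S' => S' = S2)
      (Triple.straight 1 rfl le_rfl ?_) ?_
    · simp only [Program.exec, hS2, eval_or_self]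
      rw [hS1, setReg_reg, if_neg (by norm_num), h0]
    rintro _ rfl -
    refine ifLarge_triple N X.length S2 hX (by simp [hS2]) (by simp [hS2, hS1]) ?_ ?_
    · intro hN x
      refine hlarge hN _ ⟨?_, ?_, ha⟩ (fun i hi hi' => ?_) (fun b hb => ?_) rfl
      · simp [hS2, hS1, h0]
      · simp [hS2, hS1]
      · simp only [hS2, hS1, setReg_reg, if_neg hi', if_neg (show i ≠ 1 by omega)]
        exact hreg i (by omega)
      · exact hmem b hb
    · intro _ x
      refine bruteForce_triple X hX (S2.setReg 20 x) ?_ ?_ ha (hmem 1 le_rfl) rfl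
      · simp [hS2, hS1, h0]
      · simp [hS2, hS1, hreg]
  · push_cast
    apply le_of_eq
    ring

end WordRAM

/-! ### The sizes of the instances -/

/-- The power `2 ^ r` agrees with `x` up to the factor `K`. -/
def PowerNear (K x : ℝ) (r : ℕ) : Prop := x / K ≤ 2 ^ r ∧ (2 : ℝ) ^ r ≤ K * x

section Estimates

variable {K x y : ℝ} {n r d s τ : ℕ}

theorem two_pow_log_bounds (hn : 0 < n) :
    (n : ℝ) / 2 ≤ 2 ^ Nat.log 2 n ∧ (2 : ℝ) ^ Nat.log 2 n ≤ n := by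
  constructor
  · have := Nat.lt_pow_succ_log_self (b := 2) (by norm_num) n
    have h : (n : ℝ) < 2 ^ (Nat.log 2 n + 1) := by exact_mod_cast this
    rw [pow_succ] at h
    linarith
  · exact_mod_cast Nat.pow_log_le_self 2 hn.ne'

/-- The estimates for the powers of two that occur as sizes, in terms of the powers `x` and `y`
of `n`. -/
theorem size_bounds (hK : 1 ≤ K) (hx : 0 < x) (hy : 0 < y) (hn : 0 < n) (hr : PowerNear K x r)
    (hd : PowerNear K y d) (hrL : r ≤ Nat.log 2 n) (hs : s = (Nat.log 2 n + d - r) / 2)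
    (hτ : τ = Nat.log 2 n - r + 2) :
    (n * y / x / K ^ 2 ≤ (2 : ℝ) ^ (2 * s + 2) ∧ (2 : ℝ) ^ (2 * s + 2) ≤ 4 * K ^ 2 * (n * y / x)) ∧
    (√(n * x * y) / (2 * K) ≤ (2 : ℝ) ^ (r + s) ∧ (2 : ℝ) ^ (r + s) ≤ K * √(n * x * y)) ∧
    (2 : ℝ) ^ τ ≤ 4 * K * (n / x) ∧ n * y / (4 * K) ≤ (2 : ℝ) ^ (r + 2 * s) := by
  obtain ⟨hl1, hl2⟩ := two_pow_log_bounds hn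
  obtain ⟨hr1, hr2⟩ := hr
  obtain ⟨hd1, hd2⟩ := hd
  have hn' : (0 : ℝ) < n := by exact_mod_cast hn
  have hK0 : 0 < K := by linarith
  set L := Nat.log 2 n with hL
  have hu : (0 : ℝ) < 2 ^ r := by positivity
  have hv : (0 : ℝ) < 2 ^ d := by positivity
  have hl : (0 : ℝ) < 2 ^ L := by positivity
  have hc1 : (2 : ℝ) * (2 ^ L * 2 ^ d) ≤ 2 ^ (2 * s + 2) * 2 ^ r := by
    rw [← pow_add, ← pow_add, ← pow_succ']
    exact pow_le_pow_right₀ (by norm_num) (by omega)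
  have hc2 : (2 : ℝ) ^ (2 * s + 2) * 2 ^ r ≤ 4 * (2 ^ L * 2 ^ d) := by
    rw [← pow_add, ← pow_add, show (4 : ℝ) = 2 ^ 2 by norm_num, ← pow_add]
    exact pow_le_pow_right₀ (by norm_num) (by omega)
  have ha1 : (2 : ℝ) ^ L * 2 ^ d * 2 ^ r ≤ 2 * (2 ^ (r + s)) ^ 2 := by
    rw [← pow_add, ← pow_add, ← pow_mul, ← pow_succ']
    exact pow_le_pow_right₀ (by norm_num) (by omega)
  have ha2 : ((2 : ℝ) ^ (r + s)) ^ 2 ≤ 2 ^ L * 2 ^ d * 2 ^ r := by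
    rw [← pow_add, ← pow_add, ← pow_mul]
    exact pow_le_pow_right₀ (by norm_num) (by omega)
  have ht : (2 : ℝ) ^ τ * 2 ^ r = 4 * 2 ^ L := by
    rw [← pow_add, show (4 : ℝ) = 2 ^ 2 by norm_num, ← pow_add]
    congr 1; omega
  have hg : (2 : ℝ) ^ L * 2 ^ d ≤ 2 * 2 ^ (r + 2 * s) := by
    rw [← pow_add, ← pow_succ']
    exact pow_le_pow_right₀ (by norm_num) (by omega)
  have hr1' : x ≤ K * 2 ^ r := by rwa [div_le_iff₀' hK0] at hr1
  have hd1' : y ≤ K * 2 ^ d := by rwa [div_le_iff₀' hK0] at hd1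
  refine ⟨⟨?_, ?_⟩, ⟨?_, ?_⟩, ?_, ?_⟩
  · rw [div_div, div_le_iff₀ (by positivity)]
    refine le_of_mul_le_mul_right ?_ hu
    calc n * y * 2 ^ r ≤ n * (K * 2 ^ d) * (K * x) := by gcongr
      _ = 2 * (n / 2 * 2 ^ d) * (x * K ^ 2) := by ring
      _ ≤ 2 * (2 ^ L * 2 ^ d) * (x * K ^ 2) := by gcongr
      _ ≤ 2 ^ (2 * s + 2) * 2 ^ r * (x * K ^ 2) := by gcongr
      _ = _ := by ring
  · rw [← mul_div_assoc, le_div_iff₀ hx]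
    calc (2 : ℝ) ^ (2 * s + 2) * x ≤ 2 ^ (2 * s + 2) * (K * 2 ^ r) := by gcongr
      _ = K * (2 ^ (2 * s + 2) * 2 ^ r) := by ring
      _ ≤ K * (4 * (n * (K * y))) :=
          mul_le_mul_of_nonneg_left (hc2.trans (by gcongr)) hK0.le
      _ = _ := by ring
  · rw [div_le_iff₀ (by positivity), Real.sqrt_le_left (by positivity)]
    calc n * x * y = n / 2 * (2 * x * y) := by ring
      _ ≤ 2 ^ L * (2 * (K * 2 ^ r) * (K * 2 ^ d)) := by gcongr
      _ = 2 * K ^ 2 * (2 ^ L * 2 ^ d * 2 ^ r) := by ring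
      _ ≤ 2 * K ^ 2 * (2 * (2 ^ (r + s)) ^ 2) := by gcongr
      _ = _ := by ring
  · refine (sq_le_sq₀ (by positivity) (by positivity)).1 ?_
    rw [mul_pow, Real.sq_sqrt (by positivity)]
    calc ((2 : ℝ) ^ (r + s)) ^ 2 ≤ n * (K * y) * (K * x) := ha2.trans (by gcongr)
      _ = _ := by ring
  · rw [← mul_div_assoc, le_div_iff₀ hx]
    calc (2 : ℝ) ^ τ * x ≤ 2 ^ τ * (K * 2 ^ r) := by gcongr
      _ = K * (2 ^ τ * 2 ^ r) := by ring
      _ ≤ K * (4 * n) := by rw [ht]; gcongr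
      _ = _ := by ring
  · rw [div_le_iff₀ (by positivity)]
    calc n * y = 2 * (n / 2 * y) := by ring
      _ ≤ 2 * (2 ^ L * (K * 2 ^ d)) := by gcongr
      _ = 2 * K * (2 ^ L * 2 ^ d) := by ring
      _ ≤ 2 * K * (2 * 2 ^ (r + 2 * s)) := by gcongr
      _ = _ := by ring

end Estimates

section Eventually

variable {γ δ K : ℝ} {W : ℕ → Set ℕ}

/-- The products of powers of `n` that describe the sizes of the universe, the families, the sets,
the queries and the total size of the sets. -/
theorem rpow_identities (γ δ : ℝ) {n : ℕ} (hn : 0 < n) :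
    (n : ℝ) * (n : ℝ) ^ δ / (n : ℝ) ^ γ = (n : ℝ) ^ (1 + δ - γ) ∧
      (n : ℝ) * (n : ℝ) ^ γ * (n : ℝ) ^ δ = (n : ℝ) ^ (1 + δ + γ) ∧
      (n : ℝ) / (n : ℝ) ^ γ = (n : ℝ) ^ (1 - γ) ∧ (n : ℝ) * (n : ℝ) ^ γ = (n : ℝ) ^ (1 + γ) ∧
      √((n : ℝ) ^ (1 + δ + γ)) * (n : ℝ) ^ (1 - γ) = (n : ℝ) ^ ((3 + δ - γ) / 2) := by
  have hn' : (0 : ℝ) < n := by exact_mod_cast hn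
  refine ⟨?_, ?_, ?_, ?_, ?_⟩
  · rw [Real.rpow_sub hn', Real.rpow_add hn', Real.rpow_one]
  · rw [Real.rpow_add hn', Real.rpow_add hn', Real.rpow_one]; ring
  · rw [Real.rpow_sub hn', Real.rpow_one]
  · rw [Real.rpow_add hn', Real.rpow_one]
  · rw [Real.sqrt_eq_rpow, ← Real.rpow_mul hn'.le, ← Real.rpow_add hn']
    congr 1; ring

theorem eventually_const_mul_rpow_le {a b : ℝ} (h : a < b) (M : ℝ) :
    ∀ᶠ n : ℕ in atTop, M * (n : ℝ) ^ a ≤ (n : ℝ) ^ b := by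
  filter_upwards [((tendsto_rpow_atTop (sub_pos.2 h)).comp
    tendsto_natCast_atTop_atTop).eventually_ge_atTop M, eventually_gt_atTop 0] with n h1 h2
  have hn : (0 : ℝ) < n := by exact_mod_cast h2
  calc M * (n : ℝ) ^ a ≤ (n : ℝ) ^ (b - a) * (n : ℝ) ^ a := by gcongr; exact h1
    _ = _ := by rw [← Real.rpow_add hn]; congr 1; ring

/-- For large `n` the numbers that describe the instances fit into words. -/
theorem eventually_sizes (hγ₁ : γ < 1) (hδ : 0 < δ) (hγδ : δ < 1 + γ) (hK : 1 ≤ K)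
    (hW : AdmissibleWordLengths γ δ W) :
    ∀ᶠ n : ℕ in atTop, ∀ w ∈ W n, ∀ r d : ℕ, PowerNear K ((n : ℝ) ^ γ) r →
      PowerNear K ((n : ℝ) ^ δ) d →
      Sizes w n r d ((Nat.log 2 n + d - r) / 2) (Nat.log 2 n - r + 2) := by
  filter_upwards [hW.rpow_lt (e := 1 + δ - γ) (.inl le_rfl) (4 * K ^ 2),
    hW.rpow_lt (e := 1 + γ) (.inr (.inl le_rfl)) K,
    hW.rpow_lt (e := (3 + δ - γ) / 2) (.inr (.inr le_rfl)) (4 * K ^ 2),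
    hW.rpow_lt (e := δ) (.inr (.inl hγδ.le)) K,
    eventually_const_mul_rpow_le hγ₁ (2 * K),
    eventually_const_mul_rpow_le (show 1 - γ < 1 + δ - γ by linarith) (4 * K * (4 * K ^ 2)),
    eventually_ge_atTop (2 ^ 32)] with n h1 h2 h3 h4 h5 h6 h7 w hw r d hr hd
  have hn : 0 < n := by omega
  have hnw := hW.1 n w hw
  have hn' : (0 : ℝ) < n := by exact_mod_cast hn
  have hK0 : 0 < K := by linarith
  obtain ⟨e1, e2, e3, e4, e5⟩ := rpow_identities γ δ hn
  have hrL : r ≤ Nat.log 2 n := by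
    have h8 : (2 : ℝ) ^ r ≤ 2 ^ Nat.log 2 n := by
      rw [Real.rpow_one] at h5
      calc (2 : ℝ) ^ r ≤ K * (n : ℝ) ^ γ := hr.2
        _ ≤ n / 2 := by linarith
        _ ≤ _ := (two_pow_log_bounds hn).1
    exact (pow_le_pow_iff_right₀ (by norm_num)).1 h8
  obtain ⟨⟨b1, b2⟩, ⟨b3, b4⟩, b5, b6⟩ := size_bounds hK (Real.rpow_pos_of_pos hn' γ)
    (Real.rpow_pos_of_pos hn' δ) hn hr hd hrL rfl rfl
  rw [e1] at b1 b2
  rw [e2] at b3 b4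
  rw [e3] at b5
  have lift : ∀ {m : ℕ}, (m : ℝ) < 2 ^ w → m < 2 ^ w := fun {m} h => by exact_mod_cast h
  refine ⟨?_, hn, hnw, ?_, hrL, rfl, rfl, ?_, ?_, ?_, ?_⟩
  · exact ((Nat.pow_lt_pow_iff_right (by norm_num)).1 (h7.trans_lt hnw)).le
  · exact lift (by push_cast; exact hd.2.trans_lt (h4 w hw))
  · refine lift ?_
    push_cast
    calc (n : ℝ) * 2 ^ r ≤ n * (K * (n : ℝ) ^ γ) := by gcongr; exact hr.2
      _ = K * (n : ℝ) ^ (1 + γ) := by rw [← e4]; ring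
      _ < _ := h2 w hw
  · refine lift ?_
    rw [pow_add]
    push_cast
    calc _ ≤ K * √((n : ℝ) ^ (1 + δ + γ)) * (4 * K * (n : ℝ) ^ (1 - γ)) := by gcongr
      _ = 4 * K ^ 2 * (n : ℝ) ^ ((3 + δ - γ) / 2) := by rw [← e5]; ring
      _ < _ := h3 w hw
  · exact lift (by push_cast; exact b2.trans_lt (h1 w hw))
  · have h8 : (2 : ℝ) ^ (Nat.log 2 n - r + 2) ≤ 2 ^ (2 * ((Nat.log 2 n + d - r) / 2)) := by
      have h9 : 4 * (2 : ℝ) ^ (Nat.log 2 n - r + 2) ≤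
          2 ^ (2 * ((Nat.log 2 n + d - r) / 2) + 2) := by
        refine le_trans ?_ b1
        rw [le_div_iff₀ (by positivity)]
        calc 4 * (2 : ℝ) ^ (Nat.log 2 n - r + 2) * K ^ 2
            ≤ 4 * (4 * K * (n : ℝ) ^ (1 - γ)) * K ^ 2 := by gcongr
          _ = 4 * K * (4 * K ^ 2) * (n : ℝ) ^ (1 - γ) := by ring
          _ ≤ _ := h6
      rw [pow_add _ (2 * _) 2] at h9
      linarith
    exact (pow_le_pow_iff_right₀ (by norm_num)).1 h8

theorem flatten_length_grid (a b : ℕ) (F : ℕ → ℕ → ℕ) : (grid a b F).flatten.length = a * b := by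
  rw [flatten_grid]; simp

/-- The instances that are produced by the reduction have the required sizes. -/
theorem hashInstance_allowed {n w r d s τ : ℕ} {h₁ h₂ : ℕ → ℕ} {slot : ℕ → ℕ → Option ℕ} {K' : ℝ}
    (hs : Sizes w n r d s τ) (hG : GoodSlots n r s τ h₁ h₂ slot) (hK : 1 ≤ K)
    (hr : PowerNear K ((n : ℝ) ^ γ) r) (hd : PowerNear K ((n : ℝ) ^ δ) d) (hK' : 8 * K ^ 2 ≤ K') :
    (hashInstance n r s τ h₁ h₂ slot).Allowed γ δ K' n w := by
  have hn := hs.pos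
  have hn' : (0 : ℝ) < n := by exact_mod_cast hn
  have hK0 : 0 < K := by linarith
  obtain ⟨e1, e2, e3, e4, e5⟩ := rpow_identities γ δ hn
  obtain ⟨⟨b1, b2⟩, ⟨b3, b4⟩, b5, b6⟩ := size_bounds hK (Real.rpow_pos_of_pos hn' γ)
    (Real.rpow_pos_of_pos hn' δ) hn hr hd hs.r_le hs.s_eq hs.τ_eq
  rw [e1] at b1 b2
  rw [e2] at b3 b4
  rw [e3] at b5
  have hA : 2 ^ (r + s) < 2 ^ w :=
    (Nat.pow_le_pow_right (by norm_num) (by omega)).trans_lt hs.fill_lt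
  have hK1 : K ≤ K ^ 2 := by nlinarith
  refine ⟨hG.valid, ⟨hs.c_lt, ?_, ?_, ?_, ?_, ?_⟩, ⟨⟨?_, ?_⟩, ?_, ⟨?_, ?_⟩, ?_, ⟨?_, ?_⟩⟩⟩
  · simpa [hashInstance, length_grid] using hA
  · simpa [hashInstance, length_grid] using hA
  · simpa [hashInstance] using hs.query_lt
  · exact (flatten_length_grid _ _ _).trans_lt (by rw [← pow_add]; exact hs.fill_lt)
  · exact (flatten_length_grid _ _ _).trans_lt (by rw [← pow_add]; exact hs.fill_lt)
  · simp only [hashInstance]; push_cast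
    refine le_trans ?_ b1
    gcongr
    linarith [sq_nonneg K]
  · simp only [hashInstance]; push_cast
    refine b2.trans ?_
    gcongr
    linarith [sq_nonneg K]
  · simp [hashInstance, length_grid]
  · simp only [hashInstance, length_grid]; push_cast
    refine le_trans ?_ b3
    gcongr
    linarith [sq_nonneg K]
  · simp only [hashInstance, length_grid]; push_cast
    refine b4.trans ?_
    gcongr
    linarith [sq_nonneg K]
  · intro S hS
    have hlen : S.length = 2 ^ τ := by
      simp only [hashInstance, List.mem_append, mem_grid] at hS
      rcases hS with ⟨i, -, rfl⟩ | ⟨i, -, rfl⟩ <;> simp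
    rw [hlen]; push_cast
    refine b5.trans ?_
    gcongr
    linarith [sq_nonneg K]
  · simp only [hashInstance, List.length_map, List.length_range]; push_cast
    rw [← e4, mul_div_assoc]
    gcongr
    refine le_trans ?_ hr.1
    gcongr
    linarith [sq_nonneg K]
  · simp only [hashInstance, List.length_map, List.length_range]; push_cast
    rw [← e4]
    calc (n : ℝ) * 2 ^ r ≤ n * (K * (n : ℝ) ^ γ) := by gcongr; exact hr.2
      _ = K * (n * (n : ℝ) ^ γ) := by ring
      _ ≤ _ := by gcongr; linarith [sq_nonneg K]

end Eventually

/-! ### The overhead of the reduction -/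

section Overhead

variable {γ δ K : ℝ} {W : ℕ → Set ℕ}

theorem eventually_logb_le {a : ℝ} (ha : 0 < a) :
    ∀ᶠ n : ℕ in atTop, Real.logb 2 n ≤ (n : ℝ) ^ a := by
  have hlog : 0 < Real.log 2 := Real.log_pos (by norm_num)
  filter_upwards [eventually_const_mul_rpow_le (show a / 2 < a by linarith)
    (1 / (a / 2) / Real.log 2)] with n h1
  refine le_trans ?_ h1
  rw [Real.logb, div_mul_eq_mul_div]
  gcongr
  have := Real.log_le_rpow_div (x := n) (by positivity) (show 0 < a / 2 by linarith)
  rwa [one_div, inv_mul_eq_div]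

/-- The bound on the admissible word lengths `w` only says that `log w = O(n log n)`, which is still
negligible compared to `n ^ 2`. -/
theorem eventually_clog_le (hW : AdmissibleWordLengths γ δ W) :
    ∃ M : ℝ, 0 ≤ M ∧ ∀ᶠ n : ℕ in atTop, ∀ w ∈ W n,
      (Nat.clog 2 w : ℝ) ≤ M * (n : ℝ) ^ (3 / 2 : ℝ) := by
  obtain ⟨-, -, M, hM⟩ := hW
  refine ⟨|M| + 1, by positivity, ?_⟩
  filter_upwards [hM, eventually_logb_le (show (0 : ℝ) < 1 / 2 by norm_num),
    eventually_ge_atTop 1] with n h1 h2 h3 w hw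
  have hn : (1 : ℝ) ≤ n := by exact_mod_cast h3
  have hlb : 0 ≤ Real.logb 2 n := Real.logb_nonneg (by norm_num) hn
  have h4 : (n : ℝ) * Real.logb 2 n ≤ (n : ℝ) ^ (3 / 2 : ℝ) := by
    rw [show (3 / 2 : ℝ) = 1 + 1 / 2 by norm_num, Real.rpow_add (by linarith), Real.rpow_one]
    gcongr
  have h5 : M * n * Real.logb 2 n ≤ |M| * (n : ℝ) ^ (3 / 2 : ℝ) := by
    rw [mul_assoc]
    exact mul_le_mul (le_abs_self M) h4 (by positivity) (abs_nonneg M)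
  have h6 : w ≤ 2 ^ ⌈|M| * (n : ℝ) ^ (3 / 2 : ℝ)⌉₊ := by
    have : (w : ℝ) ≤ (2 : ℝ) ^ ⌈|M| * (n : ℝ) ^ (3 / 2 : ℝ)⌉₊ := by
      refine (h1 w hw).trans ?_
      rw [← Real.rpow_natCast]
      exact Real.rpow_le_rpow_of_exponent_le (by norm_num) (h5.trans (Nat.le_ceil _))
    exact_mod_cast this
  have h7 := Nat.clog_le_of_le_pow h6
  have h8 : (1 : ℝ) ≤ (n : ℝ) ^ (3 / 2 : ℝ) := Real.one_le_rpow hn (by norm_num)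
  calc (Nat.clog 2 w : ℝ) ≤ ⌈|M| * (n : ℝ) ^ (3 / 2 : ℝ)⌉₊ := by exact_mod_cast h7
    _ ≤ |M| * (n : ℝ) ^ (3 / 2 : ℝ) + 1 := (Nat.ceil_lt_add_one (by positivity)).le
    _ ≤ _ := by rw [add_mul]; linarith

/-- Computing the hash values takes time `O(n ^ (3 / 2))`. -/
theorem eventually_hash_time_le (hγ₁ : γ < 1) (hγδ : δ < 1 + γ)
    (hW : AdmissibleWordLengths γ δ W) :
    ∀ᶠ n : ℕ in atTop, ∀ w ∈ W n, ∀ r d s : ℕ, PowerNear K ((n : ℝ) ^ δ) d →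
      r ≤ Nat.log 2 n → s = (Nat.log 2 n + d - r) / 2 →
      ((7 + (r + 2 * s) * (8 + n * (8 * blockExp w + 50)) : ℕ) : ℝ) ≤
        457 * (n : ℝ) ^ (3 / 2 : ℝ) := by
  obtain ⟨M, hM, hclog⟩ := eventually_clog_le hW
  filter_upwards [hclog, eventually_const_mul_rpow_le (show (3 / 2 : ℝ) < 2 by norm_num) M,
    eventually_const_mul_rpow_le (show δ < 2 by linarith) K,
    eventually_logb_le (show (0 : ℝ) < 1 / 4 by norm_num), eventually_ge_atTop 2]
    with n h1 h2 h3 h4 h5 w hw r d s hd hr hs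
  set L := Nat.log 2 n with hL
  have hn : (1 : ℝ) ≤ n := by exact_mod_cast (show 1 ≤ n by omega)
  have hL1 : 1 ≤ L := Nat.log_pos (by norm_num) h5
  have hnL : n ^ 2 ≤ 2 ^ (2 * L + 2) := by
    have := Nat.lt_pow_succ_log_self (b := 2) (by norm_num) n
    calc n ^ 2 ≤ (2 ^ (L + 1)) ^ 2 := Nat.pow_le_pow_left this.le 2
      _ = _ := by rw [← pow_mul]; congr 1; ring
  have hd' : d ≤ 2 * L + 2 := by
    have h6 : (2 : ℝ) ^ d ≤ (n : ℝ) ^ 2 := by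
      rw [← Real.rpow_natCast (n : ℝ) 2]
      exact hd.2.trans h3
    have h7 : 2 ^ d ≤ 2 ^ (2 * L + 2) := le_trans (by exact_mod_cast h6) hnL
    exact (Nat.pow_le_pow_iff_right (by norm_num)).1 h7
  have hb : blockExp w ≤ 2 * L + 2 := by
    refine Nat.clog_le_of_le_pow (le_trans ?_ hnL)
    have h6 : (Nat.clog 2 w : ℝ) ≤ (n : ℝ) ^ 2 := by
      rw [← Real.rpow_natCast (n : ℝ) 2]
      exact (h1 w hw).trans h2
    exact_mod_cast h6
  have h6 : 7 + (r + 2 * s) * (8 + n * (8 * blockExp w + 50)) ≤ 7 + 450 * (L ^ 2 * n) := by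
    have h7 : r + 2 * s ≤ 5 * L := by omega
    have h8 : 8 + n * (8 * blockExp w + 50) ≤ 90 * L * n := by
      calc 8 + n * (8 * blockExp w + 50) ≤ n * 8 + n * (8 * (2 * L + 2) + 50) := by gcongr; omega
        _ = n * (16 * L + 74) := by ring
        _ ≤ n * (90 * L) := by gcongr; omega
        _ = _ := by ring
    calc _ ≤ 7 + 5 * L * (90 * L * n) := by gcongr
      _ = _ := by ring
  have h7 : (L : ℝ) ^ 2 * n ≤ (n : ℝ) ^ (3 / 2 : ℝ) := by
    have h8 : (L : ℝ) ≤ (n : ℝ) ^ (1 / 4 : ℝ) := (Real.natLog_le_logb n 2).trans h4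
    calc (L : ℝ) ^ 2 * n ≤ ((n : ℝ) ^ (1 / 4 : ℝ)) ^ 2 * n := by gcongr
      _ = _ := by
        rw [← Real.rpow_natCast, ← Real.rpow_mul (by linarith)]
        nth_rw 2 [← Real.rpow_one (n : ℝ)]
        rw [← Real.rpow_add (by linarith)]
        norm_num
  have h8 : (1 : ℝ) ≤ (n : ℝ) ^ (3 / 2 : ℝ) := Real.one_le_rpow hn (by norm_num)
  calc _ ≤ ((7 + 450 * (L ^ 2 * n) : ℕ) : ℝ) := by exact_mod_cast h6
    _ = 7 + 450 * ((L : ℝ) ^ 2 * n) := by push_cast; ring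
    _ ≤ _ := by linarith

/-- The part of the running time that is not spent by the subroutine. -/
theorem eventually_overhead_le (hγ₁ : γ < 1) (hδ : 0 < δ) (hγδ : δ < 1 + γ)
    (hK : 1 ≤ K)
    (hW : AdmissibleWordLengths γ δ W) {β : ℝ} (hβ : 3 / 2 ≤ β) (hβγ : 1 + γ ≤ β) (hβδ : 2 - δ ≤ β)
    (hβ' : (3 + δ - γ) / 2 ≤ β) :
    ∃ C : ℝ, 0 ≤ C ∧ ∀ᶠ n : ℕ in atTop, ∀ w ∈ W n, ∀ r d s τ : ℕ, PowerNear K ((n : ℝ) ^ γ) r →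
      PowerNear K ((n : ℝ) ^ δ) d → Sizes w n r d s τ →
      ((12 * n + 30 * Nat.clog 2 w + 127 + 2 ^ d * 28 + (1 +
        (7 + (r + 2 * s) * (8 + n * (8 * blockExp w + 50))) +
        (100 + 50 * n + 50 * 2 ^ (r + s + τ) + 30 * (n * 2 ^ r))) : ℕ) : ℝ) +
        (10 * n + 10) * ((n : ℝ) ^ 2 / 2 ^ (r + 2 * s) + 2 * 2 ^ r) ≤ C * (n : ℝ) ^ β := by
  obtain ⟨M, hM, hclog⟩ := eventually_clog_le hW
  refine ⟨30 * M + 800 + 98 * K + 120 * K + 200 * K ^ 2, by positivity, ?_⟩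
  filter_upwards [hclog, eventually_hash_time_le (K := K) hγ₁ hγδ hW, eventually_ge_atTop 1]
    with n h1 h2 h3 w hw r d s τ hr hd hs
  have hn : (1 : ℝ) ≤ n := by exact_mod_cast h3
  have hn0 : (0 : ℝ) < n := by linarith
  have hK0 : 0 < K := by linarith
  obtain ⟨e1, e2, e3, e4, e5⟩ := rpow_identities γ δ h3
  obtain ⟨⟨b1, b2⟩, ⟨b3, b4⟩, b5, b6⟩ := size_bounds hK (Real.rpow_pos_of_pos hn0 γ)
    (Real.rpow_pos_of_pos hn0 δ) h3 hr hd hs.r_le hs.s_eq hs.τ_eq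
  rw [e2] at b3 b4
  rw [e3] at b5
  set Y := (n : ℝ) ^ β with hY
  have mono : ∀ {e : ℝ}, e ≤ β → (n : ℝ) ^ e ≤ Y := fun he =>
    Real.rpow_le_rpow_of_exponent_le hn he
  have h1Y : 1 ≤ Y := Real.one_le_rpow hn (by linarith)
  have hnY : (n : ℝ) ≤ Y := by simpa using mono (show (1 : ℝ) ≤ β by linarith)
  have g1 : (Nat.clog 2 w : ℝ) ≤ M * Y := (h1 w hw).trans (by gcongr; exact mono hβ)
  have g2 : (2 : ℝ) ^ d ≤ K * Y := hd.2.trans (by gcongr; exact mono (by linarith))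
  have g3 := (h2 w hw r d s hd hs.r_le hs.s_eq).trans
    (mul_le_mul_of_nonneg_left (mono hβ) (by norm_num))
  have g4 : (2 : ℝ) ^ (r + s + τ) ≤ 4 * K ^ 2 * Y := by
    rw [pow_add]
    calc _ ≤ K * √((n : ℝ) ^ (1 + δ + γ)) * (4 * K * (n : ℝ) ^ (1 - γ)) := by gcongr
      _ = 4 * K ^ 2 * (n : ℝ) ^ ((3 + δ - γ) / 2) := by rw [← e5]; ring
      _ ≤ _ := by gcongr; exact mono hβ'
  have g5 : (n : ℝ) * 2 ^ r ≤ K * Y := by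
    calc (n : ℝ) * 2 ^ r ≤ n * (K * (n : ℝ) ^ γ) := by gcongr; exact hr.2
      _ = K * (n : ℝ) ^ (1 + γ) := by rw [← e4]; ring
      _ ≤ _ := by gcongr; exact mono hβγ
  have g6 : (n : ℝ) * ((n : ℝ) ^ 2 / 2 ^ (r + 2 * s)) ≤ 4 * K * Y := by
    rw [← mul_div_assoc, div_le_iff₀ (by positivity)]
    calc (n : ℝ) * (n : ℝ) ^ 2 = 4 * K * (n : ℝ) ^ (2 - δ) * (n * (n : ℝ) ^ δ / (4 * K)) := by
          rw [Real.rpow_sub hn0, Real.rpow_ofNat]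
          field_simp
      _ ≤ 4 * K * Y * 2 ^ (r + 2 * s) := by gcongr; exact mono hβδ
  have g7 : (10 * n + 10) * ((n : ℝ) ^ 2 / 2 ^ (r + 2 * s) + 2 * 2 ^ r) ≤ 120 * K * Y := by
    calc (10 * n + 10) * ((n : ℝ) ^ 2 / 2 ^ (r + 2 * s) + 2 * 2 ^ r)
        ≤ (20 * n) * ((n : ℝ) ^ 2 / 2 ^ (r + 2 * s) + 2 * 2 ^ r) := by gcongr; linarith
      _ = 20 * (n * ((n : ℝ) ^ 2 / 2 ^ (r + 2 * s))) + 40 * (n * 2 ^ r) := by ring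
      _ ≤ _ := by linarith
  push_cast at g3 ⊢
  nlinarith

end Overhead

namespace WordRAM

variable {w : ℕ}

/-! ### The distribution of the instances -/

/-- The law of the instance on which the subroutine is run.  If the sample contains a pair whose
sum belongs to the list, then the subroutine is not needed, and an instance without answers takes
the place of the instance made by hashing: this makes the expected output size small even if there
are many triples. -/
noncomputable def instanceLaw (X : List (BitVec w)) (r d s τ : ℕ) : PMF SetIntersectionInstance :=
  (drawMany (drawIndices w X.length) (2 ^ d)).bind fun l =>
    if ∀ p ∈ l, Misses X p then (drawPair w r (2 * s)).map (reducedInstance X r s τ)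
    else PMF.pure (hashInstance X.length r s τ (fun _ => 0) (fun _ => 0) fun _ _ => none)

/-- An expectation under `instanceLaw` is at least the contribution of the hashed instances, and
equal to it if the instance without answers contributes nothing. -/
theorem expect_instanceLaw (X : List (BitVec w)) (r d s τ : ℕ)
    (F : SetIntersectionInstance → ℝ≥0∞) :
    missProb X ^ 2 ^ d * (drawPair w r (2 * s)).expect (fun l => F (reducedInstance X r s τ l)) ≤
        (instanceLaw X r d s τ).expect F ∧
      (F (hashInstance X.length r s τ (fun _ => 0) (fun _ => 0) fun _ _ => none) = 0 →
        (instanceLaw X r d s τ).expect F = missProb X ^ 2 ^ d *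
          (drawPair w r (2 * s)).expect fun l => F (reducedInstance X r s τ l)) := by
  set E := (drawPair w r (2 * s)).expect fun l => F (reducedInstance X r s τ l) with hE
  set z := F (hashInstance X.length r s τ (fun _ => 0) (fun _ => 0) fun _ _ => none) with hz
  have key : (instanceLaw X r d s τ).expect F = (drawMany (drawIndices w X.length) (2 ^ d)).expect
      fun l => if ∀ p ∈ l, Misses X p then E else z := by
    rw [instanceLaw, PMF.expect_bind]
    congr 1
    funext l
    split_ifs
    · rw [PMF.expect_map]
    · rw [PMF.expect_pure]
  have hE' : missProb X ^ 2 ^ d * E = (drawMany (drawIndices w X.length) (2 ^ d)).expect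
      fun l => E * if ∀ p ∈ l, Misses X p then 1 else 0 := by
    rw [PMF.expect_const_mul, mul_comm, missProb, ← expect_drawMany_forall]
    congr!
  rw [key, hE']
  constructor
  · refine PMF.expect_mono _ fun l _ => ?_
    split_ifs <;> simp
  · intro h0
    congr 1
    funext l
    split_ifs <;> simp [h0]

theorem missProb_le_one (X : List (BitVec w)) : missProb X ≤ 1 :=
  PMF.expect_le _ fun _ _ => by split_ifs <;> simp

/-- The buckets are properly filled, for all hash functions. -/
theorem goodSlots_reduced {X : List (BitVec w)} {r d s τ : ℕ} (hs : Sizes w X.length r d s τ)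
    {l : List (BitVec w) × List (BitVec w)} (h1 : l.1.length = r) (h2 : l.2.length = 2 * s) :
    GoodSlots X.length r s τ (hashValue X l.1) (hashValue X l.2) (slotOf (hashValue X l.1)
      (goodAfter (hashValue X l.1) (hashValue X l.2) (2 ^ τ) X.length 0)) := by
  have hfw := (Nat.pow_lt_pow_iff_right (by norm_num)).1 hs.fill_lt
  have hcw := (Nat.pow_lt_pow_iff_right (by norm_num)).1 hs.c_lt
  refine goodSlots_slotOf hs.τ_le (fun k _ => ?_) fun k _ => ?_
  · have := hashValue_lt X (l := l.1) (by omega) k; rwa [h1] at this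
  · have := hashValue_lt X (l := l.2) (by omega) k; rwa [h2] at this

section Law

variable {γ δ K K' : ℝ} {X : List (BitVec w)} {r d s τ : ℕ}

theorem reducedInstance_allowed (hs : Sizes w X.length r d s τ) (hK : 1 ≤ K)
    (hr : PowerNear K ((X.length : ℝ) ^ γ) r) (hd : PowerNear K ((X.length : ℝ) ^ δ) d)
    (hK' : 8 * K ^ 2 ≤ K') {l : List (BitVec w) × List (BitVec w)} (h1 : l.1.length = r)
    (h2 : l.2.length = 2 * s) : (reducedInstance X r s τ l).Allowed γ δ K' X.length w :=
  hashInstance_allowed hs (goodSlots_reduced hs h1 h2) hK hr hd hK'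

theorem instanceLaw_allowed (hs : Sizes w X.length r d s τ) (hK : 1 ≤ K)
    (hr : PowerNear K ((X.length : ℝ) ^ γ) r) (hd : PowerNear K ((X.length : ℝ) ^ δ) d)
    (hK' : 8 * K ^ 2 ≤ K') :
    ∀ I ∈ (instanceLaw X r d s τ).support, I.Allowed γ δ K' X.length w := by
  intro I hI
  rw [instanceLaw, PMF.mem_support_bind_iff] at hI
  obtain ⟨l, -, hI⟩ := hI
  split_ifs at hI
  · rw [PMF.mem_support_map_iff] at hI
    obtain ⟨l', hl', rfl⟩ := hI
    exact reducedInstance_allowed hs hK hr hd hK' (mem_drawPair hl').1 (mem_drawPair hl').2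
  · rw [PMF.mem_support_pure_iff] at hI
    rw [hI]
    exact hashInstance_allowed hs (goodSlots_none hs.τ_le) hK hr hd hK'

theorem ofReal_div_two_pow (x : ℝ) (hx : 0 ≤ x) (k : ℕ) :
    ENNReal.ofReal (x / 2 ^ k) = ENNReal.ofReal x * (2 ^ k)⁻¹ := by
  rw [div_eq_mul_inv, ENNReal.ofReal_mul hx, ENNReal.ofReal_inv_of_pos (by positivity),
    ENNReal.ofReal_pow (by norm_num), ENNReal.ofReal_ofNat]

/-- The expected output size is small. Answers that stem from true sums are rare because with many
sums the sample rarely misses all of them; the others are false positives of the hash functions. -/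
theorem instanceLaw_outputSize (hX : X.Nodup) (hs : Sizes w X.length r d s τ) (hK : 1 ≤ K)
    (hr : PowerNear K ((X.length : ℝ) ^ γ) r) (hd : PowerNear K ((X.length : ℝ) ^ δ) d)
    (hK' : 8 * K ^ 2 ≤ K') :
    (instanceLaw X r d s τ).expect (fun I => (I.outputSize : ℝ≥0∞)) ≤
      ENNReal.ofReal (K' * (X.length : ℝ) ^ (2 - δ)) := by
  have hfw := (Nat.pow_lt_pow_iff_right (by norm_num)).1 hs.fill_lt
  have hcw := (Nat.pow_lt_pow_iff_right (by norm_num)).1 hs.c_lt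
  set n := X.length with hn
  have hn0 : (0 : ℝ) < n := by exact_mod_cast hs.pos
  have hK0 : 0 < K := by linarith
  rw [(expect_instanceLaw X r d s τ fun I => (I.outputSize : ℝ≥0∞)).2
    (by simp [outputSize, hashInstance_none_answers hs.τ_le])]
  have h1 : (drawPair w r (2 * s)).expect
      (fun l => ((reducedInstance X r s τ l).outputSize : ℝ≥0∞)) ≤
      (sumPairs X).card + (n : ℝ≥0∞) ^ 3 * (2 ^ (r + 2 * s))⁻¹ := by
    refine le_trans (PMF.expect_mono _ fun l hl => ?_)
      (expect_hashTriples hX (show r ≤ w by omega) (show 2 * s ≤ w by omega))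
    exact_mod_cast (goodSlots_reduced hs (mem_drawPair hl).1 (mem_drawPair hl).2).outputSize_le
  have h2 : missProb X ^ 2 ^ d * (sumPairs X).card ≤ (n : ℝ≥0∞) ^ 2 * (2 ^ d)⁻¹ := by
    rw [← div_eq_mul_inv, ENNReal.le_div_iff_mul_le (by simp) (by simp)]
    have := misses_pow_mul_le X hs.lt hs.pos (2 ^ d)
    push_cast at this
    exact this
  obtain ⟨-, -, -, b6⟩ := size_bounds hK (Real.rpow_pos_of_pos hn0 γ)
    (Real.rpow_pos_of_pos hn0 δ) hs.pos hr hd hs.r_le hs.s_eq hs.τ_eq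
  have hy := Real.rpow_pos_of_pos hn0 δ
  have e1 : (n : ℝ) ^ (2 - δ) = n ^ 2 / (n : ℝ) ^ δ := by rw [Real.rpow_sub hn0, Real.rpow_ofNat]
  have h3 : (n : ℝ) ^ 2 / 2 ^ d ≤ K * (n : ℝ) ^ (2 - δ) := by
    rw [e1, ← mul_div_assoc, div_le_div_iff₀ (by positivity) hy]
    have := (div_le_iff₀' hK0).1 hd.1
    calc (n : ℝ) ^ 2 * (n : ℝ) ^ δ ≤ n ^ 2 * (K * 2 ^ d) := by gcongr
      _ = _ := by ring
  have h4 : (n : ℝ) ^ 3 / 2 ^ (r + 2 * s) ≤ 4 * K * (n : ℝ) ^ (2 - δ) := by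
    rw [e1, div_le_iff₀ (by positivity)]
    calc (n : ℝ) ^ 3 = 4 * K * (n ^ 2 / (n : ℝ) ^ δ) * (n * (n : ℝ) ^ δ / (4 * K)) := by field_simp
      _ ≤ _ := by gcongr
  calc _ ≤ missProb X ^ 2 ^ d * ((sumPairs X).card + (n : ℝ≥0∞) ^ 3 * (2 ^ (r + 2 * s))⁻¹) := by
        gcongr
    _ ≤ (n : ℝ≥0∞) ^ 2 * (2 ^ d)⁻¹ + 1 * ((n : ℝ≥0∞) ^ 3 * (2 ^ (r + 2 * s))⁻¹) := by
        rw [mul_add]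
        gcongr
        exact pow_le_one₀ (by simp) (missProb_le_one X)
    _ = ENNReal.ofReal ((n : ℝ) ^ 2 / 2 ^ d + (n : ℝ) ^ 3 / 2 ^ (r + 2 * s)) := by
        rw [ENNReal.ofReal_add (by positivity) (by positivity),
          ofReal_div_two_pow _ (by positivity), ofReal_div_two_pow _ (by positivity),
          ENNReal.ofReal_pow (by positivity),
          ENNReal.ofReal_pow (by positivity), ENNReal.ofReal_natCast, one_mul]
    _ ≤ _ := by
        refine ENNReal.ofReal_le_ofReal ?_
        calc _ ≤ 5 * K * (n : ℝ) ^ (2 - δ) := by linarith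
          _ ≤ _ := by gcongr; nlinarith

/-- The running time of the reduction, up to the time spent for computing the exponents, is the
expected time of the subroutine, up to a factor `60` and the overhead. -/
theorem stage_time_le (hX : X.Nodup) (hs : Sizes w X.length r d s τ) (P : Program) {x : ℝ}
    (hx : ((12 * X.length + 30 * Nat.clog 2 w + 127 + 2 ^ d * 28 + (1 +
        (7 + (r + 2 * s) * (8 + X.length * (8 * blockExp w + 50))) +
        (100 + 50 * X.length + 50 * 2 ^ (r + s + τ) + 30 * (X.length * 2 ^ r))) : ℕ) : ℝ) +
        (10 * X.length + 10) * ((X.length : ℝ) ^ 2 / 2 ^ (r + 2 * s) + 2 * 2 ^ r) ≤ x) :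
    ((12 * X.length + 30 * Nat.clog 2 w + 127 + 2 ^ d * 28 : ℕ) + missProb X ^ 2 ^ d *
        (1 + (7 + (r + 2 * s) * (8 + X.length * (8 * blockExp w + 50)) : ℕ) +
          (drawPair w r (2 * s)).expect (stageTime P X r s τ)) : ℝ≥0∞) ≤
      ENNReal.ofReal x +
        60 * (instanceLaw X r d s τ).expect fun I => expectedTime P (I.input w) := by
  have hfw := (Nat.pow_lt_pow_iff_right (by norm_num)).1 hs.fill_lt
  have hcw := (Nat.pow_lt_pow_iff_right (by norm_num)).1 hs.c_lt
  set n := X.length with hn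
  set N₁ := 12 * n + 30 * Nat.clog 2 w + 127 + 2 ^ d * 28 with hN₁
  set N₂ := 7 + (r + 2 * s) * (8 + n * (8 * blockExp w + 50)) with hN₂
  set N₃ := 100 + 50 * n + 50 * 2 ^ (r + s + τ) + 30 * (n * 2 ^ r) with hN₃
  set E := (drawPair w r (2 * s)).expect
    (fun l => expectedTime P ((reducedInstance X r s τ l).input w)) with hE
  set b : ℝ := (n : ℝ) ^ 2 / 2 ^ (r + 2 * s) + 2 * 2 ^ r with hb
  -- the capacity of a bucket is at least twice the average number of elements in it
  have hcap : 2 * n ≤ 2 ^ r * 2 ^ τ := by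
    have h1 := Nat.lt_pow_succ_log_self (b := 2) (by norm_num) n
    have h2 := hs.r_le
    rw [hs.τ_eq, ← pow_add, show r + (Nat.log 2 n - r + 2) = Nat.log 2 n + 1 + 1 by omega, pow_succ]
    omega
  have hbad : (drawPair w r (2 * s)).expect (fun l => (badCount (hashValue X l.1) (hashValue X l.2)
      (2 ^ τ) n : ℝ≥0∞)) ≤ ENNReal.ofReal b := by
    refine (expect_badCount hX (by omega) (by omega) hcap hs.pos).trans (le_of_eq ?_)
    rw [hb, ENNReal.ofReal_add (by positivity) (by positivity),
      ofReal_div_two_pow _ (by positivity), ENNReal.ofReal_pow (by positivity),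
      ENNReal.ofReal_natCast, ENNReal.ofReal_mul (by norm_num),
      ENNReal.ofReal_pow (by norm_num), ENNReal.ofReal_ofNat]
  have hstage : (drawPair w r (2 * s)).expect (stageTime P X r s τ) ≤
      (N₃ : ℝ≥0∞) + (10 * n + 10 : ℕ) * ENNReal.ofReal b + 60 * E := by
    unfold stageTime
    rw [PMF.expect_add, PMF.expect_add, PMF.expect_const, PMF.expect_const_mul,
      PMF.expect_const_mul]
    gcongr
    norm_num
  have hlaw := (expect_instanceLaw X r d s τ fun I => expectedTime P (I.input w)).1
  have hmiss : missProb X ^ 2 ^ d ≤ 1 := pow_le_one₀ (by simp) (missProb_le_one X)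
  calc _ ≤ (N₁ : ℝ≥0∞) + missProb X ^ 2 ^ d *
        ((1 + N₂ + N₃ + (10 * n + 10 : ℕ) * ENNReal.ofReal b) + 60 * E) := by
        refine add_le_add le_rfl (mul_le_mul' le_rfl ?_)
        refine (add_le_add le_rfl hstage).trans (le_of_eq ?_)
        ring
    _ = (N₁ : ℝ≥0∞) + (missProb X ^ 2 ^ d * (1 + N₂ + N₃ + (10 * n + 10 : ℕ) * ENNReal.ofReal b) +
        60 * (missProb X ^ 2 ^ d * E)) := by ring
    _ ≤ (N₁ : ℝ≥0∞) + (1 * (1 + N₂ + N₃ + (10 * n + 10 : ℕ) * ENNReal.ofReal b) +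
        60 * (instanceLaw X r d s τ).expect fun I => expectedTime P (I.input w)) := by gcongr
    _ = ENNReal.ofReal (((N₁ + (1 + N₂ + N₃) : ℕ) : ℝ) + (10 * n + 10) * b) +
        60 * (instanceLaw X r d s τ).expect fun I => expectedTime P (I.input w) := by
        have hb0 : 0 ≤ b := by positivity
        clear_value b
        rw [show (10 * (n : ℝ) + 10) = ((10 * n + 10 : ℕ) : ℝ) by push_cast; ring,
          ENNReal.ofReal_add (by positivity) (by positivity), ENNReal.ofReal_natCast,
          ENNReal.ofReal_mul (by positivity), ENNReal.ofReal_natCast]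
        push_cast
        ring
    _ ≤ _ := by gcongr

end Law

end WordRAM

namespace WordRAM

/-! ### The lower bound -/

/-- On the input `n`, for every word length, `P` computes an exponent `r` such that `2 ^ r` agrees
with `n ^ α` up to the factor `K`, and the expected time is at most `K * n ^ β`. -/
def ComputesPower (P : Program) (α K β : ℝ) (n : ℕ) : Prop :=
  ∀ w : ℕ, n < 2 ^ w →
    HaltsWith P (initState w [n] [])
      (fun out => ∃ r : ℕ, PowerNear K ((n : ℝ) ^ α) r ∧ out = [BitVec.ofNat w r]) ∧
    expectedTime P (initState w [n] []) ≤ ENNReal.ofReal (K * (n : ℝ) ^ β)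

/-- The constants in the bounds may be increased. -/
theorem PowerConstructible.exists_computesPower {α : ℝ} (h : PowerConstructible α) :
    ∃ (P : Program) (K₁ β : ℝ), β < 2 ∧ ∀ K, K₁ ≤ K →
      ∀ᶠ n : ℕ in atTop, ComputesPower P α K β n := by
  obtain ⟨P, K₁, ε, hK₁, hε, h⟩ := h
  refine ⟨P, K₁, 2 - ε, by linarith, fun K hK => ?_⟩
  filter_upwards [h] with n hn w hw
  obtain ⟨⟨h1, h2⟩, h3⟩ := hn w hw
  refine ⟨⟨h1, fun t c hc hh => ?_⟩, h3.trans (ENNReal.ofReal_le_ofReal (by gcongr))⟩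
  obtain ⟨r, h4, h5, h6⟩ := h2 t c hc hh
  exact ⟨r, ⟨le_trans (by gcongr) h4, h5.trans (by gcongr)⟩, h6⟩

theorem _root_.IsSubpolynomial.eventually_pos {f : ℕ → ℝ} (hf : IsSubpolynomial f) :
    ∀ᶠ n : ℕ in atTop, 0 < (n : ℝ) ^ 2 / f n := by
  obtain ⟨e, -, he⟩ := hf
  filter_upwards [he, eventually_ge_atTop 1] with n h1 h2
  have : (0 : ℝ) < n := by exact_mod_cast h2
  rw [h1]
  positivity

/-- Powers with an exponent `β < 2` are negligible, as `f` is eventually at most `n ^ ((2 - β) /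
2)`. -/
theorem _root_.IsSubpolynomial.eventually_const_mul_rpow_le {f : ℕ → ℝ} (hf : IsSubpolynomial f)
    {β : ℝ} (hβ : β < 2) (M : ℝ) : ∀ᶠ n : ℕ in atTop, M * (n : ℝ) ^ β ≤ (n : ℝ) ^ 2 / f n := by
  obtain ⟨e, he0, he⟩ := hf
  have h1 : ∀ᶠ n : ℕ in atTop, e n < (2 - β) / 2 := he0.eventually_lt_const (by linarith)
  filter_upwards [he, h1, _root_.eventually_const_mul_rpow_le
    (show β < 2 - (2 - β) / 2 by linarith) M, eventually_ge_atTop 1] with n h2 h3 h4 h5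
  have h5 : (1 : ℝ) ≤ n := by exact_mod_cast h5
  rw [h2, ← Real.rpow_ofNat, ← Real.rpow_sub (by linarith)]
  exact h4.trans (Real.rpow_le_rpow_of_exponent_le h5 (by linarith))

section Solve

variable {γ δ K K' : ℝ} {W : ℕ → Set ℕ} {w : ℕ}

/-- On large inputs the reduction finds the right answer, in the time spent by the programs that
compute the two powers, plus the time of the sampling stage. -/
theorem largeStage_correct {Pγ Pδ P : Program} {βγ βδ : ℝ} {X : List (BitVec w)}
    [Decidable (HasXORTriple X)]
    (hK : 1 ≤ K) (hK' : 8 * K ^ 2 ≤ K') (hwW : w ∈ W X.length) (hX : X.length < 2 ^ w)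
    (hPγ : ComputesPower Pγ γ K βγ X.length) (hPδ : ComputesPower Pδ δ K βδ X.length)
    (hsizes : ∀ r d : ℕ, PowerNear K ((X.length : ℝ) ^ γ) r → PowerNear K ((X.length : ℝ) ^ δ) d →
      Sizes w X.length r d ((Nat.log 2 X.length + d - r) / 2) (Nat.log 2 X.length - r + 2))
    (hP : SolvesSetIntersection W γ δ K' P) {B : ℝ≥0∞}
    (hB : ∀ r d s τ : ℕ, PowerNear K ((X.length : ℝ) ^ γ) r → PowerNear K ((X.length : ℝ) ^ δ) d →
      Sizes w X.length r d s τ →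
      ((12 * X.length + 30 * Nat.clog 2 w + 127 + 2 ^ d * 28 : ℕ) + missProb X ^ 2 ^ d *
        (1 + (7 + (r + 2 * s) * (8 + X.length * (8 * blockExp w + 50)) : ℕ) +
          (drawPair w r (2 * s)).expect (stageTime P X r s τ)) : ℝ≥0∞) ≤ B) {S : State w}
    (h : Holds X S) (hreg : ∀ i, 2 ≤ i → i ≠ 20 → S.reg i = 0#w)
    (hmem : ∀ b, 1 ≤ b → S.mem b = fun _ => 0#w) (hout : S.out = []) :
    Triple (largeStage Pγ Pδ P) S (8 + ENNReal.ofReal (K * (X.length : ℝ) ^ βγ) +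
        ENNReal.ofReal (K * (X.length : ℝ) ^ βδ) + B)
      (fun S' => S'.out = [BitVec.ofNat w (if HasXORTriple X then 1 else 0)]) := by
  obtain ⟨hγ, tγ⟩ := hPγ w hX
  obtain ⟨hδ, tδ⟩ := hPδ w hX
  refine (largeStage_triple hγ hδ (fun r d hr hd => ⟨_, _, hsizes r d hr hd, fun l h1 h2 => ?_,
    hB r d _ _ hr hd (hsizes r d hr hd)⟩) h hreg hmem hout).mono (by gcongr) fun _ h _ => h
  exact hP _ w hwW _ (reducedInstance_allowed (hsizes r d hr hd) hK hr hd hK' h1 h2)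

/-- The lower bound for parameters for which the sets have fewer than `n ^ 2` elements altogether,
so that the instance can be written down in time `n ^ (2 - Ω(1))`. -/
theorem setIntersectionRequires_of_small (hγ₁ : γ < 1) (hδ : 0 < δ) (hγδ : δ < 1 + γ)
    (hK : 1 ≤ K) (hK' : 8 * K ^ 2 ≤ K') {Pγ Pδ : Program} {βγ βδ : ℝ} (hβγ : βγ < 2) (hβδ : βδ < 2)
    (hPγ : ∀ᶠ n : ℕ in atTop, ComputesPower Pγ γ K βγ n)
    (hPδ : ∀ᶠ n : ℕ in atTop, ComputesPower Pδ δ K βδ n)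
    (hW : AdmissibleWordLengths γ δ W) {f : ℕ → ℝ} (hf : IsSubpolynomial f)
    (h : ThreeXORRequires W (fun n => (n : ℝ) ^ 2 / f n)) :
    SetIntersectionRequires W γ δ K' (fun n => (n : ℝ) ^ 2 / f n) := by
  intro P hP
  obtain ⟨N, hN⟩ := eventually_atTop.1 ((hPγ.and hPδ).and (eventually_sizes hγ₁ hδ hγδ hK hW))
  have hsolve : SolvesThreeXOR W (reduction N Pγ Pδ P) := by
    classical
    rintro n w hw X hXn rfl
    have := (reduction_triple (T := ⊤) (N := N) (Pγ := Pγ) (Pδ := Pδ) (P := P) (hW.1 _ w hw)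
      fun hn S h1 h2 h3 h4 => (largeStage_correct (W := W) (B := ⊤) hK hK' hw (hW.1 _ w hw)
        (hN _ hn).1.1 (hN _ hn).1.2 ((hN _ hn).2 w hw) hP (fun _ _ _ _ _ _ _ => le_top)
        h1 h2 h3 h4).mono le_top fun _ h _ => h).haltsWith
      (good := fun out => out = [BitVec.ofNat w (if HasXORTriple X then 1 else 0)]) fun _ h => h
    convert this
  obtain ⟨c, hc, hlow⟩ := h _ hsolve
  -- `240 = 4 * 60`: the subroutine is slowed down by a factor `60`, and thus spends at most a
  -- quarter of the time that the reduction needs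
  refine ⟨c / 240, by positivity, ?_⟩
  -- a common bound on the exponents of all contributions other than that of the subroutine
  obtain ⟨β, hβ2, k1, k2, k3, k4, k5, k6⟩ : ∃ β : ℝ, β < 2 ∧ 3 / 2 ≤ β ∧ 1 + γ ≤ β ∧ 2 - δ ≤ β ∧
      (3 + δ - γ) / 2 ≤ β ∧ βγ ≤ β ∧ βδ ≤ β := by
    refine ⟨max (max (3 / 2) (max (1 + γ) (2 - δ))) (max ((3 + δ - γ) / 2) (max βγ βδ)), ?_, ?_⟩
    · simp only [max_lt_iff]; refine ⟨⟨?_, ?_, ?_⟩, ?_, ?_, ?_⟩ <;> linarith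
    · simp only [le_max_iff, le_refl, true_or, or_true, and_self]
  obtain ⟨C, hC, hover⟩ := eventually_overhead_le (K := K) hγ₁ hδ hγδ hK hW k1 k2 k3 k4
  filter_upwards [hlow, hover, hf.eventually_pos, eventually_ge_atTop N, eventually_ge_atTop 1,
    hf.eventually_const_mul_rpow_le hβ2 (4 / c * (C + 2 * K + 3 * N + 13))]
    with n ⟨w, hw, X, hXd, hXn, htime⟩ hov hpos hnN hn1 hsmall
  subst hXn
  set n := X.length with hn
  refine ⟨w, hw, ?_⟩
  -- otherwise the subroutine is fast on `instanceLaw`, and the reduction violates the hypothesis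
  by_contra hno
  push Not at hno
  have hn1' : (1 : ℝ) ≤ n := by exact_mod_cast hn1
  set g := (n : ℝ) ^ 2 / f n with hg
  have hB : ∀ r d s τ : ℕ, PowerNear K ((n : ℝ) ^ γ) r → PowerNear K ((n : ℝ) ^ δ) d →
      Sizes w n r d s τ →
      ((12 * n + 30 * Nat.clog 2 w + 127 + 2 ^ d * 28 : ℕ) + missProb X ^ 2 ^ d *
        (1 + (7 + (r + 2 * s) * (8 + n * (8 * blockExp w + 50)) : ℕ) +
          (drawPair w r (2 * s)).expect (stageTime P X r s τ)) : ℝ≥0∞) ≤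
      ENNReal.ofReal (C * (n : ℝ) ^ β + 60 * (c / 240 * g)) := by
    intro r d s τ hr hd hs
    have h1 := hno (instanceLaw X r d s τ) (instanceLaw_allowed hs hK hr hd hK')
      (instanceLaw_outputSize hXd hs hK hr hd hK')
    refine (stage_time_le hXd hs P (hov w hw r d s τ hr hd hs)).trans ?_
    rw [ENNReal.ofReal_add (by positivity) (by positivity),
      ENNReal.ofReal_mul (p := 60) (by norm_num), ENNReal.ofReal_ofNat]
    gcongr
    exact h1.le
  classical
  have h2 := htime.trans (reduction_triple (T := _) (N := N) (Pγ := Pγ) (Pδ := Pδ) (P := P)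
    (hW.1 _ w hw) fun hn S h1 h2 h3 h4 => largeStage_correct (W := W) hK hK' hw (hW.1 _ w hw)
      (hN _ hn).1.1 (hN _ hn).1.2 ((hN _ hn).2 w hw) hP hB h1 h2 h3 h4).expectedTime_le
  rw [if_pos hnN] at h2
  have hβ1 : 1 ≤ (n : ℝ) ^ β := Real.one_le_rpow hn1' (by linarith)
  have h3 : ENNReal.ofReal (c * g) ≤ ENNReal.ofReal (4 + (3 * N + (8 + K * (n : ℝ) ^ βγ +
      K * (n : ℝ) ^ βδ + (C * (n : ℝ) ^ β + 60 * (c / 240 * g))))) := by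
    refine h2.trans (le_of_eq ?_)
    rw [ENNReal.ofReal_add (p := 4) (by positivity) (by positivity),
      ENNReal.ofReal_add (p := 3 * N) (by positivity) (by positivity),
      ENNReal.ofReal_add (p := 8 + K * (n : ℝ) ^ βγ + K * (n : ℝ) ^ βδ) (by positivity)
        (by positivity),
      ENNReal.ofReal_add (p := 8 + K * (n : ℝ) ^ βγ) (by positivity) (by positivity),
      ENNReal.ofReal_add (p := 8) (by positivity) (by positivity),
      ENNReal.ofReal_mul (p := 3) (by positivity)]
    simp [← hn]
  rw [ENNReal.ofReal_le_ofReal_iff (by positivity)] at h3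
  have h4 : K * (n : ℝ) ^ βγ ≤ K * (n : ℝ) ^ β := by gcongr
  have h5 : K * (n : ℝ) ^ βδ ≤ K * (n : ℝ) ^ β := by gcongr
  have h6 : (C + 2 * K + 3 * N + 13) * (n : ℝ) ^ β ≤ c / 4 * g := by
    calc _ = c / 4 * (4 / c * (C + 2 * K + 3 * N + 13) * (n : ℝ) ^ β) := by field_simp
      _ ≤ _ := by gcongr
  have h7 : (3 * N + 12 : ℝ) ≤ (3 * N + 12) * (n : ℝ) ^ β :=
    le_mul_of_one_le_right (by positivity) hβ1
  have h8 : 0 < c * g := by positivity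
  linarith

end Solve

end WordRAM

theorem mainTheorem4 (γ δ : ℝ) (hγ₀ : 0 ≤ γ) (hγ₁ : γ < 1) (hδ : 0 < δ)
    (hγc : WordRAM.PowerConstructible γ) (hδc : WordRAM.PowerConstructible δ) :
    ∃ K₀ : ℝ, 0 < K₀ ∧ ∀ K : ℝ, K₀ ≤ K →
      ∀ W : ℕ → Set ℕ, AdmissibleWordLengths γ δ W →
      ∀ f : ℕ → ℝ, IsSubpolynomial f →
        ThreeXORRequires W (fun n => (n : ℝ) ^ 2 / f n) →
        SetIntersectionRequires W γ δ K (fun n => (n : ℝ) ^ 2 / f n) := by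
  obtain ⟨Pγ, Kγ, βγ, hβγ, hPγ⟩ := hγc.exists_computesPower
  obtain ⟨Pδ, Kδ, βδ, hβδ, hPδ⟩ := hδc.exists_computesPower
  set K₁ := max 1 (max Kγ Kδ) with hK₁
  have h1 : 1 ≤ K₁ := le_max_left _ _
  refine ⟨8 * K₁ ^ 2, by positivity, fun K hK W hW f hf h => ?_⟩
  rcases lt_or_ge δ (1 + γ) with hγδ | hγδ
  · exact setIntersectionRequires_of_small hγ₁ hδ hγδ h1 hK hβγ hβδ
      (hPγ _ ((le_max_left _ _).trans (le_max_right _ _)))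
      (hPδ _ ((le_max_right _ _).trans (le_max_right _ _))) hW hf h
  · exact setIntersectionRequires_of_large hγ₀ hγ₁ hδ hγδ (by nlinarith) hW hf.eventually_pos h
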